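/- Let $\Omega\subset\mathbb R^2$ be a bounded polygonal domain (holes are allowed) lying locally on one side of its boundary. Let $Re, Ro>0$, $F\in L^2(\Omega)$ and $X=H^2_0(\Omega)$. Write $(\cdot,\cdot)$ for the $L^2(\Omega)$ inner product, $|\cdot|_k$ and $\|\cdot\|_k$ for the seminorm and norm of $H^k(\Omega)$ ($|v|_k$ is the $L^2$ norm of the tensor of all $k$-th derivatives, so $|v|_2=\|\Delta v\|_0$ on $X$), and, for $g\in L^2(\Omega)$, $\|g\|_{-k}=\sup\{|(g,\chi)|:\chi\in H^k_0(\Omega),\ |\chi|_k\le 1\}$. Let $$a_0(\psi,\chi)=Re^{-1}\int_\Omega\Delta\psi\,\Delta\chi,\qquad a_1(\zeta,\psi,\chi)=\int_\Omega\Delta\zeta\,(\psi_y\chi_x-\psi_x\chi_y),\qquad a_2(\psi,\chi)=-Ro^{-1}\int_\Omega\psi_x\,\chi,$$ and let $\Gamma_1,\Gamma_2>0$ be constants such that $|a_1(\zeta,\psi,\chi)|\le\Gamma_1|\zeta|_2|\psi|_2|\chi|_2$ and $|a_2(\psi,\chi)|\le Ro^{-1}\Gamma_2|\psi|_2|\chi|_2$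 for all $\zeta,\psi,\chi\in X$. Assume the small data condition $$Re^{-2}\,Ro>\Gamma_1\,\|F\|_{-2}.$$ Then for every $\sigma$ there are positive constants $C_0,C_1,C_2$, depending only on $\Omega,Re,Ro,\Gamma_1,\Gamma_2,F,\sigma$, such that the following holds. Let $\psi\in H^6(\Omega)\cap H^2_0(\Omega)$ solve the weak streamfunction formulation of the stationary quasi-geostrophic equations, $$a_0(\psi,\chi)+a_1(\psi,\psi,\chi)+a_2(\psi,\chi)=Ro^{-1}(F,\chi)\qquad\forall\,\chi\in X,$$ and assume elliptic regularity of the dual linearized problem: there is a constant $C$ such that, for every $g\in L^2(\Omega)$, each $\psi^*\in X$ with $$a_0(\chi,\psi^*)+a_1(\psi,\chi,\psi^*)+a_1(\chi,\psi,\psi^*)+a_2(\chi,\psi^*)=(g,\chi)\qquad\forall\,\chi\in X$$ satisfies $\psi^*\in H^4(\Omega)$, $\|\psi^*\|_4\le C\|g\|_0$ and $\|\psi^*\|_3\le C\|g\|_{-1}$. Let $\mathcal T^h$ be a conforming triangulation of $\overline\Omega$ with meshsize (maximal triangle diameter) $h$, each triangle $T$ of which contains a disc of diameter $\rho$ with $\operatorname{diam}T\le\sigma\rho$.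 Let $X^h\subset X$ be the Argyris finite element space on $\mathcal T^h$, i.e. the functions in $X$ that are polynomials of degree at most $5$ on each closed triangle and whose values, first and second derivatives at the vertices and normal derivatives at the edge midpoints agree between triangles sharing these nodes. Let $\psi^h\in X^h$ satisfy $$a_0(\psi^h,\chi^h)+a_1(\psi^h,\psi^h,\chi^h)+a_2(\psi^h,\chi^h)=Ro^{-1}(F,\chi^h)\qquad\forall\,\chi^h\in X^h.$$ Then $$|\psi-\psi^h|_2\le C_2\,h^4,\qquad |\psi-\psi^h|_1\le C_1\,h^5,\qquad \|\psi-\psi^h\|_0\le C_0\,h^6.$$ -/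

import Mathlib

open MeasureTheory Set
open scoped ContDiff

noncomputable section

namespace QGE

/-- The Euclidean plane; the coordinate with index `0` is `x`, the one with index `1` is `y`. -/
abbrev Plane : Type := EuclideanSpace ℝ (Fin 2)

/-! ### Sobolev spaces on an open set, through weak derivatives -/

/-- `φ ∈ C_c^∞(Ω)`. -/
def IsTestFunction (Ω : Set Plane) (φ : Plane → ℝ) : Prop :=
  ContDiff ℝ ∞ φ ∧ HasCompactSupport φ ∧ tsupport φ ⊆ Ω

/-- The classical partial derivative `∂_{s 0} ⋯ ∂_{s (k-1)} φ` of order `k`; a derivative of order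
`k` is indexed by the sequence `s` of the coordinate directions. -/
def partialDeriv {k : ℕ} (s : Fin k → Fin 2) (φ : Plane → ℝ) (x : Plane) : ℝ :=
  iteratedFDeriv ℝ k φ x (fun l => EuclideanSpace.single (s l) (1 : ℝ))

/-- `g` is the weak partial derivative `∂^s f` in `Ω`. -/
def HasWeakDeriv (Ω : Set Plane) {k : ℕ} (s : Fin k → Fin 2) (f g : Plane → ℝ) : Prop :=
  LocallyIntegrableOn f Ω ∧ LocallyIntegrableOn g Ω ∧
    ∀ φ, IsTestFunction Ω φ →
      ∫ x in Ω, f x * partialDeriv s φ x = (-1) ^ k * ∫ x in Ω, g x * φ x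

open Classical in
/-- The weak partial derivative `∂^s f` in `Ω` (unique up to null sets; `0` if there is none). -/
def weakDeriv (Ω : Set Plane) {k : ℕ} (s : Fin k → Fin 2) (f : Plane → ℝ) : Plane → ℝ :=
  if h : ∃ g, HasWeakDeriv Ω s f g then h.choose else 0

/-- `f ∈ H^k(Ω)`: all weak derivatives of order at most `k` exist and are in `L²(Ω)`. -/
def MemH (k : ℕ) (Ω : Set Plane) (f : Plane → ℝ) : Prop :=
  ∀ j ≤ k, ∀ s : Fin j → Fin 2,
    ∃ g, HasWeakDeriv Ω s f g ∧ MemLp g 2 (volume.restrict Ω)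

/-- The seminorm `|f|_k`, the `L²(Ω)` norm of the tensor of all derivatives of order `k`. On
`H²_0(Ω)` one has `|f|_2 = ‖Δ f‖_0`, and `|f|_0` is the `L²(Ω)` norm `‖f‖_0`. -/
def seminormH (k : ℕ) (Ω : Set Plane) (f : Plane → ℝ) : ℝ :=
  Real.sqrt (∑ s : Fin k → Fin 2, ∫ x in Ω, (weakDeriv Ω s f x) ^ 2)

/-- The norm `‖f‖_k` of `H^k(Ω)`. -/
def normH (k : ℕ) (Ω : Set Plane) (f : Plane → ℝ) : ℝ :=
  Real.sqrt (∑ j ∈ Finset.range (k + 1), (seminormH j Ω f) ^ 2)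

/-- `f ∈ H^k_0(Ω)`, the closure of `C_c^∞(Ω)` in `H^k(Ω)`. -/
def MemH0 (k : ℕ) (Ω : Set Plane) (f : Plane → ℝ) : Prop :=
  MemH k Ω f ∧ ∀ ε > 0, ∃ φ, IsTestFunction Ω φ ∧ normH k Ω (fun x => f x - φ x) < ε

/-- The negative norm `‖g‖_{-k}` of `g ∈ L²(Ω)`, dual to `(H^k_0(Ω), |·|_k)`. -/
def dualNorm (k : ℕ) (Ω : Set Plane) (g : Plane → ℝ) : ℝ :=
  sSup {r : ℝ | ∃ χ, MemH0 k Ω χ ∧ seminormH k Ω χ ≤ 1 ∧ r = |∫ x in Ω, g x * χ x|}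

/-! ### The forms of the quasi-geostrophic equations and the weak problems -/

/-- The weak derivative `f_x`. -/
def dX (Ω : Set Plane) (f : Plane → ℝ) : Plane → ℝ := weakDeriv Ω ![0] f

/-- The weak derivative `f_y`. -/
def dY (Ω : Set Plane) (f : Plane → ℝ) : Plane → ℝ := weakDeriv Ω ![1] f

/-- The weak Laplacian `Δ f`. -/
def lap (Ω : Set Plane) (f : Plane → ℝ) : Plane → ℝ :=
  fun x => weakDeriv Ω ![0, 0] f x + weakDeriv Ω ![1, 1] f x

def a₀ (Ω : Set Plane) (Re : ℝ) (ψ χ : Plane → ℝ) : ℝ :=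
  Re⁻¹ * ∫ x in Ω, lap Ω ψ x * lap Ω χ x

def a₁ (Ω : Set Plane) (ζ ψ χ : Plane → ℝ) : ℝ :=
  ∫ x in Ω, lap Ω ζ x * (dY Ω ψ x * dX Ω χ x - dX Ω ψ x * dY Ω χ x)

def a₂ (Ω : Set Plane) (Ro : ℝ) (ψ χ : Plane → ℝ) : ℝ :=
  -Ro⁻¹ * ∫ x in Ω, dX Ω ψ x * χ x

def load (Ω : Set Plane) (Ro : ℝ) (F χ : Plane → ℝ) : ℝ :=
  Ro⁻¹ * ∫ x in Ω, F x * χ x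

/-- `Γ` is a continuity constant of the trilinear form `a₁` on `H²_0(Ω)`. -/
def IsContConstA₁ (Ω : Set Plane) (Γ : ℝ) : Prop :=
  ∀ ζ ψ χ, MemH0 2 Ω ζ → MemH0 2 Ω ψ → MemH0 2 Ω χ →
    |a₁ Ω ζ ψ χ| ≤ Γ * seminormH 2 Ω ζ * seminormH 2 Ω ψ * seminormH 2 Ω χ

/-- `Γ` is a continuity constant of the bilinear form `Ro * a₂` on `H²_0(Ω)`. -/
def IsContConstA₂ (Ω : Set Plane) (Ro Γ : ℝ) : Prop :=
  ∀ ψ χ, MemH0 2 Ω ψ → MemH0 2 Ω χ →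
    |a₂ Ω Ro ψ χ| ≤ Ro⁻¹ * Γ * seminormH 2 Ω ψ * seminormH 2 Ω χ

/-- `ψ ∈ V` solves the weak streamfunction equation with the test functions of `V`. -/
def IsSolutionIn (V : Set (Plane → ℝ)) (Ω : Set Plane) (Re Ro : ℝ) (F ψ : Plane → ℝ) : Prop :=
  ψ ∈ V ∧ ∀ χ ∈ V, a₀ Ω Re ψ χ + a₁ Ω ψ ψ χ + a₂ Ω Ro ψ χ = load Ω Ro F χ

/-- `ψs` is a weak solution in `H²_0(Ω)` of the dual problem `𝓛* ψs = g`, where `𝓛*` is the formal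
adjoint of the linearization
`𝓛 χ = Re⁻¹ Δ² χ + J(χ, Δ ψ) + J(ψ, Δ χ) - Ro⁻¹ χ_x` of the equation at `ψ`. -/
def IsDualSolution (Ω : Set Plane) (Re Ro : ℝ) (ψ g ψs : Plane → ℝ) : Prop :=
  MemH0 2 Ω ψs ∧ ∀ χ, MemH0 2 Ω χ →
    a₀ Ω Re χ ψs + a₁ Ω ψ χ ψs + a₁ Ω χ ψ ψs + a₂ Ω Ro χ ψs = ∫ x in Ω, g x * χ x

/-- Elliptic regularity of the dual problem of the linearization at `ψ`. -/
def DualRegularity (Ω : Set Plane) (Re Ro : ℝ) (ψ : Plane → ℝ) : Prop :=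
  ∃ C : ℝ, ∀ g ψs, MemLp g 2 (volume.restrict Ω) → IsDualSolution Ω Re Ro ψ g ψs →
    MemH 4 Ω ψs ∧ normH 4 Ω ψs ≤ C * seminormH 0 Ω g ∧ normH 3 Ω ψs ≤ C * dualNorm 1 Ω g

/-! ### Triangulations of polygonal domains and the Argyris space -/

/-- `K` is a finite conforming triangulation of `closure Ω`. Its triangles are the faces with three
vertices, each face being given by the finite set of its vertices. -/
def IsTriangulation (K : Geometry.SimplicialComplex ℝ Plane) (Ω : Set Plane) : Prop :=
  K.faces.Finite ∧ K.space = closure Ω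

/-- The vertex sets of the triangles of `K`. -/
def triangles (K : Geometry.SimplicialComplex ℝ Plane) : Set (Finset Plane) :=
  {s | s ∈ K.faces ∧ s.card = 3}

/-- The closed triangle with vertex set `s`. -/
def tri (s : Finset Plane) : Set Plane := convexHull ℝ (s : Set Plane)

/-- A bounded polygonal domain (holes are allowed): it can be triangulated, and it lies locally on
one side of its boundary (no slits, no isolated boundary points, no boundary points at which
several sectors of `Ω` touch). -/
structure IsPolygonalDomain (Ω : Set Plane) : Prop where
  isOpen : IsOpen Ω
  isConnected : IsConnected Ω
  interior_closure : interior (closure Ω) = Ω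
  locally_connected : ∀ x ∈ frontier Ω, ∀ ε > 0, ∃ δ, 0 < δ ∧ δ < ε ∧
    IsConnected (Ω ∩ Metric.ball x δ)
  triangulable : ∃ K, IsTriangulation K Ω

/-- The meshsize: the largest diameter of a triangle. -/
def meshSize (K : Geometry.SimplicialComplex ℝ Plane) : ℝ :=
  sSup ((fun s => Metric.diam (tri s)) '' triangles K)

/-- Shape regularity: every triangle `T` contains a disc of diameter `ρ` with `diam T ≤ σ * ρ`. -/
def IsShapeRegular (σ : ℝ) (K : Geometry.SimplicialComplex ℝ Plane) : Prop :=
  ∀ s ∈ triangles K, ∃ c r, 0 < r ∧ Metric.closedBall c r ⊆ tri s ∧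
    Metric.diam (tri s) ≤ σ * (2 * r)

/-- The function on the plane given by a polynomial in two variables. -/
def polyFun (p : MvPolynomial (Fin 2) ℝ) (x : Plane) : ℝ :=
  MvPolynomial.eval (fun i => x i) p

/-- `v` is an Argyris finite element function on `K`: on each closed triangle it is a polynomial of
degree at most five, and the degrees of freedom (the value, the first and the second derivatives at
the vertices, the normal derivatives at the midpoints of the edges) of any two triangles agree at
the nodes that they share. -/
def IsArgyris (K : Geometry.SimplicialComplex ℝ Plane) (v : Plane → ℝ) : Prop :=
  ∃ p : Finset Plane → MvPolynomial (Fin 2) ℝ,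
    (∀ s ∈ triangles K, (p s).totalDegree ≤ 5 ∧ ∀ x ∈ tri s, v x = polyFun (p s) x) ∧
    ∀ s ∈ triangles K, ∀ t ∈ triangles K,
      (∀ a ∈ s, a ∈ t →
        polyFun (p s) a = polyFun (p t) a ∧
        fderiv ℝ (polyFun (p s)) a = fderiv ℝ (polyFun (p t)) a ∧
        iteratedFDeriv ℝ 2 (polyFun (p s)) a = iteratedFDeriv ℝ 2 (polyFun (p t)) a) ∧
      (∀ a ∈ s, a ∈ t → ∀ b ∈ s, b ∈ t → a ≠ b → ∀ n : Plane, inner ℝ n (b - a) = 0 →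
        fderiv ℝ (polyFun (p s)) (midpoint ℝ a b) n
          = fderiv ℝ (polyFun (p t)) (midpoint ℝ a b) n)

/-- The conforming Argyris space `X^h ⊂ H²_0(Ω)` on the triangulation `K`. -/
def argyrisSpace (K : Geometry.SimplicialComplex ℝ Plane) (Ω : Set Plane) : Set (Plane → ℝ) :=
  {v | IsArgyris K v ∧ MemH0 2 Ω v}

end QGE

end

/-! The theorem combines a Galerkin argument for a small-data nonlinear problem with an
interpolation theorem for Argyris elements.

Stability. The form `a₁` vanishes when its last two arguments coincide and `a₂` vanishes on the
diagonal. Testing with the solution therefore bounds both |ψ|_2 and |ψʰ|_2 by Re Ro⁻¹ ‖F‖_{-2}, and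
the small data condition says that Γ₁ times this bound is less than Re⁻¹. The error e = ψ - ψʰ
satisfies a₀(e,χ) + a₁(e,ψ,χ) + a₁(ψʰ,e,χ) + a₂(e,χ) = 0 for discrete χ. This form is coercive at χ
= e, so the error is quasi-optimal (`Setting.cea`).

Duality. The dual solution for the datum e exists by Lax–Milgram and lies in H⁴. Testing its
equation with e, and using orthogonality up to the linearization error a₁(e,e,·), bounds ‖e‖_0² by
|e|_2 times an O(h²) multiple of ‖e‖_0 (`Setting.duality`). The H¹ estimate lies in between because
|e|_1² ≤ |e|_0 |e|_2 on H²_0. The constants must not depend on ψ; since ψ is unique, those obtained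
from one ψ serve (`galerkin_rates`).

Interpolation (`argyris_interpolation`). For u in H²_0 ∩ H^{k+1}, k = 3 or 5, a polynomial that
matches the integrals of all derivatives of order at most k over a triangle approximates u there, by
iterated Poincaré inequalities on convex sets (`Approx.exists_poly`). A Sobolev inequality bounds
the remainder and its first two derivatives pointwise, and an explicit quintic interpolates these
data with bounds depending only on the shape of the triangle (`exists_interp`,
`local_interpolation`). The sum of the two polynomials is the local interpolant.

Conformity. The derivatives of u of order at most two have continuous representatives on each
triangle, called jets. Jets of triangles that share a point agree there: inside Ω by comparison with
a small disc, on the boundary because Ω is locally connected there (`jet_eq`). Since u is in H²_0,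
its jets of order at most one vanish on the boundary (`jet_eq_zero`). An edge determines the traces
of a quintic and of its gradient from the Argyris data (`edge_unisolvent`), so the local
interpolants match to first order across edges and vanish to first order on the boundary. Piecewise
smooth functions of this kind belong to H²_0 (`exists_glue`, through `memH0_of_flat`). -/

noncomputable section

namespace QGE

section

open Filter Topology

/-! ### Calculus of mixed partial derivatives of smooth functions -/

/-- The classical partial derivative `∂_i f`. -/
def pd (i : Fin 2) (f : Plane → ℝ) (x : Plane) : ℝ :=
  fderiv ℝ f x (EuclideanSpace.single i (1 : ℝ))

/-- The mixed partial derivative `∂_x^i ∂_y^j f`. -/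
def D (i j : ℕ) (f : Plane → ℝ) : Plane → ℝ := (pd 0)^[i] ((pd 1)^[j] f)

theorem smooth_pd {f : Plane → ℝ} (hf : ContDiff ℝ ∞ f) (i : Fin 2) : ContDiff ℝ ∞ (pd i f) := by
  unfold pd
  exact (hf.fderiv_right (m := ∞) (by simp)).clm_apply contDiff_const

theorem smooth_pd_iter {f : Plane → ℝ} (hf : ContDiff ℝ ∞ f) (i : Fin 2) (n : ℕ) :
    ContDiff ℝ ∞ ((pd i)^[n] f) := by
  induction n with
  | zero => simpa using hf
  | succ n ih => rw [Function.iterate_succ_apply']; exact smooth_pd ih i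

theorem smooth_D {f : Plane → ℝ} (hf : ContDiff ℝ ∞ f) (i j : ℕ) : ContDiff ℝ ∞ (D i j f) :=
  smooth_pd_iter (smooth_pd_iter hf 1 j) 0 i

theorem continuous_D {f : Plane → ℝ} (hf : ContDiff ℝ ∞ f) (i j : ℕ) : Continuous (D i j f) :=
  (smooth_D hf i j).continuous

theorem differentiable_of_smooth {f : Plane → ℝ} (hf : ContDiff ℝ ∞ f) : Differentiable ℝ f :=
  hf.differentiable (by simp)

theorem pd_comm {f : Plane → ℝ} (hf : ContDiff ℝ ∞ f) (i j : Fin 2) :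
    pd i (pd j f) = pd j (pd i f) := by
  funext x
  have h1 : DifferentiableAt ℝ (fderiv ℝ f) x :=
    (hf.fderiv_right (m := ∞) (by simp)).differentiable (by simp) x
  have key : ∀ a b : Fin 2, pd a (pd b f) x =
      fderiv ℝ (fderiv ℝ f) x (EuclideanSpace.single a 1) (EuclideanSpace.single b 1) := by
    intro a b
    have : pd b f = fun y => fderiv ℝ f y (EuclideanSpace.single b 1) := rfl
    rw [pd, this, fderiv_clm_apply h1 (differentiableAt_const _)]
    simp
  rw [key, key]
  have := (hf.contDiffAt (x := x)).isSymmSndFDerivAt (by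
    simpa using (show ((2 : ℕ∞) : WithTop ℕ∞) ≤ ((⊤ : ℕ∞) : WithTop ℕ∞) from
      WithTop.coe_le_coe.2 le_top))
  exact this _ _

theorem pd_one_iter_comm {f : Plane → ℝ} (hf : ContDiff ℝ ∞ f) (n : ℕ) :
    pd 1 ((pd 0)^[n] f) = (pd 0)^[n] (pd 1 f) := by
  induction n generalizing f with
  | zero => rfl
  | succ n ih =>
    rw [Function.iterate_succ_apply, Function.iterate_succ_apply, ih (smooth_pd hf 0),
      pd_comm hf]

theorem pd_zero_D (f : Plane → ℝ) (i j : ℕ) : pd 0 (D i j f) = D (i + 1) j f := by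
  unfold D; rw [Function.iterate_succ_apply']

theorem pd_one_D {f : Plane → ℝ} (hf : ContDiff ℝ ∞ f) (i j : ℕ) :
    pd 1 (D i j f) = D i (j + 1) f := by
  unfold D
  rw [pd_one_iter_comm (smooth_pd_iter hf 1 j), Function.iterate_succ_apply']

theorem D_zero_zero (f : Plane → ℝ) : D 0 0 f = f := rfl

/-- Symmetry of second derivatives is what makes the multi-index notation legitimate: orders add,
whatever the sequence of differentiations. -/
theorem D_D {f : Plane → ℝ} (hf : ContDiff ℝ ∞ f) (a b i j : ℕ) :
    D a b (D i j f) = D (a + i) (b + j) f := by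
  have h1 : ∀ b, (pd 1)^[b] (D i j f) = D i (b + j) f := by
    intro b
    induction b with
    | zero => simp
    | succ b ih =>
      rw [Function.iterate_succ_apply', ih, pd_one_D hf]; congr 1; omega
  have h2 : ∀ a, (pd 0)^[a] (D i (b + j) f) = D (a + i) (b + j) f := by
    intro a
    induction a with
    | zero => simp
    | succ a ih =>
      rw [Function.iterate_succ_apply', ih, pd_zero_D]; congr 1; omega
  rw [← h2 a, ← h1 b]; rfl

theorem pd_add {f g : Plane → ℝ} (hf : Differentiable ℝ f) (hg : Differentiable ℝ g) (i : Fin 2) :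
    pd i (fun x => f x + g x) = fun x => pd i f x + pd i g x := by
  funext x; unfold pd
  rw [fderiv_fun_add (hf x) (hg x)]; rfl

theorem pd_smul (c : ℝ) {f : Plane → ℝ} (hf : Differentiable ℝ f) (i : Fin 2) :
    pd i (fun x => c * f x) = fun x => c * pd i f x := by
  funext x; unfold pd
  rw [fderiv_const_mul (hf x)]; rfl

theorem D_add {f g : Plane → ℝ} (hf : ContDiff ℝ ∞ f) (hg : ContDiff ℝ ∞ g) (i j : ℕ) :
    D i j (fun x => f x + g x) = fun x => D i j f x + D i j g x := by
  have key : ∀ (v : Fin 2) (n : ℕ) {f g : Plane → ℝ}, ContDiff ℝ ∞ f → ContDiff ℝ ∞ g →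
      (pd v)^[n] (fun x => f x + g x) = fun x => (pd v)^[n] f x + (pd v)^[n] g x := by
    intro v n
    induction n with
    | zero => intros; rfl
    | succ n ih =>
      intro f g hf hg
      rw [Function.iterate_succ_apply, pd_add (differentiable_of_smooth hf)
        (differentiable_of_smooth hg), ih (smooth_pd hf v) (smooth_pd hg v)]
      rfl
  unfold D
  rw [key 1 j hf hg, key 0 i (smooth_pd_iter hf 1 j) (smooth_pd_iter hg 1 j)]

theorem D_smul (c : ℝ) {f : Plane → ℝ} (hf : ContDiff ℝ ∞ f) (i j : ℕ) :
    D i j (fun x => c * f x) = fun x => c * D i j f x := by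
  have key : ∀ (v : Fin 2) (n : ℕ) {f : Plane → ℝ}, ContDiff ℝ ∞ f →
      (pd v)^[n] (fun x => c * f x) = fun x => c * (pd v)^[n] f x := by
    intro v n
    induction n with
    | zero => intros; rfl
    | succ n ih =>
      intro f hf
      rw [Function.iterate_succ_apply, pd_smul c (differentiable_of_smooth hf),
        ih (smooth_pd hf v)]
      rfl
  unfold D
  rw [key 1 j hf, key 0 i (smooth_pd_iter hf 1 j)]

theorem D_sub {f g : Plane → ℝ} (hf : ContDiff ℝ ∞ f) (hg : ContDiff ℝ ∞ g) (i j : ℕ) :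
    D i j (fun x => f x - g x) = fun x => D i j f x - D i j g x := by
  have h1 : (fun x => f x - g x) = fun x => f x + (-1) * g x := by funext x; ring
  rw [h1, D_add hf (contDiff_const.mul hg), D_smul _ hg]
  funext x; ring

/-- The number of entries of `s` that are equal to `v`. -/
def cnt {k : ℕ} (s : Fin k → Fin 2) (v : Fin 2) : ℕ := ∑ l, if s l = v then 1 else 0

theorem cnt_zero (s : Fin 0 → Fin 2) (v : Fin 2) : cnt s v = 0 := by simp [cnt]

theorem cnt_succ {k : ℕ} (s : Fin (k + 1) → Fin 2) (v : Fin 2) :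
    cnt s v = (if s 0 = v then 1 else 0) + cnt (fun l => s l.succ) v := by
  unfold cnt; rw [Fin.sum_univ_succ]

theorem cnt_add {k : ℕ} (s : Fin k → Fin 2) : cnt s 0 + cnt s 1 = k := by
  induction k with
  | zero => simp [cnt_zero]
  | succ k ih =>
    have := ih (fun l => s l.succ)
    rw [cnt_succ, cnt_succ]
    have h : s 0 = 0 ∨ s 0 = 1 := by omega
    rcases h with h | h <;> simp [h] <;> omega

theorem exists_cnt (k i j : ℕ) (h : i + j = k) :
    ∃ s : Fin k → Fin 2, cnt s 0 = i ∧ cnt s 1 = j := by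
  induction k generalizing i j with
  | zero => exact ⟨fun _ => 0, by rw [cnt_zero]; omega, by rw [cnt_zero]; omega⟩
  | succ k ih =>
    rcases i with _ | i
    · obtain ⟨s, h0, h1⟩ := ih 0 k (by omega)
      refine ⟨Fin.cons 1 s, ?_, ?_⟩ <;> rw [cnt_succ] <;> simp [h0, h1]
      omega
    · obtain ⟨s, h0, h1⟩ := ih i j (by omega)
      refine ⟨Fin.cons 0 s, ?_, ?_⟩ <;> rw [cnt_succ] <;> simp [h0, h1]
      omega

/-- The bridge from derivatives indexed by sequences of directions, as in the definition of the
Sobolev spaces, to multi-indices: by symmetry only the number of occurrences of each direction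
counts. -/
theorem partialDeriv_eq_D {k : ℕ} (s : Fin k → Fin 2) {f : Plane → ℝ} (hf : ContDiff ℝ ∞ f) :
    partialDeriv s f = D (cnt s 0) (cnt s 1) f := by
  induction k with
  | zero => funext x; simp [partialDeriv, cnt_zero, D_zero_zero]
  | succ k ih =>
    have h1 : partialDeriv s f = pd (s 0) (partialDeriv (fun l => s l.succ) f) := by
      funext x
      have hd : DifferentiableAt ℝ (iteratedFDeriv ℝ k f) x :=
        (hf.differentiable_iteratedFDeriv (m := k) (by exact_mod_cast WithTop.coe_lt_top _)) x
      unfold partialDeriv pd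
      rw [iteratedFDeriv_succ_apply_left]
      have := (hd.hasFDerivAt.continuousMultilinear_apply_const
        (fun l : Fin k => EuclideanSpace.single (s l.succ) (1 : ℝ))).fderiv
      rw [this]; rfl
    rw [h1, ih, cnt_succ, cnt_succ]
    have h : s 0 = 0 ∨ s 0 = 1 := by omega
    rcases h with h | h
    · simp [h, pd_zero_D, add_comm]
    · simp [h, pd_one_D hf, add_comm]

theorem tsupport_pd_subset (i : Fin 2) (f : Plane → ℝ) : tsupport (pd i f) ⊆ tsupport f :=
  tsupport_fderiv_apply_subset ℝ _

theorem IsTestFunction.pd {Ω : Set Plane} {φ : Plane → ℝ} (h : IsTestFunction Ω φ) (i : Fin 2) :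
    IsTestFunction Ω (pd i φ) :=
  ⟨smooth_pd h.1 i, h.2.1.mono' ((subset_tsupport _).trans (tsupport_pd_subset i φ)),
    (tsupport_pd_subset i φ).trans h.2.2⟩

theorem IsTestFunction.D {Ω : Set Plane} {φ : Plane → ℝ} (h : IsTestFunction Ω φ) (i j : ℕ) :
    IsTestFunction Ω (D i j φ) := by
  have key : ∀ (v : Fin 2) (n : ℕ) {φ : Plane → ℝ}, IsTestFunction Ω φ →
      IsTestFunction Ω ((QGE.pd v)^[n] φ) := by
    intro v n
    induction n with
    | zero => intro φ h; exact h
    | succ n ih => intro φ h; rw [Function.iterate_succ_apply]; exact ih (h.pd v)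
  exact key 0 i (key 1 j h)

theorem IsTestFunction.add {Ω : Set Plane} {φ χ : Plane → ℝ} (h : IsTestFunction Ω φ)
    (h' : IsTestFunction Ω χ) : IsTestFunction Ω (fun x => φ x + χ x) :=
  ⟨h.1.add h'.1, h.2.1.add h'.2.1, (tsupport_add φ χ).trans (union_subset h.2.2 h'.2.2)⟩

theorem IsTestFunction.smul {Ω : Set Plane} {φ : Plane → ℝ} (h : IsTestFunction Ω φ) (c : ℝ) :
    IsTestFunction Ω (fun x => c * φ x) :=
  ⟨contDiff_const.mul h.1, h.2.1.mul_left,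
    (closure_mono (Function.support_mul_subset_right _ _)).trans h.2.2⟩

theorem isTestFunction_zero (Ω : Set Plane) : IsTestFunction Ω (fun _ => 0) :=
  ⟨contDiff_const, HasCompactSupport.zero, by simp [tsupport]⟩

theorem IsTestFunction.eq_zero {Ω : Set Plane} {φ : Plane → ℝ} (h : IsTestFunction Ω φ)
    {x : Plane} (hx : x ∉ Ω) : φ x = 0 :=
  image_eq_zero_of_notMem_tsupport fun h' => hx (h.2.2 h')

theorem setIntegral_mul_test {Ω : Set Plane} {φ : Plane → ℝ} (h : IsTestFunction Ω φ)
    (f : Plane → ℝ) : ∫ x in Ω, f x * φ x = ∫ x, f x * φ x :=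
  setIntegral_eq_integral_of_forall_compl_eq_zero fun x hx => by rw [h.eq_zero hx, mul_zero]

/-- Because `φ` has compact support in `Ω`, both integrals may be taken over the whole plane, where
no boundary term arises. -/
theorem integral_mul_pd {Ω : Set Plane} {f φ : Plane → ℝ} (hf : ContDiff ℝ 1 f)
    (hφ : IsTestFunction Ω φ) (i : Fin 2) :
    ∫ x in Ω, f x * pd i φ x = - ∫ x in Ω, pd i f x * φ x := by
  rw [setIntegral_mul_test (hφ.pd i), setIntegral_mul_test hφ]
  have hc : Continuous (pd i f) := (hf.continuous_fderiv (by simp)).clm_apply continuous_const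
  refine integral_mul_fderiv_eq_neg_fderiv_mul_of_integrable ?_ ?_ ?_
    (fun x _ => hf.differentiable (by simp) x) (fun x _ => differentiable_of_smooth hφ.1 x)
  · exact (hc.mul hφ.1.continuous).integrable_of_hasCompactSupport hφ.2.1.mul_left
  · exact (hf.continuous.mul (hφ.pd i).1.continuous).integrable_of_hasCompactSupport
      (hφ.pd i).2.1.mul_left
  · exact (hf.continuous.mul hφ.1.continuous).integrable_of_hasCompactSupport hφ.2.1.mul_left

theorem integral_mul_D {Ω : Set Plane} {f φ : Plane → ℝ} (hf : ContDiff ℝ ∞ f)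
    (hφ : IsTestFunction Ω φ) (i j : ℕ) :
    ∫ x in Ω, f x * D i j φ x = (-1) ^ (i + j) * ∫ x in Ω, D i j f x * φ x := by
  have step : ∀ (v : Fin 2) (n : ℕ) {f φ : Plane → ℝ}, ContDiff ℝ ∞ f → IsTestFunction Ω φ →
      ∫ x in Ω, f x * (pd v)^[n] φ x = (-1) ^ n * ∫ x in Ω, (pd v)^[n] f x * φ x := by
    intro v n
    induction n with
    | zero => intros; simp
    | succ n ih =>
      intro f φ hf hφ
      rw [Function.iterate_succ_apply, ih hf (hφ.pd v),
        integral_mul_pd ((smooth_pd_iter hf v n).of_le (by simp)) hφ,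
        ← Function.iterate_succ_apply' (pd v) n f, pow_succ]
      ring
  have comm : (pd 1)^[j] ((pd 0)^[i] f) = D i j f := by
    have := D_D hf 0 j i 0
    simpa [D] using this
  unfold D at *
  have h1 : IsTestFunction Ω ((pd 1)^[j] φ) := hφ.D 0 j
  rw [step 0 i hf h1, step 1 j (smooth_pd_iter hf 0 i) hφ, comm]
  rw [pow_add]; ring

/-! ### Weak derivatives indexed by multi-indices -/

/-- `g` is the weak derivative `∂_x^i ∂_y^j f` in `Ω`. -/
def HWD (Ω : Set Plane) (i j : ℕ) (f g : Plane → ℝ) : Prop :=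
  LocallyIntegrableOn f Ω ∧ LocallyIntegrableOn g Ω ∧
    ∀ φ, IsTestFunction Ω φ → ∫ x in Ω, f x * D i j φ x = (-1) ^ (i + j) * ∫ x in Ω, g x * φ x

theorem hasWeakDeriv_iff {Ω : Set Plane} {k : ℕ} (s : Fin k → Fin 2) (f g : Plane → ℝ) :
    HasWeakDeriv Ω s f g ↔ HWD Ω (cnt s 0) (cnt s 1) f g := by
  unfold HasWeakDeriv HWD
  rw [cnt_add]
  refine and_congr_right fun _ => and_congr_right fun _ => forall₂_congr fun φ hφ => ?_
  rw [partialDeriv_eq_D s hφ.1]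

theorem hWD_smooth (Ω : Set Plane) {f : Plane → ℝ} (hf : ContDiff ℝ ∞ f) (i j : ℕ) :
    HWD Ω i j f (D i j f) :=
  ⟨hf.continuous.locallyIntegrable.locallyIntegrableOn _,
    (continuous_D hf i j).locallyIntegrable.locallyIntegrableOn _,
    fun _ hφ => integral_mul_D hf hφ i j⟩

theorem integrableOn_mul_test {Ω : Set Plane} (hΩ : IsOpen Ω) {f φ : Plane → ℝ}
    (hf : LocallyIntegrableOn f Ω) (hφ : IsTestFunction Ω φ) :
    IntegrableOn (fun x => f x * φ x) Ω := by
  have h1 : IntegrableOn f (tsupport φ) :=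
    hf.integrableOn_compact_subset hφ.2.2 hφ.2.1
  have h2 : IntegrableOn (fun x => f x * φ x) (tsupport φ) :=
    h1.mul_continuousOn hφ.1.continuous.continuousOn hφ.2.1
  refine (h2.of_forall_sdiff_eq_zero hΩ.measurableSet ?_)
  intro x hx
  simp [image_eq_zero_of_notMem_tsupport hx.2]

theorem HWD.add {Ω : Set Plane} (hΩ : IsOpen Ω) {i j : ℕ} {f g f' g' : Plane → ℝ}
    (h : HWD Ω i j f g) (h' : HWD Ω i j f' g') :
    HWD Ω i j (fun x => f x + f' x) (fun x => g x + g' x) := by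
  refine ⟨h.1.add h'.1, h.2.1.add h'.2.1, fun φ hφ => ?_⟩
  have e1 := integral_add (integrableOn_mul_test hΩ h.1 (hφ.D i j))
    (integrableOn_mul_test hΩ h'.1 (hφ.D i j))
  have e2 := integral_add (integrableOn_mul_test hΩ h.2.1 hφ) (integrableOn_mul_test hΩ h'.2.1 hφ)
  simp only [add_mul]
  rw [e1, e2, h.2.2 φ hφ, h'.2.2 φ hφ]; ring

theorem HWD.smul {Ω : Set Plane} {i j : ℕ} {f g : Plane → ℝ} (h : HWD Ω i j f g) (c : ℝ) :
    HWD Ω i j (fun x => c * f x) (fun x => c * g x) := by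
  refine ⟨h.1.smul c, h.2.1.smul c, fun φ hφ => ?_⟩
  simp only [mul_assoc]
  rw [integral_const_mul, integral_const_mul, h.2.2 φ hφ]; ring

/-- The difference of two weak derivatives of `f` is a weak derivative of zero, hence orthogonal to
all test functions; the fundamental lemma of the calculus of variations applies. -/
theorem HWD.ae_unique {Ω : Set Plane} (hΩ : IsOpen Ω) {i j : ℕ} {f g g' : Plane → ℝ}
    (h : HWD Ω i j f g) (h' : HWD Ω i j f g') : g =ᵐ[volume.restrict Ω] g' := by
  have h0 : HWD Ω i j (fun x => f x + (-1) * f x) (fun x => g x + (-1) * g' x) :=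
    h.add hΩ (h'.smul (-1))
  have := hΩ.ae_eq_zero_of_integral_contDiff_smul_eq_zero (μ := volume) h0.2.1 (by
    intro φ h1 h2 h3
    have hφ : IsTestFunction Ω φ := ⟨h1, h2, h3⟩
    have e := h0.2.2 φ hφ
    have e0 : ∫ x in Ω, (f x + -1 * f x) * D i j φ x = 0 := by simp
    rw [e0, setIntegral_mul_test hφ] at e
    have e1 := (mul_eq_zero.1 e.symm).resolve_left (pow_ne_zero _ (by norm_num))
    simpa [mul_comm] using e1)
  rw [Filter.EventuallyEq, ae_restrict_iff' hΩ.measurableSet]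
  filter_upwards [this] with x hx hxΩ
  have := hx hxΩ
  linarith

theorem HWD.congr_ae {Ω : Set Plane} (hΩ : IsOpen Ω) {i j : ℕ} {f g f' g' : Plane → ℝ}
    (h : HWD Ω i j f g) (hf : f =ᵐ[volume.restrict Ω] f') (hg : g =ᵐ[volume.restrict Ω] g') :
    HWD Ω i j f' g' := by
  have key : ∀ {u v : Plane → ℝ}, LocallyIntegrableOn u Ω → u =ᵐ[volume.restrict Ω] v →
      LocallyIntegrableOn v Ω := by
    intro u v hu huv
    rw [locallyIntegrableOn_iff hΩ.isLocallyClosed] at hu ⊢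
    intro k hk hc
    exact (hu k hk hc).congr (ae_restrict_of_ae_restrict_of_subset hk huv)
  refine ⟨key h.1 hf, key h.2.1 hg, fun φ hφ => ?_⟩
  rw [← integral_congr_ae (hf.mono fun x hx => by simp only [hx] :
    (fun x => f x * D i j φ x) =ᵐ[volume.restrict Ω] fun x => f' x * D i j φ x),
    h.2.2 φ hφ, integral_congr_ae (hg.mono fun x hx => by simp only [hx] :
    (fun x => g x * φ x) =ᵐ[volume.restrict Ω] fun x => g' x * φ x)]

end

section

open Filter Topology

/-! ### Weak derivatives as elements of `L²(Ω)` -/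

open Classical in
/-- The class in `L²(Ω)` of the weak derivative `∂_x^i ∂_y^j f` (`0` if there is none). -/
def wL (Ω : Set Plane) (i j : ℕ) (f : Plane → ℝ) : Lp ℝ 2 (volume.restrict Ω) :=
  if h : ∃ g, HWD Ω i j f g ∧ MemLp g 2 (volume.restrict Ω) then h.choose_spec.2.toLp else 0

variable {Ω : Set Plane}

theorem wL_eq (hΩ : IsOpen Ω) {i j : ℕ} {f g : Plane → ℝ} (h : HWD Ω i j f g)
    (hg : MemLp g 2 (volume.restrict Ω)) : wL Ω i j f = hg.toLp g := by
  have hex : ∃ g, HWD Ω i j f g ∧ MemLp g 2 (volume.restrict Ω) := ⟨g, h, hg⟩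
  rw [wL, dif_pos hex]
  exact (MemLp.toLp_eq_toLp_iff _ _).2 (hex.choose_spec.1.ae_unique hΩ h)

theorem memH_iff {k : ℕ} {f : Plane → ℝ} :
    MemH k Ω f ↔ ∀ i j, i + j ≤ k → ∃ g, HWD Ω i j f g ∧ MemLp g 2 (volume.restrict Ω) := by
  constructor
  · intro h i j hij
    obtain ⟨s, h0, h1⟩ := exists_cnt (i + j) i j rfl
    obtain ⟨g, hg, hg2⟩ := h (i + j) hij s
    rw [hasWeakDeriv_iff, h0, h1] at hg
    exact ⟨g, hg, hg2⟩
  · intro h m hm s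
    obtain ⟨g, hg, hg2⟩ := h (cnt s 0) (cnt s 1) (by rw [cnt_add]; exact hm)
    exact ⟨g, (hasWeakDeriv_iff s f g).2 hg, hg2⟩

theorem MemH.hwd (hΩ : IsOpen Ω) {k i j : ℕ} {f : Plane → ℝ} (h : MemH k Ω f)
    (hij : i + j ≤ k) : HWD Ω i j f (wL Ω i j f) := by
  obtain ⟨g, hg, hg2⟩ := memH_iff.1 h i j hij
  rw [wL_eq hΩ hg hg2]
  exact hg.congr_ae hΩ (ae_eq_refl _) hg2.coeFn_toLp.symm

/-- `weakDeriv` picks an arbitrary weak derivative. Uniqueness up to null sets identifies it with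
the class `wL`, so that the forms and norms of the statement can be computed in the Hilbert space
`L²(Ω)`. -/
theorem weakDeriv_ae (hΩ : IsOpen Ω) {k m : ℕ} {f : Plane → ℝ} (h : MemH k Ω f) (hm : m ≤ k)
    (s : Fin m → Fin 2) :
    weakDeriv Ω s f =ᵐ[volume.restrict Ω] wL Ω (cnt s 0) (cnt s 1) f := by
  have hw := h.hwd hΩ (i := cnt s 0) (j := cnt s 1) (by rw [cnt_add]; exact hm)
  have hex : ∃ g, HasWeakDeriv Ω s f g := ⟨_, (hasWeakDeriv_iff s f _).2 hw⟩
  rw [weakDeriv, dif_pos hex]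
  exact ((hasWeakDeriv_iff s f _).1 hex.choose_spec).ae_unique hΩ hw

theorem memLp_wL_add (i j : ℕ) (f g : Plane → ℝ) :
    MemLp (fun x => wL Ω i j f x + wL Ω i j g x) 2 (volume.restrict Ω) :=
  MemLp.add (Lp.memLp (wL Ω i j f)) (Lp.memLp (wL Ω i j g))

theorem memLp_wL_smul (i j : ℕ) (f : Plane → ℝ) (c : ℝ) :
    MemLp (fun x => c * wL Ω i j f x) 2 (volume.restrict Ω) :=
  MemLp.const_mul (Lp.memLp (wL Ω i j f)) c

theorem MemH.add (hΩ : IsOpen Ω) {k : ℕ} {f g : Plane → ℝ} (hf : MemH k Ω f) (hg : MemH k Ω g) :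
    MemH k Ω (fun x => f x + g x) :=
  memH_iff.2 fun i j hij => ⟨fun x => wL Ω i j f x + wL Ω i j g x,
    (hf.hwd hΩ hij).add hΩ (hg.hwd hΩ hij), memLp_wL_add i j f g⟩

theorem MemH.smul (hΩ : IsOpen Ω) {k : ℕ} {f : Plane → ℝ} (hf : MemH k Ω f) (c : ℝ) :
    MemH k Ω (fun x => c * f x) :=
  memH_iff.2 fun i j hij => ⟨fun x => c * wL Ω i j f x, (hf.hwd hΩ hij).smul c,
    memLp_wL_smul i j f c⟩

theorem MemH.sub (hΩ : IsOpen Ω) {k : ℕ} {f g : Plane → ℝ} (hf : MemH k Ω f) (hg : MemH k Ω g) :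
    MemH k Ω (fun x => f x - g x) := by
  have := hf.add hΩ (hg.smul hΩ (-1))
  simpa [sub_eq_add_neg] using this

theorem wL_add (hΩ : IsOpen Ω) {k i j : ℕ} {f g : Plane → ℝ} (hf : MemH k Ω f) (hg : MemH k Ω g)
    (hij : i + j ≤ k) : wL Ω i j (fun x => f x + g x) = wL Ω i j f + wL Ω i j g := by
  rw [wL_eq hΩ ((hf.hwd hΩ hij).add hΩ (hg.hwd hΩ hij)) (memLp_wL_add i j f g)]
  refine Lp.ext ?_
  filter_upwards [MemLp.coeFn_toLp (memLp_wL_add (Ω := Ω) i j f g),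
    Lp.coeFn_add (wL Ω i j f) (wL Ω i j g)] with x h1 h2
  rw [h2]; exact h1

theorem wL_smul (hΩ : IsOpen Ω) {k i j : ℕ} {f : Plane → ℝ} (hf : MemH k Ω f)
    (hij : i + j ≤ k) (c : ℝ) : wL Ω i j (fun x => c * f x) = c • wL Ω i j f := by
  rw [wL_eq hΩ ((hf.hwd hΩ hij).smul c) (memLp_wL_smul i j f c)]
  refine Lp.ext ?_
  filter_upwards [MemLp.coeFn_toLp (memLp_wL_smul (Ω := Ω) i j f c),
    Lp.coeFn_smul c (wL Ω i j f)] with x h1 h2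
  rw [h2]; exact h1

theorem wL_sub (hΩ : IsOpen Ω) {k i j : ℕ} {f g : Plane → ℝ} (hf : MemH k Ω f) (hg : MemH k Ω g)
    (hij : i + j ≤ k) : wL Ω i j (fun x => f x - g x) = wL Ω i j f - wL Ω i j g := by
  have h1 := wL_add hΩ hf (hg.smul hΩ (-1)) hij
  rw [wL_smul hΩ hg hij] at h1
  have h2 : (fun x => f x - g x) = fun x => f x + -1 * g x := by funext x; ring
  rw [h2, h1, neg_one_smul, sub_eq_add_neg]

theorem IsTestFunction.memLp {φ : Plane → ℝ} (h : IsTestFunction Ω φ) (p : ENNReal) :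
    MemLp φ p (volume.restrict Ω) :=
  (h.1.continuous.memLp_of_hasCompactSupport h.2.1).restrict Ω

theorem IsTestFunction.memH {φ : Plane → ℝ} (h : IsTestFunction Ω φ) (k : ℕ) : MemH k Ω φ :=
  memH_iff.2 fun i j _ => ⟨QGE.D i j φ, hWD_smooth Ω h.1 i j, (h.D i j).memLp 2⟩

theorem wL_test (hΩ : IsOpen Ω) {φ : Plane → ℝ} (h : IsTestFunction Ω φ) (i j : ℕ) :
    wL Ω i j φ = ((h.D i j).memLp 2).toLp :=
  wL_eq hΩ (hWD_smooth Ω h.1 i j) ((h.D i j).memLp 2)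

theorem wL_test_ae (hΩ : IsOpen Ω) {φ : Plane → ℝ} (h : IsTestFunction Ω φ) (i j : ℕ) :
    wL Ω i j φ =ᵐ[volume.restrict Ω] D i j φ := by
  rw [wL_test hΩ h]; exact MemLp.coeFn_toLp _

theorem hwd_zero {f : Plane → ℝ} (hf : LocallyIntegrableOn f Ω) : HWD Ω 0 0 f f :=
  ⟨hf, hf, fun φ _ => by simp [D_zero_zero]⟩

theorem wL_zero_ae (hΩ : IsOpen Ω) {k : ℕ} {f : Plane → ℝ} (hf : MemH k Ω f) :
    wL Ω 0 0 f =ᵐ[volume.restrict Ω] f := by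
  have h := hf.hwd hΩ (i := 0) (j := 0) (by omega)
  exact h.ae_unique hΩ (hwd_zero h.1)

theorem MemH.memLp (hΩ : IsOpen Ω) {k : ℕ} {f : Plane → ℝ} (hf : MemH k Ω f) :
    MemLp f 2 (volume.restrict Ω) :=
  (memLp_congr_ae (wL_zero_ae hΩ hf)).1 (Lp.memLp _)

theorem norm_sq_eq_integral {α : Type*} [MeasurableSpace α] {μ : Measure α} (f : Lp ℝ 2 μ) :
    ‖f‖ ^ 2 = ∫ x, (f x) ^ 2 ∂μ := by
  rw [← real_inner_self_eq_norm_sq, L2.inner_def]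
  refine integral_congr_ae (Eventually.of_forall fun x => ?_)
  simp [pow_two]

theorem seminormH_sq (hΩ : IsOpen Ω) {k m : ℕ} {f : Plane → ℝ} (hf : MemH k Ω f) (hm : m ≤ k) :
    seminormH m Ω f ^ 2 = ∑ s : Fin m → Fin 2, ‖wL Ω (cnt s 0) (cnt s 1) f‖ ^ 2 := by
  rw [seminormH, Real.sq_sqrt (Finset.sum_nonneg fun s _ => integral_nonneg fun x => sq_nonneg _)]
  refine Finset.sum_congr rfl fun s _ => ?_
  rw [norm_sq_eq_integral]
  refine integral_congr_ae ?_
  filter_upwards [weakDeriv_ae hΩ hf hm s] with x hx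
  rw [hx]

theorem seminormH_nonneg (m : ℕ) (f : Plane → ℝ) : 0 ≤ seminormH m Ω f := Real.sqrt_nonneg _

theorem normH_nonneg (m : ℕ) (f : Plane → ℝ) : 0 ≤ normH m Ω f := Real.sqrt_nonneg _

theorem normH_sq (k : ℕ) (f : Plane → ℝ) :
    normH k Ω f ^ 2 = ∑ j ∈ Finset.range (k + 1), (seminormH j Ω f) ^ 2 :=
  Real.sq_sqrt (Finset.sum_nonneg fun _ _ => sq_nonneg _)

theorem seminormH_le_normH {m k : ℕ} (hm : m ≤ k) (f : Plane → ℝ) :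
    seminormH m Ω f ≤ normH k Ω f := by
  refine (sq_le_sq₀ (seminormH_nonneg _ _) (normH_nonneg _ _)).1 ?_
  rw [normH_sq]
  exact Finset.single_le_sum (f := fun j => (seminormH j Ω f) ^ 2) (fun _ _ => sq_nonneg _)
    (Finset.mem_range.2 (by omega))

theorem norm_wL_le_seminormH (hΩ : IsOpen Ω) {k i j : ℕ} {f : Plane → ℝ} (hf : MemH k Ω f)
    (hij : i + j ≤ k) : ‖wL Ω i j f‖ ≤ seminormH (i + j) Ω f := by
  refine (sq_le_sq₀ (norm_nonneg _) (seminormH_nonneg _ _)).1 ?_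
  rw [seminormH_sq hΩ hf hij]
  obtain ⟨s, h0, h1⟩ := exists_cnt (i + j) i j rfl
  have := Finset.single_le_sum (f := fun s : Fin (i + j) → Fin 2 =>
    ‖wL Ω (cnt s 0) (cnt s 1) f‖ ^ 2) (fun _ _ => sq_nonneg _) (Finset.mem_univ s)
  simpa only [h0, h1] using this

theorem norm_wL_le_normH (hΩ : IsOpen Ω) {k i j : ℕ} {f : Plane → ℝ} (hf : MemH k Ω f)
    (hij : i + j ≤ k) : ‖wL Ω i j f‖ ≤ normH k Ω f :=
  (norm_wL_le_seminormH hΩ hf hij).trans (seminormH_le_normH hij f)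

theorem seminormH_sq_le (hΩ : IsOpen Ω) {k m : ℕ} {f : Plane → ℝ} (hf : MemH k Ω f) (hm : m ≤ k)
    {B : ℝ} (hB : ∀ i j, i + j = m → ‖wL Ω i j f‖ ^ 2 ≤ B) :
    seminormH m Ω f ^ 2 ≤ 2 ^ m * B := by
  rw [seminormH_sq hΩ hf hm]
  refine (Finset.sum_le_card_nsmul _ _ B fun s _ => hB _ _ (cnt_add s)).trans_eq ?_
  simp

theorem seminormH_zero_sq (hΩ : IsOpen Ω) {k : ℕ} {f : Plane → ℝ} (hf : MemH k Ω f) :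
    seminormH 0 Ω f ^ 2 = ‖wL Ω 0 0 f‖ ^ 2 := by
  rw [seminormH_sq hΩ hf (by omega)]; simp [cnt_zero]

theorem seminormH_one_sq (hΩ : IsOpen Ω) {k : ℕ} {f : Plane → ℝ} (hf : MemH k Ω f) (hk : 1 ≤ k) :
    seminormH 1 Ω f ^ 2 = ‖wL Ω 1 0 f‖ ^ 2 + ‖wL Ω 0 1 f‖ ^ 2 := by
  rw [seminormH_sq hΩ hf hk, Fintype.sum_equiv (Equiv.funUnique (Fin 1) (Fin 2)) _
    (fun v => ‖wL Ω (cnt (fun _ : Fin 1 => v) 0) (cnt (fun _ : Fin 1 => v) 1) f‖ ^ 2)]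
  · simp [Fin.sum_univ_two, cnt]
  · intro s
    have : s = fun _ => s 0 := by funext l; rw [Subsingleton.elim l 0]
    rw [this]; rfl

/-- The mixed derivative belongs to two sequences of directions, hence its weight. -/
theorem seminormH_two_sq (hΩ : IsOpen Ω) {k : ℕ} {f : Plane → ℝ} (hf : MemH k Ω f) (hk : 2 ≤ k) :
    seminormH 2 Ω f ^ 2 = ‖wL Ω 2 0 f‖ ^ 2 + 2 * ‖wL Ω 1 1 f‖ ^ 2 + ‖wL Ω 0 2 f‖ ^ 2 := by
  rw [seminormH_sq hΩ hf hk, Fintype.sum_equiv (finTwoArrowEquiv (Fin 2)) _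
    (fun v => ‖wL Ω (cnt ![v.1, v.2] 0) (cnt ![v.1, v.2] 1) f‖ ^ 2)]
  · rw [Fintype.sum_prod_type]
    simp only [Fin.sum_univ_two, cnt, Matrix.cons_val_zero, Matrix.cons_val_one]
    norm_num
    ring
  · intro s
    have : ![s 0, s 1] = s := by funext l; fin_cases l <;> rfl
    simp [finTwoArrowEquiv, this]

/-- There are 1 + 2 + 4 = 7 sequences of length at most two, and 7 ≤ 3². -/
theorem normH_two_le (hΩ : IsOpen Ω) {f : Plane → ℝ} (hf : MemH 2 Ω f) {B : ℝ} (hB : 0 ≤ B)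
    (h : ∀ i j, i + j ≤ 2 → ‖wL Ω i j f‖ ≤ B) : normH 2 Ω f ≤ 3 * B := by
  refine (sq_le_sq₀ (normH_nonneg _ _) (by positivity)).1 ?_
  rw [normH_sq]
  have h' : ∀ i j, i + j ≤ 2 → ‖wL Ω i j f‖ ^ 2 ≤ B ^ 2 := fun i j hij =>
    pow_le_pow_left₀ (norm_nonneg _) (h i j hij) 2
  have h0 := seminormH_sq_le hΩ hf (m := 0) (by omega) (fun i j e => h' i j (by omega))
  have h1 := seminormH_sq_le hΩ hf (m := 1) (by omega) (fun i j e => h' i j (by omega))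
  have h2 := seminormH_sq_le hΩ hf (m := 2) (by omega) (fun i j e => h' i j (by omega))
  simp only [Finset.sum_range_succ, Finset.sum_range_zero]
  nlinarith [sq_nonneg B]

/-- Membership in `H²_0(Ω)` through approximating sequences of test functions. -/
theorem memH0_two_iff (hΩ : IsOpen Ω) {f : Plane → ℝ} :
    MemH0 2 Ω f ↔ MemH 2 Ω f ∧ ∃ φ : ℕ → Plane → ℝ, (∀ n, IsTestFunction Ω (φ n)) ∧
      ∀ i j, i + j ≤ 2 → Tendsto (fun n => wL Ω i j (φ n)) atTop (𝓝 (wL Ω i j f)) := by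
  constructor
  · rintro ⟨hf, h⟩
    refine ⟨hf, ?_⟩
    choose φ hφ hφ2 using fun n : ℕ => h (1 / ((n : ℝ) + 1)) (by positivity)
    refine ⟨φ, hφ, fun i j hij => ?_⟩
    rw [tendsto_iff_norm_sub_tendsto_zero]
    refine squeeze_zero (fun n => norm_nonneg _) (fun n => ?_)
      tendsto_one_div_add_atTop_nhds_zero_nat
    rw [norm_sub_rev, ← wL_sub hΩ hf ((hφ n).memH 2) hij]
    exact (norm_wL_le_normH hΩ (hf.sub hΩ ((hφ n).memH 2)) hij).trans (hφ2 n).le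
  · rintro ⟨hf, φ, hφ, h⟩
    refine ⟨hf, fun ε hε => ?_⟩
    have h' : ∀ᶠ n in atTop, ∀ i ∈ Finset.range 3, ∀ j ∈ Finset.range 3, i + j ≤ 2 →
        ‖wL Ω i j (φ n) - wL Ω i j f‖ < ε / 4 := by
      refine (Filter.eventually_all_finset _).2 fun i _ => (Filter.eventually_all_finset _).2
        fun j _ => ?_
      by_cases hij : i + j ≤ 2
      · have := (tendsto_iff_norm_sub_tendsto_zero.1 (h i j hij)).eventually
          (gt_mem_nhds (show (0 : ℝ) < ε / 4 by positivity))
        filter_upwards [this] with n hn _ using hn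
      · exact Eventually.of_forall fun n e => absurd e hij
    obtain ⟨n, hn⟩ := h'.exists
    refine ⟨φ n, hφ n, ?_⟩
    have hs := hf.sub hΩ ((hφ n).memH 2)
    refine (normH_two_le hΩ hs (B := ε / 4) (by positivity) fun i j hij => ?_).trans_lt
      (by linarith)
    rw [wL_sub hΩ hf ((hφ n).memH 2) hij, norm_sub_rev]
    exact (hn i (Finset.mem_range.2 (by omega)) j (Finset.mem_range.2 (by omega)) hij).le

theorem MemH0.add (hΩ : IsOpen Ω) {f g : Plane → ℝ} (hf : MemH0 2 Ω f) (hg : MemH0 2 Ω g) :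
    MemH0 2 Ω (fun x => f x + g x) := by
  obtain ⟨hf, φ, hφ, h⟩ := (memH0_two_iff hΩ).1 hf
  obtain ⟨hg, χ, hχ, h'⟩ := (memH0_two_iff hΩ).1 hg
  refine (memH0_two_iff hΩ).2 ⟨hf.add hΩ hg, fun n x => φ n x + χ n x,
    fun n => (hφ n).add (hχ n), fun i j hij => ?_⟩
  rw [wL_add hΩ hf hg hij]
  refine ((h i j hij).add (h' i j hij)).congr fun n => ?_
  rw [wL_add hΩ ((hφ n).memH 2) ((hχ n).memH 2) hij]

theorem MemH0.smul (hΩ : IsOpen Ω) {f : Plane → ℝ} (hf : MemH0 2 Ω f) (c : ℝ) :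
    MemH0 2 Ω (fun x => c * f x) := by
  obtain ⟨hf, φ, hφ, h⟩ := (memH0_two_iff hΩ).1 hf
  refine (memH0_two_iff hΩ).2 ⟨hf.smul hΩ c, fun n x => c * φ n x,
    fun n => (hφ n).smul c, fun i j hij => ?_⟩
  rw [wL_smul hΩ hf hij]
  refine ((h i j hij).const_smul c).congr fun n => ?_
  rw [wL_smul hΩ ((hφ n).memH 2) hij]

theorem MemH0.sub (hΩ : IsOpen Ω) {f g : Plane → ℝ} (hf : MemH0 2 Ω f) (hg : MemH0 2 Ω g) :
    MemH0 2 Ω (fun x => f x - g x) := by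
  have := hf.add hΩ (hg.smul hΩ (-1))
  simpa [sub_eq_add_neg] using this

theorem IsTestFunction.memH0 (hΩ : IsOpen Ω) {φ : Plane → ℝ} (h : IsTestFunction Ω φ) :
    MemH0 2 Ω φ :=
  (memH0_two_iff hΩ).2 ⟨h.memH 2, fun _ => φ, fun _ => h, fun _ _ _ => tendsto_const_nhds⟩

/-- Two functions that agree almost everywhere in `Ω` have the same weak derivatives. -/
theorem wL_congr (hΩ : IsOpen Ω) {k i j : ℕ} {f f' : Plane → ℝ} (hf : MemH k Ω f)
    (hff : f =ᵐ[volume.restrict Ω] f') (hij : i + j ≤ k) : wL Ω i j f' = wL Ω i j f := by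
  rw [wL_eq hΩ ((hf.hwd hΩ hij).congr_ae hΩ hff (ae_eq_refl _)) (Lp.memLp _), Lp.toLp_coeFn]

theorem MemH.congr (hΩ : IsOpen Ω) {k : ℕ} {f f' : Plane → ℝ} (hf : MemH k Ω f)
    (hff : f =ᵐ[volume.restrict Ω] f') : MemH k Ω f' :=
  memH_iff.2 fun _ _ hij => ⟨_, (hf.hwd hΩ hij).congr_ae hΩ hff (ae_eq_refl _), Lp.memLp _⟩

theorem seminormH_congr (hΩ : IsOpen Ω) {k m : ℕ} {f f' : Plane → ℝ} (hf : MemH k Ω f)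
    (hff : f =ᵐ[volume.restrict Ω] f') (hm : m ≤ k) : seminormH m Ω f' = seminormH m Ω f := by
  refine (pow_left_inj₀ (seminormH_nonneg _ _) (seminormH_nonneg _ _) two_ne_zero).1 ?_
  rw [seminormH_sq hΩ hf hm, seminormH_sq hΩ (hf.congr hΩ hff) hm]
  exact Finset.sum_congr rfl fun s _ => by
    rw [wL_congr hΩ hf hff (by rw [cnt_add]; exact hm)]

end

section

open Filter Topology

/-! ### Mollification -/

/-- Convolution of `g` with the kernel `κ`. -/
def conv (κ g : Plane → ℝ) (x : Plane) : ℝ := ∫ y, g y * κ (x - y)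

/-- The kernel `κ` concentrated at scale `ε`. -/
def sc (ε : ℝ) (κ : Plane → ℝ) (w : Plane) : ℝ := (ε ^ 2)⁻¹ * κ (ε⁻¹ • w)

/-- Smooth kernels supported in the ball of radius `ε`. -/
structure IsKernel (ε : ℝ) (κ : Plane → ℝ) : Prop where
  smooth : ContDiff ℝ ∞ κ
  supp : tsupport κ ⊆ Metric.closedBall 0 ε

theorem IsKernel.compact {ε : ℝ} {κ : Plane → ℝ} (h : IsKernel ε κ) : HasCompactSupport κ :=
  (isCompact_closedBall (0 : Plane) ε).of_isClosed_subset (isClosed_tsupport κ) h.supp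

theorem IsKernel.eq_zero {ε : ℝ} {κ : Plane → ℝ} (h : IsKernel ε κ) {w : Plane} (hw : ε < ‖w‖) :
    κ w = 0 :=
  image_eq_zero_of_notMem_tsupport fun h' => by
    have := h.supp h'
    rw [mem_closedBall_zero_iff] at this
    linarith

theorem IsKernel.pd {ε : ℝ} {κ : Plane → ℝ} (h : IsKernel ε κ) (v : Fin 2) :
    IsKernel ε (pd v κ) :=
  ⟨smooth_pd h.smooth v, (tsupport_pd_subset v κ).trans h.supp⟩

theorem IsKernel.sc {ε : ℝ} (hε : 0 < ε) {κ : Plane → ℝ} (h : IsKernel 1 κ) :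
    IsKernel ε (sc ε κ) := by
  refine ⟨contDiff_const.mul (h.smooth.comp (contDiff_const_smul _)), ?_⟩
  refine closure_minimal ?_ Metric.isClosed_closedBall
  intro w hw
  by_contra hw'
  rw [mem_closedBall_zero_iff, not_le] at hw'
  refine hw ?_
  unfold QGE.sc
  rw [h.eq_zero, mul_zero]
  rw [norm_smul, norm_inv, Real.norm_of_nonneg hε.le, inv_mul_eq_div, lt_div_iff₀ hε]
  linarith

theorem conv_eq_convolution (κ g : Plane → ℝ) :
    conv κ g = convolution g κ (ContinuousLinearMap.mul ℝ ℝ) volume := rfl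

theorem conv_smooth {ε : ℝ} {κ g : Plane → ℝ} (h : IsKernel ε κ) (hg : LocallyIntegrable g) :
    ContDiff ℝ ∞ (conv κ g) := by
  rw [conv_eq_convolution]
  exact h.compact.contDiff_convolution_right _ hg h.smooth

theorem pd_conv {ε : ℝ} {κ g : Plane → ℝ} (h : IsKernel ε κ) (hg : LocallyIntegrable g)
    (v : Fin 2) : pd v (conv κ g) = conv (pd v κ) g := by
  funext x
  have h1 := h.compact.hasFDerivAt_convolution_right (μ := volume)
    (ContinuousLinearMap.mul ℝ ℝ) hg (h.smooth.of_le (by simp)) x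
  rw [pd, conv_eq_convolution, h1.fderiv,
    convolution_precompR_apply _ hg (h.compact.fderiv ℝ)
      (h.smooth.continuous_fderiv (by simp))]
  rfl

theorem D_conv {ε : ℝ} {κ g : Plane → ℝ} (h : IsKernel ε κ) (hg : LocallyIntegrable g)
    (i j : ℕ) : D i j (conv κ g) = conv (D i j κ) g := by
  have key : ∀ (v : Fin 2) (n : ℕ) {κ : Plane → ℝ}, IsKernel ε κ →
      IsKernel ε ((pd v)^[n] κ) ∧ (pd v)^[n] (conv κ g) = conv ((pd v)^[n] κ) g := by
    intro v n
    induction n with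
    | zero => intro κ h; exact ⟨h, rfl⟩
    | succ n ih =>
      intro κ h
      rw [Function.iterate_succ_apply, Function.iterate_succ_apply, pd_conv h hg]
      exact ih (h.pd v)
  unfold D
  rw [(key 1 j h).2, (key 0 i (key 1 j h).1).2]

theorem D_comp_sub {κ : Plane → ℝ} (hκ : ContDiff ℝ ∞ κ) (x : Plane) (i j : ℕ) :
    D i j (fun y => κ (x - y)) = fun y => (-1) ^ (i + j) * D i j κ (x - y) := by
  have step : ∀ (v : Fin 2) {κ : Plane → ℝ}, ContDiff ℝ ∞ κ →
      pd v (fun y => κ (x - y)) = fun y => (-1) * pd v κ (x - y) := by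
    intro v κ hκ
    funext y
    have h2 : HasFDerivAt (fun y : Plane => x - y) (-(ContinuousLinearMap.id ℝ Plane)) y :=
      (hasFDerivAt_id y).const_sub x
    have h3 := ((differentiable_of_smooth hκ (x - y)).hasFDerivAt.comp y h2).fderiv
    rw [pd]
    change fderiv ℝ (κ ∘ fun y => x - y) y _ = _
    rw [h3]; simp [pd]
  have key : ∀ (v : Fin 2) (n : ℕ) {κ : Plane → ℝ}, ContDiff ℝ ∞ κ →
      (pd v)^[n] (fun y => κ (x - y)) = fun y => (-1) ^ n * (pd v)^[n] κ (x - y) := by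
    intro v n
    induction n with
    | zero => intros; simp
    | succ n ih =>
      intro κ hκ
      have hs : ContDiff ℝ ∞ (fun y => (pd v)^[n] κ (x - y)) :=
        (smooth_pd_iter hκ v n).comp (contDiff_const.sub contDiff_id)
      rw [Function.iterate_succ_apply', ih hκ, pd_smul _ (differentiable_of_smooth hs),
        step v (smooth_pd_iter hκ v n)]
      funext y
      rw [Function.iterate_succ_apply', pow_succ]; ring
  unfold D
  have hs : ContDiff ℝ ∞ (fun y => (pd 1)^[j] κ (x - y)) :=
    (smooth_pd_iter hκ 1 j).comp (contDiff_const.sub contDiff_id)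
  rw [key 1 j hκ]
  have h4 := D_smul ((-1) ^ j) hs i 0
  simp only [D, Function.iterate_zero, id_eq] at h4
  rw [h4, key 0 i (smooth_pd_iter hκ 1 j)]
  funext y; rw [pow_add]; ring

/-- Derivatives of a mollified function are mollified weak derivatives. -/
theorem D_conv_weak {Ω : Set Plane} (hΩ : IsOpen Ω) {ε : ℝ} {κ u w : Plane → ℝ} {i j : ℕ}
    (h : IsKernel ε κ) (hw : HWD Ω i j u w) (hu : LocallyIntegrable (Ω.indicator u))
    {x : Plane} (hx : Metric.closedBall x ε ⊆ Ω) :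
    D i j (conv κ (Ω.indicator u)) x = conv κ (Ω.indicator w) x := by
  have hsm : ContDiff ℝ ∞ (fun y => κ (x - y)) := h.smooth.comp (contDiff_const.sub contDiff_id)
  have hsub : tsupport (fun y => κ (x - y)) ⊆ Metric.closedBall x ε := by
    refine closure_minimal (fun y hy => ?_) Metric.isClosed_closedBall
    by_contra hy'
    rw [Metric.mem_closedBall, not_le, dist_comm, dist_eq_norm] at hy'
    exact hy (h.eq_zero hy')
  -- The reflected kernel centred at `x` is admissible as a test function because the disc of radius
  -- `ε` about `x` lies in `Ω`. Testing with it moves the derivatives from the kernel to `u`; the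
  -- sign of the weak derivative cancels that of the reflection.
  have hφ : IsTestFunction Ω (fun y => κ (x - y)) :=
    ⟨hsm, (isCompact_closedBall x ε).of_isClosed_subset (isClosed_tsupport _) hsub,
      hsub.trans hx⟩
  have e := hw.2.2 _ hφ
  have hind : ∀ (f g : Plane → ℝ), ∫ y, Ω.indicator f y * g y = ∫ y in Ω, f y * g y := by
    intro f g
    rw [← integral_indicator hΩ.measurableSet]
    refine integral_congr_ae (Eventually.of_forall fun y => ?_)
    by_cases hy : y ∈ Ω <;> simp [hy]
  rw [D_conv h hu, conv, conv, hind, hind]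
  rw [D_comp_sub h.smooth] at e
  have e2 : ∫ y in Ω, u y * ((-1) ^ (i + j) * D i j κ (x - y)) =
      (-1) ^ (i + j) * ∫ y in Ω, u y * D i j κ (x - y) := by
    rw [← integral_const_mul]; congr 1; funext y; ring
  rw [e2] at e
  exact mul_left_cancel₀ (pow_ne_zero _ (by norm_num)) e

theorem pd_sc {ε : ℝ} {κ : Plane → ℝ} (hκ : ContDiff ℝ ∞ κ) (v : Fin 2) :
    pd v (sc ε κ) = fun w => ε⁻¹ * sc ε (pd v κ) w := by
  funext w
  have hs : ContDiff ℝ ∞ (fun w : Plane => κ (ε⁻¹ • w)) := hκ.comp (contDiff_const_smul _)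
  have h2 : HasFDerivAt (fun y : Plane => ε⁻¹ • y) (ε⁻¹ • ContinuousLinearMap.id ℝ Plane) w :=
    (hasFDerivAt_id w).const_smul ε⁻¹
  have h3 := ((differentiable_of_smooth hκ (ε⁻¹ • w)).hasFDerivAt.comp w h2).fderiv
  have e : pd v (sc ε κ) w = (ε ^ 2)⁻¹ * pd v (κ ∘ fun w : Plane => ε⁻¹ • w) w :=
    congrFun (pd_smul _ (differentiable_of_smooth hs) v) w
  rw [e, pd, h3]
  simp [pd, sc]; ring

/-- Substitute `y = x - ε z`; the Jacobian `ε²` cancels the normalization of `sc`. -/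
theorem conv_sc {ε : ℝ} (hε : 0 < ε) (κ g : Plane → ℝ) (x : Plane) :
    conv (sc ε κ) g x = ∫ z, κ z * g (x - ε • z) := by
  have h1 : conv (sc ε κ) g x = ∫ y, g (x - y) * sc ε κ y := by
    unfold conv
    rw [← integral_sub_left_eq_self (fun y => g y * sc ε κ (x - y)) volume x]
    simp
  have h2 := Measure.integral_comp_smul (volume : Measure Plane)
    (fun y => g (x - y) * sc ε κ y) ε
  rw [finrank_euclideanSpace_fin, abs_of_pos (by positivity)] at h2
  have h3 : ∫ y, g (x - y) * sc ε κ y = ε ^ 2 • ∫ z, g (x - ε • z) * sc ε κ (ε • z) := by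
    rw [h2, smul_smul, mul_inv_cancel₀ (by positivity), one_smul]
  rw [h1, h3, smul_eq_mul, ← integral_const_mul]
  congr 1; funext z
  unfold sc
  rw [smul_smul, inv_mul_cancel₀ hε.ne', one_smul]
  field_simp

/-- A nonnegative smooth kernel of integral one, supported in the unit ball. -/
theorem exists_mollifier : ∃ ρ : Plane → ℝ, IsKernel 1 ρ ∧ (∀ z, 0 ≤ ρ z) ∧ ∫ z, ρ z = 1 := by
  let f : ContDiffBump (0 : Plane) := ⟨1 / 2, 1, by norm_num, by norm_num⟩
  exact ⟨f.normed volume, ⟨f.contDiff_normed, (f.tsupport_normed_eq (μ := volume)).subset⟩,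
    f.nonneg_normed, f.integral_normed⟩

/-- A fixed mollifier. -/
def moll : Plane → ℝ := exists_mollifier.choose

theorem moll_kernel : IsKernel 1 moll := exists_mollifier.choose_spec.1
theorem moll_nonneg (z : Plane) : 0 ≤ moll z := exists_mollifier.choose_spec.2.1 z
theorem integral_moll : ∫ z, moll z = 1 := exists_mollifier.choose_spec.2.2

theorem conv_sub {ε : ℝ} {κ f g : Plane → ℝ} (h : IsKernel ε κ) (hf : LocallyIntegrable f)
    (hg : LocallyIntegrable g) (x : Plane) :
    conv κ (fun y => f y - g y) x = conv κ f x - conv κ g x := by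
  have hi : ∀ {f : Plane → ℝ}, LocallyIntegrable f → Integrable (fun y => f y * κ (x - y)) :=
    fun hf => h.compact.convolutionExists_right (ContinuousLinearMap.mul ℝ ℝ) hf
      h.smooth.continuous x
  unfold conv
  rw [← integral_sub (hi hf) (hi hg)]
  congr 1; funext y; ring

theorem conv_congr_ae {κ f g : Plane → ℝ} (h : f =ᵐ[volume] g) : conv κ f = conv κ g := by
  funext x
  exact integral_congr_ae (h.mono fun y hy => by simp only [hy])

/-- The values of a mollified function are averages of nearby values. -/
theorem abs_conv_moll_le {ε : ℝ} (hε : 0 < ε) {κ : Plane → ℝ} (hκ : IsKernel 1 κ)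
    (g : Plane → ℝ) (x : Plane) {M : ℝ}
    (hM : ∀ y, ‖y - x‖ ≤ ε → |g y| ≤ M) :
    |conv (sc ε κ) g x| ≤ (∫ z, |κ z|) * M := by
  rw [conv_sc hε, ← integral_mul_const, ← Real.norm_eq_abs]
  -- Only a pointwise bound of `g` near `x` enters; the integrable majorant `|κ| M` makes
  -- measurability of `g` unnecessary.
  have hi : Integrable κ := hκ.smooth.continuous.integrable_of_hasCompactSupport hκ.compact
  refine norm_integral_le_of_norm_le (hi.abs.mul_const M) (Eventually.of_forall fun z => ?_)
  rw [norm_mul, Real.norm_eq_abs, Real.norm_eq_abs]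
  rcases le_or_gt ‖z‖ 1 with hz | hz
  · refine mul_le_mul_of_nonneg_left (hM _ ?_) (abs_nonneg _)
    rw [sub_sub_cancel_left, norm_neg, norm_smul, Real.norm_of_nonneg hε.le]
    nlinarith
  · rw [hκ.eq_zero hz]; simp

theorem conv_moll_sub_const {ε : ℝ} (hε : 0 < ε) {g : Plane → ℝ} (hg : LocallyIntegrable g)
    (x : Plane) (a : ℝ) :
    conv (sc ε moll) g x - a = conv (sc ε moll) (fun y => g y - a) x := by
  have hk := moll_kernel.sc hε
  rw [conv_sub hk hg continuous_const.locallyIntegrable]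
  congr 1
  rw [conv_sc hε, integral_mul_const, integral_moll, one_mul]

theorem integral_abs_moll : ∫ z, |moll z| = 1 := by
  simp_rw [abs_of_nonneg (moll_nonneg _)]; exact integral_moll

theorem abs_conv_moll_sub_le {ε : ℝ} (hε : 0 < ε) {g : Plane → ℝ} (hg : LocallyIntegrable g)
    (x : Plane) (a : ℝ) {M : ℝ} (hM : ∀ y, ‖y - x‖ ≤ ε → |g y - a| ≤ M) :
    |conv (sc ε moll) g x - a| ≤ M := by
  rw [conv_moll_sub_const hε hg]
  have := abs_conv_moll_le hε moll_kernel (fun y => g y - a) x hM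
  rwa [integral_abs_moll, one_mul] at this

/-! ### Convergence of mollifications in `L²` -/

/-- The probability measure with density `moll`. -/
def mollMeasure : Measure Plane := volume.withDensity fun z => ENNReal.ofReal (moll z)

instance : IsProbabilityMeasure mollMeasure := by
  refine ⟨?_⟩
  have hi : Integrable moll :=
    moll_kernel.smooth.continuous.integrable_of_hasCompactSupport moll_kernel.compact
  rw [mollMeasure, withDensity_apply _ MeasurableSet.univ, Measure.restrict_univ,
    ← ofReal_integral_eq_lintegral_ofReal hi (Eventually.of_forall moll_nonneg), integral_moll,
    ENNReal.ofReal_one]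

theorem integral_mollMeasure (f : Plane → ℝ) :
    ∫ z, f z ∂mollMeasure = ∫ z, moll z * f z := by
  have h : mollMeasure = volume.withDensity fun z => ((Real.toNNReal (moll z) : NNReal) : ENNReal) :=
    rfl
  rw [h, integral_withDensity_eq_integral_smul
    moll_kernel.smooth.continuous.measurable.real_toNNReal]
  refine integral_congr_ae (Eventually.of_forall fun z => ?_)
  simp [NNReal.smul_def, moll_nonneg]

/-- Mollification followed by a homothety of centre `c` and ratio `l`. -/
def hmoll (c : Plane) (l ε : ℝ) (g : Plane → ℝ) (x : Plane) : ℝ :=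
  conv (sc ε moll) g (c + l • (x - c))

/-- The smoothed value is an average with respect to the probability measure with density `moll`,
and the square of an average is at most the average of the squares. After Tonelli, each `z`
contributes a translated and dilated copy of `g`, whose squared integral is that of `g` divided by
`l²`. -/
theorem lintegral_hmoll_le {c : Plane} {l ε : ℝ} (hl : 0 < l) (hε : 0 < ε) {g : Plane → ℝ}
    (hg : AEStronglyMeasurable g volume) :
    ∫⁻ x, ‖hmoll c l ε g x‖ₑ ^ 2 ≤ ENNReal.ofReal (l ^ 2)⁻¹ * ∫⁻ x, ‖g x‖ₑ ^ 2 := by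
  -- Mollification sees only the almost everywhere class of `g`; a strongly measurable
  -- representative makes the integrand jointly measurable, as Tonelli requires.
  wlog hgm : StronglyMeasurable g generalizing g
  · have h1 : hmoll c l ε g = hmoll c l ε (hg.mk g) := by
      funext x; unfold hmoll; rw [conv_congr_ae hg.ae_eq_mk]
    have h2 : ∫⁻ x, ‖g x‖ₑ ^ 2 = ∫⁻ x, ‖hg.mk g x‖ₑ ^ 2 :=
      lintegral_congr_ae (hg.ae_eq_mk.mono fun x hx => by simp only [hx])
    rw [h1, h2]
    exact this hg.stronglyMeasurable_mk.aestronglyMeasurable hg.stronglyMeasurable_mk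
  have hjm : Measurable (fun p : Plane × Plane => c + l • (p.1 - c) - ε • p.2) := by fun_prop
  have hF : StronglyMeasurable (fun p : Plane × Plane => g (c + l • (p.1 - c) - ε • p.2)) :=
    hgm.comp_measurable hjm
  have hpt : ∀ x, ‖hmoll c l ε g x‖ₑ ^ 2 ≤
      ∫⁻ z, ‖g (c + l • (x - c) - ε • z)‖ₑ ^ 2 ∂mollMeasure := by
    intro x
    have hsm : StronglyMeasurable (fun z => g (c + l • (x - c) - ε • z)) :=
      hgm.comp_measurable (by fun_prop)
    have e0 : hmoll c l ε g x = ∫ z, g (c + l • (x - c) - ε • z) ∂mollMeasure := by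
      rw [hmoll, conv_sc hε, integral_mollMeasure]
    rw [e0]
    have a1 : ‖∫ z, g (c + l • (x - c) - ε • z) ∂mollMeasure‖ₑ ≤
        eLpNorm (fun z => g (c + l • (x - c) - ε • z)) 2 mollMeasure := by
      refine (enorm_integral_le_lintegral_enorm _).trans ?_
      rw [← eLpNorm_one_eq_lintegral_enorm]
      exact eLpNorm_le_eLpNorm_of_exponent_le (by norm_num) hsm.aestronglyMeasurable
    refine (pow_le_pow_left' a1 2).trans_eq ?_
    rw [eLpNorm_eq_lintegral_rpow_enorm_toReal (by norm_num) (by norm_num), ← ENNReal.rpow_natCast,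
      ← ENNReal.rpow_mul]
    norm_num
  refine (lintegral_mono hpt).trans ?_
  have hsf : SFinite mollMeasure := inferInstance
  rw [lintegral_lintegral_swap (hF.enorm.pow_const 2).aemeasurable]
  have hz : ∀ z, ∫⁻ x, ‖g (c + l • (x - c) - ε • z)‖ₑ ^ 2 =
      ENNReal.ofReal (l ^ 2)⁻¹ * ∫⁻ x, ‖g x‖ₑ ^ 2 := by
    intro z
    have e1 : ∀ x : Plane, c + l • (x - c) - ε • z = l • x + (c - l • c - ε • z) := by
      intro x; rw [smul_sub]; abel
    simp_rw [e1]
    have hmeas : Measurable (fun x => ‖g (x + (c - l • c - ε • z))‖ₑ ^ 2) :=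
      (hgm.comp_measurable (measurable_add_const _)).enorm.pow_const 2
    have e2 := lintegral_map (μ := (volume : Measure Plane)) hmeas
      (measurable_const_smul (α := Plane) l)
    rw [← e2, Measure.map_addHaar_smul _ hl.ne', lintegral_smul_measure,
      finrank_euclideanSpace_fin, abs_of_pos (by positivity)]
    rw [lintegral_add_right_eq_self (fun x => ‖g x‖ₑ ^ 2)]
    rfl
  simp_rw [hz]
  rw [lintegral_const, measure_univ, mul_one]

theorem eLpNorm_two_sq {α : Type*} [MeasurableSpace α] (μ : Measure α) (f : α → ℝ) :
    eLpNorm f 2 μ ^ 2 = ∫⁻ x, ‖f x‖ₑ ^ 2 ∂μ := by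
  rw [eLpNorm_eq_lintegral_rpow_enorm_toReal (by norm_num) (by norm_num), ← ENNReal.rpow_natCast,
    ← ENNReal.rpow_mul]
  norm_num

theorem eLpNorm_hmoll_le {c : Plane} {l ε : ℝ} (hl : 1 / 2 ≤ l) (hε : 0 < ε) {g : Plane → ℝ}
    (hg : AEStronglyMeasurable g volume) :
    eLpNorm (hmoll c l ε g) 2 volume ≤ 2 * eLpNorm g 2 volume := by
  have h := lintegral_hmoll_le (c := c) (show 0 < l by linarith) hε hg
  rw [← eLpNorm_two_sq, ← eLpNorm_two_sq] at h
  refine (ENNReal.pow_le_pow_left_iff two_ne_zero).1 (h.trans ?_)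
  rw [mul_pow]
  gcongr
  rw [show ((2 : ENNReal) ^ 2) = ENNReal.ofReal 4 by
    rw [show (4 : ℝ) = ((4 : ℕ) : ℝ) by norm_num, ENNReal.ofReal_natCast]; norm_num]
  refine ENNReal.ofReal_le_ofReal ?_
  rw [inv_le_comm₀ (by positivity) (by norm_num)]
  nlinarith

theorem hmoll_smooth {c : Plane} {l ε : ℝ} (hε : 0 < ε) {g : Plane → ℝ}
    (hg : LocallyIntegrable g) : ContDiff ℝ ∞ (hmoll c l ε g) :=
  (conv_smooth (moll_kernel.sc hε) hg).comp
    (contDiff_const.add ((contDiff_id.sub contDiff_const).const_smul l))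

/-- Uniform continuity makes the difference uniformly small, and for `l` near one it is supported in
a fixed ball, so it is also small in `L²`. -/
theorem tendsto_hmoll_of_continuous {c : Plane} {l ε : ℕ → ℝ} (hl : Tendsto l atTop (𝓝 1))
    (hε0 : ∀ n, 0 < ε n) (hε : Tendsto ε atTop (𝓝 0)) {k : Plane → ℝ} (hk : Continuous k)
    (hks : HasCompactSupport k) :
    Tendsto (fun n => eLpNorm (fun x => hmoll c (l n) (ε n) k x - k x) 2 volume) atTop (𝓝 0) := by
  obtain ⟨R, hR0, hR⟩ : ∃ R, 0 < R ∧ ∀ x, R < ‖x - c‖ → k x = 0 := by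
    obtain ⟨R, hR⟩ := hks.isCompact.isBounded.subset_closedBall c
    refine ⟨max R 1, by positivity, fun x hx => image_eq_zero_of_notMem_tsupport fun h' => ?_⟩
    have := hR h'
    rw [Metric.mem_closedBall, dist_eq_norm] at this
    exact absurd (this.trans (le_max_left R 1)) (not_le.2 hx)
  -- For `l > 1/2` a point farther than `2 (R + 1)` from `c` is sent to distance more than `R + 1`;
  -- for `ε < 1` the mollifier then sees only zeros of `k`.
  set B := Metric.closedBall c (2 * (R + 1)) with hB
  have huc : UniformContinuous k := hk.uniformContinuous_of_tendsto_cocompact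
    (hks.is_zero_at_infty)
  have hvol : volume B ≠ ⊤ := measure_closedBall_lt_top.ne
  rw [ENNReal.tendsto_nhds_zero]
  intro η hη
  obtain ⟨η', hη'0, hη'⟩ : ∃ η' : ℝ, 0 < η' ∧
      volume B ^ (2 : ENNReal).toReal⁻¹ * ENNReal.ofReal η' ≤ η := by
    have ht : Tendsto (fun t : ℝ => volume B ^ (2 : ENNReal).toReal⁻¹ * ENNReal.ofReal t)
        (𝓝[>] 0) (𝓝 (volume B ^ (2 : ENNReal).toReal⁻¹ * ENNReal.ofReal 0)) := by
      refine ENNReal.Tendsto.const_mul ?_ (Or.inr ?_)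
      · exact (ENNReal.continuous_ofReal.tendsto 0).mono_left nhdsWithin_le_nhds
      · exact ENNReal.rpow_ne_top_of_nonneg (by norm_num) hvol
    rw [ENNReal.ofReal_zero, mul_zero] at ht
    obtain ⟨t, ht1, ht2⟩ := ((ht.eventually (ge_mem_nhds hη)).and self_mem_nhdsWithin).exists
    exact ⟨t, ht2, ht1⟩
  obtain ⟨δ, hδ0, hδ⟩ := Metric.uniformContinuous_iff.1 huc η' hη'0
  have h1 : ∀ᶠ n in atTop, |l n - 1| * (2 * (R + 1)) + ε n < δ := by
    have : Tendsto (fun n => |l n - 1| * (2 * (R + 1)) + ε n) atTop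
        (𝓝 (|(1 : ℝ) - 1| * (2 * (R + 1)) + 0)) :=
      (((hl.sub_const 1).abs).mul_const _).add hε
    rw [sub_self, abs_zero, zero_mul, zero_add] at this
    exact this.eventually (gt_mem_nhds hδ0)
  have h2 : ∀ᶠ n in atTop, 1 / 2 < l n := hl.eventually (lt_mem_nhds (by norm_num))
  have h3 : ∀ᶠ n in atTop, ε n < 1 := hε.eventually (gt_mem_nhds one_pos)
  filter_upwards [h1, h2, h3] with n h1 h2 h3
  have hout : ∀ x, x ∉ B → hmoll c (l n) (ε n) k x - k x = 0 := by
    intro x hx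
    rw [hB, Metric.mem_closedBall, dist_eq_norm, not_le] at hx
    rw [hR x (by linarith), sub_zero]
    have := abs_conv_moll_le (hε0 n) moll_kernel k (c + l n • (x - c)) (M := 0) (by
      intro y hy
      rw [hR y, abs_zero]
      have e : y - c = (y - (c + l n • (x - c))) + l n • (x - c) := by abel
      have e1 : ‖l n • (x - c)‖ ≤ ‖y - c‖ + ‖y - (c + l n • (x - c))‖ := by
        have := norm_sub_le (y - c) (y - (c + l n • (x - c)))
        rwa [show (y - c) - (y - (c + l n • (x - c))) = l n • (x - c) by abel] at this
      rw [norm_smul, Real.norm_of_nonneg (show 0 ≤ l n by linarith)] at e1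
      nlinarith)
    rw [mul_zero] at this
    exact abs_nonpos_iff.1 this
  have hin : ∀ x ∈ B, ‖hmoll c (l n) (ε n) k x - k x‖ ≤ η' := by
    intro x hx
    rw [hB, Metric.mem_closedBall, dist_eq_norm] at hx
    refine abs_conv_moll_sub_le (hε0 n) hk.locallyIntegrable _ _ fun y hy => ?_
    rw [← Real.dist_eq]
    refine (hδ ?_).le
    rw [dist_eq_norm]
    have e : y - x = (y - (c + l n • (x - c))) + (l n - 1) • (x - c) := by
      rw [sub_smul, one_smul]; abel
    rw [e]
    refine (norm_add_le _ _).trans_lt ?_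
    rw [norm_smul, Real.norm_eq_abs]
    nlinarith [abs_nonneg (l n - 1)]
  have hsupp : Function.support (fun x => hmoll c (l n) (ε n) k x - k x) ⊆ B := fun x hx => by
    by_contra hxB; exact hx (hout x hxB)
  rw [← eLpNorm_restrict_eq_of_support_subset hsupp]
  refine (eLpNorm_le_of_ae_bound (C := η') ?_).trans ?_
  · exact (ae_restrict_iff' Metric.isClosed_closedBall.measurableSet).2
      (Eventually.of_forall hin)
  · rw [Measure.restrict_apply_univ]; exact hη'

/-- Mollification composed with a homothety tends to the identity in `L²`. -/
theorem tendsto_hmoll {c : Plane} {l ε : ℕ → ℝ} (hl : Tendsto l atTop (𝓝 1))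
    (hε0 : ∀ n, 0 < ε n) (hε : Tendsto ε atTop (𝓝 0)) {g : Plane → ℝ} (hg : MemLp g 2 volume) :
    Tendsto (fun n => eLpNorm (fun x => hmoll c (l n) (ε n) g x - g x) 2 volume) atTop (𝓝 0) := by
  rw [ENNReal.tendsto_nhds_zero]
  intro η hη
  -- The error `g - k` enters twice: mollified, where its norm at most doubles, and as it is. With
  -- the convergence error for `k` this makes 2 + 1 + 1 quarters of `η`.
  obtain ⟨k, hks, hk2, hkc, hkm⟩ := hg.exists_hasCompactSupport_eLpNorm_sub_le (by norm_num)
    (ε := η / 4) (ENNReal.div_pos hη.ne' (by norm_num)).ne'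
  have h1 := (ENNReal.tendsto_nhds_zero.1 (tendsto_hmoll_of_continuous (c := c) hl hε0 hε hkc hks))
    (η / 4) (ENNReal.div_pos hη.ne' (by norm_num))
  have h2 : ∀ᶠ n in atTop, 1 / 2 < l n := hl.eventually (lt_mem_nhds (by norm_num))
  filter_upwards [h1, h2] with n h1 h2
  have hgl : LocallyIntegrable g := hg.locallyIntegrable (by norm_num)
  have hkl : LocallyIntegrable k := hkc.locallyIntegrable
  have e : (fun x => hmoll c (l n) (ε n) g x - g x) =
      fun x => (hmoll c (l n) (ε n) (fun y => g y - k y) x + (hmoll c (l n) (ε n) k x - k x)) -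
        (g x - k x) := by
    funext x
    have : hmoll c (l n) (ε n) (fun y => g y - k y) x =
        hmoll c (l n) (ε n) g x - hmoll c (l n) (ε n) k x :=
      conv_sub (moll_kernel.sc (hε0 n)) hgl hkl _
    rw [this]; ring
  have hgk : AEStronglyMeasurable (fun y => g y - k y) volume := (hg.sub hkm).1
  have m1 : AEStronglyMeasurable (hmoll c (l n) (ε n) (fun y => g y - k y)) volume :=
    (hmoll_smooth (hε0 n) (hgl.sub hkl)).continuous.aestronglyMeasurable
  have m2 : AEStronglyMeasurable (fun x => hmoll c (l n) (ε n) k x - k x) volume :=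
    ((hmoll_smooth (hε0 n) hkl).continuous.sub hkc).aestronglyMeasurable
  rw [e]
  refine (eLpNorm_sub_le (m1.add m2) hgk (by norm_num)).trans ?_
  refine (add_le_add_left (eLpNorm_add_le m1 m2 (by norm_num)) _).trans ?_
  have b1 := eLpNorm_hmoll_le (c := c) h2.le (hε0 n) hgk
  have b2 : eLpNorm (fun y => g y - k y) 2 volume ≤ η / 4 := hk2
  calc _ ≤ 2 * (η / 4) + η / 4 + η / 4 := by gcongr; exact b1.trans (by gcongr)
    _ = 4 * (η / 4) := by ring
    _ = η := ENNReal.mul_div_cancel (by norm_num) (by norm_num)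

end

section

open Filter Topology
open scoped RealInnerProductSpace

/-! ### Identities and inequalities on `H²_0(Ω)` -/

variable {Ω : Set Plane}

theorem inner_eq_integral {α : Type*} [MeasurableSpace α] {μ : Measure α} (f g : Lp ℝ 2 μ) :
    ⟪f, g⟫ = ∫ x, f x * g x ∂μ := by
  rw [L2.inner_def]
  refine integral_congr_ae (Eventually.of_forall fun x => ?_)
  simp [mul_comm]

theorem inner_wL_test (hΩ : IsOpen Ω) {φ χ : Plane → ℝ} (h : IsTestFunction Ω φ)
    (h' : IsTestFunction Ω χ) (i j a b : ℕ) :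
    ⟪wL Ω i j φ, wL Ω a b χ⟫ = ∫ x in Ω, D i j φ x * D a b χ x := by
  rw [inner_eq_integral]
  refine integral_congr_ae ?_
  filter_upwards [wL_test_ae hΩ h i j, wL_test_ae hΩ h' a b] with x h1 h2
  rw [h1, h2]

theorem integral_D_mul_pd {φ χ : Plane → ℝ} (h : IsTestFunction Ω φ)
    (h' : IsTestFunction Ω χ) (v : Fin 2) :
    ∫ x in Ω, φ x * pd v χ x = - ∫ x in Ω, pd v φ x * χ x :=
  integral_mul_pd (h.1.of_le (by simp)) h' v

/-- For test functions integration by parts shows that the integral equals its negative; the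
identity survives the limit. It makes `a₂` vanish on the diagonal. -/
theorem inner_wL_dX_self (hΩ : IsOpen Ω) {f : Plane → ℝ} (hf : MemH0 2 Ω f) :
    ⟪wL Ω 1 0 f, wL Ω 0 0 f⟫ = 0 := by
  obtain ⟨hf, φ, hφ, h⟩ := (memH0_two_iff hΩ).1 hf
  refine tendsto_nhds_unique ((h 1 0 (by omega)).inner (h 0 0 (by omega))) ?_
  refine tendsto_const_nhds.congr fun n => ?_
  rw [inner_wL_test hΩ (hφ n) (hφ n)]
  have e := integral_D_mul_pd (hφ n) (hφ n) 0
  have e1 : ∫ x in Ω, D 1 0 (φ n) x * D 0 0 (φ n) x = ∫ x in Ω, φ n x * pd 0 (φ n) x := by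
    congr 1; funext x; exact mul_comm _ _
  have e2 : ∫ x in Ω, D 1 0 (φ n) x * D 0 0 (φ n) x = ∫ x in Ω, pd 0 (φ n) x * φ n x := rfl
  linarith

/-- Two integrations by parts for test functions, then a limit. This is why the Laplacian alone
controls all second derivatives on `H²_0(Ω)`. -/
theorem inner_wL_xx_yy (hΩ : IsOpen Ω) {f : Plane → ℝ} (hf : MemH0 2 Ω f) :
    ⟪wL Ω 2 0 f, wL Ω 0 2 f⟫ = ‖wL Ω 1 1 f‖ ^ 2 := by
  obtain ⟨hf, φ, hφ, h⟩ := (memH0_two_iff hΩ).1 hf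
  refine tendsto_nhds_unique ((h 2 0 (by omega)).inner (h 0 2 (by omega))) ?_
  refine ((h 1 1 (by omega)).norm.pow 2).congr fun n => ?_
  rw [← real_inner_self_eq_norm_sq, inner_wL_test hΩ (hφ n) (hφ n),
    inner_wL_test hΩ (hφ n) (hφ n)]
  have e1 := integral_D_mul_pd ((hφ n).D 0 2) ((hφ n).D 1 0) 0
  have e2 := integral_D_mul_pd ((hφ n).D 1 1) ((hφ n).D 1 0) 1
  rw [pd_zero_D, pd_zero_D] at e1
  rw [pd_one_D (hφ n).1, pd_one_D (hφ n).1] at e2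
  rw [e2, ← e1]
  congr 1; funext x; exact mul_comm _ _

theorem inner_wL_lap_self (hΩ : IsOpen Ω) {f : Plane → ℝ} (hf : MemH0 2 Ω f) :
    ⟪wL Ω 2 0 f + wL Ω 0 2 f, wL Ω 0 0 f⟫ = -(‖wL Ω 1 0 f‖ ^ 2 + ‖wL Ω 0 1 f‖ ^ 2) := by
  obtain ⟨hf, φ, hφ, h⟩ := (memH0_two_iff hΩ).1 hf
  refine tendsto_nhds_unique (((h 2 0 (by omega)).add (h 0 2 (by omega))).inner
    (h 0 0 (by omega))) ?_
  refine ((((h 1 0 (by omega)).norm.pow 2).add ((h 0 1 (by omega)).norm.pow 2)).neg).congr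
    fun n => ?_
  rw [inner_add_left, ← real_inner_self_eq_norm_sq, ← real_inner_self_eq_norm_sq,
    inner_wL_test hΩ (hφ n) (hφ n), inner_wL_test hΩ (hφ n) (hφ n),
    inner_wL_test hΩ (hφ n) (hφ n), inner_wL_test hΩ (hφ n) (hφ n)]
  have e1 := integral_D_mul_pd (hφ n) ((hφ n).D 1 0) 0
  have e2 := integral_D_mul_pd (hφ n) ((hφ n).D 0 1) 1
  rw [pd_zero_D] at e1
  rw [pd_one_D (hφ n).1] at e2
  have c1 : ∫ x in Ω, D 2 0 (φ n) x * D 0 0 (φ n) x = ∫ x in Ω, φ n x * D (1 + 1) 0 (φ n) x := by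
    congr 1; funext x; exact mul_comm _ _
  have c2 : ∫ x in Ω, D 0 2 (φ n) x * D 0 0 (φ n) x = ∫ x in Ω, φ n x * D 0 (1 + 1) (φ n) x := by
    congr 1; funext x; exact mul_comm _ _
  rw [c1, c2, e1, e2]
  have d1 : pd 0 (φ n) = D 1 0 (φ n) := rfl
  have d2 : pd 1 (φ n) = D 0 1 (φ n) := rfl
  rw [d1, d2]; ring

/-- The weak Laplacian in `L²(Ω)`. -/
def lapL (Ω : Set Plane) (f : Plane → ℝ) : Lp ℝ 2 (volume.restrict Ω) :=
  wL Ω 2 0 f + wL Ω 0 2 f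

/-- In the square of `f_xx + f_yy` the cross term supplies the two mixed derivatives of the
seminorm. -/
theorem norm_lapL (hΩ : IsOpen Ω) {f : Plane → ℝ} (hf : MemH0 2 Ω f) :
    ‖lapL Ω f‖ = seminormH 2 Ω f := by
  refine (pow_left_inj₀ (norm_nonneg _) (seminormH_nonneg _ _) two_ne_zero).1 ?_
  rw [seminormH_two_sq hΩ hf.1 le_rfl, lapL, norm_add_sq_real, inner_wL_xx_yy hΩ hf]

/-- The interpolation inequality `|f|_1² ≤ |f|_0 |f|_2` on `H²_0(Ω)`. -/
theorem seminormH_one_sq_le (hΩ : IsOpen Ω) {f : Plane → ℝ} (hf : MemH0 2 Ω f) :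
    seminormH 1 Ω f ^ 2 ≤ seminormH 0 Ω f * seminormH 2 Ω f := by
  have h0 : seminormH 0 Ω f = ‖wL Ω 0 0 f‖ :=
    (pow_left_inj₀ (seminormH_nonneg _ _) (norm_nonneg _) two_ne_zero).1
      (seminormH_zero_sq hΩ hf.1)
  rw [seminormH_one_sq hΩ hf.1 one_le_two, ← norm_lapL hΩ hf, h0]
  have h1 := inner_wL_lap_self hΩ hf
  have h2 := abs_real_inner_le_norm (lapL Ω f) (wL Ω 0 0 f)
  rw [lapL, h1, abs_neg] at h2
  have h3 := le_abs_self (‖wL Ω 1 0 f‖ ^ 2 + ‖wL Ω 0 1 f‖ ^ 2)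
  rw [lapL]
  linarith [mul_comm ‖wL Ω 2 0 f + wL Ω 0 2 f‖ ‖wL Ω 0 0 f‖]

/-! ### Sobolev and Poincaré inequalities on `H²_0(Ω)` -/

theorem norm_fderiv_le_pd (φ : Plane → ℝ) (x : Plane) :
    ‖fderiv ℝ φ x‖ ≤ ‖pd 0 φ x‖ + ‖pd 1 φ x‖ := by
  refine ContinuousLinearMap.opNorm_le_bound _ (by positivity) fun v => ?_
  have hv : v = v 0 • EuclideanSpace.single 0 (1 : ℝ) + v 1 • EuclideanSpace.single 1 (1 : ℝ) := by
    ext i; fin_cases i <;> simp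
  have h0 : ‖v 0‖ ≤ ‖v‖ := PiLp.norm_apply_le v 0
  have h1 : ‖v 1‖ ≤ ‖v‖ := PiLp.norm_apply_le v 1
  have e : fderiv ℝ φ x v = v 0 * pd 0 φ x + v 1 * pd 1 φ x := by
    conv_lhs => rw [hv]
    simp [pd]
  rw [e]
  refine (norm_add_le _ _).trans ?_
  rw [norm_mul, norm_mul]
  nlinarith [norm_nonneg (pd 0 φ x), norm_nonneg (pd 1 φ x)]

/-- A Gagliardo–Nirenberg–Sobolev inequality for test functions in a bounded open set. -/
theorem exists_eLpNorm_test_le (hb : Bornology.IsBounded Ω) (hΩ : IsOpen Ω) {q : NNReal}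
    (hq : (1 / 4 : ℝ) ≤ (q : ℝ)⁻¹) :
    ∃ C : NNReal, ∀ φ, IsTestFunction Ω φ → eLpNorm φ q (volume.restrict Ω) ≤
      C * (eLpNorm (pd 0 φ) 2 (volume.restrict Ω) + eLpNorm (pd 1 φ) 2 (volume.restrict Ω)) := by
  have hvol : volume Ω ≠ ⊤ := hb.measure_lt_top.ne
  -- In dimension two the Sobolev conjugate of 4/3 is 4, because 3/4 - 1/2 = 1/4, so every `q ≤ 4`
  -- is reached. Hölder's inequality on the bounded set then replaces the `L^{4/3}` norm of the
  -- gradient by its `L²` norm, at the cost of the factor `m`.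
  set c := eLpNormLESNormFDerivOfLeConst ℝ (volume : Measure Plane) Ω (4 / 3) q
  set m := volume Ω ^ (1 / (((4 / 3 : NNReal) : ENNReal)).toReal - 1 / (2 : ENNReal).toReal) with hm
  have hm' : m ≠ ⊤ := by
    refine ENNReal.rpow_ne_top_of_nonneg ?_ hvol
    norm_num
  refine ⟨c * m.toNNReal, fun φ hφ => ?_⟩
  have hsub : Function.support φ ⊆ Ω := (subset_tsupport φ).trans hφ.2.2
  have h1 := eLpNorm_le_eLpNorm_fderiv_of_le (volume : Measure Plane) (u := φ) (s := Ω)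
    (p := 4 / 3) (q := q) (hφ.1.of_le (by simp)) hsub (by
      rw [← NNReal.coe_le_coe]; push_cast; norm_num) (by
      rw [finrank_euclideanSpace_fin, ← NNReal.coe_lt_coe]; push_cast; norm_num) (by
      rw [finrank_euclideanSpace_fin]; push_cast; norm_num at hq ⊢; linarith) hb
  have hsub' : Function.support (fderiv ℝ φ) ⊆ Ω :=
    (subset_tsupport _).trans ((tsupport_fderiv_subset ℝ).trans hφ.2.2)
  have hcf : Continuous (fderiv ℝ φ) := hφ.1.continuous_fderiv (by simp)
  have h2 : eLpNorm (fderiv ℝ φ) (4 / 3 : NNReal) (volume.restrict Ω) ≤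
      eLpNorm (fderiv ℝ φ) 2 (volume.restrict Ω) * m := by
    have := eLpNorm_le_eLpNorm_mul_rpow_measure_univ (μ := volume.restrict Ω)
      (p := ((4 / 3 : NNReal) : ENNReal)) (q := 2) (f := fderiv ℝ φ) (by
        rw [show (2 : ENNReal) = ((2 : NNReal) : ENNReal) by norm_num, ENNReal.coe_le_coe,
          ← NNReal.coe_le_coe]; push_cast; norm_num) hcf.aestronglyMeasurable
    rwa [Measure.restrict_apply_univ] at this
  have h3 : eLpNorm (fderiv ℝ φ) 2 (volume.restrict Ω) ≤
      eLpNorm (pd 0 φ) 2 (volume.restrict Ω) + eLpNorm (pd 1 φ) 2 (volume.restrict Ω) := by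
    have e : eLpNorm (fderiv ℝ φ) 2 (volume.restrict Ω) ≤
        eLpNorm (fun x => ‖pd 0 φ x‖ + ‖pd 1 φ x‖) 2 (volume.restrict Ω) := by
      refine eLpNorm_mono fun x => (norm_fderiv_le_pd φ x).trans (le_abs_self _)
    refine e.trans ((eLpNorm_add_le (hφ.pd 0).1.continuous.norm.aestronglyMeasurable
      (hφ.pd 1).1.continuous.norm.aestronglyMeasurable (by norm_num)).trans ?_)
    rw [eLpNorm_norm, eLpNorm_norm]
  rw [eLpNorm_restrict_eq_of_support_subset hsub]
  have hsub'' : Function.support (fun x => ‖fderiv ℝ φ x‖) ⊆ Ω := fun x hx =>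
    hsub' fun h0 => hx (by simp only [h0, norm_zero])
  rw [← eLpNorm_norm (fderiv ℝ φ), ← eLpNorm_restrict_eq_of_support_subset hsub'',
    eLpNorm_norm] at h1
  refine h1.trans ?_
  rw [ENNReal.coe_mul, ENNReal.coe_toNNReal hm', mul_assoc]
  refine mul_le_mul_right (h2.trans ?_) _
  rw [mul_comm]
  exact mul_le_mul_right h3 _

theorem enorm_wL_test (hΩ : IsOpen Ω) {φ : Plane → ℝ} (h : IsTestFunction Ω φ) (i j : ℕ) :
    eLpNorm (D i j φ) 2 (volume.restrict Ω) = ENNReal.ofReal ‖wL Ω i j φ‖ := by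
  rw [wL_test hΩ h, Lp.norm_toLp, ENNReal.ofReal_toReal]
  exact ((h.D i j).memLp 2).2.ne

/-- The case `q = 2`, applied to derivatives of test functions, which are again test functions. -/
theorem exists_poincare_test (hb : Bornology.IsBounded Ω) (hΩ : IsOpen Ω) :
    ∃ C : ℝ, 0 ≤ C ∧ ∀ φ, IsTestFunction Ω φ → ∀ i j, ‖wL Ω i j φ‖ ≤
      C * (‖wL Ω (i + 1) j φ‖ + ‖wL Ω i (j + 1) φ‖) := by
  obtain ⟨C, hC⟩ := exists_eLpNorm_test_le hb hΩ (q := 2) (by norm_num)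
  refine ⟨C, C.2, fun φ hφ i j => ?_⟩
  have h := hC _ (hφ.D i j)
  rw [pd_zero_D, pd_one_D hφ.1] at h
  have h2 : ((2 : NNReal) : ENNReal) = 2 := by norm_num
  rw [h2, enorm_wL_test hΩ hφ, enorm_wL_test hΩ hφ, enorm_wL_test hΩ hφ,
    ← ENNReal.ofReal_add (norm_nonneg _) (norm_nonneg _), ← ENNReal.ofReal_coe_nnreal,
    ← ENNReal.ofReal_mul (NNReal.coe_nonneg C)] at h
  exact (ENNReal.ofReal_le_ofReal_iff (by positivity)).1 h

/-- Poincaré's inequality on `H²_0(Ω)`. -/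
theorem exists_poincare (hb : Bornology.IsBounded Ω) (hΩ : IsOpen Ω) :
    ∃ C : ℝ, 0 ≤ C ∧ ∀ f, MemH0 2 Ω f → ∀ i j, i + j ≤ 2 →
      ‖wL Ω i j f‖ ≤ C * seminormH 2 Ω f := by
  obtain ⟨C, hC0, hC⟩ := exists_poincare_test hb hΩ
  refine ⟨1 + 2 * C + 4 * C ^ 2, by positivity, fun f hf i j hij => ?_⟩
  have hlim : ∀ i j, i + j < 2 → ‖wL Ω i j f‖ ≤
      C * (‖wL Ω (i + 1) j f‖ + ‖wL Ω i (j + 1) f‖) := by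
    intro i j hij
    obtain ⟨hf, φ, hφ, h⟩ := (memH0_two_iff hΩ).1 hf
    refine le_of_tendsto_of_tendsto' (h i j (by omega)).norm
      (((h (i + 1) j (by omega)).norm.add (h i (j + 1) (by omega)).norm).const_mul C)
      fun n => hC _ (hφ n) i j
  have h2 : ∀ i j, i + j = 2 → ‖wL Ω i j f‖ ≤ seminormH 2 Ω f := by
    intro i j hij
    have := norm_wL_le_seminormH hΩ hf.1 (i := i) (j := j) hij.le
    rwa [hij] at this
  have hs := seminormH_nonneg (Ω := Ω) 2 f
  have h1 : ∀ i j, i + j = 1 → ‖wL Ω i j f‖ ≤ 2 * C * seminormH 2 Ω f := by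
    intro i j hij
    refine (hlim i j (by omega)).trans ?_
    have a := h2 (i + 1) j (by omega)
    have b := h2 i (j + 1) (by omega)
    nlinarith
  have hC2 : 0 ≤ C ^ 2 * seminormH 2 Ω f := by positivity
  have hC1 : 0 ≤ C * seminormH 2 Ω f := by positivity
  rcases (show i + j = 0 ∨ i + j = 1 ∨ i + j = 2 by omega) with h | h | h
  · obtain ⟨rfl, rfl⟩ : i = 0 ∧ j = 0 := by omega
    have a := h1 1 0 rfl
    have b := h1 0 1 rfl
    have := hlim 0 0 (by omega)
    nlinarith
  · have := h1 i j h; nlinarith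
  · have := h2 i j h; nlinarith

theorem tendsto_ae_subseq {α : Type*} [MeasurableSpace α] {μ : Measure α} {u : ℕ → Lp ℝ 2 μ}
    {v : Lp ℝ 2 μ} (h : Tendsto u atTop (𝓝 v)) :
    ∃ ns : ℕ → ℕ, StrictMono ns ∧
      ∀ᵐ x ∂μ, Tendsto (fun n => u (ns n) x) atTop (𝓝 (v x)) :=
  (tendstoInMeasure_of_tendsto_Lp h).exists_seq_tendsto_ae

/-- First derivatives of `H²_0` functions are in `L⁴`. -/
theorem memLp_four (hb : Bornology.IsBounded Ω) (hΩ : IsOpen Ω) {f : Plane → ℝ}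
    (hf : MemH0 2 Ω f) {i j : ℕ} (hij : i + j ≤ 1) :
    MemLp (wL Ω i j f) 4 (volume.restrict Ω) := by
  obtain ⟨C, hC⟩ := exists_eLpNorm_test_le hb hΩ (q := 4) (by norm_num)
  obtain ⟨hf, φ, hφ, h⟩ := (memH0_two_iff hΩ).1 hf
  obtain ⟨ns, hns, hae⟩ := tendsto_ae_subseq (h i j (by omega))
  refine ⟨(Lp.memLp _).1, ?_⟩
  have hae' : ∀ᵐ x ∂(volume.restrict Ω),
      Tendsto (fun n => D i j (φ (ns n)) x) atTop (𝓝 (wL Ω i j f x)) := by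
    have := ae_all_iff.2 fun n => wL_test_ae hΩ (hφ (ns n)) i j
    filter_upwards [hae, this] with x h1 h2
    exact h1.congr fun n => h2 n
  -- Fatou's lemma along an almost everywhere convergent subsequence: the `L⁴` norms are dominated
  -- by `L²` norms of the next derivatives, which converge.
  refine (Lp.eLpNorm_lim_le_liminf_eLpNorm (p := 4) (fun n =>
    ((hφ (ns n)).D i j).1.continuous.aestronglyMeasurable) _ hae').trans_lt ?_
  have hbd : Tendsto (fun n => (C : ENNReal) * (ENNReal.ofReal ‖wL Ω (i + 1) j (φ (ns n))‖ +
      ENNReal.ofReal ‖wL Ω i (j + 1) (φ (ns n))‖)) atTop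
      (𝓝 (C * (ENNReal.ofReal ‖wL Ω (i + 1) j f‖ + ENNReal.ofReal ‖wL Ω i (j + 1) f‖))) := by
    refine ENNReal.Tendsto.const_mul ?_ (Or.inr ENNReal.coe_ne_top)
    have a := (h (i + 1) j (by omega)).norm.comp hns.tendsto_atTop
    have b := (h i (j + 1) (by omega)).norm.comp hns.tendsto_atTop
    exact (ENNReal.tendsto_ofReal a).add (ENNReal.tendsto_ofReal b)
  refine (liminf_le_liminf (Eventually.of_forall fun n => ?_)).trans_lt
    ((hbd.liminf_eq).trans_lt (by finiteness))
  have := hC _ ((hφ (ns n)).D i j)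
  rw [pd_zero_D, pd_one_D (hφ (ns n)).1, enorm_wL_test hΩ (hφ _), enorm_wL_test hΩ (hφ _)] at this
  exact_mod_cast this

/-- Hölder's inequality with 1/2 + 1/4 + 1/4 = 1; it gives a meaning to the trilinear form. -/
theorem integrable_triple {α : Type*} [MeasurableSpace α] {μ : Measure α} {f g h : α → ℝ}
    (hf : MemLp f 2 μ) (hg : MemLp g 4 μ) (hh : MemLp h 4 μ) :
    Integrable (fun x => f x * (g x * h x)) μ := by
  have : ENNReal.HolderTriple 4 4 2 := ⟨by
    rw [show (4 : ENNReal) = 2 * 2 by norm_num, ENNReal.mul_inv (by norm_num) (by norm_num),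
      ← mul_add, ENNReal.inv_two_add_inv_two, mul_one]⟩
  exact hf.integrable_mul (MemLp.mul (r := 2) hh hg)

end

section

open Filter Topology
open scoped RealInnerProductSpace

variable {Ω : Set Plane}

/-! ### The forms in terms of `L²` classes -/

theorem dX_ae (hΩ : IsOpen Ω) {f : Plane → ℝ} (hf : MemH 2 Ω f) :
    dX Ω f =ᵐ[volume.restrict Ω] wL Ω 1 0 f := by
  have := weakDeriv_ae hΩ hf (m := 1) (by omega) ![0]
  simpa [cnt, dX] using this

theorem dY_ae (hΩ : IsOpen Ω) {f : Plane → ℝ} (hf : MemH 2 Ω f) :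
    dY Ω f =ᵐ[volume.restrict Ω] wL Ω 0 1 f := by
  have := weakDeriv_ae hΩ hf (m := 1) (by omega) ![1]
  simpa [cnt, dY] using this

theorem lap_ae (hΩ : IsOpen Ω) {f : Plane → ℝ} (hf : MemH 2 Ω f) :
    lap Ω f =ᵐ[volume.restrict Ω] lapL Ω f := by
  have h1 := weakDeriv_ae hΩ hf (m := 2) (by omega) ![0, 0]
  have h2 := weakDeriv_ae hΩ hf (m := 2) (by omega) ![1, 1]
  have e1 : cnt ![(0 : Fin 2), 0] 0 = 2 := rfl
  have e2 : cnt ![(0 : Fin 2), 0] 1 = 0 := rfl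
  have e3 : cnt ![(1 : Fin 2), 1] 0 = 0 := rfl
  have e4 : cnt ![(1 : Fin 2), 1] 1 = 2 := rfl
  rw [e1, e2] at h1
  rw [e3, e4] at h2
  filter_upwards [h1, h2, Lp.coeFn_add (wL Ω 2 0 f) (wL Ω 0 2 f)] with x h1 h2 h3
  rw [lapL, h3, lap, h1, h2]; rfl

theorem coeFn_lin {α : Type*} [MeasurableSpace α] {μ : Measure α} (c : ℝ) (u v : Lp ℝ 2 μ) :
    (c • u + v : Lp ℝ 2 μ) =ᵐ[μ] fun x => c * u x + v x := by
  filter_upwards [Lp.coeFn_add (c • u) v, Lp.coeFn_smul c u] with x h1 h2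
  rw [h1, Pi.add_apply, h2]; rfl

/-- The trilinear integral `∫ w u v`. -/
def tri3 {α : Type*} [MeasurableSpace α] {μ : Measure α} (w u v : Lp ℝ 2 μ) : ℝ :=
  ∫ x, w x * (u x * v x) ∂μ

section tri3
variable {α : Type*} [MeasurableSpace α] {μ : Measure α} {w w' u u' v : Lp ℝ 2 μ}

theorem tri3_comm (w u v : Lp ℝ 2 μ) : tri3 w u v = tri3 w v u := by
  unfold tri3; congr 1; funext x; ring

theorem tri3_lin_left (hu : MemLp u 4 μ) (hv : MemLp v 4 μ) (c : ℝ) :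
    tri3 (c • w + w') u v = c * tri3 w u v + tri3 w' u v := by
  unfold tri3
  rw [← integral_const_mul, ← integral_add ((integrable_triple (Lp.memLp w) hu hv).const_mul c)
    (integrable_triple (Lp.memLp w') hu hv)]
  refine integral_congr_ae ?_
  filter_upwards [coeFn_lin c w w'] with x h1
  rw [h1]; ring

theorem tri3_lin_mid (hu : MemLp u 4 μ) (hu' : MemLp u' 4 μ) (hv : MemLp v 4 μ) (c : ℝ) :
    tri3 w (c • u + u') v = c * tri3 w u v + tri3 w u' v := by
  unfold tri3
  rw [← integral_const_mul, ← integral_add ((integrable_triple (Lp.memLp w) hu hv).const_mul c)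
    (integrable_triple (Lp.memLp w) hu' hv)]
  refine integral_congr_ae ?_
  filter_upwards [coeFn_lin c u u'] with x h1
  rw [h1]; ring

end tri3

/-- The two products of the Jacobian can be integrated separately only because first derivatives are
in `L⁴`. Linearity in each argument is then read off from `tri3`. -/
theorem a₁_eq (hb : Bornology.IsBounded Ω) (hΩ : IsOpen Ω) {f g h : Plane → ℝ}
    (hf : MemH0 2 Ω f) (hg : MemH0 2 Ω g) (hh : MemH0 2 Ω h) :
    a₁ Ω f g h = tri3 (lapL Ω f) (wL Ω 0 1 g) (wL Ω 1 0 h) -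
      tri3 (lapL Ω f) (wL Ω 1 0 g) (wL Ω 0 1 h) := by
  have L4 : ∀ {g : Plane → ℝ}, MemH0 2 Ω g → MemLp (wL Ω 1 0 g) 4 (volume.restrict Ω) ∧
      MemLp (wL Ω 0 1 g) 4 (volume.restrict Ω) := fun hg =>
    ⟨memLp_four hb hΩ hg (by omega), memLp_four hb hΩ hg (by omega)⟩
  rw [tri3, tri3, a₁, ← integral_sub (integrable_triple (Lp.memLp _) (L4 hg).2 (L4 hh).1)
    (integrable_triple (Lp.memLp _) (L4 hg).1 (L4 hh).2)]
  refine integral_congr_ae ?_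
  filter_upwards [lap_ae hΩ hf.1, dX_ae hΩ hg.1, dY_ae hΩ hg.1, dX_ae hΩ hh.1, dY_ae hΩ hh.1]
    with x h1 h2 h3 h4 h5
  rw [h1, h2, h3, h4, h5]; ring

theorem a₀_eq (hΩ : IsOpen Ω) {Re : ℝ} {f g : Plane → ℝ} (hf : MemH0 2 Ω f) (hg : MemH0 2 Ω g) :
    a₀ Ω Re f g = Re⁻¹ * ⟪lapL Ω f, lapL Ω g⟫ := by
  rw [a₀, inner_eq_integral]
  congr 1
  refine integral_congr_ae ?_
  filter_upwards [lap_ae hΩ hf.1, lap_ae hΩ hg.1] with x h1 h2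
  rw [h1, h2]

theorem a₂_eq (hΩ : IsOpen Ω) {Ro : ℝ} {f g : Plane → ℝ} (hf : MemH0 2 Ω f) (hg : MemH0 2 Ω g) :
    a₂ Ω Ro f g = -Ro⁻¹ * ⟪wL Ω 1 0 f, wL Ω 0 0 g⟫ := by
  rw [a₂, inner_eq_integral]
  congr 1
  refine integral_congr_ae ?_
  filter_upwards [dX_ae hΩ hf.1, wL_zero_ae hΩ hg.1] with x h1 h2
  rw [h1, h2]

theorem MemH0.lin (hΩ : IsOpen Ω) {f g : Plane → ℝ} (hf : MemH0 2 Ω f) (hg : MemH0 2 Ω g)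
    (c : ℝ) : MemH0 2 Ω (fun x => c * f x + g x) := (hf.smul hΩ c).add hΩ hg

theorem wL_lin (hΩ : IsOpen Ω) {f g : Plane → ℝ} (hf : MemH0 2 Ω f) (hg : MemH0 2 Ω g)
    (c : ℝ) {i j : ℕ} (hij : i + j ≤ 2) :
    wL Ω i j (fun x => c * f x + g x) = c • wL Ω i j f + wL Ω i j g := by
  rw [wL_add hΩ (hf.1.smul hΩ c) hg.1 hij, wL_smul hΩ hf.1 hij]

theorem lapL_lin (hΩ : IsOpen Ω) {f g : Plane → ℝ} (hf : MemH0 2 Ω f) (hg : MemH0 2 Ω g)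
    (c : ℝ) : lapL Ω (fun x => c * f x + g x) = c • lapL Ω f + lapL Ω g := by
  rw [lapL, wL_lin hΩ hf hg c (by omega), wL_lin hΩ hf hg c (by omega), lapL, lapL, smul_add]
  abel

/-- A function of two arguments is bilinear on `H²_0(Ω)`. -/
structure IsBilin (Ω : Set Plane) (b : (Plane → ℝ) → (Plane → ℝ) → ℝ) : Prop where
  left : ∀ f g h, MemH0 2 Ω f → MemH0 2 Ω g → MemH0 2 Ω h → ∀ c : ℝ,
    b (fun x => c * f x + g x) h = c * b f h + b g h
  right : ∀ f g h, MemH0 2 Ω f → MemH0 2 Ω g → MemH0 2 Ω h → ∀ c : ℝ,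
    b h (fun x => c * f x + g x) = c * b h f + b h g

theorem IsBilin.add {b b' : (Plane → ℝ) → (Plane → ℝ) → ℝ} (h : IsBilin Ω b)
    (h' : IsBilin Ω b') : IsBilin Ω (fun f g => b f g + b' f g) :=
  ⟨fun f g k hf hg hk c => by rw [h.left f g k hf hg hk, h'.left f g k hf hg hk]; ring,
   fun f g k hf hg hk c => by rw [h.right f g k hf hg hk, h'.right f g k hf hg hk]; ring⟩

theorem IsBilin.flip {b : (Plane → ℝ) → (Plane → ℝ) → ℝ} (h : IsBilin Ω b) :
    IsBilin Ω (fun f g => b g f) := ⟨h.right, h.left⟩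

theorem IsBilin.sub_left {b : (Plane → ℝ) → (Plane → ℝ) → ℝ} (h : IsBilin Ω b)
    {f g k : Plane → ℝ} (hf : MemH0 2 Ω f) (hg : MemH0 2 Ω g) (hk : MemH0 2 Ω k) :
    b (fun x => f x - g x) k = b f k - b g k := by
  have := h.left g f k hg hf hk (-1)
  rw [show (fun x => -1 * g x + f x) = fun x => f x - g x by funext x; ring] at this
  linarith

theorem IsBilin.sub_right {b : (Plane → ℝ) → (Plane → ℝ) → ℝ} (h : IsBilin Ω b)
    {f g k : Plane → ℝ} (hf : MemH0 2 Ω f) (hg : MemH0 2 Ω g) (hk : MemH0 2 Ω k) :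
    b k (fun x => f x - g x) = b k f - b k g := h.flip.sub_left hf hg hk

theorem isBilin_a₀ (hΩ : IsOpen Ω) (Re : ℝ) : IsBilin Ω (a₀ Ω Re) := by
  constructor <;> intro f g h hf hg hh c
  · rw [a₀_eq hΩ (hf.lin hΩ hg c) hh, a₀_eq hΩ hf hh, a₀_eq hΩ hg hh, lapL_lin hΩ hf hg,
      inner_add_left, real_inner_smul_left]; ring
  · rw [a₀_eq hΩ hh (hf.lin hΩ hg c), a₀_eq hΩ hh hf, a₀_eq hΩ hh hg, lapL_lin hΩ hf hg,
      inner_add_right, real_inner_smul_right]; ring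

theorem isBilin_a₂ (hΩ : IsOpen Ω) (Ro : ℝ) : IsBilin Ω (a₂ Ω Ro) := by
  constructor <;> intro f g h hf hg hh c
  · rw [a₂_eq hΩ (hf.lin hΩ hg c) hh, a₂_eq hΩ hf hh, a₂_eq hΩ hg hh,
      wL_lin hΩ hf hg _ (by omega), inner_add_left, real_inner_smul_left]; ring
  · rw [a₂_eq hΩ hh (hf.lin hΩ hg c), a₂_eq hΩ hh hf, a₂_eq hΩ hh hg,
      wL_lin hΩ hf hg _ (by omega), inner_add_right, real_inner_smul_right]; ring

theorem a₂_self (hΩ : IsOpen Ω) (Ro : ℝ) {f : Plane → ℝ} (hf : MemH0 2 Ω f) :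
    a₂ Ω Ro f f = 0 := by
  rw [a₂_eq hΩ hf hf, inner_wL_dX_self hΩ hf, mul_zero]

/-- The Jacobian of a function with itself vanishes pointwise, so convection contributes nothing to
the energy. -/
theorem a₁_self (f g : Plane → ℝ) : a₁ Ω f g g = 0 := by
  unfold a₁
  simp [mul_comm]

theorem isTrilin_a₁ (hb : Bornology.IsBounded Ω) (hΩ : IsOpen Ω) {f g h k : Plane → ℝ}
    (hf : MemH0 2 Ω f) (hg : MemH0 2 Ω g) (hh : MemH0 2 Ω h) (hk : MemH0 2 Ω k) (c : ℝ) :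
    a₁ Ω (fun x => c * f x + g x) h k = c * a₁ Ω f h k + a₁ Ω g h k ∧
    a₁ Ω h (fun x => c * f x + g x) k = c * a₁ Ω h f k + a₁ Ω h g k ∧
    a₁ Ω h k (fun x => c * f x + g x) = c * a₁ Ω h k f + a₁ Ω h k g := by
  have X : ∀ {g : Plane → ℝ}, MemH0 2 Ω g → MemLp (wL Ω 1 0 g) 4 (volume.restrict Ω) :=
    fun hg => memLp_four hb hΩ hg (by omega)
  have Y : ∀ {g : Plane → ℝ}, MemH0 2 Ω g → MemLp (wL Ω 0 1 g) 4 (volume.restrict Ω) :=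
    fun hg => memLp_four hb hΩ hg (by omega)
  have hl := hf.lin hΩ hg c
  refine ⟨?_, ?_, ?_⟩
  · rw [a₁_eq hb hΩ hl hh hk, a₁_eq hb hΩ hf hh hk, a₁_eq hb hΩ hg hh hk, lapL_lin hΩ hf hg,
      tri3_lin_left (Y hh) (X hk), tri3_lin_left (X hh) (Y hk)]
    ring
  · rw [a₁_eq hb hΩ hh hl hk, a₁_eq hb hΩ hh hf hk, a₁_eq hb hΩ hh hg hk,
      wL_lin hΩ hf hg _ (by omega), wL_lin hΩ hf hg _ (by omega),
      tri3_lin_mid (Y hf) (Y hg) (X hk), tri3_lin_mid (X hf) (X hg) (Y hk)]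
    ring
  · rw [a₁_eq hb hΩ hh hk hl, a₁_eq hb hΩ hh hk hf, a₁_eq hb hΩ hh hk hg,
      wL_lin hΩ hf hg _ (by omega), wL_lin hΩ hf hg _ (by omega), tri3_comm,
      tri3_lin_mid (X hf) (X hg) (Y hk), tri3_comm _ (wL Ω 1 0 k),
      tri3_lin_mid (Y hf) (Y hg) (X hk), tri3_comm _ (wL Ω 1 0 f), tri3_comm _ (wL Ω 1 0 g),
      tri3_comm _ (wL Ω 0 1 f), tri3_comm _ (wL Ω 0 1 g)]
    ring

theorem isBilin_a₁_first (hb : Bornology.IsBounded Ω) (hΩ : IsOpen Ω) {f : Plane → ℝ}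
    (hf : MemH0 2 Ω f) : IsBilin Ω (a₁ Ω f) :=
  ⟨fun _ _ _ hg hh hk c => (isTrilin_a₁ hb hΩ hg hh hf hk c).2.1,
   fun _ _ _ hg hh hk c => (isTrilin_a₁ hb hΩ hg hh hf hk c).2.2⟩

theorem isBilin_a₁_mid (hb : Bornology.IsBounded Ω) (hΩ : IsOpen Ω) {f : Plane → ℝ}
    (hf : MemH0 2 Ω f) : IsBilin Ω (fun g h => a₁ Ω g f h) :=
  ⟨fun _ _ _ hg hh hk c => (isTrilin_a₁ hb hΩ hg hh hf hk c).1,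
   fun _ _ _ hg hh hk c => (isTrilin_a₁ hb hΩ hg hh hk hf c).2.2⟩

theorem abs_a₀_le (hΩ : IsOpen Ω) {Re : ℝ} (hRe : 0 < Re) {f g : Plane → ℝ}
    (hf : MemH0 2 Ω f) (hg : MemH0 2 Ω g) :
    |a₀ Ω Re f g| ≤ Re⁻¹ * seminormH 2 Ω f * seminormH 2 Ω g := by
  rw [a₀_eq hΩ hf hg, abs_mul, abs_of_pos (inv_pos.2 hRe), mul_assoc, ← norm_lapL hΩ hf,
    ← norm_lapL hΩ hg]
  exact mul_le_mul_of_nonneg_left (abs_real_inner_le_norm _ _) (inv_pos.2 hRe).le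

theorem a₀_self (hΩ : IsOpen Ω) (Re : ℝ) {f : Plane → ℝ} (hf : MemH0 2 Ω f) :
    a₀ Ω Re f f = Re⁻¹ * seminormH 2 Ω f ^ 2 := by
  rw [a₀_eq hΩ hf hf, real_inner_self_eq_norm_sq, norm_lapL hΩ hf]

/-! ### The space `H²_0(Ω)` as a Hilbert space and the Lax–Milgram lemma -/

/-- The multi-indices of order at most two. -/
def idx : Fin 6 → ℕ × ℕ := ![(0, 0), (1, 0), (0, 1), (2, 0), (1, 1), (0, 2)]

theorem idx_le (n : Fin 6) : (idx n).1 + (idx n).2 ≤ 2 := by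
  fin_cases n <;> simp [idx]

theorem exists_idx {i j : ℕ} (hij : i + j ≤ 2) : ∃ n, idx n = (i, j) := by
  have hi : i ≤ 2 := by omega
  have hj : j ≤ 2 := by omega
  interval_cases i <;> interval_cases j <;> first | omega | skip
  exacts [⟨0, rfl⟩, ⟨2, rfl⟩, ⟨5, rfl⟩, ⟨1, rfl⟩, ⟨4, rfl⟩, ⟨3, rfl⟩]

/-- Tuples of `L²` functions indexed by the multi-indices of order at most two. -/
abbrev Tup (Ω : Set Plane) : Type := PiLp 2 (fun _ : Fin 6 => Lp ℝ 2 (volume.restrict Ω))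

/-- The tuple of the weak derivatives of order at most two. -/
def jet (Ω : Set Plane) (f : Plane → ℝ) : Tup Ω :=
  WithLp.toLp 2 fun n => wL Ω (idx n).1 (idx n).2 f

theorem jet_apply (f : Plane → ℝ) (n : Fin 6) : jet Ω f n = wL Ω (idx n).1 (idx n).2 f := rfl

theorem tendsto_tup {u : ℕ → Tup Ω} {w : Tup Ω} :
    Tendsto u atTop (𝓝 w) ↔ ∀ n, Tendsto (fun k => u k n) atTop (𝓝 (w n)) := by
  rw [(PiLp.homeomorph 2 (fun _ : Fin 6 => Lp ℝ 2 (volume.restrict Ω))).isInducing.tendsto_nhds_iff,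
    tendsto_pi_nhds]
  rfl

theorem jet_lin (hΩ : IsOpen Ω) {f g : Plane → ℝ} (hf : MemH0 2 Ω f) (hg : MemH0 2 Ω g)
    (c : ℝ) : jet Ω (fun x => c * f x + g x) = c • jet Ω f + jet Ω g := by
  ext1 n
  exact wL_lin hΩ hf hg c (idx_le n)

theorem tendsto_jet_iff {φ : ℕ → Plane → ℝ} {f : Plane → ℝ} :
    Tendsto (fun n => jet Ω (φ n)) atTop (𝓝 (jet Ω f)) ↔
      ∀ i j, i + j ≤ 2 → Tendsto (fun n => wL Ω i j (φ n)) atTop (𝓝 (wL Ω i j f)) := by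
  rw [tendsto_tup]
  constructor
  · intro h i j hij
    obtain ⟨n, hn⟩ := exists_idx hij
    have := h n
    simp only [jet_apply, hn] at this
    exact this
  · intro h n
    exact h _ _ (idx_le n)

theorem locallyIntegrableOn_of_Lp (hb : Bornology.IsBounded Ω)
    (u : Lp ℝ 2 (volume.restrict Ω)) : LocallyIntegrableOn u Ω := by
  have : IsFiniteMeasure (volume.restrict Ω) := ⟨by
    rw [Measure.restrict_apply_univ]; exact hb.measure_lt_top⟩
  have h : IntegrableOn u Ω := (Lp.memLp u).integrable (by norm_num)
  exact h.locallyIntegrableOn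

theorem inner_toLp {φ : Plane → ℝ} (h : IsTestFunction Ω φ) (u : Lp ℝ 2 (volume.restrict Ω)) :
    ⟪u, (h.memLp 2).toLp⟫ = ∫ x in Ω, u x * φ x := by
  rw [inner_eq_integral]
  refine integral_congr_ae ?_
  filter_upwards [(h.memLp 2).coeFn_toLp] with x hx
  rw [hx]

/-- Weak derivatives pass to limits in `L²(Ω)`. -/
theorem hwd_of_tendsto (hb : Bornology.IsBounded Ω) {i j : ℕ}
    {u v : ℕ → Lp ℝ 2 (volume.restrict Ω)} {u₀ v₀ : Lp ℝ 2 (volume.restrict Ω)}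
    (hu : Tendsto u atTop (𝓝 u₀)) (hv : Tendsto v atTop (𝓝 v₀))
    (h : ∀ n, HWD Ω i j (u n) (v n)) : HWD Ω i j u₀ v₀ := by
  refine ⟨locallyIntegrableOn_of_Lp hb u₀, locallyIntegrableOn_of_Lp hb v₀, fun φ hφ => ?_⟩
  rw [← inner_toLp hφ, ← inner_toLp (hφ.D i j)]
  refine tendsto_nhds_unique (hu.inner tendsto_const_nhds)
    (((hv.inner tendsto_const_nhds).const_mul _).congr fun n => ?_)
  rw [inner_toLp hφ, inner_toLp (hφ.D i j)]
  exact ((h n).2.2 φ hφ).symm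

/-- Limits of tuples of derivatives of test functions are tuples of weak derivatives. -/
theorem exists_memH0_of_tendsto (hb : Bornology.IsBounded Ω) (hΩ : IsOpen Ω)
    {φ : ℕ → Plane → ℝ} (hφ : ∀ n, IsTestFunction Ω (φ n)) {w : Tup Ω}
    (h : Tendsto (fun n => jet Ω (φ n)) atTop (𝓝 w)) :
    MemH0 2 Ω (w 0) ∧ jet Ω (w 0) = w := by
  rw [tendsto_tup] at h
  -- The component of index zero is the limit function; closedness of weak differentiation
  -- identifies the other components as its derivatives.
  have hw : ∀ n, HWD Ω (idx n).1 (idx n).2 (w 0) (w n) := fun n =>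
    hwd_of_tendsto hb (h 0) (h n) fun k => by
      refine (hWD_smooth Ω (hφ k).1 _ _).congr_ae hΩ ?_ ?_
      · exact (wL_test_ae hΩ (hφ k) 0 0).symm
      · exact (wL_test_ae hΩ (hφ k) _ _).symm
  have hj : jet Ω (w 0) = w := by
    ext1 n
    rw [jet_apply, wL_eq hΩ (hw n) (Lp.memLp _), Lp.toLp_coeFn]
  refine ⟨(memH0_two_iff hΩ).2 ⟨memH_iff.2 fun i j hij => ?_, φ, hφ, ?_⟩, hj⟩
  · obtain ⟨n, hn⟩ := exists_idx hij
    have := hw n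
    rw [hn] at this
    exact ⟨_, this, Lp.memLp _⟩
  · rw [← tendsto_jet_iff, hj]
    exact tendsto_tup.2 h

/-- `H²_0(Ω)` as a closed subspace of a power of `L²(Ω)`. -/
def H0space (hΩ : IsOpen Ω) : Submodule ℝ (Tup Ω) where
  carrier := {w | ∃ f, MemH0 2 Ω f ∧ jet Ω f = w}
  add_mem' := by
    rintro _ _ ⟨f, hf, rfl⟩ ⟨g, hg, rfl⟩
    exact ⟨_, hf.lin hΩ hg 1, by rw [jet_lin hΩ hf hg, one_smul]⟩
  zero_mem' := by
    have h := (isTestFunction_zero Ω).memH0 hΩ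
    refine ⟨_, h.lin hΩ h (-1), ?_⟩
    rw [jet_lin hΩ h h, neg_one_smul, neg_add_cancel]
  smul_mem' := by
    rintro c _ ⟨f, hf, rfl⟩
    have h := (isTestFunction_zero Ω).memH0 hΩ
    have h' : jet Ω (fun _ => (0 : ℝ)) = 0 := by
      have := jet_lin hΩ h h (-1)
      rw [neg_one_smul, neg_add_cancel] at this
      simpa using this
    exact ⟨_, hf.lin hΩ h c, by rw [jet_lin hΩ hf h, h', add_zero]⟩

/-- The subspace is exactly the closure of the jets of test functions. Closedness gives
completeness, hence a Hilbert space. -/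
theorem isClosed_H0space (hb : Bornology.IsBounded Ω) (hΩ : IsOpen Ω) :
    IsClosed (H0space hΩ : Set (Tup Ω)) := by
  have : (H0space hΩ : Set (Tup Ω)) =
      closure {w | ∃ φ, IsTestFunction Ω φ ∧ jet Ω φ = w} := by
    ext w
    constructor
    · rintro ⟨f, hf, rfl⟩
      obtain ⟨_, φ, hφ, h⟩ := (memH0_two_iff hΩ).1 hf
      exact mem_closure_of_tendsto (tendsto_jet_iff.2 h)
        (Eventually.of_forall fun n => ⟨φ n, hφ n, rfl⟩)
    · intro hw
      obtain ⟨u, hu, hlim⟩ := mem_closure_iff_seq_limit.1 hw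
      choose φ hφ hφu using hu
      have : Tendsto (fun n => jet Ω (φ n)) atTop (𝓝 w) := by simpa only [hφu] using hlim
      obtain ⟨h1, h2⟩ := exists_memH0_of_tendsto hb hΩ hφ this
      exact ⟨_, h1, h2⟩
  rw [this]; exact isClosed_closure

theorem seminormH_two_eq_zero_of_jet (hΩ : IsOpen Ω) {f : Plane → ℝ} (hf : MemH0 2 Ω f)
    (h : jet Ω f = 0) : seminormH 2 Ω f = 0 := by
  have h1 : wL Ω 2 0 f = 0 := congrArg (fun w : Tup Ω => w 3) h
  have h2 : wL Ω 0 2 f = 0 := congrArg (fun w : Tup Ω => w 5) h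
  rw [← norm_lapL hΩ hf, lapL, h1, h2, add_zero, norm_zero]

theorem seminormH_two_le_jet (hΩ : IsOpen Ω) {f : Plane → ℝ} (hf : MemH0 2 Ω f) :
    seminormH 2 Ω f ≤ 2 * ‖jet Ω f‖ := by
  rw [← norm_lapL hΩ hf, lapL]
  have h1 : ‖wL Ω 2 0 f‖ ≤ ‖jet Ω f‖ := PiLp.norm_apply_le (jet Ω f) 3
  have h2 : ‖wL Ω 0 2 f‖ ≤ ‖jet Ω f‖ := PiLp.norm_apply_le (jet Ω f) 5
  linarith [norm_add_le (wL Ω 2 0 f) (wL Ω 0 2 f)]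

set_option maxHeartbeats 1600000 in
/-- The Lax–Milgram lemma on `H²_0(Ω)`. -/
theorem lax_milgram (hb : Bornology.IsBounded Ω) (hΩ : IsOpen Ω)
    {b : (Plane → ℝ) → (Plane → ℝ) → ℝ} (hbl : IsBilin Ω b) {M κ N : ℝ} (hκ : 0 < κ)
    (hM : 0 ≤ M) (hN : 0 ≤ N)
    (hbM : ∀ f g, MemH0 2 Ω f → MemH0 2 Ω g → |b f g| ≤ M * seminormH 2 Ω f * seminormH 2 Ω g)
    (hbκ : ∀ f, MemH0 2 Ω f → κ * seminormH 2 Ω f ^ 2 ≤ b f f)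
    {ℓ : (Plane → ℝ) → ℝ} (hℓ : ∀ f g, MemH0 2 Ω f → MemH0 2 Ω g → ∀ c : ℝ,
      ℓ (fun x => c * f x + g x) = c * ℓ f + ℓ g)
    (hℓN : ∀ f, MemH0 2 Ω f → |ℓ f| ≤ N * seminormH 2 Ω f) :
    ∃ f, MemH0 2 Ω f ∧ ∀ g, MemH0 2 Ω g → b f g = ℓ g := by
  set V := H0space hΩ with hV
  have : CompleteSpace V := (isClosed_H0space hb hΩ).completeSpace_coe
  -- Elements of `V` are jets, while the forms take functions; `r` chooses a function for each jet.
  -- The forms descend to `V`: functions with equal jets differ by one with `|·|_2 = 0`, on which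
  -- the bounds for `b` and `ℓ` give zero.
  choose r hr hrj using fun w : V => w.2
  have semi : ∀ {f g : Plane → ℝ}, MemH0 2 Ω f → MemH0 2 Ω g → jet Ω f = jet Ω g →
      seminormH 2 Ω (fun x => -1 * f x + g x) = 0 := fun hf hg h =>
    seminormH_two_eq_zero_of_jet hΩ (hf.lin hΩ hg (-1)) (by
      rw [jet_lin hΩ hf hg, h, neg_one_smul, neg_add_cancel])
  have congrL : ∀ {f g h : Plane → ℝ}, MemH0 2 Ω f → MemH0 2 Ω g → MemH0 2 Ω h →
      jet Ω f = jet Ω g → b f h = b g h := by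
    intro f g h hf hg hh e
    have h1 := hbM _ h (hf.lin hΩ hg (-1)) hh
    rw [semi hf hg e, mul_zero, zero_mul, hbl.left f g h hf hg hh, abs_nonpos_iff] at h1
    linarith
  have congrR : ∀ {f g h : Plane → ℝ}, MemH0 2 Ω f → MemH0 2 Ω g → MemH0 2 Ω h →
      jet Ω f = jet Ω g → b h f = b h g := by
    intro f g h hf hg hh e
    have h1 := hbM h _ hh (hf.lin hΩ hg (-1))
    rw [semi hf hg e, mul_zero, hbl.right f g h hf hg hh, abs_nonpos_iff] at h1
    linarith
  have congrℓ : ∀ {f g : Plane → ℝ}, MemH0 2 Ω f → MemH0 2 Ω g →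
      jet Ω f = jet Ω g → ℓ f = ℓ g := by
    intro f g hf hg e
    have h1 := hℓN _ (hf.lin hΩ hg (-1))
    rw [semi hf hg e, mul_zero, hℓ f g hf hg, abs_nonpos_iff] at h1
    linarith
  have jl : ∀ (c : ℝ) (w w' : V), jet Ω (r (c • w + w')) =
      jet Ω (fun x => c * r w x + r w' x) := by
    intro c w w'
    rw [jet_lin hΩ (hr w) (hr w'), hrj, hrj, hrj]; rfl
  have bl : ∀ (c : ℝ) (w w' v : V), b (r (c • w + w')) (r v) =
      c * b (r w) (r v) + b (r w') (r v) := fun c w w' v => by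
    rw [congrL (hr _) ((hr w).lin hΩ (hr w') c) (hr v) (jl c w w'), hbl.left _ _ _ (hr w) (hr w')
      (hr v)]
  have br : ∀ (c : ℝ) (w w' v : V), b (r v) (r (c • w + w')) =
      c * b (r v) (r w) + b (r v) (r w') := fun c w w' v => by
    rw [congrR (hr _) ((hr w).lin hΩ (hr w') c) (hr v) (jl c w w'), hbl.right _ _ _ (hr w)
      (hr w') (hr v)]
  have lr : ∀ (c : ℝ) (w w' : V), ℓ (r (c • w + w')) = c * ℓ (r w) + ℓ (r w') :=
    fun c w w' => by
      rw [congrℓ (hr _) ((hr w).lin hΩ (hr w') c) (jl c w w'), hℓ _ _ (hr w) (hr w')]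
  have zl : ∀ v : V, b (r 0) (r v) = 0 := fun v => by
    have := bl (-1) 0 0 v
    rw [smul_zero, add_zero] at this; linarith
  have zr : ∀ v : V, b (r v) (r 0) = 0 := fun v => by
    have := br (-1) 0 0 v
    rw [smul_zero, add_zero] at this; linarith
  have z0 : ℓ (r 0) = 0 := by
    have := lr (-1) 0 0
    rw [smul_zero, add_zero] at this; linarith
  have nr : ∀ w : V, seminormH 2 Ω (r w) ≤ 2 * ‖w‖ := fun w => by
    have := seminormH_two_le_jet hΩ (hr w)
    rwa [hrj] at this
  let B₀ : V →ₗ[ℝ] V →ₗ[ℝ] ℝ := LinearMap.mk₂ ℝ (fun w v => b (r w) (r v))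
    (fun w w' v => by have := bl 1 w w' v; rwa [one_smul, one_mul] at this)
    (fun c w v => by have := bl c w 0 v; rwa [add_zero, zl, add_zero] at this)
    (fun v w w' => by have := br 1 w w' v; rwa [one_smul, one_mul] at this)
    (fun c v w => by have := br c w 0 v; rwa [add_zero, zr, add_zero] at this)
  let B : V →L[ℝ] V →L[ℝ] ℝ := B₀.mkContinuous₂ (4 * M) fun w v => by
    refine (hbM _ _ (hr w) (hr v)).trans ?_
    have h1 := nr w
    have h2 := nr v
    have h3 := seminormH_nonneg (Ω := Ω) 2 (r w)
    have h4 := seminormH_nonneg (Ω := Ω) 2 (r v)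
    have h5 : seminormH 2 Ω (r w) * seminormH 2 Ω (r v) ≤ (2 * ‖w‖) * (2 * ‖v‖) :=
      mul_le_mul h1 h2 h4 (h3.trans h1)
    nlinarith
  have hBapp : ∀ w v, B w v = b (r w) (r v) := fun w v => rfl
  obtain ⟨P, hP0, hP⟩ := exists_poincare hb hΩ
  have hco : IsCoercive B := by
    -- By Poincaré each of the six components of a jet has a square of at most `P² |·|_2²`; the
    -- summand one keeps the denominator positive.
    refine ⟨κ / (6 * (P ^ 2 + 1)), by positivity, fun w => ?_⟩
    rw [hBapp]
    have h1 : ‖w‖ ^ 2 ≤ 6 * (P ^ 2 + 1) * seminormH 2 Ω (r w) ^ 2 := by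
      have e : ‖w‖ ^ 2 = ∑ n, ‖jet Ω (r w) n‖ ^ 2 := by
        rw [← PiLp.norm_sq_eq_of_L2, hrj]; rfl
      rw [e]
      have : ∀ n : Fin 6, ‖jet Ω (r w) n‖ ^ 2 ≤ (P ^ 2 + 1) * seminormH 2 Ω (r w) ^ 2 := by
        intro n
        have h2 := pow_le_pow_left₀ (norm_nonneg _) (hP _ (hr w) _ _ (idx_le n)) 2
        rw [mul_pow] at h2
        rw [jet_apply]
        nlinarith [sq_nonneg (seminormH 2 Ω (r w))]
      refine (Finset.sum_le_card_nsmul _ _ _ fun n _ => this n).trans_eq ?_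
      simp; ring
    refine le_trans ?_ (hbκ _ (hr w))
    rw [mul_assoc, ← pow_two, div_mul_eq_mul_div, div_le_iff₀ (by positivity)]
    nlinarith
  let L₀ : V →ₗ[ℝ] ℝ :=
    { toFun := fun w => ℓ (r w)
      map_add' := fun w w' => by have := lr 1 w w'; rwa [one_smul, one_mul] at this
      map_smul' := fun c w => by
        have := lr c w 0
        rw [add_zero, z0, add_zero] at this
        exact this }
  let L : V →L[ℝ] ℝ := L₀.mkContinuous (2 * N) fun w => by
    refine (hℓN _ (hr w)).trans ?_
    nlinarith [nr w]
  set v := (InnerProductSpace.toDual ℝ V).symm L with hv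
  set u := hco.continuousLinearEquivOfBilin.symm v with hu
  refine ⟨r u, hr u, fun g hg => ?_⟩
  have h1 := hco.continuousLinearEquivOfBilin_apply u ⟨jet Ω g, g, hg, rfl⟩
  rw [hu, ContinuousLinearEquiv.apply_symm_apply, ← hu, hv,
    InnerProductSpace.toDual_symm_apply, hBapp] at h1
  have h2 : jet Ω (r ⟨jet Ω g, g, hg, rfl⟩) = jet Ω g := hrj _
  rw [congrR (hr _) hg (hr u) h2] at h1
  rw [← h1]
  exact congrℓ (hr _) hg h2

end

section

open Filter Topology
open scoped RealInnerProductSpace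

/-! ### The Galerkin error in terms of the best approximation error -/

/-- The standing assumptions on the domain and the data. -/
structure Setting (Ω : Set Plane) (Re Ro Γ₁ Γ₂ : ℝ) (F : Plane → ℝ) : Prop where
  isOpen : IsOpen Ω
  bounded : Bornology.IsBounded Ω
  hRe : 0 < Re
  hRo : 0 < Ro
  hΓ₁ : 0 < Γ₁
  hΓ₂ : 0 < Γ₂
  ha₁ : IsContConstA₁ Ω Γ₁
  ha₂ : IsContConstA₂ Ω Ro Γ₂
  hF : MemLp F 2 (volume.restrict Ω)
  small : Γ₁ * dualNorm 2 Ω F < Re⁻¹ ^ 2 * Ro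

variable {Ω : Set Plane} {Re Ro Γ₁ Γ₂ : ℝ} {F : Plane → ℝ}

theorem integral_mul_eq_inner (hΩ : IsOpen Ω) {g χ : Plane → ℝ}
    (hg : MemLp g 2 (volume.restrict Ω)) (hχ : MemH0 2 Ω χ) :
    ∫ x in Ω, g x * χ x = ⟪hg.toLp, wL Ω 0 0 χ⟫ := by
  rw [inner_eq_integral]
  refine integral_congr_ae ?_
  filter_upwards [hg.coeFn_toLp, wL_zero_ae hΩ hχ.1] with x h1 h2
  rw [h1, h2]

/-- A consequence of Poincaré's inequality. It shows that the set in the definition of `dualNorm 2`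
is bounded above, without which its supremum would be the default value zero. -/
theorem exists_abs_integral_mul_le (hb : Bornology.IsBounded Ω) (hΩ : IsOpen Ω) {g : Plane → ℝ}
    (hg : MemLp g 2 (volume.restrict Ω)) :
    ∃ N, 0 ≤ N ∧ ∀ χ, MemH0 2 Ω χ → |∫ x in Ω, g x * χ x| ≤ N * seminormH 2 Ω χ := by
  obtain ⟨C, hC0, hC⟩ := exists_poincare hb hΩ
  refine ⟨‖hg.toLp‖ * C, by positivity, fun χ hχ => ?_⟩
  rw [integral_mul_eq_inner hΩ hg hχ, mul_assoc]
  exact (abs_real_inner_le_norm _ _).trans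
    (mul_le_mul_of_nonneg_left (hC χ hχ 0 0 (by omega)) (norm_nonneg _))

theorem seminormH_two_smul (hΩ : IsOpen Ω) {f : Plane → ℝ} (hf : MemH0 2 Ω f) (c : ℝ) :
    seminormH 2 Ω (fun x => c * f x) = |c| * seminormH 2 Ω f := by
  rw [← norm_lapL hΩ (hf.smul hΩ c), ← norm_lapL hΩ hf, lapL, wL_smul hΩ hf.1 (by omega),
    wL_smul hΩ hf.1 (by omega), ← smul_add, norm_smul, Real.norm_eq_abs, lapL]

/-- Normalize `χ`. If `|χ|_2 = 0`, the crude bound already shows that the integral is zero. -/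
theorem abs_integral_mul_le_dualNorm (hb : Bornology.IsBounded Ω) (hΩ : IsOpen Ω) {g : Plane → ℝ}
    (hg : MemLp g 2 (volume.restrict Ω)) {χ : Plane → ℝ} (hχ : MemH0 2 Ω χ) :
    |∫ x in Ω, g x * χ x| ≤ dualNorm 2 Ω g * seminormH 2 Ω χ := by
  obtain ⟨N, hN0, hN⟩ := exists_abs_integral_mul_le hb hΩ hg
  have hbdd : BddAbove {r : ℝ | ∃ χ, MemH0 2 Ω χ ∧ seminormH 2 Ω χ ≤ 1 ∧
      r = |∫ x in Ω, g x * χ x|} := by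
    refine ⟨N, ?_⟩
    rintro _ ⟨χ, hχ, h1, rfl⟩
    refine (hN χ hχ).trans ?_
    nlinarith
  rcases (seminormH_nonneg (Ω := Ω) 2 χ).eq_or_lt with h0 | h0
  · have := hN χ hχ
    rw [← h0, mul_zero] at this ⊢
    exact this
  · have h1 : |∫ x in Ω, g x * ((seminormH 2 Ω χ)⁻¹ * χ x)| ≤ dualNorm 2 Ω g := by
      refine le_csSup hbdd ⟨_, hχ.smul hΩ (seminormH 2 Ω χ)⁻¹, ?_, rfl⟩
      rw [seminormH_two_smul hΩ hχ, abs_of_pos (inv_pos.2 h0), inv_mul_cancel₀ h0.ne']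
    have h2 : ∫ x in Ω, g x * ((seminormH 2 Ω χ)⁻¹ * χ x) =
        (seminormH 2 Ω χ)⁻¹ * ∫ x in Ω, g x * χ x := by
      rw [← integral_const_mul]; congr 1; funext x; ring
    rw [h2, abs_mul, abs_of_pos (inv_pos.2 h0), inv_mul_le_iff₀ h0] at h1
    linarith

theorem dualNorm_nonneg (k : ℕ) (g : Plane → ℝ) : 0 ≤ dualNorm k Ω g :=
  Real.sSup_nonneg (by rintro _ ⟨χ, _, _, rfl⟩; exact abs_nonneg _)

/-! ### Stability, quasi-optimality and duality -/

namespace Setting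

/-- The a priori bound for `|ψ|_2`. -/
def bd (Ω : Set Plane) (Re Ro : ℝ) (F : Plane → ℝ) : ℝ := Re * Ro⁻¹ * dualNorm 2 Ω F

/-- The coercivity constant of the linearized problem. -/
def coer (Ω : Set Plane) (Re Ro Γ₁ : ℝ) (F : Plane → ℝ) : ℝ := Re⁻¹ - Γ₁ * bd Ω Re Ro F

/-- The continuity constant of the linearized problem. -/
def cont (Ω : Set Plane) (Re Ro Γ₁ Γ₂ : ℝ) (F : Plane → ℝ) : ℝ :=
  Re⁻¹ + 2 * Γ₁ * bd Ω Re Ro F + Ro⁻¹ * Γ₂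

variable (S : Setting Ω Re Ro Γ₁ Γ₂ F)
include S

theorem bd_nonneg : 0 ≤ bd Ω Re Ro F := by
  have := S.hRe; have := S.hRo; have := dualNorm_nonneg (Ω := Ω) 2 F
  unfold bd; positivity

/-- This is the small data condition multiplied by `Re * Ro⁻¹`. -/
theorem coer_pos : 0 < coer Ω Re Ro Γ₁ F := by
  have h := S.small
  have hRe := S.hRe
  have hRo := S.hRo
  unfold coer bd
  have h1 : Γ₁ * dualNorm 2 Ω F * (Re * Ro⁻¹) < Re⁻¹ ^ 2 * Ro * (Re * Ro⁻¹) :=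
    mul_lt_mul_of_pos_right h (by positivity)
  have h2 : Re⁻¹ ^ 2 * Ro * (Re * Ro⁻¹) = Re⁻¹ := by field_simp
  rw [h2] at h1
  linarith

theorem cont_pos : 0 < cont Ω Re Ro Γ₁ Γ₂ F := by
  have := S.bd_nonneg; have := S.hRe; have := S.hRo; have := S.hΓ₁; have := S.hΓ₂
  unfold cont; positivity

/-- Test the equation with the solution itself; only the viscous term survives on the left. The
space `V` is arbitrary, so that the exact and the discrete solutions obey the same bound. -/
theorem energy {V : Set (Plane → ℝ)} (hV : ∀ v ∈ V, MemH0 2 Ω v) {ψ : Plane → ℝ}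
    (h : IsSolutionIn V Ω Re Ro F ψ) : seminormH 2 Ω ψ ≤ bd Ω Re Ro F := by
  have hψ := hV ψ h.1
  have e := h.2 ψ h.1
  rw [a₀_self S.isOpen Re hψ, a₁_self, a₂_self S.isOpen Ro hψ, add_zero, add_zero, load] at e
  have h1 := abs_integral_mul_le_dualNorm S.bounded S.isOpen S.hF hψ
  have hRe := S.hRe
  have hRo := S.hRo
  have h2 := (le_abs_self _).trans h1
  have h3 : Re⁻¹ * seminormH 2 Ω ψ ^ 2 ≤ Ro⁻¹ * (dualNorm 2 Ω F * seminormH 2 Ω ψ) := by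
    rw [e]; exact mul_le_mul_of_nonneg_left h2 (by positivity)
  rcases (seminormH_nonneg (Ω := Ω) 2 ψ).eq_or_lt with h0 | h0
  · rw [← h0]; exact S.bd_nonneg
  · have h4 : Re⁻¹ * seminormH 2 Ω ψ ≤ Ro⁻¹ * dualNorm 2 Ω F := by
      refine le_of_mul_le_mul_right ?_ h0
      nlinarith
    rw [inv_mul_le_iff₀ hRe] at h4
    unfold bd; linarith

/-- Subtract the two equations and write the difference of the quadratic terms as a₁(e,ψ,χ) +
a₁(ψʰ,e,χ). In this splitting the second term vanishes for χ = e, and the first is controlled by the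
a priori bound of ψ. -/
theorem orth {V : Set (Plane → ℝ)} (hV : ∀ v ∈ V, MemH0 2 Ω v) {ψ ψh : Plane → ℝ}
    (h : IsSolutionIn {f | MemH0 2 Ω f} Ω Re Ro F ψ) (hh : IsSolutionIn V Ω Re Ro F ψh)
    {χ : Plane → ℝ} (hχ : χ ∈ V) :
    a₀ Ω Re (fun x => ψ x - ψh x) χ + a₁ Ω (fun x => ψ x - ψh x) ψ χ +
      a₁ Ω ψh (fun x => ψ x - ψh x) χ + a₂ Ω Ro (fun x => ψ x - ψh x) χ = 0 := by
  have hψ : MemH0 2 Ω ψ := h.1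
  have hψh := hV _ hh.1
  have hX := hV _ hχ
  have e1 := h.2 χ hX
  have e2 := hh.2 χ hχ
  rw [(isBilin_a₀ S.isOpen Re).sub_left hψ hψh hX, (isBilin_a₂ S.isOpen Ro).sub_left hψ hψh hX,
    (isBilin_a₁_first S.bounded S.isOpen hψh).sub_left hψ hψh hX,
    (isBilin_a₁_mid S.bounded S.isOpen hψ).sub_left hψ hψh hX]
  linarith

/-- Quasi-optimality of the Galerkin approximation. -/
theorem cea {V : Set (Plane → ℝ)} (hV : ∀ v ∈ V, MemH0 2 Ω v)
    (hVs : ∀ v ∈ V, ∀ w ∈ V, (fun x => v x - w x) ∈ V) {ψ ψh : Plane → ℝ}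
    (h : IsSolutionIn {f | MemH0 2 Ω f} Ω Re Ro F ψ) (hh : IsSolutionIn V Ω Re Ro F ψh)
    {v : Plane → ℝ} (hv : v ∈ V) :
    seminormH 2 Ω (fun x => ψ x - ψh x) ≤ cont Ω Re Ro Γ₁ Γ₂ F / coer Ω Re Ro Γ₁ F *
      seminormH 2 Ω (fun x => ψ x - v x) := by
  have hΩ := S.isOpen
  have hψ : MemH0 2 Ω ψ := h.1
  have hψh := hV _ hh.1
  have hv0 := hV _ hv
  have he := hψ.sub hΩ hψh
  have hη := hψ.sub hΩ hv0
  have hw := hVs ψh hh.1 v hv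
  have hw0 := hV _ hw
  have hB : IsBilin Ω (fun f g => a₀ Ω Re f g + a₁ Ω f ψ g + a₁ Ω ψh f g + a₂ Ω Ro f g) :=
    (((isBilin_a₀ hΩ Re).add (isBilin_a₁_mid S.bounded hΩ hψ)).add
      (isBilin_a₁_first S.bounded hΩ hψh)).add (isBilin_a₂ hΩ Ro)
  set e := fun x => ψ x - ψh x with hedef
  set η := fun x => ψ x - v x with hηdef
  -- Since `e = η - (ψh - v)` and the form vanishes at `(e, ψh - v)`, its value at `(e, e)` is its
  -- value at `(e, η)`.
  have h1 := hB.sub_right hη hw0 he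
  have eq : (fun x => η x - (ψh x - v x)) = e := by funext x; simp [hηdef, hedef]
  rw [eq, S.orth hV h hh hw, sub_zero, a₀_self hΩ Re he, a₁_self, a₂_self hΩ Ro he] at h1
  have n0 := seminormH_nonneg (Ω := Ω) 2 e
  have n1 := seminormH_nonneg (Ω := Ω) 2 η
  have bψ := S.energy (fun v hv => hv) h
  have bψh := S.energy hV hh
  have hΓ := S.hΓ₁
  have c0 := (abs_le.1 (abs_a₀_le hΩ S.hRe he hη)).2
  have c1 := (abs_le.1 (S.ha₁ e ψ η he hψ hη)).2
  have c2 := (abs_le.1 (S.ha₁ ψh e η hψh he hη)).2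
  have c3 := (abs_le.1 (S.ha₂ e η he hη)).2
  have c4 := (abs_le.1 (S.ha₁ e ψ e he hψ he)).1
  have p : 0 ≤ Γ₁ * (seminormH 2 Ω e * seminormH 2 Ω η) := by positivity
  have p' : 0 ≤ Γ₁ * (seminormH 2 Ω e * seminormH 2 Ω e) := by positivity
  have q1 := mul_le_mul_of_nonneg_left bψ p
  have q2 := mul_le_mul_of_nonneg_left bψh p
  have q3 := mul_le_mul_of_nonneg_left bψ p'
  -- On the left a₁(e,ψ,e) is subtracted from the viscous term. On the right the two convection
  -- terms contain ψ and ψʰ, both bounded by `bd`, hence the factor two in `cont`.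
  have key : coer Ω Re Ro Γ₁ F * seminormH 2 Ω e * seminormH 2 Ω e ≤
      cont Ω Re Ro Γ₁ Γ₂ F * seminormH 2 Ω η * seminormH 2 Ω e := by
    unfold coer cont
    nlinarith
  rw [div_mul_eq_mul_div, le_div_iff₀ S.coer_pos, mul_comm]
  rcases n0.eq_or_lt with h0 | h0
  · rw [← h0, mul_zero]
    exact mul_nonneg S.cont_pos.le n1
  · exact le_of_mul_le_mul_right key h0

/-- The regularity hypothesis speaks of dual solutions but does not provide one; Lax–Milgram for the
transposed form does. On the diagonal a₁(ψ,χ,χ) vanishes and a₁(χ,ψ,χ) is absorbed thanks to the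
small data. -/
theorem exists_dual {ψ : Plane → ℝ} (h : IsSolutionIn {f | MemH0 2 Ω f} Ω Re Ro F ψ)
    {g : Plane → ℝ} (hg : MemLp g 2 (volume.restrict Ω)) :
    ∃ ψs, IsDualSolution Ω Re Ro ψ g ψs := by
  have hΩ := S.isOpen
  have hψ : MemH0 2 Ω ψ := h.1
  have bψ := S.energy (fun v hv => hv) h
  have hB : IsBilin Ω (fun f g => a₀ Ω Re f g + a₁ Ω ψ f g + a₁ Ω f ψ g + a₂ Ω Ro f g) :=
    (((isBilin_a₀ hΩ Re).add (isBilin_a₁_first S.bounded hΩ hψ)).add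
      (isBilin_a₁_mid S.bounded hΩ hψ)).add (isBilin_a₂ hΩ Ro)
  have hΓ := S.hΓ₁
  obtain ⟨N, hN0, hN⟩ := exists_abs_integral_mul_le S.bounded hΩ hg
  obtain ⟨ψs, h1, h2⟩ := lax_milgram S.bounded hΩ hB.flip (M := cont Ω Re Ro Γ₁ Γ₂ F)
    (κ := coer Ω Re Ro Γ₁ F) (N := N) S.coer_pos S.cont_pos.le hN0 (by
      intro f k hf hk
      have n0 := seminormH_nonneg (Ω := Ω) 2 f
      have n1 := seminormH_nonneg (Ω := Ω) 2 k
      have c0 := abs_le.1 (abs_a₀_le hΩ S.hRe hk hf)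
      have c1 := abs_le.1 (S.ha₁ ψ k f hψ hk hf)
      have c2 := abs_le.1 (S.ha₁ k ψ f hk hψ hf)
      have c3 := abs_le.1 (S.ha₂ k f hk hf)
      have p : 0 ≤ Γ₁ * (seminormH 2 Ω k * seminormH 2 Ω f) := by positivity
      have q1 := mul_le_mul_of_nonneg_left bψ p
      unfold cont
      rw [abs_le]
      constructor <;> nlinarith) (by
      intro f hf
      have c1 := abs_le.1 (S.ha₁ f ψ f hf hψ hf)
      have n0 := seminormH_nonneg (Ω := Ω) 2 f
      have p : 0 ≤ Γ₁ * (seminormH 2 Ω f * seminormH 2 Ω f) := by positivity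
      have q1 := mul_le_mul_of_nonneg_left bψ p
      rw [a₀_self hΩ Re hf, a₁_self, a₂_self hΩ Ro hf]
      unfold coer
      nlinarith) (ℓ := fun χ => ∫ x in Ω, g x * χ x) (by
      intro f k hf hk c
      rw [integral_mul_eq_inner hΩ hg (hf.lin hΩ hk c), integral_mul_eq_inner hΩ hg hf,
        integral_mul_eq_inner hΩ hg hk, wL_lin hΩ hf hk c (by omega), inner_add_right,
        real_inner_smul_right]) hN
  exact ⟨ψs, h1, h2⟩

/-- The duality argument. -/
theorem duality {V : Set (Plane → ℝ)} (hV : ∀ v ∈ V, MemH0 2 Ω v) {ψ ψh ψs : Plane → ℝ}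
    (h : IsSolutionIn {f | MemH0 2 Ω f} Ω Re Ro F ψ) (hh : IsSolutionIn V Ω Re Ro F ψh)
    (hs : IsDualSolution Ω Re Ro ψ (fun x => ψ x - ψh x) ψs)
    {v : Plane → ℝ} (hv : v ∈ V) :
    seminormH 0 Ω (fun x => ψ x - ψh x) ^ 2 ≤
      seminormH 2 Ω (fun x => ψ x - ψh x) *
        ((cont Ω Re Ro Γ₁ Γ₂ F + Γ₁ * seminormH 2 Ω (fun x => ψ x - ψh x)) *
          seminormH 2 Ω (fun x => ψs x - v x) +
        Γ₁ * seminormH 2 Ω (fun x => ψ x - ψh x) * seminormH 2 Ω ψs) := by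
  have hΩ := S.isOpen
  have hψ : MemH0 2 Ω ψ := h.1
  have hψh := hV _ hh.1
  have hv0 := hV _ hv
  have he := hψ.sub hΩ hψh
  have hη := hs.1.sub hΩ hv0
  -- Let B be the form linearized at ψ. The dual equation tested with e gives ‖e‖_0² = B(e,ψ*).
  -- Orthogonality gives B(e,v) = a₁(e,e,v), the linearization error. With η = ψ* - v this yields
  -- ‖e‖_0² = B(e,η) + a₁(e,e,ψ*) - a₁(e,e,η).
  have o := S.orth hV h hh hv
  have d := hs.2 _ he
  have s1 := (isBilin_a₁_mid S.bounded hΩ he).sub_left hψ hψh hv0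
  have hB : IsBilin Ω (fun f g => a₀ Ω Re f g + a₁ Ω ψ f g + a₁ Ω f ψ g + a₂ Ω Ro f g) :=
    (((isBilin_a₀ hΩ Re).add (isBilin_a₁_first S.bounded hΩ hψ)).add
      (isBilin_a₁_mid S.bounded hΩ hψ)).add (isBilin_a₂ hΩ Ro)
  have h1 := hB.sub_right hs.1 hv0 he
  have h2 := (isBilin_a₁_first S.bounded hΩ he).sub_right hs.1 hv0 he
  have z : seminormH 0 Ω (fun x => ψ x - ψh x) ^ 2 =
      ∫ x in Ω, (ψ x - ψh x) * (ψ x - ψh x) := by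
    rw [seminormH_zero_sq hΩ he.1, norm_sq_eq_integral]
    refine integral_congr_ae ?_
    filter_upwards [wL_zero_ae hΩ he.1] with x hx
    rw [hx]; ring
  rw [z, ← d]
  set e := fun x => ψ x - ψh x with hedef
  set η := fun x => ψs x - v x with hηdef
  have n0 := seminormH_nonneg (Ω := Ω) 2 e
  have n1 := seminormH_nonneg (Ω := Ω) 2 η
  have bψ := S.energy (fun v hv => hv) h
  have hΓ := S.hΓ₁
  have c0 := (abs_le.1 (abs_a₀_le hΩ S.hRe he hη)).2
  have c1 := (abs_le.1 (S.ha₁ e ψ η he hψ hη)).2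
  have c2 := (abs_le.1 (S.ha₁ ψ e η hψ he hη)).2
  have c3 := (abs_le.1 (S.ha₂ e η he hη)).2
  have c4 := (abs_le.1 (S.ha₁ e e η he he hη)).1
  have c5 := (abs_le.1 (S.ha₁ e e ψs he he hs.1)).2
  have p : 0 ≤ Γ₁ * (seminormH 2 Ω e * seminormH 2 Ω η) := by positivity
  have q1 := mul_le_mul_of_nonneg_left bψ p
  unfold cont
  nlinarith

end Setting

theorem sq_mul_le_of_sq_le {a b : ℝ} (hb : 0 ≤ b) (ha : 0 ≤ a) (h : a ^ 2 ≤ b * a) : a ≤ b := by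
  rcases ha.eq_or_lt with h0 | h0
  · rw [← h0]; exact hb
  · exact le_of_mul_le_mul_right (by nlinarith) h0

set_option maxHeartbeats 1000000 in
/-- Convergence rates of the Galerkin approximation in a family of spaces with the approximation
properties of order four for `H⁶` and two for `H⁴`. -/
theorem galerkin_rates (S : Setting Ω Re Ro Γ₁ Γ₂ F) {ι : Type*} (V : ι → Set (Plane → ℝ))
    (h : ι → ℝ) {H : ℝ} (hh0 : ∀ i, 0 ≤ h i) (hhH : ∀ i, h i ≤ H)
    (hV : ∀ i, ∀ v ∈ V i, MemH0 2 Ω v)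
    (hVs : ∀ i, ∀ v ∈ V i, ∀ w ∈ V i, (fun x => v x - w x) ∈ V i)
    {A : ℝ} (hA : 0 ≤ A)
    (hA6 : ∀ i u, MemH0 2 Ω u → MemH 6 Ω u → ∃ v ∈ V i,
      seminormH 2 Ω (fun x => u x - v x) ≤ A * h i ^ 4 * normH 6 Ω u)
    (hA4 : ∀ i u, MemH0 2 Ω u → MemH 4 Ω u → ∃ v ∈ V i,
      seminormH 2 Ω (fun x => u x - v x) ≤ A * h i ^ 2 * normH 4 Ω u) :
    ∃ C₀ C₁ C₂ : ℝ, 0 < C₀ ∧ 0 < C₁ ∧ 0 < C₂ ∧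
      ∀ ψ : Plane → ℝ, IsSolutionIn {f | MemH0 2 Ω f} Ω Re Ro F ψ → MemH 6 Ω ψ →
        DualRegularity Ω Re Ro ψ → ∀ i, ∀ ψh, IsSolutionIn (V i) Ω Re Ro F ψh →
            seminormH 2 Ω (fun x => ψ x - ψh x) ≤ C₂ * h i ^ 4 ∧
            seminormH 1 Ω (fun x => ψ x - ψh x) ≤ C₁ * h i ^ 5 ∧
            seminormH 0 Ω (fun x => ψ x - ψh x) ≤ C₀ * h i ^ 6 := by
  have hΩ := S.isOpen
  -- The constants may depend on the data but not on ψ. Either there is no admissible ψ, and any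
  -- constants will do, or one is fixed to produce them, and uniqueness transfers the estimates to
  -- every other one.
  by_cases hex : ∃ ψ : Plane → ℝ, IsSolutionIn {f | MemH0 2 Ω f} Ω Re Ro F ψ ∧ MemH 6 Ω ψ ∧
      DualRegularity Ω Re Ro ψ
  swap
  · exact ⟨1, 1, 1, one_pos, one_pos, one_pos, fun ψ h1 h2 h3 => absurd ⟨ψ, h1, h2, h3⟩ hex⟩
  obtain ⟨ψ, hψ, hψ6, C, hC⟩ := hex
  have hψ0 : MemH0 2 Ω ψ := hψ.1
  set M := Setting.cont Ω Re Ro Γ₁ Γ₂ F with hM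
  set κ := Setting.coer Ω Re Ro Γ₁ F with hκ
  have hM0 : 0 < M := S.cont_pos
  have hκ0 : 0 < κ := S.coer_pos
  have hΓ := S.hΓ₁
  -- The regularity constant comes without a sign.
  set C' := max C 0 with hC'
  have hC'0 : 0 ≤ C' := le_max_right _ _
  -- The quasi-optimality factor times the interpolation constant; the summand one only ensures
  -- positivity.
  set C₂ := M / κ * (A * normH 6 Ω ψ) + 1 with hC₂
  have hn6 := normH_nonneg (Ω := Ω) 6 ψ
  have hC₂0 : 0 < C₂ := by positivity
  -- In the duality estimate the first factor is at most `C₂ h⁴`. The bracket contributes `h²`, once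
  -- through the interpolation of the dual solution and once through `|e|_2 ≤ C₂ |H|² h²`; the
  -- surplus powers of `h` are absorbed in powers of `|H|`.
  set C₀ := C₂ * ((M + Γ₁ * (C₂ * |H| ^ 4)) * (A * C') + Γ₁ * C₂ * |H| ^ 2 * C') + 1 with hC₀
  have hC₀0 : 0 < C₀ := by positivity
  refine ⟨C₀, C₀ + C₂, C₂, hC₀0, by positivity, hC₂0, ?_⟩
  have main : ∀ i, ∀ ψh, IsSolutionIn (V i) Ω Re Ro F ψh →
            seminormH 2 Ω (fun x => ψ x - ψh x) ≤ C₂ * h i ^ 4 ∧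
            seminormH 1 Ω (fun x => ψ x - ψh x) ≤ (C₀ + C₂) * h i ^ 5 ∧
            seminormH 0 Ω (fun x => ψ x - ψh x) ≤ C₀ * h i ^ 6 := by
    intro i ψh hψh
    have hh := hh0 i
    have hHa : h i ≤ |H| := (hhH i).trans (le_abs_self H)
    have hψh0 := hV i _ hψh.1
    have he := hψ0.sub hΩ hψh0
    have r2 : seminormH 2 Ω (fun x => ψ x - ψh x) ≤ C₂ * h i ^ 4 := by
      obtain ⟨v, hv, hvb⟩ := hA6 i ψ hψ0 hψ6
      refine (S.cea (hV i) (hVs i) hψ hψh hv).trans ?_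
      have : M / κ * seminormH 2 Ω (fun x => ψ x - v x) ≤ M / κ * (A * h i ^ 4 * normH 6 Ω ψ) :=
        mul_le_mul_of_nonneg_left hvb (by positivity)
      refine this.trans ?_
      rw [hC₂]
      nlinarith [pow_nonneg hh 4]
    set e := fun x => ψ x - ψh x with hedef
    have n0 := seminormH_nonneg (Ω := Ω) 2 e
    have n00 := seminormH_nonneg (Ω := Ω) 0 e
    have r0 : seminormH 0 Ω e ≤ C₀ * h i ^ 6 := by
      obtain ⟨ψs, hψs⟩ := S.exists_dual hψ (he.1.memLp hΩ)
      obtain ⟨d1, d2, -⟩ := hC _ ψs (he.1.memLp hΩ) hψs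
      have d2' : normH 4 Ω ψs ≤ C' * seminormH 0 Ω e :=
        d2.trans (mul_le_mul_of_nonneg_right (le_max_left _ _) n00)
      obtain ⟨v, hv, hvb⟩ := hA4 i ψs hψs.1 d1
      have dd := S.duality (hV i) hψ hψh hψs hv
      rw [← hedef] at dd
      have ns : seminormH 2 Ω ψs ≤ C' * seminormH 0 Ω e :=
        (seminormH_le_normH (by omega) ψs).trans d2'
      have nv : seminormH 2 Ω (fun x => ψs x - v x) ≤ A * h i ^ 2 * (C' * seminormH 0 Ω e) :=
        hvb.trans (mul_le_mul_of_nonneg_left d2' (by positivity))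
      have e4 : C₂ * h i ^ 4 ≤ C₂ * |H| ^ 4 := by gcongr
      have e2 : C₂ * h i ^ 4 ≤ C₂ * |H| ^ 2 * h i ^ 2 := by
        have : h i ^ 4 ≤ |H| ^ 2 * h i ^ 2 := by
          have := pow_le_pow_left₀ hh hHa 2
          nlinarith [sq_nonneg (h i)]
        nlinarith
      have b1 : (M + Γ₁ * seminormH 2 Ω e) * seminormH 2 Ω (fun x => ψs x - v x) ≤
          (M + Γ₁ * (C₂ * |H| ^ 4)) * (A * h i ^ 2 * (C' * seminormH 0 Ω e)) := by
        gcongr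
        · exact seminormH_nonneg _ _
        · exact r2.trans e4
      have b2 : Γ₁ * seminormH 2 Ω e * seminormH 2 Ω ψs ≤
          Γ₁ * (C₂ * |H| ^ 2 * h i ^ 2) * (C' * seminormH 0 Ω e) := by
        gcongr
        · exact seminormH_nonneg _ _
        · exact r2.trans e2
      have b3 := dd.trans (mul_le_mul r2 (add_le_add b1 b2) (add_nonneg
        (mul_nonneg (by positivity) (seminormH_nonneg _ _))
        (mul_nonneg (by positivity) (seminormH_nonneg _ _))) (by positivity))
      refine sq_mul_le_of_sq_le (by positivity) n00 (b3.trans ?_)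
      rw [hC₀]
      have : 0 ≤ h i ^ 6 * seminormH 0 Ω e := by positivity
      nlinarith
    refine ⟨r2, ?_, r0⟩
    -- Interpolation between the two other estimates gives |e|_1² ≤ C₀ C₂ h¹⁰, and C₀ C₂ ≤ (C₀ +
    -- C₂)².
    have i1 := seminormH_one_sq_le hΩ he
    refine (sq_le_sq₀ (seminormH_nonneg _ _) (by positivity)).1 (i1.trans ?_)
    refine (mul_le_mul r0 r2 n0 (by positivity)).trans ?_
    have : 0 ≤ (h i ^ 5) ^ 2 := by positivity
    have e1 : C₀ * h i ^ 6 * (C₂ * h i ^ 4) = C₀ * C₂ * (h i ^ 5) ^ 2 := by ring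
    rw [e1, mul_pow]
    refine mul_le_mul_of_nonneg_right ?_ this
    nlinarith
  intro ψ' hψ' hψ6' _ i ψh hψh
  have hψ0' : MemH0 2 Ω ψ' := hψ'.1
  -- Uniqueness is quasi-optimality for the full space: `ψ'` takes the part of the discrete
  -- solution, and `ψ` approximates itself without error.
  have hz : seminormH 2 Ω (fun x => ψ x - ψ' x) = 0 := by
    have := S.cea (V := {f | MemH0 2 Ω f}) (fun v hv => hv) (fun v hv w hw => hv.sub hΩ hw)
      hψ hψ' (v := ψ) hψ0
    have z0 : seminormH 2 Ω (fun x => ψ x - ψ x) = 0 := by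
      have := seminormH_two_smul hΩ hψ0 0
      simpa using this
    rw [z0, mul_zero] at this
    exact le_antisymm this (seminormH_nonneg _ _)
  have hae : ψ =ᵐ[volume.restrict Ω] ψ' := by
    obtain ⟨P, hP0, hP⟩ := exists_poincare S.bounded hΩ
    have h1 := hP _ (hψ0.sub hΩ hψ0') 0 0 (by omega)
    rw [hz, mul_zero, norm_le_zero_iff, wL_sub hΩ hψ0.1 hψ0'.1 (by omega), sub_eq_zero] at h1
    have h2 := wL_zero_ae hΩ hψ0.1
    rw [h1] at h2
    exact h2.symm.trans (wL_zero_ae hΩ hψ0'.1)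
  have hψh0 := hV i _ hψh.1
  have he := (hψ0.sub hΩ hψh0).1
  have hae' : (fun x => ψ x - ψh x) =ᵐ[volume.restrict Ω] fun x => ψ' x - ψh x :=
    hae.mono fun x hx => by simp only [hx]
  rw [seminormH_congr hΩ he hae' le_rfl, seminormH_congr hΩ he hae' one_le_two,
    seminormH_congr hΩ he hae' (Nat.zero_le 2)]
  exact main i ψh hψh

end

section

open Filter Topology

/-! ### Poincaré and Sobolev inequalities for smooth functions on convex sets -/

/-- The square of the length of the gradient. -/
def q1 (f : Plane → ℝ) (x : Plane) : ℝ := D 1 0 f x ^ 2 + D 0 1 f x ^ 2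

/-- The square of the length of the Hessian. -/
def q2 (f : Plane → ℝ) (x : Plane) : ℝ := D 2 0 f x ^ 2 + 2 * D 1 1 f x ^ 2 + D 0 2 f x ^ 2

theorem q1_nonneg (f : Plane → ℝ) (x : Plane) : 0 ≤ q1 f x := by unfold q1; positivity

theorem q2_nonneg (f : Plane → ℝ) (x : Plane) : 0 ≤ q2 f x := by unfold q2; positivity

theorem continuous_q1 {f : Plane → ℝ} (hf : ContDiff ℝ ∞ f) : Continuous (q1 f) :=
  ((continuous_D hf 1 0).pow 2).add ((continuous_D hf 0 1).pow 2)

theorem continuous_q2 {f : Plane → ℝ} (hf : ContDiff ℝ ∞ f) : Continuous (q2 f) :=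
  (((continuous_D hf 2 0).pow 2).add (continuous_const.mul ((continuous_D hf 1 1).pow 2))).add
    ((continuous_D hf 0 2).pow 2)

theorem fderiv_apply_eq (f : Plane → ℝ) (x v : Plane) :
    fderiv ℝ f x v = v 0 * D 1 0 f x + v 1 * D 0 1 f x := by
  have hv : v = v 0 • EuclideanSpace.single 0 (1 : ℝ) + v 1 • EuclideanSpace.single 1 (1 : ℝ) := by
    ext i; fin_cases i <;> simp
  conv_lhs => rw [hv]
  simp [D, pd]

theorem hasDerivAt_line {f : Plane → ℝ} (hf : ContDiff ℝ ∞ f) (x v : Plane) (s : ℝ) :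
    HasDerivAt (fun s : ℝ => f (x + s • v))
      (v 0 * D 1 0 f (x + s • v) + v 1 * D 0 1 f (x + s • v)) s := by
  have h1 : HasDerivAt (fun s : ℝ => x + s • v) v s := by
    simpa using ((hasDerivAt_id s).smul_const v).const_add x
  have h2 := (differentiable_of_smooth hf (x + s • v)).hasFDerivAt.comp_hasDerivAt s h1
  rw [fderiv_apply_eq] at h2
  exact h2

theorem norm_sq_plane (v : Plane) : ‖v‖ ^ 2 = v 0 ^ 2 + v 1 ^ 2 := by
  rw [EuclideanSpace.norm_sq_eq, Fin.sum_univ_two]; simp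

theorem sq_integral_le {g : ℝ → ℝ} (hg : Continuous g) :
    (∫ s in (0 : ℝ)..1, g s) ^ 2 ≤ ∫ s in (0 : ℝ)..1, g s ^ 2 := by
  set c := ∫ s in (0 : ℝ)..1, g s with hc
  have h0 : 0 ≤ ∫ s in (0 : ℝ)..1, (g s - c) ^ 2 :=
    intervalIntegral.integral_nonneg zero_le_one fun s _ => sq_nonneg _
  have h1 : ∫ s in (0 : ℝ)..1, (g s - c) ^ 2 = (∫ s in (0 : ℝ)..1, g s ^ 2) - c ^ 2 := by
    have e : ∀ s, (g s - c) ^ 2 = g s ^ 2 - (2 * c) * g s + c ^ 2 := fun s => by ring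
    simp_rw [e]
    rw [intervalIntegral.integral_add, intervalIntegral.integral_sub,
      intervalIntegral.integral_const_mul, ← hc, intervalIntegral.integral_const]
    · simp; ring
    all_goals exact Continuous.intervalIntegrable (by fun_prop) _ _
  linarith

/-- The fundamental theorem of calculus along the segment, with Cauchy–Schwarz both in the parameter
and for the product of gradient and direction. -/
theorem sq_sub_le_integral {f : Plane → ℝ} (hf : ContDiff ℝ ∞ f) (x y : Plane) :
    (f x - f y) ^ 2 ≤ ∫ s in (0 : ℝ)..1, ‖x - y‖ ^ 2 * q1 f (y + s • (x - y)) := by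
  set v := x - y with hv
  have hline : Continuous fun s : ℝ => y + s • v := by fun_prop
  have c10 := (continuous_D hf 1 0).comp hline
  have c01 := (continuous_D hf 0 1).comp hline
  have hc : Continuous fun s : ℝ => v 0 * D 1 0 f (y + s • v) + v 1 * D 0 1 f (y + s • v) :=
    (continuous_const.mul c10).add (continuous_const.mul c01)
  have h1 := intervalIntegral.integral_eq_sub_of_hasDerivAt (a := 0) (b := 1)
    (fun s _ => hasDerivAt_line hf y v s) (hc.intervalIntegrable _ _)
  have h2 : f x - f y = ∫ s in (0 : ℝ)..1,
      (v 0 * D 1 0 f (y + s • v) + v 1 * D 0 1 f (y + s • v)) := by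
    rw [h1]; simp [hv]
  rw [h2]
  refine (sq_integral_le hc).trans (intervalIntegral.integral_mono_on zero_le_one
    ((hc.pow 2).intervalIntegrable _ _)
    ((continuous_const.mul ((continuous_q1 hf).comp hline)).intervalIntegrable _ _) fun s _ => ?_)
  rw [norm_sq_plane, q1]
  nlinarith [sq_nonneg (v 0 * D 0 1 f (y + s • v) - v 1 * D 1 0 f (y + s • v))]

/-- Taylor's formula about `y` with the remainder parametrized from `x`, so that the second
derivative at `x + s (y - x)` carries the weight `s`. Squaring turns it into `s²`, which later
cancels the Jacobian of the contraction towards `x`. The factor 3 comes from squaring a sum of three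
terms. -/
theorem sq_le_taylor {f : Plane → ℝ} (hf : ContDiff ℝ ∞ f) (x y : Plane) :
    f x ^ 2 ≤ 3 * (f y ^ 2 + ‖y - x‖ ^ 2 * q1 f y +
      ∫ s in (0 : ℝ)..1, ‖y - x‖ ^ 4 * (s ^ 2 * q2 f (x + s • (y - x)))) := by
  set v := y - x with hv
  have hline : Continuous fun s : ℝ => x + s • v := by fun_prop
  have c20 := (continuous_D hf 2 0).comp hline
  have c11 := (continuous_D hf 1 1).comp hline
  have c02 := (continuous_D hf 0 2).comp hline
  set g2 : ℝ → ℝ := fun s => v 0 * (v 0 * D 2 0 f (x + s • v) + v 1 * D 1 1 f (x + s • v)) +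
    v 1 * (v 0 * D 1 1 f (x + s • v) + v 1 * D 0 2 f (x + s • v)) with hg2
  have hg2c : Continuous g2 :=
    (continuous_const.mul ((continuous_const.mul c20).add (continuous_const.mul c11))).add
      (continuous_const.mul ((continuous_const.mul c11).add (continuous_const.mul c02)))
  set g1 : ℝ → ℝ := fun s => v 0 * D 1 0 f (x + s • v) + v 1 * D 0 1 f (x + s • v) with hg1
  have d1 : ∀ s, HasDerivAt g1 (g2 s) s := by
    intro s
    have a := (hasDerivAt_line (smooth_D hf 1 0) x v s).const_mul (v 0)
    have b := (hasDerivAt_line (smooth_D hf 0 1) x v s).const_mul (v 1)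
    rw [D_D hf, D_D hf] at a b
    exact a.add b
  have d2 : ∀ s, HasDerivAt (fun s => s * g1 s - f (x + s • v)) (s * g2 s) s := by
    intro s
    have a : HasDerivAt (fun s => s * g1 s - f (x + s • v)) (1 * g1 s + s * g2 s - g1 s) s :=
      ((hasDerivAt_id s).mul (d1 s)).sub (hasDerivAt_line hf x v s)
    rwa [one_mul, add_sub_cancel_left] at a
  have hsg : Continuous fun s => s * g2 s := continuous_id.mul hg2c
  have h1 := intervalIntegral.integral_eq_sub_of_hasDerivAt (a := 0) (b := 1)
    (fun s _ => d2 s) (hsg.intervalIntegrable _ _)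
  have e0 : x + (0 : ℝ) • v = x := by simp
  have e1 : x + (1 : ℝ) • v = y := by simp [hv]
  rw [e0, e1] at h1
  have h2 : f x = f y - g1 1 + ∫ s in (0 : ℝ)..1, s * g2 s := by rw [h1]; ring
  have h3 := sq_integral_le hsg
  have h4 : ∫ s in (0 : ℝ)..1, (s * g2 s) ^ 2 ≤
      ∫ s in (0 : ℝ)..1, ‖v‖ ^ 4 * (s ^ 2 * q2 f (x + s • v)) := by
    refine intervalIntegral.integral_mono_on zero_le_one
      ((hsg.pow 2).intervalIntegrable _ _) ((continuous_const.mul ((continuous_id.pow 2).mul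
        ((continuous_q2 hf).comp hline))).intervalIntegrable _ _) fun s _ => ?_
    rw [mul_pow, show ‖v‖ ^ 4 = (‖v‖ ^ 2) ^ 2 by ring, norm_sq_plane]
    have : g2 s ^ 2 ≤ (v 0 ^ 2 + v 1 ^ 2) ^ 2 * q2 f (x + s • v) := by
      rw [hg2, q2]
      simp only
      set a := D 2 0 f (x + s • v)
      set b := D 1 1 f (x + s • v)
      set c := D 0 2 f (x + s • v)
      nlinarith [sq_nonneg (v 0 * v 0 * b - v 0 * v 1 * a), sq_nonneg (v 0 * v 0 * c - v 1 * v 1 * a),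
        sq_nonneg (v 0 * v 1 * c - v 1 * v 1 * b)]
    nlinarith [sq_nonneg s]
  have h5 : g1 1 ^ 2 ≤ ‖v‖ ^ 2 * q1 f y := by
    rw [norm_sq_plane, q1, hg1]
    simp only [e1]
    nlinarith [sq_nonneg (v 0 * D 0 1 f y - v 1 * D 1 0 f y)]
  rw [h2]
  set I := ∫ s in (0 : ℝ)..1, s * g2 s
  nlinarith [sq_nonneg (f y + g1 1), sq_nonneg (f y - I), sq_nonneg (g1 1 + I)]

theorem lintegral_homothety (x : Plane) {s : ℝ} (hs : 0 < s) {G : Plane → ENNReal}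
    (hG : Measurable G) :
    ∫⁻ y, G (x + s • (y - x)) = ENNReal.ofReal (s ^ 2)⁻¹ * ∫⁻ y, G y := by
  have e1 : ∀ y : Plane, x + s • (y - x) = s • y + (x - s • x) := by
    intro y; rw [smul_sub]; abel
  simp_rw [e1]
  have hmeas : Measurable (fun y => G (y + (x - s • x))) := hG.comp (measurable_add_const _)
  have e2 := lintegral_map (μ := (volume : Measure Plane)) hmeas
    (measurable_const_smul (α := Plane) s)
  rw [← e2, Measure.map_addHaar_smul _ hs.ne', lintegral_smul_measure,
    finrank_euclideanSpace_fin, abs_of_pos (by positivity)]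
  rw [lintegral_add_right_eq_self G]
  rfl

/-- Contracting a subset of a convex set towards one of its points. -/
theorem lintegral_contract_le {C S : Set Plane} (hC : Convex ℝ C) (hCm : MeasurableSet C)
    (hS : S ⊆ C) (hSm : MeasurableSet S) {x : Plane} (hx : x ∈ C) {s : ℝ} (hs : 0 < s)
    (hs1 : s ≤ 1) {Q : Plane → ENNReal} (hQ : Measurable Q) :
    ∫⁻ y in S, Q (x + s • (y - x)) ≤ ENNReal.ofReal (s ^ 2)⁻¹ * ∫⁻ y in C, Q y := by
  rw [← lintegral_indicator hSm, ← lintegral_indicator hCm,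
    ← lintegral_homothety x hs (hQ.indicator hCm)]
  refine lintegral_mono fun y => ?_
  by_cases hy : y ∈ S
  · have : x + s • (y - x) ∈ C := hC.add_smul_sub_mem hx (hS hy) ⟨hs.le, hs1⟩
    simp [hy, this]
  · simp [hy]

theorem lintegral_Ioc_eq {g : ℝ → ℝ} (hg : Continuous g) (h0 : ∀ s, 0 ≤ g s) :
    ENNReal.ofReal (∫ s in (0 : ℝ)..1, g s) = ∫⁻ s in Ioc (0 : ℝ) 1, ENNReal.ofReal (g s) := by
  rw [intervalIntegral.integral_of_le zero_le_one, ofReal_integral_eq_lintegral_ofReal]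
  · exact (hg.integrableOn_Icc).mono_set Ioc_subset_Icc_self
  · exact Eventually.of_forall h0

theorem lintegral_compact_eq {C : Set Plane} (hC : IsCompact C) {g : Plane → ℝ}
    (hg : Continuous g) (h0 : ∀ x, 0 ≤ g x) :
    ∫⁻ y in C, ENNReal.ofReal (g y) = ENNReal.ofReal (∫ y in C, g y) := by
  rw [ofReal_integral_eq_lintegral_ofReal (hg.continuousOn.integrableOn_compact hC)]
  exact Eventually.of_forall h0

/-- A Sobolev inequality: the value at a point `x` of a convex set in terms of the function and its
gradient on a subset `S` and of the second derivatives. -/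
theorem sobolev_convex {C S : Set Plane} (hC : Convex ℝ C) (hCc : IsCompact C)
    (hS : S ⊆ C) (hSc : IsCompact S) {x : Plane} (hx : x ∈ C) {d : ℝ} (hd : 0 ≤ d)
    (hdS : ∀ y ∈ S, ‖y - x‖ ≤ d) {f : Plane → ℝ} (hf : ContDiff ℝ ∞ f) :
    volume.real S * f x ^ 2 ≤
      3 * ((∫ y in S, f y ^ 2) + d ^ 2 * (∫ y in S, q1 f y) + d ^ 4 * ∫ y in C, q2 f y) := by
  have hSm := hSc.measurableSet
  have hCm := hCc.measurableSet
  have cf : Continuous fun y => f y ^ 2 := hf.continuous.pow 2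
  have cq1 := continuous_q1 hf
  have cq2 := continuous_q2 hf
  have hpt : ∀ y ∈ S, ENNReal.ofReal (f x ^ 2) ≤ 3 * (ENNReal.ofReal (f y ^ 2) +
      ENNReal.ofReal (d ^ 2) * ENNReal.ofReal (q1 f y) + ENNReal.ofReal (d ^ 4) *
        ∫⁻ s in Ioc (0 : ℝ) 1, ENNReal.ofReal (s ^ 2) * ENNReal.ofReal (q2 f (x + s • (y - x)))) := by
    intro y hy
    have hline : Continuous fun s : ℝ => x + s • (y - x) := by fun_prop
    have h1 := sq_le_taylor hf x y
    have hcs : Continuous fun s : ℝ => s ^ 2 * q2 f (x + s • (y - x)) :=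
      (continuous_id.pow 2).mul (cq2.comp hline)
    have hn : ∀ s : ℝ, 0 ≤ s ^ 2 * q2 f (x + s • (y - x)) := fun s =>
      mul_nonneg (sq_nonneg s) (q2_nonneg _ _)
    have hI : 0 ≤ ∫ s in (0 : ℝ)..1, s ^ 2 * q2 f (x + s • (y - x)) :=
      intervalIntegral.integral_nonneg zero_le_one fun s _ => hn s
    rw [intervalIntegral.integral_const_mul] at h1
    have h2 : f x ^ 2 ≤ 3 * (f y ^ 2 + d ^ 2 * q1 f y +
        d ^ 4 * ∫ s in (0 : ℝ)..1, s ^ 2 * q2 f (x + s • (y - x))) := by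
      refine h1.trans ?_
      have := hdS y hy
      have := q1_nonneg f y
      gcongr
    refine (ENNReal.ofReal_le_ofReal h2).trans_eq ?_
    have e : ∫⁻ s in Ioc (0 : ℝ) 1, ENNReal.ofReal (s ^ 2) *
        ENNReal.ofReal (q2 f (x + s • (y - x))) =
        ENNReal.ofReal (∫ s in (0 : ℝ)..1, s ^ 2 * q2 f (x + s • (y - x))) := by
      rw [lintegral_Ioc_eq hcs hn]
      exact lintegral_congr fun s => (ENNReal.ofReal_mul (sq_nonneg s)).symm
    have := q1_nonneg f y
    rw [e, ENNReal.ofReal_mul (by norm_num), ENNReal.ofReal_add (by positivity) (by positivity),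
      ENNReal.ofReal_add (by positivity) (by positivity), ENNReal.ofReal_mul (by positivity),
      ENNReal.ofReal_mul (by positivity)]
    norm_num
  have m1 : Measurable fun y => ENNReal.ofReal (f y ^ 2) := cf.measurable.ennreal_ofReal
  have m2 : Measurable fun y => ENNReal.ofReal (q1 f y) := cq1.measurable.ennreal_ofReal
  have m3 : Measurable fun y => ENNReal.ofReal (q2 f y) := cq2.measurable.ennreal_ofReal
  have mj : Measurable (fun p : Plane × ℝ => ENNReal.ofReal (p.2 ^ 2) *
      ENNReal.ofReal (q2 f (x + p.2 • (p.1 - x)))) := by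
    refine Measurable.mul (by fun_prop) (m3.comp (by fun_prop))
  have m4 : Measurable fun y => ∫⁻ s in Ioc (0 : ℝ) 1, ENNReal.ofReal (s ^ 2) *
      ENNReal.ofReal (q2 f (x + s • (y - x))) := mj.lintegral_prod_right'
  have m12 : Measurable fun y => ENNReal.ofReal (f y ^ 2) +
      ENNReal.ofReal (d ^ 2) * ENNReal.ofReal (q1 f y) := m1.add (m2.const_mul _)
  have m124 : Measurable fun y => ENNReal.ofReal (f y ^ 2) +
      ENNReal.ofReal (d ^ 2) * ENNReal.ofReal (q1 f y) + ENNReal.ofReal (d ^ 4) *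
        ∫⁻ s in Ioc (0 : ℝ) 1, ENNReal.ofReal (s ^ 2) * ENNReal.ofReal (q2 f (x + s • (y - x))) :=
    m12.add (m4.const_mul _)
  have hint := lintegral_mono_ae (μ := volume.restrict S) ((ae_restrict_iff' hSm).2 (Eventually.of_forall hpt))
  rw [lintegral_const, Measure.restrict_apply_univ, lintegral_const_mul _ m124,
    lintegral_add_left m12, lintegral_add_left m1, lintegral_const_mul _ m2,
    lintegral_const_mul _ m4] at hint
  -- For fixed `s` the map `y ↦ x + s (y - x)` sends `S` into `C` with Jacobian `s²`, which the
  -- weight compensates exactly, so nothing singular remains at `s = 0`.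
  have hswap : ∫⁻ y in S, ∫⁻ s in Ioc (0 : ℝ) 1, ENNReal.ofReal (s ^ 2) *
      ENNReal.ofReal (q2 f (x + s • (y - x))) ≤ ∫⁻ y in C, ENNReal.ofReal (q2 f y) := by
    rw [lintegral_lintegral_swap mj.aemeasurable]
    have : ∀ s ∈ Ioc (0 : ℝ) 1, ∫⁻ y in S, ENNReal.ofReal (s ^ 2) *
        ENNReal.ofReal (q2 f (x + s • (y - x))) ≤ ∫⁻ y in C, ENNReal.ofReal (q2 f y) := by
      intro s hs
      have hs0 : 0 < s ^ 2 := pow_pos hs.1 2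
      have m3s : Measurable fun y => ENNReal.ofReal (q2 f (x + s • (y - x))) :=
        m3.comp (by fun_prop)
      rw [lintegral_const_mul _ m3s]
      refine (mul_le_mul_right (lintegral_contract_le hC hCm hS hSm hx hs.1 hs.2 m3) _).trans_eq ?_
      rw [← mul_assoc, ← ENNReal.ofReal_mul hs0.le, mul_inv_cancel₀ hs0.ne', ENNReal.ofReal_one,
        one_mul]
    refine (lintegral_mono_ae ((ae_restrict_iff' measurableSet_Ioc).2
      (Eventually.of_forall this))).trans_eq ?_
    rw [lintegral_const, Measure.restrict_apply_univ, Real.volume_Ioc]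
    simp
  have hfin := hint.trans (mul_le_mul_right (add_le_add_right (mul_le_mul_right hswap _) _) _)
  rw [lintegral_compact_eq hSc cf (fun y => sq_nonneg _), lintegral_compact_eq hSc cq1 (q1_nonneg f),
    lintegral_compact_eq hCc cq2 (q2_nonneg f)] at hfin
  have i1 : 0 ≤ ∫ y in S, f y ^ 2 := integral_nonneg fun y => sq_nonneg _
  have i2 : 0 ≤ ∫ y in S, q1 f y := integral_nonneg (q1_nonneg f)
  have i3 : 0 ≤ ∫ y in C, q2 f y := integral_nonneg (q2_nonneg f)
  have hv : volume S = ENNReal.ofReal (volume.real S) := by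
    rw [Measure.real, ENNReal.ofReal_toReal hSc.measure_lt_top.ne]
  rw [hv, ← ENNReal.ofReal_mul (sq_nonneg _), ← ENNReal.ofReal_mul (by positivity),
    ← ENNReal.ofReal_mul (by positivity), ← ENNReal.ofReal_add (by positivity) (by positivity),
    ← ENNReal.ofReal_add (by positivity) (by positivity),
    show (3 : ENNReal) = ENNReal.ofReal 3 by norm_num, ← ENNReal.ofReal_mul (by norm_num),
    ENNReal.ofReal_le_ofReal_iff (by positivity)] at hfin
  linarith [mul_comm (volume.real S) (f x ^ 2)]

/-- Poincaré's inequality for functions of mean value zero on a convex set. -/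
theorem poincare_convex {C : Set Plane} (hC : Convex ℝ C) (hCc : IsCompact C)
    (hvol : volume C ≠ 0) {d : ℝ} (hd : 0 ≤ d) (hdC : ∀ x ∈ C, ∀ y ∈ C, ‖x - y‖ ≤ d)
    {f : Plane → ℝ} (hf : ContDiff ℝ ∞ f) (hmean : ∫ y in C, f y = 0) :
    ∫ y in C, f y ^ 2 ≤ 4 * d ^ 2 * ∫ y in C, q1 f y := by
  have hCm := hCc.measurableSet
  have cq1 := continuous_q1 hf
  have cf : Continuous fun y => f y ^ 2 := hf.continuous.pow 2
  have hvt : volume C ≠ ⊤ := hCc.measure_lt_top.ne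
  have m2 : Measurable fun y => ENNReal.ofReal (q1 f y) := cq1.measurable.ennreal_ofReal
  set A := ∫⁻ y in C, ENNReal.ofReal (q1 f y) with hA
  -- As `f` has mean value zero, the mixed term vanishes, and ∫ (f - f(y))² exceeds ∫ f² by the
  -- integral of the constant f(y)².
  have h1 : ∀ y, ∫⁻ x in C, ENNReal.ofReal (f x ^ 2) ≤
      ∫⁻ x in C, ENNReal.ofReal ((f x - f y) ^ 2) := by
    intro y
    rw [lintegral_compact_eq hCc cf (fun y => sq_nonneg _),
      lintegral_compact_eq hCc (by fun_prop : Continuous fun x => (f x - f y) ^ 2)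
      (fun y => sq_nonneg _)]
    refine ENNReal.ofReal_le_ofReal ?_
    have i0 : IntegrableOn f C := hf.continuous.continuousOn.integrableOn_compact hCc
    have i2 : IntegrableOn (fun x => f x ^ 2) C := cf.continuousOn.integrableOn_compact hCc
    have i3 : IntegrableOn (fun _ : Plane => f y ^ 2) C :=
      continuous_const.continuousOn.integrableOn_compact hCc
    have e : ∀ x, (f x - f y) ^ 2 = f x ^ 2 - 2 * f y * f x + f y ^ 2 := fun x => by ring
    simp_rw [e]
    have i4 : IntegrableOn (fun x => 2 * f y * f x) C := i0.const_mul _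
    have i5 : IntegrableOn (fun x => f x ^ 2 - 2 * f y * f x) C := i2.sub i4
    rw [integral_add i5 i3, integral_sub i2 i4, integral_const_mul, hmean]
    have : 0 ≤ ∫ x in C, f y ^ 2 := integral_nonneg fun _ => sq_nonneg _
    linarith
  have mj : Measurable (fun p : (Plane × Plane) × ℝ =>
      ENNReal.ofReal (q1 f (p.1.2 + p.2 • (p.1.1 - p.1.2)))) := m2.comp (by fun_prop)
  -- For `s ≥ 1/2` the substitution is made in `x`, otherwise in `y`. Either way the ratio of the
  -- homothety is at least 1/2, and the inverse Jacobian is at most 4.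
  have hs : ∀ s ∈ Ioc (0 : ℝ) 1, ∫⁻ y in C, ∫⁻ x in C,
      ENNReal.ofReal (q1 f (y + s • (x - y))) ≤ 4 * A * volume C := by
    intro s hs
    have four : ∀ t : ℝ, 1 / 2 ≤ t → ENNReal.ofReal (t ^ 2)⁻¹ ≤ 4 := by
      intro t ht
      rw [show (4 : ENNReal) = ENNReal.ofReal 4 by norm_num]
      refine ENNReal.ofReal_le_ofReal ?_
      rw [inv_le_comm₀ (by positivity) (by norm_num)]
      nlinarith
    rcases le_or_gt (1 / 2) s with h | h
    · have : ∀ y ∈ C, ∫⁻ x in C, ENNReal.ofReal (q1 f (y + s • (x - y))) ≤ 4 * A := fun y hy =>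
        (lintegral_contract_le hC hCm Subset.rfl hCm hy hs.1 hs.2 m2).trans
          (mul_le_mul_left (four s h) _)
      refine (lintegral_mono_ae ((ae_restrict_iff' hCm).2 (Eventually.of_forall this))).trans_eq ?_
      rw [lintegral_const, Measure.restrict_apply_univ]
    · have mm : Measurable (fun p : Plane × Plane =>
          ENNReal.ofReal (q1 f (p.1 + s • (p.2 - p.1)))) := m2.comp (by fun_prop)
      rw [lintegral_lintegral_swap mm.aemeasurable]
      have : ∀ x ∈ C, ∫⁻ y in C, ENNReal.ofReal (q1 f (y + s • (x - y))) ≤ 4 * A := by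
        intro x hx
        have e : ∀ y : Plane, y + s • (x - y) = x + (1 - s) • (y - x) := by
          intro y
          rw [sub_smul, one_smul, smul_sub, smul_sub]; abel
        simp_rw [e]
        exact (lintegral_contract_le hC hCm Subset.rfl hCm hx (by linarith) (by linarith [hs.1])
          m2).trans (mul_le_mul_left (four _ (by linarith)) _)
      refine (lintegral_mono_ae ((ae_restrict_iff' hCm).2 (Eventually.of_forall this))).trans_eq ?_
      rw [lintegral_const, Measure.restrict_apply_univ]
  have h2 : ∀ y ∈ C, ∀ x ∈ C, ENNReal.ofReal ((f x - f y) ^ 2) ≤ ENNReal.ofReal (d ^ 2) *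
      ∫⁻ s in Ioc (0 : ℝ) 1, ENNReal.ofReal (q1 f (y + s • (x - y))) := by
    intro y hy x hx
    have hline : Continuous fun s : ℝ => y + s • (x - y) := by fun_prop
    have h3 := sq_sub_le_integral hf x y
    rw [intervalIntegral.integral_const_mul] at h3
    have hI : 0 ≤ ∫ s in (0 : ℝ)..1, q1 f (y + s • (x - y)) :=
      intervalIntegral.integral_nonneg zero_le_one fun s _ => q1_nonneg _ _
    have cql : Continuous fun s : ℝ => q1 f (y + s • (x - y)) := cq1.comp hline
    rw [← lintegral_Ioc_eq cql (fun s => q1_nonneg _ _), ← ENNReal.ofReal_mul (sq_nonneg d)]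
    refine ENNReal.ofReal_le_ofReal (h3.trans ?_)
    have := hdC x hx y hy
    gcongr
  -- Integration over `y` produces the factor `volume C` on both sides; it is finite and nonzero and
  -- is cancelled afterwards.
  have h4 : volume C * ∫⁻ x in C, ENNReal.ofReal (f x ^ 2) ≤
      ENNReal.ofReal (d ^ 2) * (4 * A * volume C) := by
    calc volume C * ∫⁻ x in C, ENNReal.ofReal (f x ^ 2)
        = ∫⁻ _y in C, ∫⁻ x in C, ENNReal.ofReal (f x ^ 2) := by
          rw [lintegral_const, Measure.restrict_apply_univ, mul_comm]
      _ ≤ ∫⁻ y in C, ∫⁻ x in C, ENNReal.ofReal ((f x - f y) ^ 2) := lintegral_mono h1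
      _ ≤ ∫⁻ y in C, ∫⁻ x in C, ENNReal.ofReal (d ^ 2) *
          ∫⁻ s in Ioc (0 : ℝ) 1, ENNReal.ofReal (q1 f (y + s • (x - y))) := by
          refine lintegral_mono_ae ((ae_restrict_iff' hCm).2 (Eventually.of_forall fun y hy => ?_))
          exact lintegral_mono_ae ((ae_restrict_iff' hCm).2 (Eventually.of_forall (h2 y hy)))
      _ = ENNReal.ofReal (d ^ 2) * ∫⁻ s in Ioc (0 : ℝ) 1, ∫⁻ y in C, ∫⁻ x in C,
            ENNReal.ofReal (q1 f (y + s • (x - y))) := by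
          have a1 : ∀ y, ∫⁻ x in C, ENNReal.ofReal (d ^ 2) *
              ∫⁻ s in Ioc (0 : ℝ) 1, ENNReal.ofReal (q1 f (y + s • (x - y))) =
              ENNReal.ofReal (d ^ 2) * ∫⁻ s in Ioc (0 : ℝ) 1, ∫⁻ x in C,
                ENNReal.ofReal (q1 f (y + s • (x - y))) := by
            intro y
            have m : Measurable (fun p : Plane × ℝ =>
              ENNReal.ofReal (q1 f (y + p.2 • (p.1 - y)))) := m2.comp (by fun_prop)
            rw [lintegral_const_mul _ m.lintegral_prod_right', lintegral_lintegral_swap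
              m.aemeasurable]
          simp_rw [a1]
          have m5 : Measurable (fun p : (Plane × ℝ) × Plane =>
            ENNReal.ofReal (q1 f (p.1.1 + p.1.2 • (p.2 - p.1.1)))) := m2.comp (by fun_prop)
          have m6 := m5.lintegral_prod_right' (ν := volume.restrict C)
          rw [lintegral_const_mul _ m6.lintegral_prod_right', lintegral_lintegral_swap
            m6.aemeasurable]
      _ ≤ ENNReal.ofReal (d ^ 2) * ∫⁻ _s in Ioc (0 : ℝ) 1, 4 * A * volume C := by
          gcongr 1
          exact lintegral_mono_ae ((ae_restrict_iff' measurableSet_Ioc).2 (Eventually.of_forall hs))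
      _ = ENNReal.ofReal (d ^ 2) * (4 * A * volume C) := by
          rw [lintegral_const, Measure.restrict_apply_univ, Real.volume_Ioc]; simp
  rw [show ENNReal.ofReal (d ^ 2) * (4 * A * volume C) =
    volume C * (ENNReal.ofReal (d ^ 2) * (4 * A)) by ring] at h4
  have h5 := (ENNReal.mul_le_mul_iff_right hvol hvt).1 h4
  have i2 : 0 ≤ ∫ y in C, q1 f y := integral_nonneg (q1_nonneg f)
  rw [hA, lintegral_compact_eq hCc cf (fun y => sq_nonneg _), lintegral_compact_eq hCc cq1
    (q1_nonneg f), show (4 : ENNReal) = ENNReal.ofReal 4 by norm_num,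
    ← ENNReal.ofReal_mul (by norm_num), ← ENNReal.ofReal_mul (by positivity),
    ENNReal.ofReal_le_ofReal_iff (by positivity)] at h5
  linarith

end

section

open Filter Topology

/-! ### Polynomials as functions on the plane -/

theorem polyFun_add (p q : MvPolynomial (Fin 2) ℝ) :
    polyFun (p + q) = fun x => polyFun p x + polyFun q x := by funext x; simp [polyFun]

theorem polyFun_sub (p q : MvPolynomial (Fin 2) ℝ) :
    polyFun (p - q) = fun x => polyFun p x - polyFun q x := by funext x; simp [polyFun]

theorem polyFun_mul (p q : MvPolynomial (Fin 2) ℝ) :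
    polyFun (p * q) = fun x => polyFun p x * polyFun q x := by funext x; simp [polyFun]

theorem polyFun_sum {ι : Type*} (s : Finset ι) (p : ι → MvPolynomial (Fin 2) ℝ) :
    polyFun (∑ i ∈ s, p i) = fun x => ∑ i ∈ s, polyFun (p i) x := by funext x; simp [polyFun]

theorem polyFun_C (c : ℝ) : polyFun (MvPolynomial.C c) = fun _ => c := by funext x; simp [polyFun]

theorem polyFun_X (i : Fin 2) : polyFun (MvPolynomial.X i) = fun x : Plane => x i := by
  funext x; simp [polyFun]

theorem smooth_coord (i : Fin 2) : ContDiff ℝ ∞ (fun x : Plane => x i) :=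
  (EuclideanSpace.proj (𝕜 := ℝ) i).contDiff

theorem polyFun_smooth (p : MvPolynomial (Fin 2) ℝ) : ContDiff ℝ ∞ (polyFun p) := by
  induction p using MvPolynomial.induction_on with
  | C a => rw [polyFun_C]; exact contDiff_const
  | add p q hp hq => rw [polyFun_add]; exact hp.add hq
  | mul_X p i hp => rw [polyFun_mul, polyFun_X]; exact hp.mul (smooth_coord i)

theorem pd_mul {f g : Plane → ℝ} (hf : ContDiff ℝ ∞ f) (hg : ContDiff ℝ ∞ g) (i : Fin 2) :
    pd i (fun x => f x * g x) = fun x => pd i f x * g x + f x * pd i g x := by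
  funext x
  have := (((differentiable_of_smooth hf x).hasFDerivAt).mul
    ((differentiable_of_smooth hg x).hasFDerivAt)).fderiv
  rw [pd, show (fun x => f x * g x) = f * g from rfl, this]
  simp [pd]; ring

theorem pd_polyFun (i : Fin 2) (p : MvPolynomial (Fin 2) ℝ) :
    pd i (polyFun p) = polyFun (MvPolynomial.pderiv i p) := by
  induction p using MvPolynomial.induction_on with
  | C a => rw [polyFun_C, MvPolynomial.pderiv_C]; funext x; simp [pd, polyFun]
  | add p q hp hq =>
    rw [polyFun_add, pd_add (differentiable_of_smooth (polyFun_smooth p))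
      (differentiable_of_smooth (polyFun_smooth q)), hp, hq, map_add, polyFun_add]
  | mul_X p j hp =>
    rw [polyFun_mul, polyFun_X, pd_mul (polyFun_smooth p) (smooth_coord j), hp,
      MvPolynomial.pderiv_mul, polyFun_add, polyFun_mul, polyFun_mul, polyFun_X]
    funext x
    have : pd i (fun x : Plane => x j) x = polyFun (MvPolynomial.pderiv i (MvPolynomial.X j)) x := by
      rw [pd, show (fun x : Plane => x j) = EuclideanSpace.proj (𝕜 := ℝ) j from rfl,
        ContinuousLinearMap.fderiv, MvPolynomial.pderiv_X]
      by_cases h : i = j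
      · subst h; simp [polyFun]
      · simp [polyFun, Pi.single_apply, h, Ne.symm h]
    rw [this]

theorem D_polyFun (i j : ℕ) (p : MvPolynomial (Fin 2) ℝ) : D i j (polyFun p) =
    polyFun ((MvPolynomial.pderiv 0)^[i] ((MvPolynomial.pderiv 1)^[j] p)) := by
  have key : ∀ (v : Fin 2) (n : ℕ) (q : MvPolynomial (Fin 2) ℝ),
      (pd v)^[n] (polyFun q) = polyFun ((MvPolynomial.pderiv v)^[n] q) := by
    intro v n
    induction n with
    | zero => intro q; rfl
    | succ n ih => intro q; rw [Function.iterate_succ_apply, pd_polyFun, ih,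
        Function.iterate_succ_apply]
  rw [D, key, key]

theorem D_sum {ι : Type*} (s : Finset ι) {f : ι → Plane → ℝ} (hf : ∀ i, ContDiff ℝ ∞ (f i))
    (a b : ℕ) : D a b (fun x => ∑ i ∈ s, f i x) = fun x => ∑ i ∈ s, D a b (f i) x := by
  classical
  induction s using Finset.induction_on with
  | empty =>
    have := D_smul 0 (contDiff_const (c := (0 : ℝ)) : ContDiff ℝ ∞ fun _ : Plane => (0 : ℝ)) a b
    simpa using this
  | insert i s hi ih =>
    simp only [Finset.sum_insert hi]
    rw [D_add (hf i) (ContDiff.sum fun i _ => hf i), ih]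

theorem pderiv_iter_monomial (v w : Fin 2) (hvw : w ≠ v) (c : ℝ) (a b n : ℕ) :
    (MvPolynomial.pderiv v)^[n] (MvPolynomial.C c * MvPolynomial.X w ^ a * MvPolynomial.X v ^ b) =
      MvPolynomial.C (c * b.descFactorial n) * MvPolynomial.X w ^ a * MvPolynomial.X v ^ (b - n) := by
  induction n with
  | zero => simp
  | succ n ih =>
    rw [Function.iterate_succ_apply', ih, MvPolynomial.pderiv_mul, MvPolynomial.pderiv_mul,
      MvPolynomial.pderiv_C, MvPolynomial.pderiv_pow, MvPolynomial.pderiv_pow,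
      MvPolynomial.pderiv_X_self, MvPolynomial.pderiv_X_of_ne hvw, Nat.descFactorial_succ]
    push_cast
    simp only [map_mul, map_natCast, Nat.sub_sub]
    ring

/-- The monomial `c x^a y^b`. -/
def mono (c : ℝ) (a b : ℕ) : MvPolynomial (Fin 2) ℝ :=
  MvPolynomial.C c * MvPolynomial.X 0 ^ a * MvPolynomial.X 1 ^ b

theorem D_mono (c : ℝ) (a b i j : ℕ) : D i j (polyFun (mono c a b)) =
    polyFun (mono (c * (a.descFactorial i * b.descFactorial j)) (a - i) (b - j)) := by
  rw [D_polyFun, mono, pderiv_iter_monomial 1 0 (by decide), mul_right_comm,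
    pderiv_iter_monomial 0 1 (by decide), mono, mul_right_comm]
  congr 4
  ring

theorem totalDegree_mono (c : ℝ) (a b : ℕ) : (mono c a b).totalDegree ≤ a + b := by
  refine (MvPolynomial.totalDegree_mul _ _).trans (add_le_add ((MvPolynomial.totalDegree_mul _ _).trans
    ?_) ((MvPolynomial.totalDegree_pow _ _).trans ?_))
  · rw [MvPolynomial.totalDegree_C, zero_add]
    exact (MvPolynomial.totalDegree_pow _ _).trans (by simp)
  · simp

/-- Prescribing the mean values of all derivatives of order at most `n` of a polynomial of degree
at most `n`. -/
theorem exists_poly_means {C : Set Plane} (hC : IsCompact C) (hv : volume.real C ≠ 0) (n : ℕ)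
    (m : ℕ → ℕ → ℝ) : ∃ Q : MvPolynomial (Fin 2) ℝ, Q.totalDegree ≤ n ∧
      (∀ i j, n < i + j → ∀ x, D i j (polyFun Q) x = 0) ∧
      ∀ i j, i + j ≤ n → ∫ x in C, D i j (polyFun Q) x = m i j := by
  -- A homogeneous polynomial has constant derivatives of top order, so its coefficients follow from
  -- the prescribed integrals after division by the volume and the factorials. Terms of lower degree
  -- do not change these derivatives, and the remaining integrals are corrected by induction on the
  -- degree.
  have top : ∀ (n : ℕ) (m : ℕ → ℕ → ℝ), ∃ P : MvPolynomial (Fin 2) ℝ, P.totalDegree ≤ n ∧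
      (∀ i j, n < i + j → ∀ x, D i j (polyFun P) x = 0) ∧
      ∀ i j, i + j = n → ∫ x in C, D i j (polyFun P) x = m i j := by
    intro n m
    set c : ℕ → ℝ := fun a => m a (n - a) / (volume.real C * (a.factorial * (n - a).factorial))
      with hc
    have e : ∀ i j x, D i j (polyFun (∑ a ∈ Finset.range (n + 1), mono (c a) a (n - a))) x =
        ∑ a ∈ Finset.range (n + 1), polyFun (mono (c a * (a.descFactorial i *
          (n - a).descFactorial j)) (a - i) (n - a - j)) x := by
      intro i j x
      rw [polyFun_sum, D_sum _ fun a => polyFun_smooth _]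
      simp only [D_mono]
    have z : ∀ i j a x, a < n + 1 → (a < i ∨ n - a < j) →
        polyFun (mono (c a * (a.descFactorial i * (n - a).descFactorial j)) (a - i) (n - a - j)) x
          = 0 := by
      intro i j a x _ h
      have : ((a.descFactorial i : ℝ) * (n - a).descFactorial j) = 0 := by
        rcases h with h | h <;> simp [Nat.descFactorial_eq_zero_iff_lt.2 h]
      simp [this, mono, polyFun]
    refine ⟨∑ a ∈ Finset.range (n + 1), mono (c a) a (n - a),
      MvPolynomial.totalDegree_finsetSum_le fun a ha =>
      (totalDegree_mono (c a) a (n - a)).trans ?_, fun i j hij x => ?_, fun i j hij => ?_⟩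
    · have := Finset.mem_range.1 ha; omega
    · rw [e]
      exact Finset.sum_eq_zero fun a ha => z i j a x (Finset.mem_range.1 ha)
        (by have := Finset.mem_range.1 ha; omega)
    · have e1 : ∀ x, D i j (polyFun (∑ a ∈ Finset.range (n + 1), mono (c a) a (n - a))) x =
          c i * (i.factorial * j.factorial) := by
        intro x
        rw [e, Finset.sum_eq_single i]
        · have hj : n - i = j := by omega
          simp [mono, polyFun, hj, Nat.descFactorial_self]
        · intro a ha hai
          exact z i j a x (Finset.mem_range.1 ha) (by have := Finset.mem_range.1 ha; omega)
        · intro h; exact absurd (Finset.mem_range.2 (by omega)) h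
      simp_rw [e1]
      have hj : n - i = j := by omega
      have h1 : (i.factorial : ℝ) ≠ 0 := by exact_mod_cast i.factorial_ne_zero
      have h2 : (j.factorial : ℝ) ≠ 0 := by exact_mod_cast j.factorial_ne_zero
      rw [setIntegral_const, hc]
      simp only [hj, smul_eq_mul]
      field_simp
  induction n generalizing m with
  | zero =>
    obtain ⟨P, h1, h2, h3⟩ := top 0 m
    exact ⟨P, h1, h2, fun i j h => h3 i j (by omega)⟩
  | succ n ih =>
    obtain ⟨P, h1, h2, h3⟩ := top (n + 1) m
    obtain ⟨Q, k1, k2, k3⟩ := ih fun i j => m i j - ∫ x in C, D i j (polyFun P) x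
    have e : ∀ i j x, D i j (polyFun (P + Q)) x = D i j (polyFun P) x + D i j (polyFun Q) x := by
      intro i j x
      rw [polyFun_add, D_add (polyFun_smooth P) (polyFun_smooth Q)]
    refine ⟨P + Q, (MvPolynomial.totalDegree_add _ _).trans (max_le h1 (k1.trans (by omega))),
      fun i j h x => ?_, fun i j h => ?_⟩
    · rw [e, h2 i j h, k2 i j (by omega), add_zero]
    · simp_rw [e]
      have int : ∀ R : MvPolynomial (Fin 2) ℝ, IntegrableOn (D i j (polyFun R)) C := fun R =>
        (continuous_D (polyFun_smooth R) i j).continuousOn.integrableOn_compact hC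
      rw [integral_add (int P) (int Q)]
      rcases Nat.lt_or_ge n (i + j) with h' | h'
      · rw [h3 i j (by omega)]
        simp [k2 i j h']
      · rw [k3 i j h']; ring

/-! ### Products and scaled jets -/

theorem D_mul_two {f g : Plane → ℝ} (hf : ContDiff ℝ ∞ f) (hg : ContDiff ℝ ∞ g) (x : Plane) :
    D 0 0 (fun x => f x * g x) x = f x * g x ∧
    D 1 0 (fun x => f x * g x) x = D 1 0 f x * g x + f x * D 1 0 g x ∧
    D 0 1 (fun x => f x * g x) x = D 0 1 f x * g x + f x * D 0 1 g x ∧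
    D 2 0 (fun x => f x * g x) x = D 2 0 f x * g x + 2 * (D 1 0 f x * D 1 0 g x) + f x * D 2 0 g x ∧
    D 1 1 (fun x => f x * g x) x = D 1 1 f x * g x + D 1 0 f x * D 0 1 g x +
      D 0 1 f x * D 1 0 g x + f x * D 1 1 g x ∧
    D 0 2 (fun x => f x * g x) x =
      D 0 2 f x * g x + 2 * (D 0 1 f x * D 0 1 g x) + f x * D 0 2 g x := by
  have e0 : D 1 0 (fun x => f x * g x) = fun x => D 1 0 f x * g x + f x * D 1 0 g x :=
    pd_mul hf hg 0
  have e1 : D 0 1 (fun x => f x * g x) = fun x => D 0 1 f x * g x + f x * D 0 1 g x :=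
    pd_mul hf hg 1
  have s10f := smooth_D hf 1 0
  have s01f := smooth_D hf 0 1
  have s10g := smooth_D hg 1 0
  have s01g := smooth_D hg 0 1
  refine ⟨rfl, congrFun e0 x, congrFun e1 x, ?_, ?_, ?_⟩
  · rw [← pd_zero_D, e0, pd_add (differentiable_of_smooth (s10f.mul hg))
      (differentiable_of_smooth (hf.mul s10g)), pd_mul s10f hg, pd_mul hf s10g, pd_zero_D, pd_zero_D,
      show pd 0 f = D 1 0 f from rfl, show pd 0 g = D 1 0 g from rfl]
    ring
  · rw [← pd_zero_D, e1, pd_add (differentiable_of_smooth (s01f.mul hg))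
      (differentiable_of_smooth (hf.mul s01g)), pd_mul s01f hg, pd_mul hf s01g, pd_zero_D, pd_zero_D,
      show pd 0 f = D 1 0 f from rfl, show pd 0 g = D 1 0 g from rfl]
    ring
  · rw [← pd_one_D (hf.mul hg), e1, pd_add (differentiable_of_smooth (s01f.mul hg))
      (differentiable_of_smooth (hf.mul s01g)), pd_mul s01f hg, pd_mul hf s01g, pd_one_D hf,
      pd_one_D hg, show pd 1 f = D 0 1 f from rfl, show pd 1 g = D 0 1 g from rfl]
    ring

/-- The derivatives of order at most two of `f` at `x`, scaled with `h`, are bounded by `A`. -/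
def JB (h A : ℝ) (f : Plane → ℝ) (x : Plane) : Prop :=
  ∀ i j, i + j ≤ 2 → |D i j f x| * h ^ (i + j) ≤ A

theorem forall_two {P : ℕ → ℕ → Prop} : (∀ i j, i + j ≤ 2 → P i j) ↔
    P 0 0 ∧ P 1 0 ∧ P 0 1 ∧ P 2 0 ∧ P 1 1 ∧ P 0 2 := by
  refine ⟨fun h => ⟨h _ _ (by omega), h _ _ (by omega), h _ _ (by omega), h _ _ (by omega),
    h _ _ (by omega), h _ _ (by omega)⟩, ?_⟩
  rintro ⟨h1, h2, h3, h4, h5, h6⟩ i j hij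
  obtain ⟨rfl, rfl⟩ | ⟨rfl, rfl⟩ | ⟨rfl, rfl⟩ | ⟨rfl, rfl⟩ | ⟨rfl, rfl⟩ | ⟨rfl, rfl⟩ :
    (i = 0 ∧ j = 0) ∨ (i = 1 ∧ j = 0) ∨ (i = 0 ∧ j = 1) ∨ (i = 2 ∧ j = 0) ∨ (i = 1 ∧ j = 1) ∨
      (i = 0 ∧ j = 2) := by omega
  all_goals assumption

theorem JB.nonneg {h A : ℝ} {f : Plane → ℝ} {x : Plane} (hf : JB h A f x) : 0 ≤ A := by
  have := hf 0 0 (by norm_num)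
  simp only [add_zero, pow_zero, mul_one] at this
  exact (abs_nonneg _).trans this

/-- By the Leibniz rule a derivative of order at most two is a sum of at most four products, counted
with multiplicity, and the powers of `h` distribute over the factors. -/
theorem JB.mul {h A B : ℝ} (hh : 0 ≤ h) {f g : Plane → ℝ} (hf : ContDiff ℝ ∞ f)
    (hg : ContDiff ℝ ∞ g) {x : Plane} (h1 : JB h A f x) (h2 : JB h B g x) :
    JB h (4 * (A * B)) (fun x => f x * g x) x := by
  have hAB : 0 ≤ A * B := mul_nonneg h1.nonneg h2.nonneg
  have key : ∀ i j k l, i + j ≤ 2 → k + l ≤ 2 →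
      |D i j f x * D k l g x| * h ^ (i + j + (k + l)) ≤ A * B := by
    intro i j k l hij hkl
    rw [abs_mul, pow_add, mul_mul_mul_comm]
    exact mul_le_mul (h1 i j hij) (h2 k l hkl) (by positivity) h1.nonneg
  obtain ⟨m00, m10, m01, m20, m11, m02⟩ := D_mul_two hf hg x
  unfold JB
  rw [forall_two (P := fun i j => |D i j (fun x => f x * g x) x| * h ^ (i + j) ≤ 4 * (A * B))]
  rw [m00, m10, m01, m20, m11, m02]
  have k0 := key 0 0 0 0 (by norm_num) (by norm_num)
  have k1 := key 1 0 0 0 (by norm_num) (by norm_num)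
  have k2 := key 0 0 1 0 (by norm_num) (by norm_num)
  have k3 := key 0 1 0 0 (by norm_num) (by norm_num)
  have k4 := key 0 0 0 1 (by norm_num) (by norm_num)
  have k5 := key 2 0 0 0 (by norm_num) (by norm_num)
  have k6 := key 1 0 1 0 (by norm_num) (by norm_num)
  have k7 := key 0 0 2 0 (by norm_num) (by norm_num)
  have k8 := key 1 1 0 0 (by norm_num) (by norm_num)
  have k9 := key 1 0 0 1 (by norm_num) (by norm_num)
  have k10 := key 0 1 1 0 (by norm_num) (by norm_num)
  have k11 := key 0 0 1 1 (by norm_num) (by norm_num)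
  have k12 := key 0 2 0 0 (by norm_num) (by norm_num)
  have k13 := key 0 1 0 1 (by norm_num) (by norm_num)
  have k14 := key 0 0 0 2 (by norm_num) (by norm_num)
  simp only [D_zero_zero, add_zero, zero_add, Nat.reduceAdd] at *
  have two : ∀ {a b H c : ℝ}, 0 ≤ H → |a| * H ≤ c → |b| * H ≤ c → |a + b| * H ≤ 2 * c := by
    intro a b H c hH ha hb
    nlinarith [abs_add_le a b]
  have hh1 : 0 ≤ h ^ 1 := by positivity
  have hh2 : 0 ≤ h ^ 2 := by positivity
  refine ⟨by linarith, ?_, ?_, ?_, ?_, ?_⟩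
  · linarith [two hh1 k1 k2]
  · linarith [two hh1 k3 k4]
  · rw [two_mul (D 1 0 f x * _), ← add_assoc, add_assoc _ _ (f x * _)]
    linarith [two hh2 (two hh2 k5 k6) (two hh2 k6 k7)]
  · rw [add_assoc _ (D 0 1 f x * _)]
    linarith [two hh2 (two hh2 k8 k9) (two hh2 k10 k11)]
  · rw [two_mul (D 0 1 f x * _), ← add_assoc, add_assoc _ _ (f x * _)]
    linarith [two hh2 (two hh2 k12 k13) (two hh2 k13 k14)]

theorem JB.add {h A B : ℝ} (hh : 0 ≤ h) {f g : Plane → ℝ} (hf : ContDiff ℝ ∞ f)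
    (hg : ContDiff ℝ ∞ g) {x : Plane} (h1 : JB h A f x) (h2 : JB h B g x) :
    JB h (A + B) (fun x => f x + g x) x := by
  intro i j hij
  rw [D_add hf hg]
  have := h1 i j hij
  have := h2 i j hij
  have := abs_add_le (D i j f x) (D i j g x)
  have : 0 ≤ h ^ (i + j) := by positivity
  nlinarith

end

section

open Filter Topology MvPolynomial

/-! ### Interpolation of nodal data on one triangle -/

/-- The affine function with gradient `(a, b)` and value `1` at `v`. -/
def lam (a b : ℝ) (v : Plane) : MvPolynomial (Fin 2) ℝ :=
  C (1 - a * v 0 - b * v 1) + C a * X 0 + C b * X 1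

theorem polyFun_lam (a b : ℝ) (v x : Plane) :
    polyFun (lam a b v) x = 1 + a * (x 0 - v 0) + b * (x 1 - v 1) := by
  simp [polyFun, lam]; ring

theorem totalDegree_lam (a b : ℝ) (v : Plane) : (lam a b v).totalDegree ≤ 1 := by
  refine (totalDegree_add _ _).trans (max_le ((totalDegree_add _ _).trans (max_le ?_ ?_)) ?_)
  · rw [totalDegree_C]; norm_num
  · exact (totalDegree_mul _ _).trans (by simp)
  · exact (totalDegree_mul _ _).trans (by simp)

theorem D_lam (a b : ℝ) (v x : Plane) : D 1 0 (polyFun (lam a b v)) x = a ∧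
    D 0 1 (polyFun (lam a b v)) x = b ∧ D 2 0 (polyFun (lam a b v)) x = 0 ∧
    D 1 1 (polyFun (lam a b v)) x = 0 ∧ D 0 2 (polyFun (lam a b v)) x = 0 := by
  simp only [D_polyFun, Function.iterate_succ, Function.iterate_zero, Function.comp, id]
  refine ⟨?_, ?_, ?_, ?_, ?_⟩ <;> simp [lam, polyFun, pderiv_mul, pderiv_X]

theorem jb_lam {a b h κ : ℝ} (hh : 0 ≤ h) (ha : |a| * h ≤ κ) (hb : |b| * h ≤ κ) {v x : Plane}
    (hx : |polyFun (lam a b v) x| ≤ 1) : JB h (1 + κ) (polyFun (lam a b v)) x := by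
  have hk : 0 ≤ κ := (by positivity : 0 ≤ |a| * h).trans ha
  obtain ⟨h1, h2, h3, h4, h5⟩ := D_lam a b v x
  unfold JB
  rw [forall_two (P := fun i j => |D i j (polyFun (lam a b v)) x| * h ^ (i + j) ≤ 1 + κ), h1, h2,
    h3, h4, h5]
  simp only [D_zero_zero, abs_zero, zero_mul, add_zero, zero_add, pow_zero, mul_one, pow_one]
  refine ⟨?_, ?_, ?_, ?_, ?_, ?_⟩ <;> linarith

/-- The quadratic polynomial with given Taylor coefficients at `v`. -/
def quad (v : Plane) (c : ℕ → ℕ → ℝ) : MvPolynomial (Fin 2) ℝ :=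
  C (c 0 0) + C (c 1 0) * (X 0 - C (v 0)) + C (c 0 1) * (X 1 - C (v 1)) +
    C (c 2 0) * (X 0 - C (v 0)) ^ 2 + C (c 1 1) * ((X 0 - C (v 0)) * (X 1 - C (v 1))) +
    C (c 0 2) * (X 1 - C (v 1)) ^ 2

theorem totalDegree_quad (v : Plane) (c : ℕ → ℕ → ℝ) : (quad v c).totalDegree ≤ 2 := by
  have h : ∀ i : Fin 2, (X i - C (v i) : MvPolynomial (Fin 2) ℝ).totalDegree ≤ 1 := fun i =>
    (totalDegree_sub _ _).trans (by simp)
  have hC : ∀ (r : ℝ) (q : MvPolynomial (Fin 2) ℝ) (n : ℕ), q.totalDegree ≤ n →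
      (C r * q).totalDegree ≤ n := fun r q n hq =>
    (totalDegree_mul _ _).trans (by simpa using hq)
  have hadd : ∀ {p q : MvPolynomial (Fin 2) ℝ} {n : ℕ}, p.totalDegree ≤ n → q.totalDegree ≤ n →
      (p + q).totalDegree ≤ n := fun hp hq => (totalDegree_add _ _).trans (max_le hp hq)
  refine hadd (hadd (hadd (hadd (hadd (by simp) (hC _ _ _ ?_)) (hC _ _ _ ?_)) (hC _ _ _ ?_))
    (hC _ _ _ ?_)) (hC _ _ _ ?_)
  · exact (h 0).trans (by norm_num)
  · exact (h 1).trans (by norm_num)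
  · exact (totalDegree_pow _ _).trans (Nat.mul_le_mul_left 2 (h 0))
  · exact (totalDegree_mul _ _).trans (add_le_add (h 0) (h 1))
  · exact (totalDegree_pow _ _).trans (Nat.mul_le_mul_left 2 (h 1))

theorem polyFun_quad (v : Plane) (c : ℕ → ℕ → ℝ) (x : Plane) : polyFun (quad v c) x =
    c 0 0 + c 1 0 * (x 0 - v 0) + c 0 1 * (x 1 - v 1) + c 2 0 * (x 0 - v 0) ^ 2 +
      c 1 1 * ((x 0 - v 0) * (x 1 - v 1)) + c 0 2 * (x 1 - v 1) ^ 2 := by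
  simp [polyFun, quad]

theorem D_quad (v : Plane) (c : ℕ → ℕ → ℝ) (x : Plane) :
    D 1 0 (polyFun (quad v c)) x = c 1 0 + 2 * c 2 0 * (x 0 - v 0) + c 1 1 * (x 1 - v 1) ∧
    D 0 1 (polyFun (quad v c)) x = c 0 1 + c 1 1 * (x 0 - v 0) + 2 * c 0 2 * (x 1 - v 1) ∧
    D 2 0 (polyFun (quad v c)) x = 2 * c 2 0 ∧ D 1 1 (polyFun (quad v c)) x = c 1 1 ∧
    D 0 2 (polyFun (quad v c)) x = 2 * c 0 2 := by
  simp only [D_polyFun, Function.iterate_succ, Function.iterate_zero, Function.comp, id]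
  refine ⟨?_, ?_, ?_, ?_, ?_⟩ <;>
  · simp [quad, polyFun, pderiv_mul, pderiv_pow, pderiv_X, Derivation.map_natCast, -Nat.cast_ofNat]
    try push_cast
    try ring

theorem jb_quad {v x : Plane} {c : ℕ → ℕ → ℝ} {h M : ℝ} (hh : 0 ≤ h)
    (hc : ∀ i j, i + j ≤ 2 → |c i j| * h ^ (i + j) ≤ M) (hx : ∀ k, |x k - v k| ≤ h) :
    JB h (6 * M) (polyFun (quad v c)) x := by
  have c00 := hc 0 0 (by norm_num)
  have c10 := hc 1 0 (by norm_num)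
  have c01 := hc 0 1 (by norm_num)
  have c20 := hc 2 0 (by norm_num)
  have c11 := hc 1 1 (by norm_num)
  have c02 := hc 0 2 (by norm_num)
  have x0 := hx 0
  have x1 := hx 1
  obtain ⟨h1, h2, h3, h4, h5⟩ := D_quad v c x
  unfold JB
  rw [forall_two (P := fun i j => |D i j (polyFun (quad v c)) x| * h ^ (i + j) ≤ 6 * M), h1, h2,
    h3, h4, h5]
  simp only [D_zero_zero, add_zero, zero_add, pow_zero, mul_one, pow_one, Nat.reduceAdd] at *
  rw [polyFun_quad]
  set X := x 0 - v 0
  set Y := x 1 - v 1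
  have m1 : ∀ {a Z : ℝ}, |Z| ≤ h → |a * Z| ≤ |a| * h := by
    intro a Z hZ; rw [abs_mul]; exact mul_le_mul_of_nonneg_left hZ (abs_nonneg _)
  have m2 : ∀ {a Z W : ℝ}, |Z| ≤ h → |W| ≤ h → |a * (Z * W)| ≤ |a| * h ^ 2 := by
    intro a Z W hZ hW
    rw [abs_mul, abs_mul, pow_two]
    exact mul_le_mul_of_nonneg_left (mul_le_mul hZ hW (abs_nonneg _) hh) (abs_nonneg _)
  have hM : 0 ≤ M := (abs_nonneg _).trans c00
  have t1 := m1 (a := c 1 0) x0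
  have t2 := m1 (a := c 0 1) x1
  have t3 := m2 (a := c 2 0) x0 x0
  have t4 := m2 (a := c 1 1) x0 x1
  have t5 := m2 (a := c 0 2) x1 x1
  have s1 := m1 (a := c 2 0) x0
  have s2 := m1 (a := c 1 1) x1
  have s3 := m1 (a := c 1 1) x0
  have s4 := m1 (a := c 0 2) x1
  have up : ∀ {u w : ℝ}, |u| ≤ |w| * h → |w| * h ^ 2 ≤ M → |u| * h ≤ M := by
    intro u w hu hw
    calc |u| * h ≤ |w| * h * h := by gcongr
      _ = |w| * h ^ 2 := by ring
      _ ≤ M := hw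
  have s1 := up s1 c20
  have s2 := up s2 c11
  have s3 := up s3 c11
  have s4 := up s4 c02
  refine ⟨?_, ?_, ?_, ?_, ?_, ?_⟩
  · rw [pow_two, pow_two]
    refine (abs_add_le _ _).trans ?_
    have := abs_add_le (c 0 0 + c 1 0 * X + c 0 1 * Y + c 2 0 * (X * X)) (c 1 1 * (X * Y))
    have := abs_add_le (c 0 0 + c 1 0 * X + c 0 1 * Y) (c 2 0 * (X * X))
    have := abs_add_le (c 0 0 + c 1 0 * X) (c 0 1 * Y)
    have := abs_add_le (c 0 0) (c 1 0 * X)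
    linarith
  · have e1 := abs_add_le (c 1 0 + 2 * c 2 0 * X) (c 1 1 * Y)
    have e2 := abs_add_le (c 1 0) (2 * c 2 0 * X)
    rw [mul_assoc 2, abs_mul 2, abs_two] at e2
    rw [mul_assoc 2] at e1 ⊢
    nlinarith
  · have e1 := abs_add_le (c 0 1 + c 1 1 * X) (2 * c 0 2 * Y)
    have e2 := abs_add_le (c 0 1) (c 1 1 * X)
    rw [mul_assoc 2, abs_mul 2, abs_two] at e1
    rw [mul_assoc 2]
    nlinarith
  · rw [abs_mul, abs_two]; linarith
  · linarith
  · rw [abs_mul, abs_two]; linarith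

theorem D_cube_lam (a b : ℝ) (v x : Plane) :
    polyFun (lam a b v ^ 3) x = polyFun (lam a b v) x ^ 3 ∧
    D 1 0 (polyFun (lam a b v ^ 3)) x = 3 * polyFun (lam a b v) x ^ 2 * a ∧
    D 0 1 (polyFun (lam a b v ^ 3)) x = 3 * polyFun (lam a b v) x ^ 2 * b ∧
    D 2 0 (polyFun (lam a b v ^ 3)) x = 6 * polyFun (lam a b v) x * a ^ 2 ∧
    D 1 1 (polyFun (lam a b v ^ 3)) x = 6 * polyFun (lam a b v) x * (a * b) ∧
    D 0 2 (polyFun (lam a b v ^ 3)) x = 6 * polyFun (lam a b v) x * b ^ 2 := by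
  simp only [D_polyFun, Function.iterate_succ, Function.iterate_zero, Function.comp, id]
  refine ⟨by simp [polyFun], ?_, ?_, ?_, ?_, ?_⟩ <;>
  · simp [lam, polyFun, pderiv_mul, pderiv_pow, pderiv_X, Derivation.map_natCast, -Nat.cast_ofNat]
    push_cast
    ring

/-- The Taylor coefficients of `λ⁻³ j`, where `λ` has the value `1` and the gradient `(a, b)`, for
a function with the derivatives `j`. -/
def vtxCoeff (a b : ℝ) (j : ℕ → ℕ → ℝ) : ℕ → ℕ → ℝ
  | 0, 0 => j 0 0
  | 1, 0 => j 1 0 - 3 * a * j 0 0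
  | 0, 1 => j 0 1 - 3 * b * j 0 0
  | 2, 0 => j 2 0 / 2 - 3 * a * j 1 0 + 6 * a ^ 2 * j 0 0
  | 1, 1 => j 1 1 - 3 * a * j 0 1 - 3 * b * j 1 0 + 12 * (a * b) * j 0 0
  | 0, 2 => j 0 2 / 2 - 3 * b * j 0 1 + 6 * b ^ 2 * j 0 0
  | _, _ => 0

/-- The polynomial `λ³ g` with the derivatives `j` at the vertex `v`, at which `λ = 1`. -/
def vtx (a b : ℝ) (v : Plane) (j : ℕ → ℕ → ℝ) : MvPolynomial (Fin 2) ℝ :=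
  lam a b v ^ 3 * quad v (vtxCoeff a b j)

theorem totalDegree_vtx (a b : ℝ) (v : Plane) (j : ℕ → ℕ → ℝ) : (vtx a b v j).totalDegree ≤ 5 :=
  (totalDegree_mul _ _).trans (add_le_add ((totalDegree_pow _ _).trans
    (Nat.mul_le_mul_left 3 (totalDegree_lam a b v))) (totalDegree_quad _ _))

theorem D_vtx_self (a b : ℝ) (v : Plane) (j : ℕ → ℕ → ℝ) :
    ∀ k l, k + l ≤ 2 → D k l (polyFun (vtx a b v j)) v = j k l := by
  rw [vtx, polyFun_mul]
  obtain ⟨m00, m10, m01, m20, m11, m02⟩ := D_mul_two (polyFun_smooth (lam a b v ^ 3))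
    (polyFun_smooth (quad v (vtxCoeff a b j))) v
  obtain ⟨c00, c10, c01, c20, c11, c02⟩ := D_cube_lam a b v v
  obtain ⟨q10, q01, q20, q11, q02⟩ := D_quad v (vtxCoeff a b j) v
  have q00 := polyFun_quad v (vtxCoeff a b j) v
  have hl : polyFun (lam a b v) v = 1 := by rw [polyFun_lam]; ring
  rw [forall_two (P := fun k l => D k l _ v = j k l), m00, m10, m01, m20, m11, m02, c00, c10, c01,
    c20, c11, c02, q10, q01, q20, q11, q02, q00, hl]
  simp only [vtxCoeff]
  refine ⟨?_, ?_, ?_, ?_, ?_, ?_⟩ <;> ring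

/-- The cube has a zero of order three where `λ = 0`, so the function attached to one vertex leaves
the second-order data at the other vertices unchanged. -/
theorem D_vtx_of_eq_zero {a b : ℝ} {v x : Plane} (hx : polyFun (lam a b v) x = 0)
    (j : ℕ → ℕ → ℝ) : ∀ k l, k + l ≤ 2 → D k l (polyFun (vtx a b v j)) x = 0 := by
  rw [vtx, polyFun_mul]
  obtain ⟨m00, m10, m01, m20, m11, m02⟩ := D_mul_two (polyFun_smooth (lam a b v ^ 3))
    (polyFun_smooth (quad v (vtxCoeff a b j))) x
  obtain ⟨c00, c10, c01, c20, c11, c02⟩ := D_cube_lam a b v x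
  rw [forall_two (P := fun k l => D k l _ x = 0), m00, m10, m01, m20, m11, m02, c00, c10, c01,
    c20, c11, c02, hx]
  simp

/-- The constant is 4 · 16 · 6: a product costs 4, the cube of `λ` is bounded by 16 (1 + κ)³, and
the quadratic by six times the bound (1 + 6κ + 12κ²) E of its coefficients. -/
theorem jb_vtx {a b h κ E : ℝ} (hh : 0 ≤ h) (ha : |a| * h ≤ κ) (hb : |b| * h ≤ κ) {v x : Plane}
    {j : ℕ → ℕ → ℝ} (hj : ∀ k l, k + l ≤ 2 → |j k l| * h ^ (k + l) ≤ E)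
    (hx : |polyFun (lam a b v) x| ≤ 1) (hxv : ∀ k, |x k - v k| ≤ h) :
    JB h (384 * (1 + κ) ^ 3 * (1 + 6 * κ + 12 * κ ^ 2) * E) (polyFun (vtx a b v j)) x := by
  have hk : 0 ≤ κ := (by positivity : 0 ≤ |a| * h).trans ha
  have j00 : |j 0 0| * h ^ 0 ≤ E := hj 0 0 (by norm_num)
  have j10 : |j 1 0| * h ^ 1 ≤ E := hj 1 0 (by norm_num)
  have j01 : |j 0 1| * h ^ 1 ≤ E := hj 0 1 (by norm_num)
  have j20 : |j 2 0| * h ^ 2 ≤ E := hj 2 0 (by norm_num)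
  have j11 : |j 1 1| * h ^ 2 ≤ E := hj 1 1 (by norm_num)
  have j02 : |j 0 2| * h ^ 2 ≤ E := hj 0 2 (by norm_num)
  have hE : 0 ≤ E := (by positivity : (0 : ℝ) ≤ |j 0 0| * h ^ 0).trans j00
  have hL := jb_lam hh ha hb hx
  have hs := polyFun_smooth (lam a b v)
  have hL3 : JB h (4 * (4 * ((1 + κ) * (1 + κ)) * (1 + κ))) (polyFun (lam a b v ^ 3)) x := by
    rw [show lam a b v ^ 3 = lam a b v * lam a b v * lam a b v by ring, polyFun_mul, polyFun_mul]
    exact (hL.mul hh hs hs hL).mul hh (hs.mul hs) hs hL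
  have prod : ∀ {u w A B : ℝ} (m n : ℕ), |u| * h ^ m ≤ A → |w| * h ^ n ≤ B → 0 ≤ A →
      |u * w| * h ^ (m + n) ≤ A * B := by
    intro u w A B m n h1 h2 hA
    rw [abs_mul, pow_add, mul_mul_mul_comm]
    exact mul_le_mul h1 h2 (by positivity) hA
  have sum : ∀ {u w A B : ℝ} {m : ℕ}, |u| * h ^ m ≤ A → |w| * h ^ m ≤ B →
      |u + w| * h ^ m ≤ A + B := by
    intro u w A B m h1 h2
    have : 0 ≤ h ^ m := by positivity
    nlinarith [abs_add_le u w]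
  have dif : ∀ {u w A B : ℝ} {m : ℕ}, |u| * h ^ m ≤ A → |w| * h ^ m ≤ B →
      |u - w| * h ^ m ≤ A + B := by
    intro u w A B m h1 h2
    have : 0 ≤ h ^ m := by positivity
    nlinarith [abs_sub u w]
  have cst : ∀ {c u A : ℝ} {m : ℕ}, 0 ≤ c → |u| * h ^ m ≤ A → |c * u| * h ^ m ≤ c * A := by
    intro c u A m hc h1
    rw [abs_mul, abs_of_nonneg hc, mul_assoc]
    exact mul_le_mul_of_nonneg_left h1 hc
  have ha' : |a| * h ^ 1 ≤ κ := by simpa using ha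
  have hb' : |b| * h ^ 1 ≤ κ := by simpa using hb
  have hcoef : ∀ k l, k + l ≤ 2 → |vtxCoeff a b j k l| * h ^ (k + l) ≤
      (1 + 6 * κ + 12 * κ ^ 2) * E := by
    have kE : 0 ≤ κ * E := by positivity
    have kkE : 0 ≤ κ * κ * E := by positivity
    have n3 : (0 : ℝ) ≤ 3 := by norm_num
    have n6 : (0 : ℝ) ≤ 6 := by norm_num
    have n12 : (0 : ℝ) ≤ 12 := by norm_num
    have kk : 0 ≤ κ * κ := by positivity
    rw [forall_two (P := fun k l => |vtxCoeff a b j k l| * h ^ (k + l) ≤ _)]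
    simp only [vtxCoeff, div_eq_inv_mul, mul_assoc, pow_two a, pow_two b, Nat.reduceAdd]
    refine ⟨?_, ?_, ?_, ?_, ?_, ?_⟩
    · linarith
    · linarith [dif j10 (cst n3 (prod 1 0 ha' j00 hk))]
    · linarith [dif j01 (cst n3 (prod 1 0 hb' j00 hk))]
    · linarith [sum (dif (cst (by norm_num : (0 : ℝ) ≤ 2⁻¹) j20) (cst n3 (prod 1 1 ha' j10 hk)))
        (cst n6 (prod 1 1 ha' (prod 1 0 ha' j00 hk) hk))]
    · linarith [sum (dif (dif j11 (cst n3 (prod 1 1 ha' j01 hk))) (cst n3 (prod 1 1 hb' j10 hk)))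
        (cst n12 (prod 1 1 ha' (prod 1 0 hb' j00 hk) hk))]
    · linarith [sum (dif (cst (by norm_num : (0 : ℝ) ≤ 2⁻¹) j02) (cst n3 (prod 1 1 hb' j01 hk)))
        (cst n6 (prod 1 1 hb' (prod 1 0 hb' j00 hk) hk))]
  have hq := jb_quad hh hcoef hxv
  have := hL3.mul hh (polyFun_smooth _) (polyFun_smooth (quad v (vtxCoeff a b j))) hq
  rw [vtx, polyFun_mul]
  convert this using 1
  ring

/-- The bubble `(λ₁ λ₂)² λ₃` of an edge. -/
def bub (l₁ l₂ l₃ : MvPolynomial (Fin 2) ℝ) : MvPolynomial (Fin 2) ℝ :=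
  (l₁ * l₂) * (l₁ * l₂) * l₃

/-- The double zero kills the gradient on the two other edges, and all second derivatives vanish at
the vertices. At the midpoint of its own edge, where `λ₁ = λ₂ = 1/2`, the gradient is that of `λ₃`
divided by 16. Hence the bubbles adjust the three normal derivatives independently and leave the
vertex data alone. -/
theorem D_bub (l₁ l₂ l₃ : MvPolynomial (Fin 2) ℝ) (x : Plane) :
    (polyFun l₁ x * polyFun l₂ x = 0 → D 1 0 (polyFun (bub l₁ l₂ l₃)) x = 0 ∧
      D 0 1 (polyFun (bub l₁ l₂ l₃)) x = 0) ∧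
    (polyFun l₁ x * polyFun l₂ x = 0 → (polyFun l₃ x = 0 ∨ polyFun l₁ x = 0 ∧ polyFun l₂ x = 0) →
      ∀ k l, k + l ≤ 2 → D k l (polyFun (bub l₁ l₂ l₃)) x = 0) ∧
    (polyFun l₃ x = 0 → polyFun l₁ x = 1 / 2 → polyFun l₂ x = 1 / 2 →
      D 1 0 (polyFun (bub l₁ l₂ l₃)) x = D 1 0 (polyFun l₃) x / 16 ∧
      D 0 1 (polyFun (bub l₁ l₂ l₃)) x = D 0 1 (polyFun l₃) x / 16) := by
  have s1 := polyFun_smooth l₁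
  have s2 := polyFun_smooth l₂
  have s3 := polyFun_smooth l₃
  have sp : ContDiff ℝ ∞ (fun x => polyFun l₁ x * polyFun l₂ x) := s1.mul s2
  obtain ⟨-, p10, p01, p20, p11, p02⟩ := D_mul_two s1 s2 x
  obtain ⟨-, r10, r01, r20, r11, r02⟩ := D_mul_two sp sp x
  obtain ⟨b00, b10, b01, b20, b11, b02⟩ := D_mul_two (sp.mul sp) s3 x
  have e : polyFun (bub l₁ l₂ l₃) = fun x => (polyFun l₁ x * polyFun l₂ x) *
    (polyFun l₁ x * polyFun l₂ x) * polyFun l₃ x := by simp only [bub, polyFun_mul]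
  rw [e]
  refine ⟨fun h => ?_, fun h h' => ?_, fun h h1 h2 => ?_⟩
  · rw [b10, b01, r10, r01, h]; simp
  · rw [forall_two (P := fun k l => D k l _ x = 0), b00, b10, b01, b20, b11, b02, r10, r01, r20,
      r11, r02, p10, p01, h]
    rcases h' with h' | ⟨h1, h2⟩
    · simp [h']
    · simp [h1, h2]
  · rw [b10, b01, h, h1, h2]
    constructor <;> ring

theorem jb_bub {l₁ l₂ l₃ : MvPolynomial (Fin 2) ℝ} {h A : ℝ} (hh : 0 ≤ h) {x : Plane}
    (h1 : JB h A (polyFun l₁) x) (h2 : JB h A (polyFun l₂) x) (h3 : JB h A (polyFun l₃) x) :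
    JB h (256 * A ^ 5) (polyFun (bub l₁ l₂ l₃)) x := by
  have s1 := polyFun_smooth l₁
  have s2 := polyFun_smooth l₂
  have s3 := polyFun_smooth l₃
  have sp : ContDiff ℝ ∞ (fun x => polyFun l₁ x * polyFun l₂ x) := s1.mul s2
  have p := h1.mul hh s1 s2 h2
  have := (p.mul hh sp sp p).mul hh (sp.mul sp) s3 h3
  simp only [bub, polyFun_mul]
  convert this using 1
  ring

/-- `a i` and `b i` are the components of the gradient of the barycentric coordinate of the vertex
`v i` of a triangle. -/
def Bary (v : Fin 3 → Plane) (a b : Fin 3 → ℝ) : Prop :=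
  ∀ i j, polyFun (lam (a i) (b i) (v i)) (v j) = if i = j then 1 else 0

/-- The midpoint of the edge opposite to the vertex `v i`. -/
def mid (v : Fin 3 → Plane) (i : Fin 3) : Plane := midpoint ℝ (v (i + 1)) (v (i + 2))

theorem midpoint_coord (x y : Plane) (k : Fin 2) : midpoint ℝ x y k = (x k + y k) / 2 := by
  rw [midpoint_eq_smul_add]; simp; ring

theorem Bary.mid {v : Fin 3 → Plane} {a b : Fin 3 → ℝ} (hb : Bary v a b) (i j : Fin 3) :
    polyFun (lam (a i) (b i) (v i)) (mid v j) = if i = j then 0 else 1 / 2 := by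
  have h1 := hb i (j + 1)
  have h2 := hb i (j + 2)
  rw [polyFun_lam] at h1 h2 ⊢
  have e : ∀ k, QGE.mid v j k = (v (j + 1) k + v (j + 2) k) / 2 := midpoint_coord _ _
  have h3 : 1 + a i * ((QGE.mid v j) 0 - v i 0) + b i * ((QGE.mid v j) 1 - v i 1) =
    ((if i = j + 1 then (1 : ℝ) else 0) + if i = j + 2 then 1 else 0) / 2 := by
    rw [← h1, ← h2, e, e]; ring
  rw [h3]
  fin_cases i <;> fin_cases j <;> simp

/-- Interpolation by polynomials of degree at most five of the derivatives of order at most two at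
the vertices of a triangle and of the normal derivatives at the midpoints of the edges, with bounds
that depend only on the shape of the triangle. -/
theorem exists_interp (κ : ℝ) : ∃ C : ℝ, 0 ≤ C ∧ ∀ (v : Fin 3 → Plane) (a b : Fin 3 → ℝ) (h E : ℝ)
    (jet : Fin 3 → ℕ → ℕ → ℝ) (μ ν : Fin 3 → ℝ), 0 < h → Bary v a b →
    (∀ i, |a i| * h ≤ κ) → (∀ i, |b i| * h ≤ κ) → (∀ i j k, |v i k - v j k| ≤ h) →
    (∀ i k l, k + l ≤ 2 → |jet i k l| * h ^ (k + l) ≤ E) → (∀ i, |μ i| * h ≤ E) →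
    (∀ i, |ν i| * h ≤ E) → ∃ p : MvPolynomial (Fin 2) ℝ, p.totalDegree ≤ 5 ∧
      (∀ i k l, k + l ≤ 2 → D k l (polyFun p) (v i) = jet i k l) ∧
      (∀ i, a i * D 1 0 (polyFun p) (mid v i) + b i * D 0 1 (polyFun p) (mid v i) =
        a i * μ i + b i * ν i) ∧
      ∀ x, (∀ i, |polyFun (lam (a i) (b i) (v i)) x| ≤ 1) → (∀ i k, |x k - v i k| ≤ h) →
        JB h (C * E) (polyFun p) x := by
  set K₁ : ℝ := 384 * (1 + κ) ^ 3 * (1 + 6 * κ + 12 * κ ^ 2) with hK₁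
  set K₂ : ℝ := 64 * κ * (1 + 3 * K₁) with hK₂
  -- The absolute value makes the constant nonnegative although `κ` is arbitrary; `κ ≥ 0` is known
  -- only once a triangle is given.
  refine ⟨|3 * K₁ + 3 * (K₂ * (256 * (1 + κ) ^ 5))|, abs_nonneg _, ?_⟩
  intro v a b h E jet μ ν hh hB ha hb hv hj hμ hν
  have hk : 0 ≤ κ := (by positivity : 0 ≤ |a 0| * h).trans (ha 0)
  have hK₁0 : 0 ≤ K₁ := by rw [hK₁]; positivity
  have hE : 0 ≤ E := (by positivity : 0 ≤ |μ 0| * h).trans (hμ 0)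
  set L : Fin 3 → MvPolynomial (Fin 2) ℝ := fun i => lam (a i) (b i) (v i) with hL
  set W : MvPolynomial (Fin 2) ℝ := ∑ i, vtx (a i) (b i) (v i) (jet i) with hW
  -- `W` matches all vertex data; `r` is the defect that it leaves in the normal derivatives at the
  -- midpoints.
  set r : Fin 3 → ℝ := fun i => a i * μ i + b i * ν i -
    (a i * D 1 0 (polyFun W) (mid v i) + b i * D 0 1 (polyFun W) (mid v i)) with hr
  -- At its midpoint the bubble of edge `i` has the derivative `(a i ^ 2 + b i ^ 2) / 16` in the
  -- direction `(a i, b i)`.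
  set c : Fin 3 → ℝ := fun i => 16 * r i / (a i ^ 2 + b i ^ 2) with hc
  set B : Fin 3 → MvPolynomial (Fin 2) ℝ := fun i => bub (L (i + 1)) (L (i + 2)) (L i) with hBdef
  have DW : ∀ k l x, D k l (polyFun W) x =
      ∑ i, D k l (polyFun (vtx (a i) (b i) (v i) (jet i))) x := by
    intro k l x
    rw [hW, polyFun_sum, D_sum _ fun i => polyFun_smooth _]
  have DP : ∀ k l x, D k l (polyFun (W + ∑ i, C (c i) * B i)) x =
      D k l (polyFun W) x + ∑ i, c i * D k l (polyFun (B i)) x := by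
    intro k l x
    have e : D k l (polyFun (∑ i, C (c i) * B i)) x = ∑ i, c i * D k l (polyFun (B i)) x := by
      rw [polyFun_sum, D_sum _ fun i => polyFun_smooth _]
      simp only [polyFun_mul, polyFun_C, D_smul _ (polyFun_smooth _)]
    rw [polyFun_add, D_add (polyFun_smooth _) (polyFun_smooth _)]
    simp only [e]
  have hJBW : ∀ x, (∀ i, |polyFun (lam (a i) (b i) (v i)) x| ≤ 1) → (∀ i k, |x k - v i k| ≤ h) →
      JB h (3 * (K₁ * E)) (polyFun W) x := by
    intro x h1 h2
    have := fun i => jb_vtx hh.le (ha i) (hb i) (hj i) (h1 i) (h2 i)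
    rw [hW, Fin.sum_univ_three, polyFun_add, polyFun_add]
    convert ((this 0).add hh.le (polyFun_smooth _) (polyFun_smooth _) (this 1)).add hh.le
      ((polyFun_smooth _).add (polyFun_smooth _)) (polyFun_smooth _) (this 2) using 1
    ring
  have hmid1 : ∀ i j, |polyFun (lam (a i) (b i) (v i)) (mid v j)| ≤ 1 := by
    intro i j
    rw [hB.mid]; split_ifs <;> norm_num [abs_of_pos]
  have hmid2 : ∀ i j k, |mid v j k - v i k| ≤ h := by
    intro i j k
    have e : mid v j k = (v (j + 1) k + v (j + 2) k) / 2 := midpoint_coord _ _ _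
    rw [e, abs_le]
    have h1 := abs_le.1 (hv (j + 1) i k)
    have h2 := abs_le.1 (hv (j + 2) i k)
    constructor <;> linarith [h1.1, h1.2, h2.1, h2.2]
  -- The barycentric coordinate drops from 1 to 0 between two vertices whose coordinates differ by
  -- at most `h`, so its gradient is at least of order `1 / h`. This bounds the coefficients `c`
  -- from above.
  have hgrad : ∀ i, 1 ≤ 2 * ((a i ^ 2 + b i ^ 2) * h ^ 2) := by
    intro i
    have h1 := hB i (i + 1)
    rw [polyFun_lam, if_neg (by fin_cases i <;> decide)] at h1
    have h2 : 1 = a i * (v i 0 - v (i + 1) 0) + b i * (v i 1 - v (i + 1) 1) := by linarith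
    have h3 := hv i (i + 1) 0
    have h4 := hv i (i + 1) 1
    have h5 : 1 ≤ |a i| * h + |b i| * h := by
      calc (1 : ℝ) ≤ |a i * (v i 0 - v (i + 1) 0)| + |b i * (v i 1 - v (i + 1) 1)| := by
            rw [← abs_one, h2]; exact (abs_add_le _ _)
        _ ≤ _ := by rw [abs_mul, abs_mul]; gcongr
    have h6 : (1 : ℝ) ≤ (|a i| * h + |b i| * h) ^ 2 := by nlinarith
    have h7 := sq_abs (a i)
    have h8 := sq_abs (b i)
    nlinarith [sq_nonneg (|a i| * h - |b i| * h)]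
  have hpos : ∀ i, 0 < a i ^ 2 + b i ^ 2 := by
    intro i
    have := hgrad i
    by_contra hcon
    have h0 : a i ^ 2 + b i ^ 2 = 0 := le_antisymm (not_lt.1 hcon) (by positivity)
    rw [h0] at this; norm_num at this
  have hrb : ∀ i, |r i| * h ^ 2 ≤ 2 * κ * (1 + 3 * K₁) * E := by
    intro i
    have hJ := hJBW (mid v i) (fun j => hmid1 j i) (fun j k => hmid2 j i k)
    have w1 := hJ 1 0 (by norm_num)
    have w2 := hJ 0 1 (by norm_num)
    simp only [add_zero, zero_add, pow_one] at w1 w2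
    set w₁ := D 1 0 (polyFun W) (mid v i)
    set w₂ := D 0 1 (polyFun W) (mid v i)
    have pr : ∀ {x y A : ℝ}, |x| * h ≤ κ → |y| * h ≤ A → |x * y| * h ^ 2 ≤ κ * A := by
      intro x y A h1 h2
      rw [abs_mul, pow_two, mul_mul_mul_comm]
      exact mul_le_mul h1 h2 (by positivity) hk
    have t1 := pr (ha i) (hμ i)
    have t2 := pr (hb i) (hν i)
    have t3 := pr (ha i) w1
    have t4 := pr (hb i) w2
    have t5 : |r i| ≤ |a i * μ i| + |b i * ν i| + (|a i * w₁| + |b i * w₂|) :=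
      (abs_sub _ _).trans (add_le_add (abs_add_le _ _) (abs_add_le _ _))
    have : 0 ≤ h ^ 2 := by positivity
    nlinarith
  have hcb : ∀ i, |c i| ≤ K₂ * E := by
    intro i
    rw [hc]
    simp only
    rw [abs_div, abs_mul, abs_of_pos (hpos i), div_le_iff₀ (hpos i),
      abs_of_pos (by norm_num : (0 : ℝ) < 16)]
    have h1 := hrb i
    have h2 := hgrad i
    have h3 : |r i| ≤ |r i| * (2 * ((a i ^ 2 + b i ^ 2) * h ^ 2)) :=
      le_mul_of_one_le_right (abs_nonneg _) h2
    have h4 : |r i| * h ^ 2 * (a i ^ 2 + b i ^ 2) ≤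
      2 * κ * (1 + 3 * K₁) * E * (a i ^ 2 + b i ^ 2) := mul_le_mul_of_nonneg_right h1 (hpos i).le
    rw [hK₂]
    linarith
  refine ⟨W + ∑ i, C (c i) * B i, ?_, ?_, ?_, ?_⟩
  · refine (totalDegree_add _ _).trans (max_le (totalDegree_finsetSum_le fun i _ =>
      totalDegree_vtx _ _ _ _) (totalDegree_finsetSum_le fun i _ => ?_))
    refine (totalDegree_mul _ _).trans ?_
    rw [totalDegree_C, zero_add]
    have hl : ∀ i, (L i).totalDegree ≤ 1 := fun i => totalDegree_lam _ _ _
    have h1 := (totalDegree_mul (L (i + 1)) (L (i + 2))).trans (add_le_add (hl _) (hl _))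
    exact (totalDegree_mul _ _).trans (add_le_add ((totalDegree_mul _ _).trans (add_le_add h1 h1))
      (hl i))
  · intro i k l hkl
    rw [DP, DW, Finset.sum_eq_single i, D_vtx_self _ _ _ _ _ _ hkl, Finset.sum_eq_zero, add_zero]
    · intro j _
      have key := (D_bub (L (j + 1)) (L (j + 2)) (L j) (v i)).2.1
      have hv1 := hB (j + 1) i
      have hv2 := hB (j + 2) i
      have hv0 := hB j i
      rw [hBdef]
      simp only
      rw [key ?_ ?_ k l hkl, mul_zero]
      · simp only [hL]; rw [hv1, hv2]; fin_cases i <;> fin_cases j <;> simp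
      · simp only [hL]; rw [hv1, hv2, hv0]; fin_cases i <;> fin_cases j <;> simp
    · intro j _ hji
      exact D_vtx_of_eq_zero (by rw [hB, if_neg hji]) _ _ _ hkl
    · simp
  · intro i
    rw [DP, DP, Finset.sum_eq_single i, Finset.sum_eq_single i]
    · obtain ⟨k1, k2⟩ := (D_bub (L (i + 1)) (L (i + 2)) (L i) (mid v i)).2.2
        (by simp only [hL]; rw [hB.mid]; simp)
        (by simp only [hL]; rw [hB.mid, if_neg (by fin_cases i <;> decide)])
        (by simp only [hL]; rw [hB.mid, if_neg (by fin_cases i <;> decide)])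
      rw [hBdef]
      simp only
      rw [k1, k2, hL]
      simp only
      rw [(D_lam _ _ _ _).1, (D_lam _ _ _ _).2.1]
      have := (hpos i).ne'
      have hci : c i * (a i ^ 2 + b i ^ 2) = 16 * r i := by
        rw [hc]; field_simp
      have hri : r i = a i * μ i + b i * ν i -
        (a i * D 1 0 (polyFun W) (mid v i) + b i * D 0 1 (polyFun W) (mid v i)) := rfl
      linear_combination hci / 16 + hri
    all_goals first
      | (intro j _ hji
         obtain ⟨k1, k2⟩ := (D_bub (L (j + 1)) (L (j + 2)) (L j) (mid v i)).1 (by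
          simp only [hL]; rw [hB.mid, hB.mid]
          revert hji; fin_cases i <;> fin_cases j <;> simp)
         rw [hBdef]
         simp only
         first
           | rw [k1, mul_zero]
           | rw [k2, mul_zero])
      | simp
  · intro x h1 h2
    have hw := hJBW x h1 h2
    have hb := fun i => jb_bub hh.le (jb_lam hh.le (ha (i + 1)) (hb (i + 1)) (h1 (i + 1)))
      (jb_lam hh.le (ha (i + 2)) (hb (i + 2)) (h1 (i + 2))) (jb_lam hh.le (ha i) (hb i) (h1 i))
    intro k l hkl
    rw [DP]
    have hw' := hw k l hkl
    have hb' := fun i => hb i k l hkl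
    have hH : 0 ≤ h ^ (k + l) := by positivity
    have hbb : ∀ i, |c i * D k l (polyFun (B i)) x| * h ^ (k + l) ≤
        K₂ * E * (256 * (1 + κ) ^ 5) := by
      intro i
      rw [abs_mul, mul_assoc]
      exact mul_le_mul (hcb i) (hb' i) (by positivity) ((abs_nonneg _).trans (hcb i))
    rw [Fin.sum_univ_three]
    have e1 := abs_add_le (D k l (polyFun W) x) (c 0 * D k l (polyFun (B 0)) x +
      c 1 * D k l (polyFun (B 1)) x + c 2 * D k l (polyFun (B 2)) x)
    have e2 := abs_add_three (c 0 * D k l (polyFun (B 0)) x) (c 1 * D k l (polyFun (B 1)) x)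
      (c 2 * D k l (polyFun (B 2)) x)
    have f0 := hbb 0
    have f1 := hbb 1
    have f2 := hbb 2
    have hfin : (3 * K₁ + 3 * (K₂ * (256 * (1 + κ) ^ 5))) * E ≤
      |3 * K₁ + 3 * (K₂ * (256 * (1 + κ) ^ 5))| * E := mul_le_mul_of_nonneg_right (le_abs_self _) hE
    nlinarith

end

section

open Filter Topology

/-! ### Sobolev functions on a triangle as limits of smooth functions -/

/-- The derivatives of order at most `k` of the smooth functions `u n` converge in `L²(T)` to the
functions `g i j`. -/
structure Approx (T : Set Plane) (k : ℕ) (u : ℕ → Plane → ℝ) (g : ℕ → ℕ → Plane → ℝ) : Prop where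
  smooth : ∀ n, ContDiff ℝ ∞ (u n)
  memLp : ∀ i j, i + j ≤ k → MemLp (g i j) 2 (volume.restrict T)
  tendsto : ∀ i j, i + j ≤ k → Tendsto (fun n => eLpNorm (fun x => D i j (u n) x - g i j x) 2
    (volume.restrict T)) atTop (𝓝 0)

theorem tendsto_integral_of_eLpNorm {α : Type*} [MeasurableSpace α] {μ : Measure α}
    [IsFiniteMeasure μ] {f : ℕ → α → ℝ} {g : α → ℝ} (hf : ∀ n, MemLp (f n) 2 μ) (hg : MemLp g 2 μ)
    (h : Tendsto (fun n => eLpNorm (fun x => f n x - g x) 2 μ) atTop (𝓝 0)) :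
    Tendsto (fun n => ∫ x, f n x ^ 2 ∂μ) atTop (𝓝 (∫ x, g x ^ 2 ∂μ)) ∧
    Tendsto (fun n => ∫ x, f n x ∂μ) atTop (𝓝 (∫ x, g x ∂μ)) := by
  have hL : Tendsto (fun n => (hf n).toLp (f n)) atTop (𝓝 (hg.toLp g)) :=
    (Lp.tendsto_Lp_iff_tendsto_eLpNorm'' f hf g hg).2 h
  have e : ∀ {u : α → ℝ} (hu : MemLp u 2 μ), ‖hu.toLp u‖ ^ 2 = ∫ x, u x ^ 2 ∂μ := by
    intro u hu
    rw [norm_sq_eq_integral]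
    exact integral_congr_ae (by filter_upwards [hu.coeFn_toLp] with x hx; rw [hx])
  have h1 : MemLp (fun _ : α => (1 : ℝ)) 2 μ := memLp_const 1
  have e1 : ∀ {u : α → ℝ} (hu : MemLp u 2 μ), inner ℝ (h1.toLp _) (hu.toLp u) = ∫ x, u x ∂μ := by
    intro u hu
    rw [L2.inner_def]
    refine integral_congr_ae ?_
    filter_upwards [hu.coeFn_toLp, h1.coeFn_toLp] with x hx hx1
    rw [hx, hx1]; simp
  constructor
  · have := (hL.norm.pow 2)
    simpa only [e] using this
  · have h2 := (tendsto_const_nhds (x := h1.toLp _)).inner (𝕜 := ℝ) hL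
    simpa only [e1] using h2

theorem memLp_of_continuous {T : Set Plane} (hT : IsCompact T) {f : Plane → ℝ}
    (hf : Continuous f) : MemLp f 2 (volume.restrict T) := by
  have : IsFiniteMeasure (volume.restrict T) := ⟨by simpa using hT.measure_lt_top⟩
  obtain ⟨C, hC⟩ := hT.exists_bound_of_continuousOn hf.continuousOn
  exact MemLp.of_bound hf.aestronglyMeasurable C
    ((ae_restrict_iff' hT.measurableSet).2 (Eventually.of_forall hC))

theorem Approx.sub {T : Set Plane} (hT : IsCompact T) {k : ℕ} {u : ℕ → Plane → ℝ}
    {g : ℕ → ℕ → Plane → ℝ} (h : Approx T k u g) {q : Plane → ℝ} (hq : ContDiff ℝ ∞ q) :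
    Approx T k (fun n x => u n x - q x) (fun i j x => g i j x - D i j q x) where
  smooth n := (h.smooth n).sub hq
  memLp i j hij := (h.memLp i j hij).sub (memLp_of_continuous hT (continuous_D hq i j))
  tendsto i j hij := by
    refine (h.tendsto i j hij).congr fun n => ?_
    rw [D_sub (h.smooth n) hq]
    simp

theorem Approx.integrals {T : Set Plane} (hT : IsCompact T) {k : ℕ} {u : ℕ → Plane → ℝ}
    {g : ℕ → ℕ → Plane → ℝ} (h : Approx T k u g) {i j : ℕ} (hij : i + j ≤ k) :
    Tendsto (fun n => ∫ x in T, D i j (u n) x ^ 2) atTop (𝓝 (∫ x in T, g i j x ^ 2)) ∧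
    Tendsto (fun n => ∫ x in T, D i j (u n) x) atTop (𝓝 (∫ x in T, g i j x)) := by
  have : IsFiniteMeasure (volume.restrict T) := ⟨by simpa using hT.measure_lt_top⟩
  exact tendsto_integral_of_eLpNorm
    (fun n => memLp_of_continuous hT (continuous_D (h.smooth n) i j)) (h.memLp i j hij)
    (h.tendsto i j hij)

theorem integrableOn_D_sq {T : Set Plane} (hT : IsCompact T) {f : Plane → ℝ}
    (hf : ContDiff ℝ ∞ f) (i j : ℕ) : IntegrableOn (fun x => D i j f x ^ 2) T :=
  ((continuous_D hf i j).pow 2).continuousOn.integrableOn_compact hT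

theorem integral_q1_D {T : Set Plane} (hT : IsCompact T) {f : Plane → ℝ} (hf : ContDiff ℝ ∞ f)
    (i j : ℕ) : ∫ x in T, q1 (D i j f) x =
      (∫ x in T, D (i + 1) j f x ^ 2) + ∫ x in T, D i (j + 1) f x ^ 2 := by
  rw [← integral_add (integrableOn_D_sq hT hf _ _) (integrableOn_D_sq hT hf _ _)]
  refine integral_congr_ae (Eventually.of_forall fun x => ?_)
  simp only [q1, D_D hf]
  rw [add_comm 1 i, add_comm 1 j, zero_add, zero_add]

theorem integral_q2_D {T : Set Plane} (hT : IsCompact T) {f : Plane → ℝ} (hf : ContDiff ℝ ∞ f)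
    (i j : ℕ) : ∫ x in T, q2 (D i j f) x = (∫ x in T, D (i + 2) j f x ^ 2) +
      2 * (∫ x in T, D (i + 1) (j + 1) f x ^ 2) + ∫ x in T, D i (j + 2) f x ^ 2 := by
  have i1 : IntegrableOn (fun x => 2 * D (i + 1) (j + 1) f x ^ 2) T :=
    (integrableOn_D_sq hT hf _ _).const_mul 2
  have i2 : IntegrableOn (fun x => D (i + 2) j f x ^ 2 + 2 * D (i + 1) (j + 1) f x ^ 2) T :=
    (integrableOn_D_sq hT hf _ _).add i1
  rw [← integral_const_mul, ← integral_add (integrableOn_D_sq hT hf _ _) i1,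
    ← integral_add i2 (integrableOn_D_sq hT hf _ _)]
  refine integral_congr_ae (Eventually.of_forall fun x => ?_)
  simp only [q2, D_D hf]
  rw [add_comm 2 i, add_comm 2 j, add_comm 1 i, add_comm 1 j, zero_add, zero_add]

/-- Subtract the mean value. A version without the hypothesis of mean zero is needed because the
smooth approximations of a function of mean zero need not have mean zero; the additional term
disappears in the limit. -/
theorem poincare_mean {C : Set Plane} (hC : Convex ℝ C) (hCc : IsCompact C)
    (hvol : volume C ≠ 0) {d : ℝ} (hd : 0 ≤ d) (hdC : ∀ x ∈ C, ∀ y ∈ C, ‖x - y‖ ≤ d)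
    {f : Plane → ℝ} (hf : ContDiff ℝ ∞ f) :
    ∫ y in C, f y ^ 2 ≤ 4 * d ^ 2 * (∫ y in C, q1 f y) + (∫ y in C, f y) ^ 2 / volume.real C := by
  have hv : 0 < volume.real C := ENNReal.toReal_pos hvol hCc.measure_lt_top.ne
  set I := ∫ y in C, f y with hI
  set c := I / volume.real C with hc
  have i1 : IntegrableOn f C := hf.continuous.continuousOn.integrableOn_compact hCc
  have i2 : IntegrableOn (fun x => f x ^ 2) C :=
    (hf.continuous.pow 2).continuousOn.integrableOn_compact hCc
  have i3 : ∀ r : ℝ, IntegrableOn (fun _ : Plane => r) C := fun r =>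
    continuous_const.continuousOn.integrableOn_compact hCc
  have hg : ContDiff ℝ ∞ (fun x => f x - c) := hf.sub contDiff_const
  have h1 := poincare_convex hC hCc hvol hd hdC hg (by
    rw [integral_sub i1 (i3 c), ← hI, setIntegral_const, hc, smul_eq_mul]
    field_simp; ring)
  have e : ∀ i j, i + j = 1 → ∀ x, D i j (fun x => f x - c) x = D i j f x := by
    intro i j hij x
    have h0 : D i j (fun _ : Plane => c) x = 0 := by
      have := D_mono c 0 0 i j
      have e0 : polyFun (mono c 0 0) = fun _ => c := by funext x; simp [polyFun, mono]
      rw [e0] at this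
      rw [this]
      have h0 : ((0 : ℕ).descFactorial i : ℝ) * (0 : ℕ).descFactorial j = 0 := by
        obtain ⟨rfl, rfl⟩ | ⟨rfl, rfl⟩ : (i = 0 ∧ j = 1) ∨ (i = 1 ∧ j = 0) := by omega
        all_goals simp
      rw [h0]; simp [mono, polyFun]
    rw [D_sub hf contDiff_const]
    simp only [h0, sub_zero]
  have hq : ∀ x, q1 (fun x => f x - c) x = q1 f x := by
    intro x; rw [q1, q1, e 1 0 rfl, e 0 1 rfl]
  simp_rw [hq] at h1
  have e2 : ∀ x, (f x - c) ^ 2 = f x ^ 2 - 2 * c * f x + c ^ 2 := fun x => by ring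
  have i4 : IntegrableOn (fun x => 2 * c * f x) C := i1.const_mul _
  have i5 : IntegrableOn (fun x => f x ^ 2 - 2 * c * f x) C := i2.sub i4
  simp_rw [e2] at h1
  rw [integral_add i5 (i3 _), integral_sub i2 i4, integral_const_mul, ← hI, setIntegral_const,
    smul_eq_mul] at h1
  have : I ^ 2 / volume.real C = 2 * c * I - volume.real C * c ^ 2 := by
    rw [hc]; field_simp; ring
  linarith

theorem Approx.poincare {T : Set Plane} (hT : IsCompact T) (hTc : Convex ℝ T)
    (hvol : volume T ≠ 0) {d : ℝ} (hd : 0 ≤ d) (hdT : ∀ x ∈ T, ∀ y ∈ T, ‖x - y‖ ≤ d) {k : ℕ}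
    {u : ℕ → Plane → ℝ} {g : ℕ → ℕ → Plane → ℝ} (h : Approx T k u g) {i j : ℕ} (hij : i + j + 1 ≤ k)
    (h0 : ∫ x in T, g i j x = 0) : ∫ x in T, g i j x ^ 2 ≤
      4 * d ^ 2 * ((∫ x in T, g (i + 1) j x ^ 2) + ∫ x in T, g i (j + 1) x ^ 2) := by
  obtain ⟨t1, t2⟩ := h.integrals hT (i := i) (j := j) (by omega)
  have t3 := (h.integrals hT (i := i + 1) (j := j) (by omega)).1
  have t4 := (h.integrals hT (i := i) (j := j + 1) (by omega)).1
  have := le_of_tendsto_of_tendsto' t1 (((t3.add t4).const_mul (4 * d ^ 2)).add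
    ((t2.pow 2).div_const (volume.real T))) fun n => by
      have := poincare_mean hTc hT hvol hd hdT (smooth_D (h.smooth n) i j)
      rwa [integral_q1_D hT (h.smooth n)] at this
  rw [h0] at this
  simpa using this

/-- Formulated for a limit `l` of point values of the approximations, so that no pointwise
representative of the Sobolev function has to be chosen. -/
theorem Approx.sobolev {T : Set Plane} (hT : IsCompact T) (hTc : Convex ℝ T)
    {d : ℝ} (hd : 0 ≤ d) (hdT : ∀ x ∈ T, ∀ y ∈ T, ‖x - y‖ ≤ d) {k : ℕ}
    {u : ℕ → Plane → ℝ} {g : ℕ → ℕ → Plane → ℝ} (h : Approx T k u g) {i j : ℕ} (hij : i + j + 2 ≤ k)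
    {x : Plane} (hx : x ∈ T) {l : ℝ} (hl : Tendsto (fun n => D i j (u n) x) atTop (𝓝 l)) :
    volume.real T * l ^ 2 ≤ 3 * ((∫ x in T, g i j x ^ 2) +
      d ^ 2 * ((∫ x in T, g (i + 1) j x ^ 2) + ∫ x in T, g i (j + 1) x ^ 2) +
      d ^ 4 * ((∫ x in T, g (i + 2) j x ^ 2) + 2 * (∫ x in T, g (i + 1) (j + 1) x ^ 2) +
        ∫ x in T, g i (j + 2) x ^ 2)) := by
  have t : ∀ a b, a + b ≤ 2 → Tendsto (fun n => ∫ x in T, D (i + a) (j + b) (u n) x ^ 2) atTop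
      (𝓝 (∫ x in T, g (i + a) (j + b) x ^ 2)) := fun a b hab =>
    (h.integrals hT (i := i + a) (j := j + b) (by omega)).1
  refine le_of_tendsto_of_tendsto' ((hl.pow 2).const_mul _) (((((t 0 0 (by norm_num)).add
    (((t 1 0 (by norm_num)).add (t 0 1 (by norm_num))).const_mul (d ^ 2))).add
    ((((t 2 0 (by norm_num)).add ((t 1 1 (by norm_num)).const_mul 2)).add
      (t 0 2 (by norm_num))).const_mul (d ^ 4))).const_mul 3)) fun n => ?_
  have := sobolev_convex hTc hT Subset.rfl hT hx hd (fun y hy => hdT y hy x hx)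
    (smooth_D (h.smooth n) i j)
  rwa [integral_q1_D hT (h.smooth n), integral_q2_D hT (h.smooth n)] at this

/-- The averaged Taylor polynomial: a polynomial approximation of order `k` on a convex set. -/
theorem Approx.exists_poly {T : Set Plane} (hT : IsCompact T) (hTc : Convex ℝ T)
    (hvol : volume T ≠ 0) {d : ℝ} (hd : 0 ≤ d) (hdT : ∀ x ∈ T, ∀ y ∈ T, ‖x - y‖ ≤ d) {k : ℕ}
    {u : ℕ → Plane → ℝ} {g : ℕ → ℕ → Plane → ℝ} (h : Approx T (k + 1) u g) :
    ∃ Q : MvPolynomial (Fin 2) ℝ, Q.totalDegree ≤ k ∧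
      (∀ i j, i + j ≤ k + 1 → ∫ x in T, (g i j x - D i j (polyFun Q) x) ^ 2 ≤
        (8 * d ^ 2) ^ (k + 1 - (i + j)) *
          ∑ p ∈ Finset.HasAntidiagonal.antidiagonal (k + 1), ∫ x in T, g p.1 p.2 x ^ 2) ∧
      ∀ i j, i + j + 2 ≤ k + 1 → ∀ x ∈ T, ∀ l, Tendsto (fun n => D i j (u n) x) atTop (𝓝 l) →
        volume.real T * (l - D i j (polyFun Q) x) ^ 2 ≤ 4 * (8 * d ^ 2) ^ (k + 1 - (i + j)) *
          ∑ p ∈ Finset.HasAntidiagonal.antidiagonal (k + 1), ∫ x in T, g p.1 p.2 x ^ 2 := by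
  have hv : volume.real T ≠ 0 := (ENNReal.toReal_pos hvol hT.measure_lt_top.ne).ne'
  have : IsFiniteMeasure (volume.restrict T) := ⟨by simpa using hT.measure_lt_top⟩
  -- All derivatives of the remainder of order at most `k` have mean value zero, so Poincaré's
  -- inequality can be iterated.
  obtain ⟨Q, hQ1, hQ2, hQ3⟩ := exists_poly_means hT hv k fun i j => ∫ x in T, g i j x
  set S := ∑ p ∈ Finset.HasAntidiagonal.antidiagonal (k + 1), ∫ x in T, g p.1 p.2 x ^ 2 with hS
  have hA := h.sub hT (polyFun_smooth Q)
  have hnn : ∀ i j, 0 ≤ ∫ x in T, g i j x ^ 2 := fun i j => integral_nonneg fun x => sq_nonneg _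
  have hS0 : 0 ≤ S := Finset.sum_nonneg fun p _ => hnn _ _
  -- Induction on the distance to the order `k + 1`, at which `Q` contributes nothing. Each step
  -- costs `4 d²` and doubles the bound through the two partial derivatives, hence `8 d²`.
  have main : ∀ m i j, i + j + m = k + 1 →
      ∫ x in T, (g i j x - D i j (polyFun Q) x) ^ 2 ≤ (8 * d ^ 2) ^ m * S := by
    intro m
    induction m with
    | zero =>
      intro i j hij
      have : ∀ x, D i j (polyFun Q) x = 0 := hQ2 i j (by omega)
      simp_rw [this, sub_zero]
      rw [pow_zero, one_mul]
      exact Finset.single_le_sum (f := fun p : ℕ × ℕ => ∫ x in T, g p.1 p.2 x ^ 2)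
        (fun p _ => hnn _ _) (Finset.HasAntidiagonal.mem_antidiagonal.2 (by omega : (i, j).1 + (i, j).2 = k + 1))
    | succ m ih =>
      intro i j hij
      have i1 : IntegrableOn (g i j) T := (h.memLp i j (by omega)).integrable (by norm_num)
      have i2 : IntegrableOn (D i j (polyFun Q)) T :=
        (continuous_D (polyFun_smooth Q) i j).continuousOn.integrableOn_compact hT
      have h0 : ∫ x in T, (g i j x - D i j (polyFun Q) x) = 0 := by
        rw [integral_sub i1 i2, hQ3 i j (by omega), sub_self]
      have h1 := hA.poincare hT hTc hvol hd hdT (i := i) (j := j) (by omega) h0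
      have h2 := ih (i + 1) j (by omega)
      have h3 := ih i (j + 1) (by omega)
      refine h1.trans ((mul_le_mul_of_nonneg_left (add_le_add h2 h3) (by positivity)).trans_eq ?_)
      ring
  refine ⟨Q, hQ1, fun i j hij => main _ i j (by omega), fun i j hij x hx l hl => ?_⟩
  have hl' : Tendsto (fun n => D i j (fun x => u n x - polyFun Q x) x) atTop
      (𝓝 (l - D i j (polyFun Q) x)) := by
    refine (hl.sub_const _).congr fun n => ?_
    rw [D_sub (h.smooth n) (polyFun_smooth Q)]
  refine (hA.sobolev hT hTc hd hdT hij hx hl').trans ?_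
  -- With `R` the bound at order `i + j + 2`, the Sobolev inequality gives 3 (64 + 16 + 4) d⁴ R,
  -- which is below 4 · 64 d⁴ R.
  obtain ⟨m, hm⟩ : ∃ m, k + 1 = i + j + (m + 2) := ⟨k + 1 - (i + j) - 2, by omega⟩
  rw [show k + 1 - (i + j) = m + 2 by omega]
  have s0 := main (m + 2) i j (by omega)
  have s1 := main (m + 1) (i + 1) j (by omega)
  have s2 := main (m + 1) i (j + 1) (by omega)
  have s3 := main m (i + 2) j (by omega)
  have s4 := main m (i + 1) (j + 1) (by omega)
  have s5 := main m i (j + 2) (by omega)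
  have hR : 0 ≤ (8 * d ^ 2) ^ m * S := by positivity
  have hd2 : 0 ≤ d ^ 2 := sq_nonneg d
  have hd4 : 0 ≤ d ^ 4 := by positivity
  set R := (8 * d ^ 2) ^ m * S with hRdef
  have e1 : (8 * d ^ 2) ^ (m + 1) * S = 8 * d ^ 2 * R := by rw [hRdef]; ring
  have e2 : (8 * d ^ 2) ^ (m + 2) * S = 64 * d ^ 4 * R := by rw [hRdef]; ring
  rw [e1] at s1 s2
  rw [e2] at s0
  rw [mul_assoc 4, e2]
  have p1 := mul_le_mul_of_nonneg_left (add_le_add s1 s2) hd2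
  have p2 := mul_le_mul_of_nonneg_left (add_le_add (add_le_add s3
    (mul_le_mul_of_nonneg_left s4 (by norm_num : (0 : ℝ) ≤ 2))) s5) hd4
  have hdR : 0 ≤ d ^ 4 * R := by positivity
  linarith

end

section

open Filter Topology

/-! ### Barycentric coordinates of a triangle and local interpolation -/

/-- The barycentric coordinate `λ_i`. -/
def bc (v : Fin 3 → Plane) (a b : Fin 3 → ℝ) (i : Fin 3) (x : Plane) : ℝ :=
  polyFun (lam (a i) (b i) (v i)) x

/-- `v` lists the vertices of the nondegenerate triangle with the vertex set `s`, and `a i`, `b i`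
are the components of the gradient of the barycentric coordinate of `v i`. -/
structure IsTri (s : Finset Plane) (v : Fin 3 → Plane) (a b : Fin 3 → ℝ) : Prop where
  inj : Function.Injective v
  mem_iff : ∀ x, x ∈ s ↔ ∃ i, v i = x
  bary : Bary v a b
  mem_tri : ∀ x, x ∈ tri s ↔ ∀ i, 0 ≤ bc v a b i x
  mem_interior : ∀ x, x ∈ interior (tri s) ↔ ∀ i, 0 < bc v a b i x
  sum_bc : ∀ x, bc v a b 0 x + bc v a b 1 x + bc v a b 2 x = 1
  combo : ∀ x, x = bc v a b 0 x • v 0 + bc v a b 1 x • v 1 + bc v a b 2 x • v 2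

/-- Three affinely independent points form an affine basis of the plane. Its coordinates are affine
functions, hence of the form `lam`, and their signs describe the triangle and its interior. -/
theorem exists_isTri {s : Finset Plane} (hs : s.card = 3)
    (hi : AffineIndependent ℝ ((↑) : s → Plane)) : ∃ v a b, IsTri s v a b := by
  set e : Fin 3 ≃ s := (s.equivFinOfCardEq hs).symm
  set v : Fin 3 → Plane := fun i => e i with hv
  have hind : AffineIndependent ℝ v := hi.comp_embedding e.toEmbedding
  have htop : affineSpan ℝ (range v) = ⊤ := by
    rw [hind.affineSpan_eq_top_iff_card_eq_finrank_add_one]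
    simp
  set B : AffineBasis (Fin 3) ℝ Plane := ⟨v, hind, htop⟩ with hB
  have hBv : ∀ i, B i = v i := fun i => rfl
  set a : Fin 3 → ℝ := fun i => (B.coord i).linear (EuclideanSpace.single 0 1) with ha
  set b : Fin 3 → ℝ := fun i => (B.coord i).linear (EuclideanSpace.single 1 1) with hb
  have key : ∀ i x, bc v a b i x = B.coord i x := by
    intro i x
    have h1 : B.coord i x = (B.coord i).linear (x - v i) + B.coord i (v i) := by
      have := (B.coord i).map_vadd (v i) (x - v i)
      simpa using this
    have h2 : x - v i = (x 0 - v i 0) • EuclideanSpace.single (0 : Fin 2) (1 : ℝ) +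
        (x 1 - v i 1) • EuclideanSpace.single (1 : Fin 2) (1 : ℝ) := by
      ext l; fin_cases l <;> simp
    rw [h1, ← hBv, B.coord_apply_eq, hBv, h2, map_add, map_smul, map_smul, bc, polyFun_lam]
    simp only [smul_eq_mul, ha, hb]
    ring
  have hrange : (s : Set Plane) = range B := by
    ext x
    constructor
    · intro hx; exact ⟨e.symm ⟨x, hx⟩, by rw [hBv, hv]; simp⟩
    · rintro ⟨i, rfl⟩; exact (e i).2
  have htri : tri s = {x | ∀ i, 0 ≤ B.coord i x} := by
    rw [tri, hrange, B.convexHull_eq_nonneg_coord]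
  refine ⟨v, a, b, ⟨fun i j h => e.injective (Subtype.ext h), fun x => ?_, fun i j => ?_,
    fun x => ?_, fun x => ?_, fun x => ?_, fun x => ?_⟩⟩
  · rw [← Finset.mem_coe, hrange]; rfl
  · have := key i (v j)
    rw [bc] at this
    rw [this, ← hBv, B.coord_apply]
  · rw [htri]; simp only [key, mem_ofPred_eq]
  · rw [tri, hrange, B.interior_convexHull]; simp only [key, mem_ofPred_eq]
  · have := B.sum_coord_apply_eq_one x
    rw [Fin.sum_univ_three] at this
    simpa only [key] using this
  · have := B.linear_combination_coord_eq_self x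
    rw [Fin.sum_univ_three] at this
    simp only [key]
    exact this.symm

variable {s : Finset Plane} {v : Fin 3 → Plane} {a b : Fin 3 → ℝ}

theorem IsTri.bc_le_one (h : IsTri s v a b) {x : Plane} (hx : x ∈ tri s) (i : Fin 3) :
    bc v a b i x ≤ 1 := by
  have h1 := (h.mem_tri x).1 hx
  have h2 := h.sum_bc x
  have h3 := h1 0
  have h4 := h1 1
  have h5 := h1 2
  fin_cases i <;> simp only [Fin.zero_eta, Fin.mk_one, Fin.reduceFinMk] <;> linarith

theorem IsTri.abs_bc_le_one (h : IsTri s v a b) {x : Plane} (hx : x ∈ tri s) (i : Fin 3) :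
    |bc v a b i x| ≤ 1 := by
  rw [abs_of_nonneg ((h.mem_tri x).1 hx i)]; exact h.bc_le_one hx i

theorem IsTri.vertex_mem (h : IsTri s v a b) (i : Fin 3) : v i ∈ tri s :=
  subset_convexHull ℝ _ ((h.mem_iff _).2 ⟨i, rfl⟩)

theorem isCompact_tri (s : Finset Plane) : IsCompact (tri s) :=
  Set.Finite.isCompact_convexHull (𝕜 := ℝ) s.finite_toSet

theorem convex_tri (s : Finset Plane) : Convex ℝ (tri s) := convex_convexHull ℝ _

theorem norm_sub_le_diam {s : Finset Plane} {x y : Plane} (hx : x ∈ tri s) (hy : y ∈ tri s) :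
    ‖x - y‖ ≤ Metric.diam (tri s) := by
  rw [← dist_eq_norm]; exact Metric.dist_le_diam_of_mem (isCompact_tri s).isBounded hx hy

theorem abs_coord_le_norm (x : Plane) (k : Fin 2) : |x k| ≤ ‖x‖ := by
  rw [← Real.norm_eq_abs]; exact PiLp.norm_apply_le x k

theorem IsTri.mid_mem (h : IsTri s v a b) (i : Fin 3) : mid v i ∈ tri s :=
  Convex.midpoint_mem (𝕜 := ℝ) (convex_tri s) (h.vertex_mem _) (h.vertex_mem _)

/-- A step of length `r` from the centre of the disc in a coordinate direction stays in the
triangle, where barycentric coordinates take values between 0 and 1. -/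
theorem IsTri.grad_le (h : IsTri s v a b) {c : Plane} {r : ℝ} (hr : 0 < r)
    (hc : Metric.closedBall c r ⊆ tri s) (i : Fin 3) : |a i| * r ≤ 1 ∧ |b i| * r ≤ 1 := by
  have key : ∀ k : Fin 2, |bc v a b i (c + r • EuclideanSpace.single k 1) - bc v a b i c| ≤ 1 := by
    intro k
    have m1 : c + r • EuclideanSpace.single k (1 : ℝ) ∈ tri s := hc (by
      rw [Metric.mem_closedBall, dist_eq_norm, add_sub_cancel_left, norm_smul]
      simp [abs_of_pos hr])
    have m0 : c ∈ tri s := hc (Metric.mem_closedBall_self hr.le)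
    have h1 := (h.mem_tri _).1 m1 i
    have h2 := (h.mem_tri _).1 m0 i
    have h3 := h.bc_le_one m1 i
    have h4 := h.bc_le_one m0 i
    rw [abs_le]; constructor <;> linarith
  have k0 := key 0
  have k1 := key 1
  have e : ∀ k, bc v a b i (c + r • EuclideanSpace.single k 1) - bc v a b i c =
      (if k = 0 then a i else b i) * r := by
    intro k
    simp only [bc, polyFun_lam]
    fin_cases k <;> simp <;> ring
  rw [e, abs_mul, abs_of_pos hr] at k0 k1
  exact ⟨by simpa using k0, by simpa using k1⟩

theorem volume_real_tri_ge {s : Finset Plane} {c : Plane} {r : ℝ} (hr : 0 < r)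
    (hc : Metric.closedBall c r ⊆ tri s) : r ^ 2 ≤ volume.real (tri s) := by
  have h1 : volume.real (Metric.closedBall c r) ≤ volume.real (tri s) :=
    measureReal_mono hc (isCompact_tri s).measure_lt_top.ne
  refine le_trans ?_ h1
  rw [Measure.real, EuclideanSpace.volume_closedBall_fin_two, ENNReal.toReal_mul,
    ENNReal.toReal_pow, ENNReal.toReal_ofReal hr.le]
  rw [ENNReal.toReal_ofReal Real.pi_pos.le]
  nlinarith [sq_nonneg r, Real.pi_gt_three]

theorem volume_real_tri_le (h : IsTri s v a b) :
    volume.real (tri s) ≤ 4 * Metric.diam (tri s) ^ 2 := by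
  have h0 : 0 ≤ Metric.diam (tri s) := Metric.diam_nonneg
  have h1 : tri s ⊆ Metric.closedBall (v 0) (Metric.diam (tri s)) := fun x hx => by
    rw [Metric.mem_closedBall, dist_eq_norm]; exact norm_sub_le_diam hx (h.vertex_mem 0)
  have h2 : volume.real (tri s) ≤ volume.real (Metric.closedBall (v 0) (Metric.diam (tri s))) :=
    measureReal_mono h1 measure_closedBall_lt_top.ne
  refine h2.trans ?_
  rw [Measure.real, EuclideanSpace.volume_closedBall_fin_two, ENNReal.toReal_mul,
    ENNReal.toReal_pow, ENNReal.toReal_ofReal h0, ENNReal.toReal_ofReal Real.pi_pos.le]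
  nlinarith [sq_nonneg (Metric.diam (tri s)), Real.pi_le_four]

/-- The local Argyris interpolation estimate. -/
theorem local_interpolation (σ : ℝ) (k : ℕ) (hk3 : 3 ≤ k) (hk5 : k ≤ 5) :
    ∃ A : ℝ, 0 ≤ A ∧ ∀ (s : Finset Plane) (v : Fin 3 → Plane) (a b : Fin 3 → ℝ) (c : Plane) (r : ℝ)
      (u : ℕ → Plane → ℝ) (g J : ℕ → ℕ → Plane → ℝ), IsTri s v a b → 0 < r →
      Metric.closedBall c r ⊆ tri s → Metric.diam (tri s) ≤ σ * (2 * r) →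
      Approx (tri s) (k + 1) u g →
      (∀ i j, i + j ≤ 2 → ∀ x ∈ tri s, Tendsto (fun n => D i j (u n) x) atTop (𝓝 (J i j x))) →
      ∃ p : MvPolynomial (Fin 2) ℝ, p.totalDegree ≤ 5 ∧
        (∀ i m l, m + l ≤ 2 → D m l (polyFun p) (v i) = J m l (v i)) ∧
        (∀ i, a i * D 1 0 (polyFun p) (mid v i) + b i * D 0 1 (polyFun p) (mid v i) =
          a i * J 1 0 (mid v i) + b i * J 0 1 (mid v i)) ∧
        ∀ m l, m + l = 2 → ∫ x in tri s, (g m l x - D m l (polyFun p) x) ^ 2 ≤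
          A * Metric.diam (tri s) ^ (2 * (k - 1)) *
            ∑ p ∈ Finset.HasAntidiagonal.antidiagonal (k + 1), ∫ x in tri s, g p.1 p.2 x ^ 2 := by
  obtain ⟨C, hC0, hC⟩ := exists_interp (2 * σ)
  -- The first summand is twice the error of the polynomial `Q`. The second is 8 C² · 16 σ² 8^{k+1},
  -- from the correction `P` integrated over a triangle of area at most `4 h²`.
  refine ⟨2 * 8 ^ (k - 1) + 128 * C ^ 2 * σ ^ 2 * 8 ^ (k + 1), by positivity, ?_⟩
  intro s v a b c r u g J ht hr hc hσ hu hJ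
  set h := Metric.diam (tri s) with hh
  have hhr : r ≤ h := by
    have m1 : c + r • EuclideanSpace.single (0 : Fin 2) (1 : ℝ) ∈ tri s := hc (by
      rw [Metric.mem_closedBall, dist_eq_norm, add_sub_cancel_left, norm_smul]
      simp [abs_of_pos hr])
    have := norm_sub_le_diam m1 (hc (Metric.mem_closedBall_self hr.le))
    rw [add_sub_cancel_left, norm_smul] at this
    simpa [abs_of_pos hr] using this
  have hh0 : 0 < h := hr.trans_le hhr
  have hσ0 : 0 < σ := by
    by_contra hcon
    have : σ * (2 * r) ≤ 0 := mul_nonpos_of_nonpos_of_nonneg (not_lt.1 hcon) (by positivity)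
    linarith
  have hT := isCompact_tri s
  have hV1 := volume_real_tri_ge hr hc
  have hV2 := volume_real_tri_le ht
  rw [← hh] at hV2
  have hVpos : 0 < volume.real (tri s) := by nlinarith
  have hvol : volume (tri s) ≠ 0 := fun h0 => by simp [Measure.real, h0] at hVpos
  have : IsFiniteMeasure (volume.restrict (tri s)) := ⟨by simpa using hT.measure_lt_top⟩
  obtain ⟨Q, hQd, hQ1, hQ2⟩ := hu.exists_poly hT (convex_tri s) hvol hh0.le
    (fun x hx y hy => norm_sub_le_diam hx hy)
  set S := ∑ p ∈ Finset.HasAntidiagonal.antidiagonal (k + 1), ∫ x in tri s, g p.1 p.2 x ^ 2 with hS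
  have hS0 : 0 ≤ S := Finset.sum_nonneg fun p _ => integral_nonneg fun x => sq_nonneg _
  -- `E` bounds the scaled derivatives of order at most two of the remainder after subtraction of
  -- `Q`. The factor 16 σ² combines `h² ≤ 4 σ² volume` with the factor 4 in the pointwise estimate.
  set E := Real.sqrt (16 * σ ^ 2 * 8 ^ (k + 1) * h ^ (2 * k) * S) with hE
  have hE2 : E ^ 2 = 16 * σ ^ 2 * 8 ^ (k + 1) * h ^ (2 * k) * S := Real.sq_sqrt (by positivity)
  have hE0 : 0 ≤ E := Real.sqrt_nonneg _
  have hhV : h ^ 2 ≤ 4 * σ ^ 2 * volume.real (tri s) := by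
    calc h ^ 2 ≤ (σ * (2 * r)) ^ 2 := by gcongr
      _ = 4 * σ ^ 2 * r ^ 2 := by ring
      _ ≤ _ := by gcongr
  have hw : ∀ m l, m + l ≤ 2 → ∀ x ∈ tri s,
      |J m l x - D m l (polyFun Q) x| * h ^ (m + l) ≤ E := by
    intro m l hml x hx
    have h1 := hQ2 m l (by omega) x hx _ (hJ m l hml x hx)
    set w := J m l x - D m l (polyFun Q) x
    rw [hE]
    refine Real.le_sqrt_of_sq_le ?_
    rw [mul_pow, sq_abs]
    have h2 : h ^ 2 * w ^ 2 ≤ 4 * σ ^ 2 * (4 * (8 * h ^ 2) ^ (k + 1 - (m + l)) * S) := by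
      calc h ^ 2 * w ^ 2 ≤ 4 * σ ^ 2 * volume.real (tri s) * w ^ 2 := by gcongr
        _ = 4 * σ ^ 2 * (volume.real (tri s) * w ^ 2) := by ring
        _ ≤ _ := by gcongr
    have h3 : h ^ 2 * (w ^ 2 * (h ^ (m + l)) ^ 2) ≤
        h ^ 2 * (16 * σ ^ 2 * 8 ^ (k + 1) * h ^ (2 * k) * S) := by
      calc h ^ 2 * (w ^ 2 * (h ^ (m + l)) ^ 2) = (h ^ 2 * w ^ 2) * (h ^ 2) ^ (m + l) := by
            rw [← pow_mul, ← pow_mul, mul_comm (m + l) 2]; ring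
        _ ≤ 4 * σ ^ 2 * (4 * (8 * h ^ 2) ^ (k + 1 - (m + l)) * S) * (h ^ 2) ^ (m + l) := by gcongr
        _ = 16 * σ ^ 2 * 8 ^ (k + 1 - (m + l)) * (h ^ 2) ^ (k + 1) * S := by
            rw [mul_pow, show (h ^ 2) ^ (k + 1) = (h ^ 2) ^ (k + 1 - (m + l)) * (h ^ 2) ^ (m + l) by
              rw [← pow_add]; congr 1; omega]
            ring
        _ ≤ 16 * σ ^ 2 * 8 ^ (k + 1) * (h ^ 2) ^ (k + 1) * S := by
            gcongr
            · norm_num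
            · omega
        _ = _ := by rw [← pow_mul]; ring
    exact le_of_mul_le_mul_left h3 (by positivity)
  have hgr : ∀ i, |a i| * h ≤ 2 * σ ∧ |b i| * h ≤ 2 * σ := by
    intro i
    obtain ⟨g1, g2⟩ := ht.grad_le hr hc i
    constructor
    · calc |a i| * h ≤ |a i| * (σ * (2 * r)) := by gcongr
        _ = 2 * σ * (|a i| * r) := by ring
        _ ≤ 2 * σ * 1 := by gcongr
        _ = 2 * σ := mul_one _
    · calc |b i| * h ≤ |b i| * (σ * (2 * r)) := by gcongr
        _ = 2 * σ * (|b i| * r) := by ring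
        _ ≤ 2 * σ * 1 := by gcongr
        _ = 2 * σ := mul_one _
  have hcoord : ∀ {x y : Plane}, x ∈ tri s → y ∈ tri s → ∀ k, |x k - y k| ≤ h := fun hx hy k =>
    (abs_coord_le_norm (_ - _) k).trans (norm_sub_le_diam hx hy)
  -- Only the remainder is interpolated: its data are of size `E`, and adding `Q` restores the data
  -- of the original function because `Q` has degree at most five.
  obtain ⟨P, hPd, hP1, hP2, hP3⟩ := hC v a b h E (fun i m l => J m l (v i) - D m l (polyFun Q) (v i))
    (fun i => J 1 0 (mid v i) - D 1 0 (polyFun Q) (mid v i))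
    (fun i => J 0 1 (mid v i) - D 0 1 (polyFun Q) (mid v i)) hh0 ht.bary (fun i => (hgr i).1)
    (fun i => (hgr i).2) (fun i j k => hcoord (ht.vertex_mem i) (ht.vertex_mem j) k)
    (fun i m l hml => hw m l hml _ (ht.vertex_mem i))
    (fun i => by simpa using hw 1 0 (by norm_num) _ (ht.mid_mem i))
    (fun i => by simpa using hw 0 1 (by norm_num) _ (ht.mid_mem i))
  have e : ∀ m l x, D m l (polyFun (Q + P)) x = D m l (polyFun Q) x + D m l (polyFun P) x := by
    intro m l x
    rw [polyFun_add, D_add (polyFun_smooth Q) (polyFun_smooth P)]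
  refine ⟨Q + P, (MvPolynomial.totalDegree_add _ _).trans (max_le (hQd.trans hk5) hPd),
    fun i m l hml => ?_, fun i => ?_, fun m l hml => ?_⟩
  · rw [e, hP1 i m l hml]; ring
  · rw [e, e]; linear_combination hP2 i
  · have hb : ∀ x ∈ tri s, (D m l (polyFun P) x) ^ 2 ≤ (C * E) ^ 2 / h ^ 4 := by
      intro x hx
      have := hP3 x (fun i => ht.abs_bc_le_one hx i) (fun i k => hcoord hx (ht.vertex_mem i) k) m l
        hml.le
      rw [hml] at this
      rw [le_div_iff₀ (by positivity), ← sq_abs,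
        show |D m l (polyFun P) x| ^ 2 * h ^ 4 = (|D m l (polyFun P) x| * h ^ 2) ^ 2 by ring]
      gcongr
    have i1 : MemLp (fun x => g m l x - D m l (polyFun Q) x) 2 (volume.restrict (tri s)) :=
      (hu.memLp m l (by omega)).sub (memLp_of_continuous hT (continuous_D (polyFun_smooth Q) m l))
    have i1' := i1.integrable_sq
    have i2 : IntegrableOn (fun _ : Plane => 2 * ((C * E) ^ 2 / h ^ 4)) (tri s) := integrable_const _
    have h1 := hQ1 m l (by omega)
    calc ∫ x in tri s, (g m l x - D m l (polyFun (Q + P)) x) ^ 2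
        ≤ ∫ x in tri s, (2 * (g m l x - D m l (polyFun Q) x) ^ 2 + 2 * ((C * E) ^ 2 / h ^ 4)) := by
          refine integral_mono_of_nonneg (Eventually.of_forall fun x => sq_nonneg _)
            ((i1'.const_mul 2).add i2) ((ae_restrict_iff' hT.measurableSet).2
            (Eventually.of_forall fun x hx => ?_))
          have := hb x hx
          simp only [e]
          nlinarith [sq_nonneg (g m l x - D m l (polyFun Q) x + D m l (polyFun P) x)]
      _ = 2 * (∫ x in tri s, (g m l x - D m l (polyFun Q) x) ^ 2) +
          volume.real (tri s) * (2 * ((C * E) ^ 2 / h ^ 4)) := by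
          rw [integral_add (i1'.const_mul 2) i2, integral_const_mul, setIntegral_const, smul_eq_mul]
      _ ≤ 2 * ((8 * h ^ 2) ^ (k + 1 - (m + l)) * S) +
          4 * h ^ 2 * (2 * ((C * E) ^ 2 / h ^ 4)) := by gcongr
      _ = _ := by
          obtain ⟨n, rfl⟩ : ∃ n, k = n + 1 := ⟨k - 1, by omega⟩
          rw [mul_pow C E, hE2, hml, show n + 1 + 1 - 2 = n by omega, show n + 1 - 1 = n by omega,
            mul_pow, ← pow_mul]
          have : h ≠ 0 := hh0.ne'
          field_simp
          ring

end

section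

open Filter Topology

/-! ### Smooth approximations of Sobolev functions up to the boundary of convex sets -/

/-- The weak derivative of `u`, extended by zero. -/
def wE (Ω : Set Plane) (i j : ℕ) (u : Plane → ℝ) : Plane → ℝ := Ω.indicator (wL Ω i j u)

variable {Ω : Set Plane}

theorem memLp_wE (hΩ : IsOpen Ω) (i j : ℕ) (u : Plane → ℝ) : MemLp (wE Ω i j u) 2 volume :=
  (memLp_indicator_iff_restrict hΩ.measurableSet).2 (Lp.memLp _)

theorem locallyIntegrable_wE (hΩ : IsOpen Ω) (i j : ℕ) (u : Plane → ℝ) :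
    LocallyIntegrable (wE Ω i j u) :=
  (memLp_wE hΩ i j u).locallyIntegrable (by norm_num)

theorem D_comp_homothety {f : Plane → ℝ} (hf : ContDiff ℝ ∞ f) (c : Plane) (l : ℝ) (i j : ℕ) :
    D i j (fun x => f (c + l • (x - c))) = fun x => l ^ (i + j) * D i j f (c + l • (x - c)) := by
  have h1 : ∀ (v : Fin 2) {f : Plane → ℝ}, ContDiff ℝ ∞ f →
      pd v (fun x => f (c + l • (x - c))) = fun x => l * pd v f (c + l • (x - c)) := by
    intro v f hf
    funext x
    have ha : HasFDerivAt (fun x : Plane => c + l • (x - c)) (l • ContinuousLinearMap.id ℝ Plane) x :=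
      (((hasFDerivAt_id x).sub_const c).const_smul l).const_add c
    have := ((differentiable_of_smooth hf (c + l • (x - c))).hasFDerivAt.comp x ha).fderiv
    rw [pd, show (fun x => f (c + l • (x - c))) = f ∘ fun x => c + l • (x - c) from rfl, this]
    simp [pd]
  have key : ∀ (v : Fin 2) (n : ℕ) {f : Plane → ℝ}, ContDiff ℝ ∞ f →
      (pd v)^[n] (fun x => f (c + l • (x - c))) =
        fun x => l ^ n * (pd v)^[n] f (c + l • (x - c)) := by
    intro v n
    induction n with
    | zero => intro f _; simp
    | succ n ih =>
      intro f hf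
      have hs := smooth_pd_iter hf v n
      have hs2 : ContDiff ℝ ∞ (fun x => (pd v)^[n] f (c + l • (x - c))) :=
        hs.comp (contDiff_const.add ((contDiff_id.sub contDiff_const).const_smul l))
      rw [Function.iterate_succ_apply', ih hf, Function.iterate_succ_apply', pd_smul _
        (differentiable_of_smooth hs2), h1 v hs]
      funext x; ring
  have hs := smooth_pd_iter hf 1 j
  have hsm : ∀ n, (pd 0)^[n] (fun x => l ^ j * (pd 1)^[j] f (c + l • (x - c))) =
      fun x => l ^ j * (pd 0)^[n] (fun x => (pd 1)^[j] f (c + l • (x - c))) x := fun n =>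
    D_smul (l ^ j) (hs.comp (contDiff_const.add ((contDiff_id.sub contDiff_const).const_smul l))) n 0
  rw [D, key 1 j hf, hsm, key 0 i hs]
  funext x
  rw [D, pow_add]; ring

theorem eLpNorm_lin_le {μ : Measure Plane} (C : Set Plane) (a b : ℝ) {F w : Plane → ℝ}
    (hF : AEStronglyMeasurable F μ) (hw : AEStronglyMeasurable w μ) :
    eLpNorm (fun x => a * F x + b * w x) 2 (μ.restrict C) ≤
      ‖a‖ₑ * eLpNorm F 2 μ + ‖b‖ₑ * eLpNorm w 2 μ := by
  have h : eLpNorm (a • F + b • w) 2 μ ≤ ‖a‖ₑ * eLpNorm F 2 μ + ‖b‖ₑ * eLpNorm w 2 μ := by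
    refine (eLpNorm_add_le (hF.const_smul a) (hw.const_smul b) (by norm_num)).trans ?_
    rw [eLpNorm_const_smul, eLpNorm_const_smul]
  exact (eLpNorm_mono_measure _ Measure.restrict_le_self).trans h

/-- Composed with the homothety, mollification reads `u` only in discs contained in `Ω`. On `C` the
derivatives of the smooth functions are therefore mollified weak derivatives times `l ^ (i + j)`,
and this factor tends to one. Thus `C` may reach the boundary of `Ω` without any extension of `u`.
-/
theorem exists_approx (hΩ : IsOpen Ω) {k : ℕ} {u : Plane → ℝ} (hu : MemH k Ω u) {C : Set Plane}
    (hCm : MeasurableSet C) {c : Plane} {l ε : ℕ → ℝ} (hl : Tendsto l atTop (𝓝 1))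
    (hε0 : ∀ n, 0 < ε n) (hε : Tendsto ε atTop (𝓝 0))
    (hC : ∀ n, ∀ x ∈ C, Metric.closedBall (c + l n • (x - c)) (ε n) ⊆ Ω) :
    Approx C k (fun n => hmoll c (l n) (ε n) (wE Ω 0 0 u)) (fun i j => wE Ω i j u) where
  smooth n := hmoll_smooth (hε0 n) (locallyIntegrable_wE hΩ 0 0 u)
  memLp i j _ := (memLp_wE hΩ i j u).restrict C
  tendsto i j hij := by
    have hL := locallyIntegrable_wE hΩ 0 0 u
    have hw : HWD Ω i j (wL Ω 0 0 u) (wL Ω i j u) :=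
      (hu.hwd hΩ hij).congr_ae hΩ (wL_zero_ae hΩ hu).symm (ae_eq_refl _)
    have hD : ∀ n, ∀ x ∈ C, D i j (hmoll c (l n) (ε n) (wE Ω 0 0 u)) x =
        l n ^ (i + j) * hmoll c (l n) (ε n) (wE Ω i j u) x := by
      intro n x hx
      have h1 := congrFun (D_comp_homothety (conv_smooth (moll_kernel.sc (hε0 n)) hL) c (l n) i j) x
      have h2 := D_conv_weak hΩ (moll_kernel.sc (hε0 n)) hw hL (hC n x hx)
      change D i j (fun x => conv (sc (ε n) moll) (wE Ω 0 0 u) (c + l n • (x - c))) x = _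
      rw [h1]
      unfold wE hmoll
      rw [h2]
    set w := wE Ω i j u with hwdef
    have hw2 : MemLp w 2 volume := memLp_wE hΩ i j u
    have hlm : Tendsto (fun n => l n ^ (i + j)) atTop (𝓝 1) := by simpa using hl.pow (i + j)
    have hb : ∀ n, eLpNorm (fun x => D i j (hmoll c (l n) (ε n) (wE Ω 0 0 u)) x - w x) 2
        (volume.restrict C) ≤ ‖l n ^ (i + j)‖ₑ *
          eLpNorm (fun x => hmoll c (l n) (ε n) w x - w x) 2 volume +
          ‖l n ^ (i + j) - 1‖ₑ * eLpNorm w 2 volume := by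
      intro n
      have e : eLpNorm (fun x => D i j (hmoll c (l n) (ε n) (wE Ω 0 0 u)) x - w x) 2
          (volume.restrict C) = eLpNorm (fun x => l n ^ (i + j) *
            (hmoll c (l n) (ε n) w x - w x) + (l n ^ (i + j) - 1) * w x) 2
          (volume.restrict C) := by
        refine eLpNorm_congr_ae ((ae_restrict_iff' hCm).2 (Eventually.of_forall fun x hx => ?_))
        simp only
        rw [hD n x hx]; ring
      have hm : AEStronglyMeasurable (fun x => hmoll c (l n) (ε n) w x - w x) volume :=
        (hmoll_smooth (hε0 n) (locallyIntegrable_wE hΩ i j u)).continuous.aestronglyMeasurable.sub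
          hw2.1
      rw [e]
      exact eLpNorm_lin_le C _ _ hm hw2.1
    refine tendsto_of_tendsto_of_tendsto_of_le_of_le tendsto_const_nhds ?_ (fun n => zero_le)
      hb
    have t1 : Tendsto (fun n => ‖l n ^ (i + j)‖ₑ) atTop (𝓝 1) := by
      have := (continuous_enorm.tendsto (1 : ℝ)).comp hlm
      rwa [enorm_one] at this
    have t2 : Tendsto (fun n => ‖l n ^ (i + j) - 1‖ₑ) atTop (𝓝 0) := by
      have h0 : Tendsto (fun n => l n ^ (i + j) - 1) atTop (𝓝 0) := by simpa using hlm.sub_const 1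
      have := (continuous_enorm.tendsto (0 : ℝ)).comp h0
      rwa [enorm_zero] at this
    have t3 := ENNReal.Tendsto.mul t1 (Or.inl one_ne_zero) (tendsto_hmoll (c := c) hl hε0 hε hw2)
      (Or.inr ENNReal.one_ne_top)
    have t4 := ENNReal.Tendsto.mul_const t2 (Or.inr hw2.2.ne)
    simpa using t3.add t4

/-! ### Continuous representatives of the derivatives of order at most two -/

/-- The Sobolev inequality, applied to differences of the approximations, bounds uniform distances
by `L²` distances of derivatives with up to two additional orders. -/
theorem Approx.uniformCauchy {C : Set Plane} (hC : IsCompact C) (hCc : Convex ℝ C)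
    (hvol : volume C ≠ 0) {k : ℕ} {u : ℕ → Plane → ℝ} {g : ℕ → ℕ → Plane → ℝ}
    (h : Approx C k u g) {i j : ℕ} (hij : i + j + 2 ≤ k) :
    UniformCauchySeqOn (fun n => D i j (u n)) atTop C := by
  have hv : 0 < volume.real C := ENNReal.toReal_pos hvol hC.measure_lt_top.ne
  set d := Metric.diam C with hd
  have hd0 : 0 ≤ d := Metric.diam_nonneg
  set N : ℕ → ℕ → ℕ × ℕ → ℝ := fun a b p =>
    ∫ x in C, (D a b (fun x => u p.1 x - u p.2 x) x) ^ 2 with hN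
  have hNt : ∀ a b, a + b ≤ k → Tendsto (N a b) (atTop ×ˢ atTop) (𝓝 0) := by
    intro a b hab
    have hm : ∀ n, MemLp (D a b (u n)) 2 (volume.restrict C) := fun n =>
      memLp_of_continuous hC (continuous_D (h.smooth n) a b)
    have hL : Tendsto (fun n => (hm n).toLp) atTop (𝓝 ((h.memLp a b hab).toLp)) :=
      (Lp.tendsto_Lp_iff_tendsto_eLpNorm'' _ hm _ _).2 (h.tendsto a b hab)
    have h2 := (((hL.comp tendsto_fst).sub (hL.comp tendsto_snd)).norm.pow 2 :
      Tendsto _ (atTop ×ˢ atTop) _)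
    rw [sub_self, norm_zero, zero_pow two_ne_zero] at h2
    refine h2.congr fun p => ?_
    rw [norm_sq_eq_integral, hN]
    refine integral_congr_ae ?_
    rw [D_sub (h.smooth p.1) (h.smooth p.2)]
    filter_upwards [Lp.coeFn_sub (hm p.1).toLp (hm p.2).toLp, (hm p.1).coeFn_toLp,
      (hm p.2).coeFn_toLp] with x h1 h2 h3
    simp only [Function.comp]
    rw [h1, Pi.sub_apply, h2, h3]
  set R : ℕ × ℕ → ℝ := fun p => 3 * (N i j p + d ^ 2 * (N (i + 1) j p + N i (j + 1) p) +
    d ^ 4 * (N (i + 2) j p + 2 * N (i + 1) (j + 1) p + N i (j + 2) p)) / volume.real C with hR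
  have hRt : Tendsto R (atTop ×ˢ atTop) (𝓝 0) := by
    have := (((hNt i j (by omega)).add (((hNt (i + 1) j (by omega)).add
      (hNt i (j + 1) (by omega))).const_mul (d ^ 2))).add ((((hNt (i + 2) j (by omega)).add
      ((hNt (i + 1) (j + 1) (by omega)).const_mul 2)).add (hNt i (j + 2) (by omega))).const_mul
      (d ^ 4))).const_mul 3 |>.div_const (volume.real C)
    simpa [hR] using this
  have hb : ∀ p : ℕ × ℕ, ∀ x ∈ C, (D i j (u p.1) x - D i j (u p.2) x) ^ 2 ≤ R p := by
    intro p x hx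
    have hs := (h.smooth p.1).sub (h.smooth p.2)
    have := sobolev_convex hCc hC Subset.rfl hC hx hd0 (fun y hy => by
      rw [← dist_eq_norm]; exact Metric.dist_le_diam_of_mem hC.isBounded hy hx) (smooth_D hs i j)
    rw [integral_q1_D hC hs, integral_q2_D hC hs] at this
    rw [hR, le_div_iff₀ hv, mul_comm,
      show D i j (u p.1) x - D i j (u p.2) x = D i j (fun x => u p.1 x - u p.2 x) x from
        (congrFun (D_sub (h.smooth p.1) (h.smooth p.2) i j) x).symm]
    exact this
  rw [Metric.uniformCauchySeqOn_iff]
  intro ε hε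
  have hev : ∀ᶠ p in (atTop ×ˢ atTop : Filter (ℕ × ℕ)), R p < ε ^ 2 :=
    hRt.eventually (gt_mem_nhds (by positivity))
  rw [prod_atTop_atTop_eq, eventually_atTop] at hev
  obtain ⟨⟨n₁, n₂⟩, hn⟩ := hev
  refine ⟨max n₁ n₂, fun m hm n hn' x hx => ?_⟩
  have h1 := hn (m, n) ⟨(le_max_left _ _).trans hm, (le_max_right _ _).trans hn'⟩
  have h2 := hb (m, n) x hx
  rw [Real.dist_eq]
  exact abs_lt_of_sq_lt_sq (h2.trans_lt h1) hε.le

/-- Continuous representatives of the derivatives of order at most two on a convex set. -/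
theorem Approx.exists_jets {C : Set Plane} (hC : IsCompact C) (hCc : Convex ℝ C)
    (hvol : volume C ≠ 0) {u : ℕ → Plane → ℝ} {g : ℕ → ℕ → Plane → ℝ} {k : ℕ} (hk : 4 ≤ k)
    (h : Approx C k u g) : ∃ J : ℕ → ℕ → Plane → ℝ, ∀ i j, i + j ≤ 2 →
      TendstoUniformlyOn (fun n => D i j (u n)) (J i j) atTop C ∧ ContinuousOn (J i j) C ∧
      J i j =ᵐ[volume.restrict C] g i j := by
  have hcau : ∀ i j, i + j ≤ 2 → ∀ x ∈ C, ∃ l, Tendsto (fun n => D i j (u n) x) atTop (𝓝 l) :=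
    fun i j hij x hx => cauchySeq_tendsto_of_complete
      ((h.uniformCauchy hC hCc hvol (by omega : i + j + 2 ≤ k)).cauchySeq hx)
  choose! J hJ using hcau
  refine ⟨J, fun i j hij => ?_⟩
  have hu : TendstoUniformlyOn (fun n => D i j (u n)) (J i j) atTop C :=
    (h.uniformCauchy hC hCc hvol (by omega)).tendstoUniformlyOn_of_tendsto (hJ i j hij)
  refine ⟨hu, hu.continuousOn (Frequently.of_forall fun n =>
    (continuous_D (h.smooth n) i j).continuousOn), ?_⟩
  have hm : ∀ n, MemLp (D i j (u n)) 2 (volume.restrict C) := fun n =>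
    memLp_of_continuous hC (continuous_D (h.smooth n) i j)
  have hL : Tendsto (fun n => (hm n).toLp (D i j (u n))) atTop
      (𝓝 ((h.memLp i j (by omega)).toLp (g i j))) :=
    (Lp.tendsto_Lp_iff_tendsto_eLpNorm'' _ hm _ _).2 (h.tendsto i j (by omega))
  obtain ⟨ns, hns, hae⟩ := tendsto_ae_subseq hL
  have h1 : ∀ᵐ x ∂(volume.restrict C), ∀ n, (hm n).toLp (D i j (u n)) x = D i j (u n) x :=
    ae_all_iff.2 fun n => (hm n).coeFn_toLp
  filter_upwards [hae, h1, (h.memLp i j (by omega)).coeFn_toLp,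
    ae_restrict_mem hC.measurableSet] with x hx1 hx2 hx3 hx4
  simp only [hx2, hx3] at hx1
  exact tendsto_nhds_unique ((hJ i j hij x hx4).comp hns.tendsto_atTop) hx1

/-- If a continuous representative vanishes on a segment, so does its tangential derivative. -/
theorem tangential_eq_zero {C : Set Plane} {u : ℕ → Plane → ℝ} {J : ℕ → ℕ → Plane → ℝ}
    (hu : ∀ n, ContDiff ℝ ∞ (u n)) (hJ : ∀ i j, i + j ≤ 2 →
      TendstoUniformlyOn (fun n => D i j (u n)) (J i j) atTop C ∧ ContinuousOn (J i j) C)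
    {i j : ℕ} (hij : i + j ≤ 1) {x v : Plane} (hseg : ∀ t ∈ Icc (0 : ℝ) 1, x + t • v ∈ C)
    (h0 : ∀ t ∈ Ioo (0 : ℝ) 1, J i j (x + t • v) = 0) {t : ℝ} (ht : t ∈ Icc (0 : ℝ) 1) :
    v 0 * J (i + 1) j (x + t • v) + v 1 * J i (j + 1) (x + t • v) = 0 := by
  set G : ℝ → ℝ := fun t => v 0 * J (i + 1) j (x + t • v) + v 1 * J i (j + 1) (x + t • v) with hG
  have hline : Continuous fun t : ℝ => x + t • v := by fun_prop
  have hGc : ContinuousOn G (Icc 0 1) :=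
    (continuousOn_const.mul ((hJ (i + 1) j (by omega)).2.comp hline.continuousOn hseg)).add
      (continuousOn_const.mul ((hJ i (j + 1) (by omega)).2.comp hline.continuousOn hseg))
  have hG0 : ∀ t ∈ Ioo (0 : ℝ) 1, G t = 0 := by
    intro t ht
    have hU : TendstoUniformlyOn (fun n (t : ℝ) => v 0 * D (i + 1) j (u n) (x + t • v) +
        v 1 * D i (j + 1) (u n) (x + t • v)) G atTop (Ioo 0 1) := by
      have h1 := ((hJ (i + 1) j (by omega)).1.comp fun t : ℝ => x + t • v).mono
        fun t ht => hseg t (Ioo_subset_Icc_self ht)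
      have h2 := ((hJ i (j + 1) (by omega)).1.comp fun t : ℝ => x + t • v).mono
        fun t ht => hseg t (Ioo_subset_Icc_self ht)
      have m : ∀ c : ℝ, UniformContinuous fun y : ℝ => c * y := fun c =>
        uniformContinuous_const_smul c
      exact ((m (v 0)).comp_tendstoUniformlyOn h1).add ((m (v 1)).comp_tendstoUniformlyOn h2)
    -- The derivatives along the segment converge uniformly, so the limit may be differentiated term
    -- by term.
    have hd : HasDerivAt (fun t : ℝ => J i j (x + t • v)) (G t) t := by
      refine hasDerivAt_of_tendstoUniformlyOn isOpen_Ioo hU (Eventually.of_forall fun n t _ => ?_)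
        (fun t ht => (hJ i j (by omega)).1.tendsto_at (hseg t (Ioo_subset_Icc_self ht))) ht
      have := hasDerivAt_line (smooth_D (hu n) i j) x v t
      rwa [D_D (hu n), D_D (hu n), add_comm 1 i, add_comm 1 j, zero_add, zero_add] at this
    have hz : HasDerivAt (fun t : ℝ => J i j (x + t • v)) 0 t :=
      (hasDerivAt_const t (0 : ℝ)).congr_of_eventuallyEq
        (eventually_of_mem (isOpen_Ioo.mem_nhds ht) h0)
    exact hd.unique hz
  -- Continuity carries the identity to the end points, which are the vertices where it is needed.
  have hcl : Icc (0 : ℝ) 1 ⊆ closure (Ioo 0 1) := by rw [closure_Ioo zero_ne_one]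
  have h1 : EqOn G (fun _ => 0) (Icc 0 1) :=
    EqOn.of_subset_closure (s := Ioo 0 1) hG0 hGc continuousOn_const Ioo_subset_Icc_self hcl
  exact h1 ht

end

section

open Filter Topology

/-! ### Geometry of triangulations -/

/-! ### Barycentric coordinates of a single triangle -/

section Triangle

variable {s t : Finset Plane} {v : Fin 3 → Plane} {a b : Fin 3 → ℝ}

theorem bc_eq (v : Fin 3 → Plane) (a b : Fin 3 → ℝ) (i : Fin 3) (x : Plane) :
    bc v a b i x = 1 + a i * (x 0 - v i 0) + b i * (x 1 - v i 1) := polyFun_lam _ _ _ _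

theorem continuous_bc (v : Fin 3 → Plane) (a b : Fin 3 → ℝ) (i : Fin 3) :
    Continuous (bc v a b i) := (polyFun_smooth _).continuous

theorem bc_combo (v : Fin 3 → Plane) (a b : Fin 3 → ℝ) (i : Fin 3) {t : Fin 3 → ℝ}
    (ht : t 0 + t 1 + t 2 = 1) (w : Fin 3 → Plane) :
    bc v a b i (t 0 • w 0 + t 1 • w 1 + t 2 • w 2) =
      t 0 * bc v a b i (w 0) + t 1 * bc v a b i (w 1) + t 2 * bc v a b i (w 2) := by
  simp only [bc_eq, PiLp.add_apply, PiLp.smul_apply, smul_eq_mul]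
  linear_combination (1 - a i * v i 0 - b i * v i 1) * (1 - ht - 1 + ht) -
    (1 - a i * v i 0 - b i * v i 1) * ht

theorem bc_line (v : Fin 3 → Plane) (a b : Fin 3 → ℝ) (i : Fin 3) (x y : Plane) (t : ℝ) :
    bc v a b i (x + t • (y - x)) = (1 - t) * bc v a b i x + t * bc v a b i y := by
  simp only [bc_eq, PiLp.add_apply, PiLp.smul_apply, PiLp.sub_apply, smul_eq_mul]
  ring

theorem IsTri.bc_vertex (h : IsTri s v a b) (i j : Fin 3) :
    bc v a b i (v j) = if i = j then 1 else 0 := h.bary i j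

theorem IsTri.exists_interior (h : IsTri s v a b) : (interior (tri s)).Nonempty := by
  refine ⟨(1 / 3 : ℝ) • v 0 + (1 / 3 : ℝ) • v 1 + (1 / 3 : ℝ) • v 2, (h.mem_interior _).2 fun i => ?_⟩
  rw [bc_combo v a b i (t := fun _ => 1 / 3) (by norm_num) v, h.bc_vertex, h.bc_vertex, h.bc_vertex]
  fin_cases i <;> simp

theorem IsTri.exists_ball (h : IsTri s v a b) :
    ∃ c r, 0 < r ∧ Metric.closedBall c r ⊆ tri s := by
  obtain ⟨c, hc⟩ := h.exists_interior
  obtain ⟨r, hr, hr2⟩ := Metric.isOpen_iff.1 isOpen_interior c hc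
  exact ⟨c, r / 2, by positivity, (Metric.closedBall_subset_ball (by linarith)).trans
    (hr2.trans interior_subset)⟩

theorem IsTri.closure_interior (h : IsTri s v a b) : closure (interior (tri s)) = tri s := by
  rw [(convex_tri s).closure_interior_eq_closure_of_nonempty_interior h.exists_interior,
    (isCompact_tri s).isClosed.closure_eq]

theorem volume_tri_diff_interior (s : Finset Plane) : volume (tri s \ interior (tri s)) = 0 := by
  have := (convex_tri s).addHaar_frontier (volume : Measure Plane)
  rwa [frontier, (isCompact_tri s).isClosed.closure_eq] at this

/-- The points of an edge in terms of the end points. -/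
theorem IsTri.edge (h : IsTri s v a b) {x : Plane} {i : Fin 3} (hi : bc v a b i x = 0) :
    bc v a b (i + 1) x + bc v a b (i + 2) x = 1 ∧
    x = v (i + 1) + bc v a b (i + 2) x • (v (i + 2) - v (i + 1)) := by
  have hs := h.sum_bc x
  have hc := h.combo x
  have key : bc v a b (i + 1) x + bc v a b (i + 2) x = 1 := by
    fin_cases i <;> simp only [Fin.zero_eta, Fin.mk_one, Fin.reduceFinMk, Fin.reduceAdd, zero_add] at * <;>
      linarith
  refine ⟨key, ?_⟩
  have hx : x = bc v a b (i + 1) x • v (i + 1) + bc v a b (i + 2) x • v (i + 2) := by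
    conv_lhs => rw [hc]
    fin_cases i <;> simp only [Fin.zero_eta, Fin.mk_one, Fin.reduceFinMk, Fin.reduceAdd, zero_add] at * <;>
    · rw [hi]; module
  conv_lhs => rw [hx]
  rw [show bc v a b (i + 1) x = 1 - bc v a b (i + 2) x by linarith]
  module

end Triangle

/-! ### How the triangles meet each other and the boundary -/

variable {Ω : Set Plane} {K : Geometry.SimplicialComplex ℝ Plane}

theorem exists_isTri_of_mem {s : Finset Plane} (hs : s ∈ triangles K) : ∃ v a b, IsTri s v a b :=
  exists_isTri hs.2 (K.indep hs.1)

theorem finite_triangles (hK : IsTriangulation K Ω) : (triangles K).Finite :=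
  hK.1.subset fun _ h => h.1

theorem tri_subset_closure (hK : IsTriangulation K Ω) {s : Finset Plane} (hs : s ∈ triangles K) :
    tri s ⊆ closure Ω := by
  rw [← hK.2]; exact K.convexHull_subset_space hs.1

theorem interior_tri_subset (hP : IsPolygonalDomain Ω) (hK : IsTriangulation K Ω)
    {s : Finset Plane} (hs : s ∈ triangles K) : interior (tri s) ⊆ Ω := by
  rw [← hP.interior_closure]; exact interior_mono (tri_subset_closure hK hs)

/-- A point common to two triangles lies opposite to the vertices that are not shared. -/
theorem bc_eq_zero_of_not_mem {s t : Finset Plane} (hs : s ∈ triangles K) (ht : t ∈ triangles K)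
    {v : Fin 3 → Plane} {a b : Fin 3 → ℝ} (h : IsTri s v a b) {x : Plane} (hxs : x ∈ tri s)
    (hxt : x ∈ tri t) {i : Fin 3} (hi : v i ∉ t) : bc v a b i x = 0 := by
  have hx := K.inter_subset_convexHull hs.1 ht.1 ⟨hxs, hxt⟩
  have hconv : Convex ℝ {x | bc v a b i x = 0} := by
    intro x hx y hy p q hp hq hpq
    rw [mem_ofPred_eq] at hx hy ⊢
    have e : p • x + q • y = x + q • (y - x) := by
      rw [show p = 1 - q by linarith]; module
    rw [e, bc_line, hx, hy]; ring
  refine convexHull_min ?_ hconv hx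
  rintro y ⟨hys, hyt⟩
  obtain ⟨j, rfl⟩ := (h.mem_iff y).1 hys
  rw [mem_ofPred_eq, h.bc_vertex, if_neg]
  rintro rfl
  exact hi hyt

theorem exists_not_mem {s t : Finset Plane} (hs : s ∈ triangles K) (ht : t ∈ triangles K)
    (hst : s ≠ t) {v : Fin 3 → Plane} {a b : Fin 3 → ℝ} (h : IsTri s v a b) : ∃ i, v i ∉ t := by
  by_contra hcon
  push Not at hcon
  refine hst (Finset.eq_of_subset_of_card_le (fun x hx => ?_) (by rw [hs.2, ht.2]))
  obtain ⟨i, rfl⟩ := (h.mem_iff x).1 hx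
  exact hcon i

/-- At some vertex of `s` that is not a vertex of `t`, common points have the barycentric coordinate
zero, whereas it is positive in the interior of `s`. -/
theorem disjoint_interior {s t : Finset Plane} (hs : s ∈ triangles K) (ht : t ∈ triangles K)
    (hst : s ≠ t) : Disjoint (interior (tri s)) (tri t) := by
  obtain ⟨v, a, b, h⟩ := exists_isTri_of_mem hs
  obtain ⟨i, hi⟩ := exists_not_mem hs ht hst h
  rw [disjoint_left]
  intro x hx hxt
  have h1 := bc_eq_zero_of_not_mem hs ht h (interior_subset hx) hxt hi
  have h2 := (h.mem_interior x).1 hx i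
  linarith

/-- The complex could have points or segments that are not faces of triangles. They are null sets,
whereas the part of `Ω` outside all triangles is open, so it must be empty. -/
theorem closure_eq_iUnion (hP : IsPolygonalDomain Ω) (hK : IsTriangulation K Ω) :
    closure Ω = ⋃ s ∈ triangles K, tri s := by
  have hcl : IsClosed (⋃ s ∈ triangles K, tri s) :=
    (finite_triangles hK).isClosed_biUnion fun s _ => (isCompact_tri s).isClosed
  refine Subset.antisymm (closure_minimal ?_ hcl) (iUnion₂_subset fun s hs => tri_subset_closure hK hs)
  intro x hx
  by_contra hcon
  have hopen : IsOpen (Ω \ ⋃ s ∈ triangles K, tri s) := hP.isOpen.sdiff hcl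
  have hpos := hopen.measure_pos volume ⟨x, hx, hcon⟩
  have hnull : ∀ f ∈ K.faces \ triangles K, volume (convexHull ℝ (f : Set Plane)) = 0 := by
    rintro f ⟨hf, hf3⟩
    have hind := K.indep hf
    have hne : affineSpan ℝ (f : Set Plane) ≠ ⊤ := by
      intro htop
      have h1 : affineSpan ℝ (range ((↑) : f → Plane)) = ⊤ := by
        simpa [Subtype.range_coe_subtype] using htop
      rw [hind.affineSpan_eq_top_iff_card_eq_finrank_add_one] at h1
      exact hf3 ⟨hf, by simpa using h1⟩
    exact measure_mono_null (convexHull_subset_affineSpan _)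
      (Measure.addHaar_affineSubspace volume _ hne)
  have hsub : Ω \ ⋃ s ∈ triangles K, tri s ⊆ ⋃ f ∈ K.faces \ triangles K,
      convexHull ℝ (f : Set Plane) := by
    rintro y ⟨hy, hy2⟩
    have hy3 : y ∈ K.space := by rw [hK.2]; exact subset_closure hy
    obtain ⟨f, hf, hyf⟩ := Geometry.SimplicialComplex.mem_space_iff.1 hy3
    refine mem_iUnion₂.2 ⟨f, ⟨hf, fun hf3 => hy2 (mem_iUnion₂.2 ⟨f, hf3, hyf⟩)⟩, hyf⟩
  have hzero : volume (⋃ f ∈ K.faces \ triangles K, convexHull ℝ (f : Set Plane)) = 0 :=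
    (measure_biUnion_null_iff (hK.1.subset sdiff_subset).countable).2 hnull
  exact hpos.ne' (measure_mono_null hsub hzero)

theorem exists_tri_of_mem (hP : IsPolygonalDomain Ω) (hK : IsTriangulation K Ω) {x : Plane}
    (hx : x ∈ closure Ω) : ∃ s ∈ triangles K, x ∈ tri s := by
  rw [closure_eq_iUnion hP hK] at hx
  simpa using hx

theorem isCompact_closure (hK : IsTriangulation K Ω) : IsCompact (closure Ω) := by
  rw [← hK.2]
  exact hK.1.isCompact_biUnion fun f _ => Set.Finite.isCompact_convexHull (𝕜 := ℝ) f.finite_toSet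

theorem isBounded_domain (hK : IsTriangulation K Ω) : Bornology.IsBounded Ω :=
  (isCompact_closure hK).isBounded.subset subset_closure

/-- Near a point, only the triangles that contain the point matter. -/
theorem exists_ball_tri (hK : IsTriangulation K Ω) (x : Plane) :
    ∃ δ > 0, ∀ t ∈ triangles K, (Metric.ball x δ ∩ tri t).Nonempty → x ∈ tri t := by
  have hcl : IsClosed (⋃ t ∈ {t | t ∈ triangles K ∧ x ∉ tri t}, tri t) :=
    ((finite_triangles hK).subset fun t h => h.1).isClosed_biUnion
      fun s _ => (isCompact_tri s).isClosed
  have hx : x ∈ (⋃ t ∈ {t | t ∈ triangles K ∧ x ∉ tri t}, tri t)ᶜ := by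
    simp only [mem_compl_iff, mem_iUnion, not_exists]
    rintro t ⟨_, h⟩ h'
    exact h h'
  obtain ⟨δ, hδ, hb⟩ := Metric.isOpen_iff.1 hcl.isOpen_compl x hx
  refine ⟨δ, hδ, fun t ht ⟨y, hy, hyt⟩ => ?_⟩
  by_contra hcon
  exact hb hy (mem_iUnion₂.2 ⟨t, ⟨ht, hcon⟩, hyt⟩)

/-- An open edge that contains a point outside `Ω` belongs to one triangle only. -/
theorem not_shared_of_not_mem (hP : IsPolygonalDomain Ω) (hK : IsTriangulation K Ω)
    {s : Finset Plane} (hs : s ∈ triangles K) {v : Fin 3 → Plane} {a b : Fin 3 → ℝ}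
    (h : IsTri s v a b) {i : Fin 3} {y : Plane} (hy : y ∉ Ω) (h0 : bc v a b i y = 0)
    (h1 : 0 < bc v a b (i + 1) y) (h2 : 0 < bc v a b (i + 2) y) {t : Finset Plane}
    (ht : t ∈ triangles K) (m1 : v (i + 1) ∈ t) (m2 : v (i + 2) ∈ t) : t = s := by
  by_contra hts
  obtain ⟨v', a', b', h'⟩ := exists_isTri_of_mem ht
  have hvi : v i ∉ t := by
    intro hvi
    obtain ⟨j, hj⟩ := exists_not_mem hs ht (Ne.symm hts) h
    have : j = i ∨ j = i + 1 ∨ j = i + 2 := by clear * -; revert i j; decide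
    rcases this with rfl | rfl | rfl
    exacts [hj hvi, hj m1, hj m2]
  obtain ⟨j1, e1⟩ := (h'.mem_iff _).1 m1
  obtain ⟨j2, e2⟩ := (h'.mem_iff _).1 m2
  have hne : v (i + 1) ≠ v (i + 2) := fun e => by
    have := h.inj e
    clear * - this; revert i; decide
  have hj12 : j1 ≠ j2 := fun e => hne (by rw [← e1, ← e2, e])
  obtain ⟨k, hk1, hk2, hk⟩ : ∃ k : Fin 3, k ≠ j1 ∧ k ≠ j2 ∧ ∀ j, j = k ∨ j = j1 ∨ j = j2 := by
    clear * - hj12; revert j1 j2; decide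
  obtain ⟨hsum, hyv⟩ := h.edge h0
  set θ := bc v a b (i + 2) y with hθ
  have hyb : ∀ j, bc v' a' b' j y =
      (1 - θ) * bc v' a' b' j (v (i + 1)) + θ * bc v' a' b' j (v (i + 2)) := by
    intro j; conv_lhs => rw [hyv]
    rw [bc_line]
  have hθ1 : 0 < 1 - θ := by linarith
  have hpos' : ∀ j, j ≠ k → 0 < bc v' a' b' j y := by
    intro j hj
    rw [hyb, ← e1, ← e2, h'.bc_vertex, h'.bc_vertex]
    rcases hk j with rfl | rfl | rfl
    · exact absurd rfl hj
    · rw [if_pos rfl, if_neg hj12]; linarith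
    · rw [if_neg hj12.symm, if_pos rfl]; linarith
  -- Both coordinates vanish on the common edge, hence they are proportional.
  have hprop : ∀ x, bc v' a' b' k x = bc v a b i x * bc v' a' b' k (v i) := by
    intro x
    conv_lhs => rw [h.combo x]
    have z1 : bc v' a' b' k (v (i + 1)) = 0 := by rw [← e1, h'.bc_vertex, if_neg hk1]
    have z2 : bc v' a' b' k (v (i + 2)) = 0 := by rw [← e2, h'.bc_vertex, if_neg hk2]
    rw [bc_combo v' a' b' k (t := fun j => bc v a b j x) (h.sum_bc x) v]
    fin_cases i <;> simp only [Fin.zero_eta, Fin.mk_one, Fin.reduceFinMk, Fin.reduceAdd, zero_add] at * <;>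
    · rw [z1, z2]; ring
  have hnear : ∀ᶠ x in 𝓝 y, 0 < bc v a b (i + 1) x ∧ 0 < bc v a b (i + 2) x ∧
      ∀ j, j ≠ k → 0 < bc v' a' b' j x := by
    refine ((continuous_bc v a b (i + 1)).continuousAt.eventually (lt_mem_nhds h1)).and
      (((continuous_bc v a b (i + 2)).continuousAt.eventually (lt_mem_nhds h2)).and ?_)
    rw [eventually_all]
    intro j
    by_cases hj : j = k
    · exact Eventually.of_forall fun x h => absurd hj h
    · filter_upwards [(continuous_bc v' a' b' j).continuousAt.eventually
        (lt_mem_nhds (hpos' j hj))] with x hx _ using hx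
  have memS : ∀ x, 0 < bc v a b (i + 1) x → 0 < bc v a b (i + 2) x → 0 ≤ bc v a b i x →
      x ∈ tri s := by
    intro x k1 k2 k0
    refine (h.mem_tri x).2 fun j => ?_
    have : j = i ∨ j = i + 1 ∨ j = i + 2 := by clear * -; revert i j; decide
    rcases this with rfl | rfl | rfl
    exacts [k0, k1.le, k2.le]
  have memT : ∀ x, (∀ j, j ≠ k → 0 < bc v' a' b' j x) → 0 ≤ bc v' a' b' k x → x ∈ tri t := by
    intro x k1 k0
    refine (h'.mem_tri x).2 fun j => ?_
    by_cases hj : j = k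
    · rw [hj]; exact k0
    · exact (k1 j hj).le
  -- If both triangles lay on the same side of the edge, points slightly off `y` towards `v i` would
  -- belong to both, although the coordinate of `v i` vanishes at common points.
  have hneg : bc v' a' b' k (v i) ≤ 0 := by
    by_contra hcon
    rw [not_le] at hcon
    have hl : Tendsto (fun δ : ℝ => y + δ • (v i - y)) (𝓝[>] 0) (𝓝 y) := by
      have : Continuous fun δ : ℝ => y + δ • (v i - y) := by fun_prop
      have h3 := this.tendsto 0
      rw [zero_smul, add_zero] at h3
      exact h3.mono_left nhdsWithin_le_nhds
    obtain ⟨δ, ⟨k1, k2, k3⟩, hδ⟩ := ((hl.eventually hnear).and self_mem_nhdsWithin).exists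
    have hδ' : 0 < δ := hδ
    have hb : bc v a b i (y + δ • (v i - y)) = δ := by
      rw [bc_line, h0, h.bc_vertex, if_pos rfl]; ring
    have hxs := memS _ k1 k2 (by rw [hb]; exact hδ'.le)
    have hxt := memT _ k3 (by rw [hprop, hb]; positivity)
    have := bc_eq_zero_of_not_mem hs ht h hxs hxt hvi
    rw [hb] at this
    linarith
  -- The triangles lie on opposite sides and together fill a neighbourhood of `y`. As `Ω` is the
  -- interior of its closure, this contradicts `y ∉ Ω`.
  have hint : y ∈ interior (closure Ω) := by
    rw [mem_interior_iff_mem_nhds]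
    filter_upwards [hnear] with x ⟨k1, k2, k3⟩
    rcases le_or_gt 0 (bc v a b i x) with hx | hx
    · exact tri_subset_closure hK hs (memS x k1 k2 hx)
    · exact tri_subset_closure hK ht (memT x k3 (by
        rw [hprop]; exact mul_nonneg_of_nonpos_of_nonpos hx.le hneg))
  rw [hP.interior_closure] at hint
  exact hy hint

/-- An open edge that contains a point outside `Ω` does not meet `Ω`. -/
theorem edge_not_mem (hP : IsPolygonalDomain Ω) (hK : IsTriangulation K Ω)
    {s : Finset Plane} (hs : s ∈ triangles K) {v : Fin 3 → Plane} {a b : Fin 3 → ℝ}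
    (h : IsTri s v a b) {i : Fin 3} {y : Plane} (hy : y ∉ Ω) (h0 : bc v a b i y = 0)
    (h1 : 0 < bc v a b (i + 1) y) (h2 : 0 < bc v a b (i + 2) y) {z : Plane}
    (z0 : bc v a b i z = 0) (z1 : 0 < bc v a b (i + 1) z) (z2 : 0 < bc v a b (i + 2) z) :
    z ∉ Ω := by
  intro hz
  have hzs : z ∈ tri s := by
    refine (h.mem_tri z).2 fun j => ?_
    have : j = i ∨ j = i + 1 ∨ j = i + 2 := by clear * -; revert i j; decide
    rcases this with rfl | rfl | rfl
    exacts [z0.ge, z1.le, z2.le]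
  -- A triangle through `z` contains both end points of the edge, and the edge is not shared.
  have honly : ∀ t ∈ triangles K, z ∈ tri t → t = s := by
    intro t ht hzt
    have mem : ∀ j, 0 < bc v a b j z → v j ∈ t := by
      intro j hj
      by_contra hcon
      have := bc_eq_zero_of_not_mem hs ht h hzs hzt hcon
      linarith
    exact not_shared_of_not_mem hP hK hs h hy h0 h1 h2 ht (mem _ z1) (mem _ z2)
  obtain ⟨δ, hδ, hb⟩ := exists_ball_tri hK z
  -- Near `z ∈ Ω` every point lies in a triangle through `z`, and `s` is the only one. Then `z`
  -- would be interior to `s`, although it lies on an edge.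
  have hint : z ∈ interior (tri s) := by
    rw [mem_interior_iff_mem_nhds]
    filter_upwards [Metric.ball_mem_nhds z hδ, hP.isOpen.mem_nhds hz] with x hx hxΩ
    obtain ⟨t, ht, hxt⟩ := exists_tri_of_mem hP hK (subset_closure hxΩ)
    rwa [honly t ht (hb t ht ⟨x, hx, hxt⟩)] at hxt
  have := (h.mem_interior z).1 hint i
  linarith

end

section

open Filter Topology

variable {Ω : Set Plane} {K : Geometry.SimplicialComplex ℝ Plane} {u : Plane → ℝ}

/-! ### Continuous jets of Sobolev functions on the closed domain -/

/-- `J` is a continuous representative on `C` of the derivatives of order at most two. -/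
def IsJet (C : Set Plane) (g J : ℕ → ℕ → Plane → ℝ) : Prop :=
  ∀ i j, i + j ≤ 2 → ContinuousOn (J i j) C ∧ J i j =ᵐ[volume.restrict C] g i j

/-- Shrinking the triangle by `1 - δ` towards the centre of a disc of radius `r` inside it leaves
room for discs of radius less than `r δ`; the mollifier uses half of that. -/
theorem exists_approx_tri (hP : IsPolygonalDomain Ω) (hK : IsTriangulation K Ω) {k : ℕ}
    (hu : MemH k Ω u) {s : Finset Plane} (hs : s ∈ triangles K) :
    ∃ w : ℕ → Plane → ℝ, Approx (tri s) k w (fun i j => wE Ω i j u) := by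
  obtain ⟨v, a, b, h⟩ := exists_isTri_of_mem hs
  obtain ⟨c, r, hr, hc⟩ := h.exists_ball
  have ht : Tendsto (fun n : ℕ => 1 / ((n : ℝ) + 2)) atTop (𝓝 0) := by
    have := (tendsto_const_div_atTop_nhds_zero_nat (1 : ℝ)).comp (tendsto_add_atTop_nat 2)
    refine this.congr fun n => ?_
    simp
  have hl : Tendsto (fun n : ℕ => 1 - 1 / ((n : ℝ) + 2)) atTop (𝓝 1) := by
    simpa using tendsto_const_nhds.sub ht
  have he : Tendsto (fun n : ℕ => r / 2 * (1 / ((n : ℝ) + 2))) atTop (𝓝 0) := by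
    simpa using tendsto_const_nhds.mul ht
  refine ⟨_, exists_approx hP.isOpen hu (isCompact_tri s).measurableSet (c := c) hl
    (fun n => by positivity) he fun n x hx y hy => ?_⟩
  refine interior_tri_subset hP hK hs ?_
  set δ : ℝ := 1 / ((n : ℝ) + 2) with hδ
  have hδ0 : 0 < δ := by positivity
  have hδ1 : δ ≤ 1 := by
    rw [hδ, div_le_one (by positivity)]; have := (Nat.cast_nonneg n : (0 : ℝ) ≤ n); linarith
  have hball : Metric.ball c r ⊆ interior (tri s) :=
    interior_maximal (Metric.ball_subset_closedBall.trans hc) Metric.isOpen_ball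
  -- This point is chosen so that `y` is its convex combination with `x`, with the weights `δ` and
  -- `1 - δ`.
  have h1 : c + δ⁻¹ • (y - (c + (1 - δ) • (x - c))) ∈ interior (tri s) := by
    apply hball
    rw [Metric.mem_ball, dist_eq_norm, add_sub_cancel_left, norm_smul, norm_inv, Real.norm_eq_abs,
      abs_of_pos hδ0, inv_mul_lt_iff₀ hδ0]
    rw [Metric.mem_closedBall, dist_eq_norm] at hy
    nlinarith [mul_pos hr hδ0]
  have h2 := (convex_tri s).combo_interior_self_mem_interior h1 hx hδ0 (sub_nonneg.2 hδ1)
    (by ring)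
  convert h2 using 1
  rw [smul_add, smul_smul, mul_inv_cancel₀ hδ0.ne', one_smul]
  module

theorem exists_jet_tri (hP : IsPolygonalDomain Ω) (hK : IsTriangulation K Ω) {k : ℕ} (hk : 4 ≤ k)
    (hu : MemH k Ω u) {s : Finset Plane} (hs : s ∈ triangles K) :
    ∃ (w : ℕ → Plane → ℝ) (J : ℕ → ℕ → Plane → ℝ), Approx (tri s) k w (fun i j => wE Ω i j u) ∧
      (∀ i j, i + j ≤ 2 → TendstoUniformlyOn (fun n => D i j (w n)) (J i j) atTop (tri s)) ∧
      IsJet (tri s) (fun i j => wE Ω i j u) J := by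
  obtain ⟨v, a, b, h⟩ := exists_isTri_of_mem hs
  obtain ⟨c, r, hr, hc⟩ := h.exists_ball
  have hvol : volume (tri s) ≠ 0 := ((Metric.measure_closedBall_pos volume c hr).trans_le
    (measure_mono hc)).ne'
  obtain ⟨w, hw⟩ := exists_approx_tri hP hK hu hs
  obtain ⟨J, hJ⟩ := hw.exists_jets (isCompact_tri s) (convex_tri s) hvol hk
  exact ⟨w, J, hw, fun i j hij => (hJ i j hij).1, fun i j hij => (hJ i j hij).2⟩

theorem exists_jet_ball (hΩ : IsOpen Ω) {k : ℕ} (hk : 4 ≤ k) (hu : MemH k Ω u) {x : Plane}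
    (hx : x ∈ Ω) : ∃ (r : ℝ) (J : ℕ → ℕ → Plane → ℝ), 0 < r ∧ Metric.closedBall x r ⊆ Ω ∧
      IsJet (Metric.closedBall x r) (fun i j => wE Ω i j u) J := by
  obtain ⟨R, hR, hRs⟩ := Metric.nhds_basis_closedBall.mem_iff.1 (hΩ.mem_nhds hx)
  have ht : Tendsto (fun n : ℕ => 1 / ((n : ℝ) + 2)) atTop (𝓝 0) := by
    have := (tendsto_const_div_atTop_nhds_zero_nat (1 : ℝ)).comp (tendsto_add_atTop_nat 2)
    refine this.congr fun n => ?_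
    simp
  have he : Tendsto (fun n : ℕ => R / 2 * (1 / ((n : ℝ) + 2))) atTop (𝓝 0) := by
    simpa using tendsto_const_nhds.mul ht
  have hw := exists_approx hΩ hu (C := Metric.closedBall x (R / 2)) (c := x)
    Metric.isClosed_closedBall.measurableSet (tendsto_const_nhds (x := (1 : ℝ)))
    (fun n => by positivity) he (fun n y hy z hz => hRs (by
      rw [one_smul, add_sub_cancel] at hz
      rw [Metric.mem_closedBall] at hy hz ⊢
      have h1 : 1 / ((n : ℝ) + 2) ≤ 1 := by
        rw [div_le_one (by positivity)]; have := (Nat.cast_nonneg n : (0 : ℝ) ≤ n); linarith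
      have := dist_triangle z y x
      nlinarith))
  obtain ⟨J, hJ⟩ := hw.exists_jets (isCompact_closedBall x (R / 2)) (convex_closedBall _ _)
    (Metric.measure_closedBall_pos volume x (half_pos hR)).ne' hk
  exact ⟨R / 2, J, half_pos hR, (Metric.closedBall_subset_closedBall (by linarith)).trans hRs,
    fun i j hij => (hJ i j hij).2⟩

/-- Continuous functions that agree almost everywhere agree at every point of a set contained in the
closure of its interior. -/
theorem IsJet.eq_of_mem {C C' : Set Plane} {g J J' : ℕ → ℕ → Plane → ℝ} (h : IsJet C g J)
    (h' : IsJet C' g J') (hm : MeasurableSet (C ∩ C')) (hC : C ∩ C' ⊆ closure (interior (C ∩ C')))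
    {i j : ℕ} (hij : i + j ≤ 2) {x : Plane} (hx : x ∈ C) (hx' : x ∈ C') : J i j x = J' i j x := by
  refine Measure.eqOn_of_ae_eq (μ := volume) ?_ ((h i j hij).1.mono inter_subset_left)
    ((h' i j hij).1.mono inter_subset_right) hC ⟨hx, hx'⟩
  have h1 : J i j =ᵐ[volume.restrict (C ∩ C')] g i j :=
    ae_restrict_of_ae_restrict_of_subset inter_subset_left (h i j hij).2
  have h2 : J' i j =ᵐ[volume.restrict (C ∩ C')] g i j :=
    ae_restrict_of_ae_restrict_of_subset inter_subset_right (h' i j hij).2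
  exact h1.trans h2.symm

theorem IsJet.eq_ball {s : Finset Plane} (hs : s ∈ triangles K) {g J J' : ℕ → ℕ → Plane → ℝ}
    (h : IsJet (tri s) g J) {y : Plane} {r : ℝ} (h' : IsJet (Metric.closedBall y r) g J')
    {i j : ℕ} (hij : i + j ≤ 2) {x : Plane} (hx : x ∈ tri s) (hx' : x ∈ Metric.ball y r) :
    J i j x = J' i j x := by
  obtain ⟨v, a, b, ht⟩ := exists_isTri_of_mem hs
  refine h.eq_of_mem h' ((isCompact_tri s).measurableSet.inter
    Metric.isClosed_closedBall.measurableSet) ?_ hij hx (Metric.ball_subset_closedBall hx')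
  refine subset_closure.trans
    (((convex_tri s).inter (convex_closedBall y r)).closure_interior_eq_closure_of_nonempty_interior
      ?_).symm.subset
  rw [interior_inter]
  rw [← ht.closure_interior] at hx
  obtain ⟨z, hz1, hz2⟩ := mem_closure_iff.1 hx _ Metric.isOpen_ball hx'
  exact ⟨z, hz2, interior_maximal Metric.ball_subset_closedBall Metric.isOpen_ball hz1⟩

/-- Jets on triangles that share a point agree there. -/
theorem jet_eq (hP : IsPolygonalDomain Ω) (hK : IsTriangulation K Ω) {k : ℕ} (hk : 4 ≤ k)
    (hu : MemH k Ω u) {J : Finset Plane → ℕ → ℕ → Plane → ℝ}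
    (hJ : ∀ s ∈ triangles K, IsJet (tri s) (fun i j => wE Ω i j u) (J s)) {s t : Finset Plane}
    (hs : s ∈ triangles K) (ht : t ∈ triangles K) {x : Plane} (hxs : x ∈ tri s) (hxt : x ∈ tri t)
    {i j : ℕ} (hij : i + j ≤ 2) : J s i j x = J t i j x := by
  have hΩ := hP.isOpen
  -- Inside `Ω` the jet on a small disc about the point is a common reference, since the disc
  -- overlaps every triangle through the point in a set with interior points.
  have hint : ∀ s ∈ triangles K, ∀ t ∈ triangles K, ∀ x ∈ Ω, x ∈ tri s → x ∈ tri t →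
      J s i j x = J t i j x := by
    intro s hs t ht x hx hxs hxt
    obtain ⟨r, J', hr, -, hJ'⟩ := exists_jet_ball hΩ hk hu hx
    rw [(hJ s hs).eq_ball hs hJ' hij hxs (Metric.mem_ball_self hr),
      (hJ t ht).eq_ball ht hJ' hij hxt (Metric.mem_ball_self hr)]
  by_cases hx : x ∈ Ω
  · exact hint s hs t ht x hx hxs hxt
  have hsel : ∀ y ∈ Ω, ∃ q ∈ triangles K, y ∈ tri q := fun y hy =>
    exists_tri_of_mem hP hK (subset_closure hy)
  choose! q hq hyq using hsel
  have hGe : ∀ s ∈ triangles K, ∀ y ∈ Ω, y ∈ tri s → J (q y) i j y = J s i j y := fun s hs y hy hys =>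
    hint _ (hq y hy) s hs y hy (hyq y hy) hys
  have hGc : ContinuousOn (fun y => J (q y) i j y) Ω := by
    intro y hy
    obtain ⟨r, J', hr, hrs, hJ'⟩ := exists_jet_ball hΩ hk hu hy
    refine ContinuousAt.continuousWithinAt ?_
    refine (((hJ' i j hij).1).continuousAt (Metric.closedBall_mem_nhds y hr)).congr ?_
    filter_upwards [Metric.ball_mem_nhds y hr] with z hz
    have hzΩ : z ∈ Ω := hrs (Metric.ball_subset_closedBall hz)
    exact ((hJ _ (hq z hzΩ)).eq_ball (hq z hzΩ) hJ' hij (hyq z hzΩ) hz).symm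
  by_contra hne
  wlog hlt : J s i j x < J t i j x generalizing s t
  · exact this ht hs hxt hxs (Ne.symm hne) (lt_of_le_of_ne (not_lt.1 hlt) (Ne.symm hne))
  have hfin := finite_triangles hK
  -- At a boundary point with two different values, `γ` lies strictly between them and avoids the
  -- finitely many values of the jets at `x`. Near `x` no jet takes the value `γ`, but the
  -- continuous function composed of the jets lies below `γ` somewhere in `Ω` near `x` and above it
  -- elsewhere. Since `Ω` meets some small disc about `x` in a connected set, the intermediate value
  -- theorem gives a contradiction.
  obtain ⟨γ, hγ, hγn⟩ := ((Set.Ioo_infinite hlt).sdiff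
    (hfin.image fun t => J t i j x)).nonempty
  obtain ⟨δ0, hδ0, hball⟩ := exists_ball_tri hK x
  have hnear : ∀ t ∈ triangles K, x ∈ tri t → ∀ᶠ y in 𝓝 x, y ∈ tri t → (J t i j y ≠ γ ∧
      (J t i j x < γ → J t i j y < γ) ∧ (γ < J t i j x → γ < J t i j y)) := by
    intro t ht hxt
    have hc := ((hJ t ht) i j hij).1 x hxt
    have hne : J t i j x ≠ γ := fun e => hγn ⟨t, ht, e⟩
    refine eventually_nhdsWithin_iff.1 ?_
    filter_upwards [hc.eventually_ne hne, (eventually_imp_distrib_left.2 fun h : J t i j x < γ =>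
      hc.eventually_lt_const h), (eventually_imp_distrib_left.2 fun h : γ < J t i j x =>
      hc.eventually_const_lt h)] with y h1 h2 h3
    exact ⟨h1, h2, h3⟩
  have hall : ∀ᶠ y in 𝓝 x, ∀ t ∈ triangles K, x ∈ tri t → y ∈ tri t → (J t i j y ≠ γ ∧
      (J t i j x < γ → J t i j y < γ) ∧ (γ < J t i j x → γ < J t i j y)) := by
    refine (hfin.eventually_all).2 fun t ht => ?_
    by_cases hxt : x ∈ tri t
    · filter_upwards [hnear t ht hxt] with y hy _ using hy
    · exact Eventually.of_forall fun y h => absurd h hxt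
  obtain ⟨δ1, hδ1, hδ1s⟩ := Metric.eventually_nhds_iff_ball.1 hall
  obtain ⟨δ, hδ, hδlt, hconn⟩ := hP.locally_connected x
    ⟨tri_subset_closure hK hs hxs, fun h => hx (hΩ.interior_eq ▸ h)⟩ (min δ0 δ1) (lt_min hδ0 hδ1)
  have hmem : ∀ t ∈ triangles K, x ∈ tri t → ∃ y ∈ Ω ∩ Metric.ball x δ, y ∈ tri t := by
    intro t ht hxt
    obtain ⟨v, a, b, htt⟩ := exists_isTri_of_mem ht
    rw [← htt.closure_interior] at hxt
    obtain ⟨z, hz1, hz2⟩ := mem_closure_iff.1 hxt _ Metric.isOpen_ball (Metric.mem_ball_self hδ)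
    exact ⟨z, ⟨interior_tri_subset hP hK ht hz2, hz1⟩, interior_subset hz2⟩
  have hb1 : Metric.ball x δ ⊆ Metric.ball x δ1 :=
    Metric.ball_subset_ball (hδlt.le.trans (min_le_right _ _))
  have hb0 : Metric.ball x δ ⊆ Metric.ball x δ0 :=
    Metric.ball_subset_ball (hδlt.le.trans (min_le_left _ _))
  obtain ⟨y, hy, hys⟩ := hmem s hs hxs
  obtain ⟨z, hz, hzt⟩ := hmem t ht hxt
  have hylt : J (q y) i j y < γ := by
    rw [hGe s hs y hy.1 hys]
    exact (hδ1s y (hb1 hy.2) s hs hxs hys).2.1 hγ.1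
  have hzlt : γ < J (q z) i j z := by
    rw [hGe t ht z hz.1 hzt]
    exact (hδ1s z (hb1 hz.2) t ht hxt hzt).2.2 hγ.2
  obtain ⟨w, hw, hwγ⟩ := hconn.isPreconnected.intermediate_value hy hz
    (hGc.mono inter_subset_left) ⟨hylt.le, hzlt.le⟩
  have hxw : x ∈ tri (q w) := hball _ (hq w hw.1) ⟨w, hb0 hw.2, hyq w hw.1⟩
  exact (hδ1s w (hb1 hw.2) _ (hq w hw.1) hxw (hyq w hw.1)).1 hwγ

/-! ### Functions with zero boundary values -/

theorem tendsto_setIntegral_wL {w : ℕ → Plane → ℝ} {i j : ℕ}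
    (h : Tendsto (fun n => wL Ω i j (w n)) atTop (𝓝 (wL Ω i j u))) {g : Plane → ℝ}
    (hg : MemLp g 2 (volume.restrict Ω)) :
    Tendsto (fun n => ∫ x in Ω, wL Ω i j (w n) x * g x) atTop (𝓝 (∫ x in Ω, wL Ω i j u x * g x)) := by
  have key : ∀ f : Lp ℝ 2 (volume.restrict Ω), inner ℝ (hg.toLp g) f = ∫ x in Ω, f x * g x := by
    intro f
    rw [L2.inner_def]
    refine integral_congr_ae ?_
    filter_upwards [hg.coeFn_toLp] with x hx
    simp [hx]
  simp only [← key]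
  exact tendsto_const_nhds.inner h

/-- For test functions of `Ω` integration by parts against any test function of the plane has no
boundary term, and `L²` limits preserve this. So extension by zero creates no singular part on the
boundary. -/
theorem hwd_wE (hΩ : IsOpen Ω) (hu : MemH0 2 Ω u) {i j : ℕ} (hij : i + j ≤ 1) :
    HWD univ 1 0 (wE Ω i j u) (wE Ω (i + 1) j u) ∧ HWD univ 0 1 (wE Ω i j u) (wE Ω i (j + 1) u) := by
  obtain ⟨hm, φ, hφ, hlim⟩ := (memH0_two_iff hΩ).1 hu
  have hloc : ∀ i j, LocallyIntegrableOn (wE Ω i j u) univ := fun i j =>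
    (locallyIntegrable_wE hΩ i j u).locallyIntegrableOn _
  have hint : ∀ i j (θ : Plane → ℝ), ∫ x in univ, wE Ω i j u x * θ x =
      ∫ x in Ω, wL Ω i j u x * θ x := by
    intro i j θ
    rw [setIntegral_univ, ← integral_indicator hΩ.measurableSet]
    congr 1; funext x
    by_cases hx : x ∈ Ω <;> simp [wE, hx]
  have key : ∀ (v : Fin 2) (i' j' : ℕ), i' + j' ≤ 2 → (∀ n, pd v (D i j (φ n)) = D i' j' (φ n)) →
      ∀ θ, IsTestFunction univ θ → ∫ x in univ, wE Ω i j u x * pd v θ x =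
        - ∫ x in univ, wE Ω i' j' u x * θ x := by
    intro v i' j' hij' hD θ hθ
    rw [hint, hint]
    have hg1 : MemLp (pd v θ) 2 (volume.restrict Ω) := by
      have := (hθ.pd v).memLp 2
      rw [Measure.restrict_univ] at this
      exact this.restrict Ω
    have hg2 : MemLp θ 2 (volume.restrict Ω) := by
      have := hθ.memLp 2
      rw [Measure.restrict_univ] at this
      exact this.restrict Ω
    refine tendsto_nhds_unique (tendsto_setIntegral_wL (hlim i j (by omega)) hg1) ?_
    refine ((tendsto_setIntegral_wL (hlim i' j' hij') hg2).neg).congr fun n => ?_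
    have e1 : ∫ x in Ω, wL Ω i j (φ n) x * pd v θ x = ∫ x in Ω, pd v θ x * D i j (φ n) x := by
      refine integral_congr_ae ?_
      filter_upwards [wL_test_ae hΩ (hφ n) i j] with x hx
      rw [hx, mul_comm]
    have e2 : ∫ x in Ω, wL Ω i' j' (φ n) x * θ x = ∫ x in Ω, θ x * pd v (D i j (φ n)) x := by
      refine integral_congr_ae ?_
      filter_upwards [wL_test_ae hΩ (hφ n) i' j'] with x hx
      rw [hx, mul_comm, hD]
    rw [e1, e2, integral_mul_pd (hθ.1.of_le (by norm_cast)) ((hφ n).D i j) v, neg_neg]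
  refine ⟨⟨hloc _ _, hloc _ _, fun θ hθ => ?_⟩, ⟨hloc _ _, hloc _ _, fun θ hθ => ?_⟩⟩
  · have := key 0 (i + 1) j (by omega) (fun n => pd_zero_D _ _ _) θ hθ
    simpa [D] using this
  · have := key 1 i (j + 1) (by omega) (fun n => pd_one_D (hφ n).1 _ _) θ hθ
    simpa [D] using this

/-- Zero extensions of derivatives of `u ∈ H²_0(Ω)` are Lipschitz continuous if their derivatives
are bounded. -/
theorem conv_wE_lipschitz (hΩ : IsOpen Ω) (hu : MemH0 2 Ω u) {M : ℝ}
    (hM : ∀ i j, i + j ≤ 2 → ∀ᵐ x, |wE Ω i j u x| ≤ M) {i j : ℕ} (hij : i + j ≤ 1) {ε : ℝ}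
    (hε : 0 < ε) (x y : Plane) :
    |conv (sc ε moll) (wE Ω i j u) x - conv (sc ε moll) (wE Ω i j u) y| ≤ 2 * M * ‖x - y‖ := by
  have hk : IsKernel ε (sc ε moll) := moll_kernel.sc hε
  have hD : ∀ i' j', i' + j' = 1 → ∀ z, |D i' j' (conv (sc ε moll) (wE Ω i j u)) z| ≤ M := by
    intro i' j' h1 z
    have hw : HWD univ i' j' (wE Ω i j u) (wE Ω (i + i') (j + j') u) := by
      obtain ⟨rfl, rfl⟩ | ⟨rfl, rfl⟩ : (i' = 1 ∧ j' = 0) ∨ (i' = 0 ∧ j' = 1) := by omega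
      exacts [(hwd_wE hΩ hu hij).1, (hwd_wE hΩ hu hij).2]
    have h2 := D_conv_weak isOpen_univ hk hw
      (by rw [indicator_univ]; exact locallyIntegrable_wE hΩ i j u) (x := z) (subset_univ _)
    rw [indicator_univ, indicator_univ] at h2
    rw [h2]
    have hae : ∀ᵐ x, |wE Ω (i + i') (j + j') u x| ≤ M := hM _ _ (by omega)
    -- The bound is known almost everywhere; the truncated function satisfies it everywhere, as the
    -- estimate for averages requires, and has the same convolution.
    have h3 : (wE Ω (i + i') (j + j') u) =ᵐ[volume]
        fun x => max (-M) (min M (wE Ω (i + i') (j + j') u x)) := by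
      filter_upwards [hae] with x hx
      rw [min_eq_right (abs_le.1 hx).2, max_eq_right (abs_le.1 hx).1]
    have hM0 : 0 ≤ M := by
      obtain ⟨x, hx⟩ := hae.exists
      exact (abs_nonneg _).trans hx
    rw [conv_congr_ae h3]
    refine (abs_conv_moll_le hε moll_kernel _ z (M := M) fun y _ => ?_).trans ?_
    · rw [abs_le]
      exact ⟨le_max_left _ _, max_le (by linarith) (min_le_left _ _)⟩
    · rw [integral_abs_moll, one_mul]
  have hs := conv_smooth hk (locallyIntegrable_wE hΩ i j u)
  have hb : ∀ z ∈ (univ : Set Plane), ‖fderiv ℝ (conv (sc ε moll) (wE Ω i j u)) z‖ ≤ 2 * M := by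
    intro z _
    have h10 := hD 1 0 rfl z
    have h01 := hD 0 1 rfl z
    refine ContinuousLinearMap.opNorm_le_bound _ (by linarith [(abs_nonneg _).trans h10]) fun v => ?_
    rw [fderiv_apply_eq, Real.norm_eq_abs]
    refine (abs_add_le _ _).trans ?_
    rw [abs_mul, abs_mul]
    have := abs_coord_le_norm v 0
    have := abs_coord_le_norm v 1
    nlinarith [mul_le_mul (abs_coord_le_norm v 0) h10 (abs_nonneg _) (norm_nonneg _),
      mul_le_mul (abs_coord_le_norm v 1) h01 (abs_nonneg _) (norm_nonneg _)]
  have := convex_univ.norm_image_sub_le_of_norm_fderiv_le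
    (fun z _ => differentiable_of_smooth hs z) hb (mem_univ y) (mem_univ x)
  simpa [Real.norm_eq_abs] using this

/-- The jets of order at most one of functions in `H²_0(Ω)` vanish on the boundary. -/
theorem jet_eq_zero (hP : IsPolygonalDomain Ω) (hK : IsTriangulation K Ω) (hu : MemH0 2 Ω u)
    {J : Finset Plane → ℕ → ℕ → Plane → ℝ}
    (hJ : ∀ s ∈ triangles K, IsJet (tri s) (fun i j => wE Ω i j u) (J s)) {s : Finset Plane}
    (hs : s ∈ triangles K) {x : Plane} (hxs : x ∈ tri s) (hx : x ∉ Ω)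
    {i j : ℕ} (hij : i + j ≤ 1) : J s i j x = 0 := by
  have hΩ := hP.isOpen
  -- Continuity of the jets on finitely many compact triangles bounds all derivatives up to order
  -- two. The mollified extensions by zero are then Lipschitz, uniformly in the scale.
  obtain ⟨M, hM⟩ : ∃ M, ∀ i j, i + j ≤ 2 → ∀ᵐ x, |wE Ω i j u x| ≤ M := by
    have h1 : ∀ t ∈ triangles K, ∀ i j, ∃ M, i + j ≤ 2 → ∀ x ∈ tri t, |J t i j x| ≤ M := by
      intro t ht i j
      by_cases hij : i + j ≤ 2
      · obtain ⟨M, hM⟩ := (isCompact_tri t).exists_bound_of_continuousOn ((hJ t ht) i j hij).1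
        exact ⟨M, fun _ x hx => hM x hx⟩
      · exact ⟨0, fun h => absurd h hij⟩
    choose! M hM using h1
    have hfin := finite_triangles hK
    obtain ⟨B, hB⟩ := ((hfin.prod ((Set.finite_Iic 2).prod (Set.finite_Iic 2))).image
      (fun p : Finset Plane × ℕ × ℕ => M p.1 p.2.1 p.2.2)).bddAbove
    refine ⟨max B 0, fun i j hij => ?_⟩
    have hcov : ∀ᵐ x, ∀ t ∈ triangles K, x ∈ tri t → J t i j x = wE Ω i j u x := by
      refine (ae_ball_iff hfin.countable).2 fun t ht => ?_
      exact (ae_restrict_iff' (isCompact_tri t).measurableSet).1 ((hJ t ht) i j hij).2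
    filter_upwards [hcov] with x hx
    by_cases hxΩ : x ∈ Ω
    · obtain ⟨t, ht, hxt⟩ := exists_tri_of_mem hP hK (subset_closure hxΩ)
      rw [← hx t ht hxt]
      refine (hM t ht i j hij x hxt).trans ((hB ?_).trans (le_max_left _ _))
      exact ⟨(t, i, j), ⟨ht, by simp; omega, by simp; omega⟩, rfl⟩
    · simp [wE, hxΩ]
  have hM0 : 0 ≤ M := by
    obtain ⟨x, hx⟩ := (hM 0 0 (by norm_num)).exists
    exact (abs_nonneg _).trans hx
  obtain ⟨v, a, b, ht⟩ := exists_isTri_of_mem hs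
  have hc := (hJ s hs i j (by omega)).1
  -- the estimate between an interior and an exterior point
  have main : ∀ y ∉ closure Ω, ∀ z ∈ interior (tri s), |J s i j z| ≤ 2 * M * ‖z - y‖ := by
    intro y hy z hz
    obtain ⟨d, hd, hdy⟩ := Metric.isOpen_iff.1 isClosed_closure.isOpen_compl y hy
    refine le_of_forall_pos_le_add fun η hη => ?_
    have hcz : ContinuousAt (J s i j) z := hc.continuousAt (mem_interior_iff_mem_nhds.1 hz)
    obtain ⟨e, he, hez⟩ := Metric.continuousAt_iff.1 hcz η hη
    obtain ⟨e', he', hez'⟩ := Metric.isOpen_iff.1 isOpen_interior z hz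
    obtain ⟨ε, hε, h1, h2, h3⟩ : ∃ ε > 0, ε < d ∧ ε < e ∧ ε < e' :=
      ⟨min d (min e e') / 2, by positivity, by
        have := min_le_left d (min e e'); have : 0 < min d (min e e') := by positivity
        linarith, by
        have := (min_le_right d (min e e')).trans (min_le_left _ _)
        have : 0 < min d (min e e') := by positivity
        linarith, by
        have := (min_le_right d (min e e')).trans (min_le_right _ _)
        have : 0 < min d (min e e') := by positivity
        linarith⟩
    have hLip := conv_wE_lipschitz hΩ hu hM hij hε z y
    have hy0 : conv (sc ε moll) (wE Ω i j u) y = 0 := by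
      have := abs_conv_moll_le hε moll_kernel (wE Ω i j u) y (M := 0) fun w hw => by
        have : w ∉ closure Ω := hdy (by rw [Metric.mem_ball, dist_eq_norm]; linarith)
        rw [wE, indicator_of_notMem (fun h => this (subset_closure h)), abs_zero]
      rw [mul_zero] at this
      exact abs_nonpos_iff.1 this
    have hz0 : |conv (sc ε moll) (wE Ω i j u) z - J s i j z| ≤ η := by
      classical
      -- The class may be represented by the continuous jet on the triangle, and the mollifier at
      -- `z` sees only points of the triangle.
      set G : Plane → ℝ := fun w => if w ∈ tri s then J s i j w else wE Ω i j u w with hG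
      have hae : wE Ω i j u =ᵐ[volume] G := by
        filter_upwards [(ae_restrict_iff' (isCompact_tri s).measurableSet).1
          (hJ s hs i j (by omega)).2] with w hw
        by_cases hws : w ∈ tri s
        · simp [hG, hws, hw hws]
        · simp [hG, hws]
      rw [conv_congr_ae hae]
      refine abs_conv_moll_sub_le hε ((locallyIntegrable_wE hΩ i j u).congr hae) z _ fun w hw => ?_
      have hwb : w ∈ tri s := interior_subset (hez' (by rw [Metric.mem_ball, dist_eq_norm]; linarith))
      have : dist w z < e := by rw [dist_eq_norm]; linarith
      have := (hez this).le
      rw [Real.dist_eq] at this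
      simpa [hG, hwb] using this
    rw [hy0, sub_zero] at hLip
    have := abs_sub_abs_le_abs_sub (J s i j z) (conv (sc ε moll) (wE Ω i j u) z)
    rw [abs_sub_comm] at this
    linarith
  have hmain2 : ∀ z ∈ interior (tri s), |J s i j z| ≤ 2 * M * ‖z - x‖ := by
    intro z hz
    -- Because `Ω` is the interior of its closure, a boundary point is a limit of points outside the
    -- closure.
    have hxc : x ∈ closure (closure Ω)ᶜ := by
      rw [closure_compl, hP.interior_closure]; exact hx
    have hcl : IsClosed {y : Plane | |J s i j z| ≤ 2 * M * ‖z - y‖} :=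
      isClosed_le continuous_const (by fun_prop)
    exact closure_minimal (fun y hy => main y hy z hz) hcl hxc
  have hmem : x ∈ closure (interior (tri s)) := by rw [ht.closure_interior]; exact hxs
  have hlim1 : Tendsto (fun z => |J s i j z|) (𝓝[interior (tri s)] x) (𝓝 |J s i j x|) :=
    ((hc x hxs).mono_left (nhdsWithin_mono _ interior_subset)).abs
  have hlim2 : Tendsto (fun z => 2 * M * ‖z - x‖) (𝓝[interior (tri s)] x) (𝓝 0) := by
    have : Continuous fun z : Plane => 2 * M * ‖z - x‖ := by fun_prop
    simpa using (this.tendsto x).mono_left nhdsWithin_le_nhds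
  have : (𝓝[interior (tri s)] x).NeBot := mem_closure_iff_nhdsWithin_neBot.1 hmem
  have := le_of_tendsto_of_tendsto hlim1 hlim2 (eventually_nhdsWithin_of_forall hmain2)
  exact abs_nonpos_iff.1 this

end

section

open Filter Topology

/-! ### Unisolvence on the edges -/

/-- Value, first and second derivative at both end points are six conditions, which determine the
six coefficients. -/
theorem quintic_eq_zero {c : ℕ → ℝ} {f f1 f2 : ℝ → ℝ}
    (hf : ∀ s, f s = ∑ k ∈ Finset.range 6, c k * s ^ k) (h1 : ∀ s, HasDerivAt f (f1 s) s)
    (h2 : ∀ s, HasDerivAt f1 (f2 s) s) (z : ∀ s, s = 0 ∨ s = 1 → f s = 0 ∧ f1 s = 0 ∧ f2 s = 0) :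
    ∀ s, f s = 0 := by
  have e0 : f = fun s => c 0 + c 1 * s + c 2 * s ^ 2 + c 3 * s ^ 3 + c 4 * s ^ 4 + c 5 * s ^ 5 := by
    funext s; rw [hf]; simp [Finset.sum_range_succ]
  have e1 : f1 = fun s => c 1 + 2 * c 2 * s + 3 * c 3 * s ^ 2 + 4 * c 4 * s ^ 3 + 5 * c 5 * s ^ 4 := by
    funext s
    refine (h1 s).unique ?_
    rw [e0]
    have hp := fun n : ℕ => hasDerivAt_pow n s
    convert ((((((hasDerivAt_const s (c 0)).add ((hp 1).const_mul (c 1))).add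
      ((hp 2).const_mul (c 2))).add ((hp 3).const_mul (c 3))).add ((hp 4).const_mul (c 4))).add
      ((hp 5).const_mul (c 5))) using 1
    · funext x; simp
    · push_cast; ring
  have e2 : f2 = fun s => 2 * c 2 + 6 * c 3 * s + 12 * c 4 * s ^ 2 + 20 * c 5 * s ^ 3 := by
    funext s
    refine (h2 s).unique ?_
    rw [e1]
    have hp := fun n : ℕ => hasDerivAt_pow n s
    convert (((((hasDerivAt_const s (c 1)).add ((hp 1).const_mul (2 * c 2))).add
      ((hp 2).const_mul (3 * c 3))).add ((hp 3).const_mul (4 * c 4))).add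
      ((hp 4).const_mul (5 * c 5))) using 1
    · funext x; simp
    · push_cast; ring
  obtain ⟨z0, z1, z2⟩ := z 0 (Or.inl rfl)
  obtain ⟨w0, w1, w2⟩ := z 1 (Or.inr rfl)
  simp only [e0, e1, e2] at z0 z1 z2 w0 w1 w2
  norm_num at z0 z1 z2 w0 w1 w2
  rw [z0, z1, z2] at w0; rw [z1, z2] at w1; rw [z2] at w2
  have h5 : c 5 = 0 := by linarith
  have h4 : c 4 = 0 := by linarith
  have h3 : c 3 = 0 := by linarith
  intro s
  rw [e0]
  simp [z0, z1, z2, h3, h4, h5]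

/-- Value and derivative at both end points and the value at the midpoint are five conditions. The
case of interest is the normal derivative of a quintic along an edge. -/
theorem quartic_eq_zero {c : ℕ → ℝ} {f f1 : ℝ → ℝ}
    (hf : ∀ s, f s = ∑ k ∈ Finset.range 5, c k * s ^ k) (h1 : ∀ s, HasDerivAt f (f1 s) s)
    (z : ∀ s, s = 0 ∨ s = 1 → f s = 0 ∧ f1 s = 0) (zm : f (1 / 2) = 0) : ∀ s, f s = 0 := by
  have e0 : f = fun s => c 0 + c 1 * s + c 2 * s ^ 2 + c 3 * s ^ 3 + c 4 * s ^ 4 := by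
    funext s; rw [hf]; simp [Finset.sum_range_succ]
  have e1 : f1 = fun s => c 1 + 2 * c 2 * s + 3 * c 3 * s ^ 2 + 4 * c 4 * s ^ 3 := by
    funext s
    refine (h1 s).unique ?_
    rw [e0]
    have hp := fun n : ℕ => hasDerivAt_pow n s
    convert (((((hasDerivAt_const s (c 0)).add ((hp 1).const_mul (c 1))).add
      ((hp 2).const_mul (c 2))).add ((hp 3).const_mul (c 3))).add ((hp 4).const_mul (c 4))) using 1
    · funext x; simp
    · push_cast; ring
  obtain ⟨z0, z1⟩ := z 0 (Or.inl rfl)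
  obtain ⟨w0, w1⟩ := z 1 (Or.inr rfl)
  simp only [e0, e1] at z0 z1 w0 w1 zm
  norm_num at z0 z1 w0 w1 zm
  rw [z0, z1] at w0 zm; rw [z1] at w1
  have h4 : c 4 = 0 := by linarith
  have h3 : c 3 = 0 := by linarith
  have h2 : c 2 = 0 := by linarith
  intro s
  rw [e0]
  simp [z0, z1, h2, h3, h4]

/-- The restriction of a polynomial to a line. -/
theorem exists_coeff_line {p : MvPolynomial (Fin 2) ℝ} {m : ℕ} (hp : p.totalDegree ≤ m)
    (x v : Plane) : ∃ c : ℕ → ℝ, ∀ s : ℝ, polyFun p (x + s • v) =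
      ∑ k ∈ Finset.range (m + 1), c k * s ^ k := by
  set P : Polynomial ℝ := MvPolynomial.aeval
    (fun i => Polynomial.C (x i) + Polynomial.C (v i) * Polynomial.X) p with hP
  have hdeg : P.natDegree < m + 1 := by
    have := MvPolynomial.aeval_natDegree_le p (n := 1) hp
      (fun i => Polynomial.C (x i) + Polynomial.C (v i) * Polynomial.X) fun i => by
        compute_degree
    rw [mul_one] at this
    exact Nat.lt_succ_of_le this
  refine ⟨P.coeff, fun s => ?_⟩
  rw [← Polynomial.eval_eq_sum_range' hdeg s, hP, polyFun]
  change _ = (Polynomial.evalRingHom s) _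
  rw [MvPolynomial.aeval_def, MvPolynomial.hom_eval₂]
  rw [MvPolynomial.eval, MvPolynomial.coe_eval₂Hom]
  congr 1
  · ext; simp
  · funext i; simp; ring

theorem totalDegree_pderiv_le {p : MvPolynomial (Fin 2) ℝ} {m : ℕ} (hp : p.totalDegree ≤ m + 1)
    (i : Fin 2) : (MvPolynomial.pderiv i p).totalDegree ≤ m := by
  conv_lhs => rw [p.as_sum, map_sum]
  refine MvPolynomial.totalDegree_finsetSum_le fun d hd => ?_
  rw [MvPolynomial.pderiv_monomial]
  by_cases h0 : d i = 0
  · simp [h0]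
  refine (MvPolynomial.totalDegree_monomial_le _ _).trans ?_
  have h1 := (MvPolynomial.le_totalDegree hd).trans hp
  have h2 : d = (d - Finsupp.single i 1) + Finsupp.single i 1 := by
    ext j
    by_cases hj : i = j
    · subst hj; simp; omega
    · simp [Finsupp.single_apply, hj]
  rw [h2, Finsupp.sum_add_index' (by simp) (by simp)] at h1
  simp only [Finsupp.sum_single_index, add_le_add_iff_right] at h1
  exact h1

/-- A quintic whose Hermite data on an edge and whose normal derivative at its midpoint vanish is
zero on that edge, together with its gradient. -/
theorem edge_unisolvent {p : MvPolynomial (Fin 2) ℝ} (hp : p.totalDegree ≤ 5) {x t : Plane}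
    (ht : t ≠ 0) {m n : ℝ} (hn : m * t 0 + n * t 1 = 0) (hn0 : m ≠ 0 ∨ n ≠ 0)
    (h : ∀ θ : ℝ, θ = 0 ∨ θ = 1 → ∀ i j, i + j ≤ 1 → D i j (polyFun p) (x + θ • t) = 0)
    (h2 : ∀ θ : ℝ, θ = 0 ∨ θ = 1 → ∀ i j, i + j = 1 →
      t 0 * D (i + 1) j (polyFun p) (x + θ • t) + t 1 * D i (j + 1) (polyFun p) (x + θ • t) = 0)
    (hmid : m * D 1 0 (polyFun p) (x + (1 / 2 : ℝ) • t) +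
      n * D 0 1 (polyFun p) (x + (1 / 2 : ℝ) • t) = 0) (θ : ℝ) {i j : ℕ} (hij : i + j ≤ 1) :
    D i j (polyFun p) (x + θ • t) = 0 := by
  have hs := polyFun_smooth p
  have hD : ∀ i j (s : ℝ), HasDerivAt (fun s : ℝ => D i j (polyFun p) (x + s • t))
      (t 0 * D (i + 1) j (polyFun p) (x + s • t) + t 1 * D i (j + 1) (polyFun p) (x + s • t)) s := by
    intro i j s
    have := hasDerivAt_line (smooth_D hs i j) x t s
    rwa [D_D hs, D_D hs, zero_add, zero_add, add_comm 1 i, add_comm 1 j] at this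
  obtain ⟨c, hc⟩ := exists_coeff_line hp x t
  have hf := quintic_eq_zero hc (hD 0 0)
    (fun s => ((hD 1 0 s).const_mul (t 0)).add ((hD 0 1 s).const_mul (t 1)))
    (fun s hs => ⟨h s hs 0 0 (by norm_num), by
      simp only [zero_add]
      rw [h s hs 1 0 (by norm_num), h s hs 0 1 (by norm_num)]; ring, by
      rw [h2 s hs 1 0 rfl, h2 s hs 0 1 rfl]; ring⟩)
  -- The derivative in the normal direction `(m, n)` has degree four only, so its midpoint value
  -- completes the Hermite data.
  set g : MvPolynomial (Fin 2) ℝ := MvPolynomial.C m * MvPolynomial.pderiv 0 p +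
    MvPolynomial.C n * MvPolynomial.pderiv 1 p with hg
  have hgd : g.totalDegree ≤ 4 := by
    refine (MvPolynomial.totalDegree_add _ _).trans (max_le ?_ ?_) <;>
    · refine (MvPolynomial.totalDegree_mul _ _).trans ?_
      rw [MvPolynomial.totalDegree_C, zero_add]
      exact totalDegree_pderiv_le hp _
  have hge : ∀ y, polyFun g y = m * D 1 0 (polyFun p) y + n * D 0 1 (polyFun p) y := by
    intro y
    rw [hg, polyFun_add, polyFun_mul, polyFun_mul, polyFun_C, polyFun_C, D_polyFun, D_polyFun]
    simp
  obtain ⟨c', hc'⟩ := exists_coeff_line hgd x t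
  have hG := quartic_eq_zero (f := fun s => m * D 1 0 (polyFun p) (x + s • t) +
      n * D 0 1 (polyFun p) (x + s • t)) (fun s => by rw [← hge]; exact hc' s)
    (fun s => ((hD 1 0 s).const_mul m).add ((hD 0 1 s).const_mul n))
    (fun s hs => ⟨by
      rw [h s hs 1 0 (by norm_num), h s hs 0 1 (by norm_num)]; ring, by
      rw [h2 s hs 1 0 rfl, h2 s hs 0 1 rfl]; ring⟩) hmid
  have hT : t 0 * D 1 0 (polyFun p) (x + θ • t) + t 1 * D 0 1 (polyFun p) (x + θ • t) = 0 := by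
    refine (hD 0 0 θ).unique ?_
    rw [show (fun s : ℝ => D 0 0 (polyFun p) (x + s • t)) = fun _ => 0 from funext hf]
    exact hasDerivAt_const θ 0
  have hN := hG θ
  -- A nonzero normal and a nonzero tangent are linearly independent, so the two directional
  -- derivatives determine the gradient.
  have hdet : m * t 1 - n * t 0 ≠ 0 := by
    intro h0
    have h3 : (m ^ 2 + n ^ 2) * t 0 = 0 := by linear_combination m * hn - n * h0
    have h4 : (m ^ 2 + n ^ 2) * t 1 = 0 := by linear_combination n * hn + m * h0
    have h5 : m ^ 2 + n ^ 2 ≠ 0 := by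
      rcases hn0 with h | h <;> positivity
    apply ht
    ext k
    fin_cases k
    exacts [(mul_eq_zero.1 h3).resolve_left h5, (mul_eq_zero.1 h4).resolve_left h5]
  obtain ⟨rfl, rfl⟩ | ⟨rfl, rfl⟩ | ⟨rfl, rfl⟩ :
    (i = 0 ∧ j = 0) ∨ (i = 1 ∧ j = 0) ∨ (i = 0 ∧ j = 1) := by omega
  · exact hf θ
  · refine (mul_eq_zero.1 ?_).resolve_left hdet
    linear_combination t 1 * hN - n * hT
  · refine (mul_eq_zero.1 ?_).resolve_left hdet
    linear_combination m * hT - t 0 * hN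

end

section

open Filter Topology

variable {Ω : Set Plane}

/-! ### Functions that vanish to second order on the boundary belong to `H²_0` -/

theorem D_congr_germ {f g : Plane → ℝ} {x : Plane} (h : f =ᶠ[𝓝 x] g) (i j : ℕ) :
    D i j f =ᶠ[𝓝 x] D i j g := by
  have h1 : ∀ (v : Fin 2) {f g : Plane → ℝ}, f =ᶠ[𝓝 x] g → pd v f =ᶠ[𝓝 x] pd v g := by
    intro v f g h
    filter_upwards [h.fderiv (𝕜 := ℝ)] with y hy
    rw [pd, pd, hy]
  have h2 : ∀ (v : Fin 2) (n : ℕ) {f g : Plane → ℝ}, f =ᶠ[𝓝 x] g →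
      (pd v)^[n] f =ᶠ[𝓝 x] (pd v)^[n] g := by
    intro v n
    induction n with
    | zero => intro f g h; exact h
    | succ n ih =>
      intro f g h
      rw [Function.iterate_succ_apply, Function.iterate_succ_apply]
      exact ih (h1 v h)
  exact h2 0 i (h2 1 j h)

theorem D_sc {ε : ℝ} {κ : Plane → ℝ} (h : IsKernel 1 κ) (i j : ℕ) : IsKernel 1 (D i j κ) ∧
    (0 < ε → D i j (sc ε κ) = fun w => ε⁻¹ ^ (i + j) * sc ε (D i j κ) w) := by
  have hk : ∀ (v : Fin 2) (n : ℕ) {κ : Plane → ℝ}, IsKernel 1 κ → IsKernel 1 ((pd v)^[n] κ) := by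
    intro v n κ h
    induction n with
    | zero => exact h
    | succ n ih => rw [Function.iterate_succ_apply']; exact ih.pd v
  refine ⟨hk 0 i (hk 1 j h), fun hε => ?_⟩
  have hs : ∀ (v : Fin 2) (n : ℕ) (c : ℝ) {κ : Plane → ℝ}, IsKernel 1 κ →
      (pd v)^[n] (fun w => c * sc ε κ w) = fun w => c * ε⁻¹ ^ n * sc ε ((pd v)^[n] κ) w := by
    intro v n c κ h
    induction n with
    | zero => simp
    | succ n ih =>
      have hn := hk v n h
      rw [Function.iterate_succ_apply', ih, Function.iterate_succ_apply',
        pd_smul _ (differentiable_of_smooth (hn.sc hε).smooth), pd_sc hn.smooth]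
      funext w; ring
  have h1 := hs 1 j 1 h
  simp only [one_mul] at h1
  rw [D, h1, hs 0 i _ (hk 1 j h)]
  funext w
  rw [D, pow_add]; ring

/-- All derivatives fall on the kernel, each at the cost of `ε⁻¹`; no smoothness of `g` is involved.
-/
theorem abs_D_conv_moll_le {g : Plane → ℝ} (hg : LocallyIntegrable g) {M : ℝ}
    (hM : ∀ x, |g x| ≤ M) {ε : ℝ} (hε : 0 < ε) (i j : ℕ) (x : Plane) :
    |D i j (conv (sc ε moll) g) x| * ε ^ (i + j) ≤ (∫ z, |D i j moll z|) * M := by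
  obtain ⟨hk, hD⟩ := D_sc (ε := ε) moll_kernel i j
  have e : D i j (conv (sc ε moll) g) x = ε⁻¹ ^ (i + j) * conv (sc ε (D i j moll)) g x := by
    rw [D_conv (moll_kernel.sc hε) hg, hD hε, conv, conv, ← integral_const_mul]
    congr 1; funext y; ring
  rw [e, abs_mul, abs_of_nonneg (by positivity), mul_comm, ← mul_assoc, ← mul_pow,
    mul_inv_cancel₀ hε.ne', one_pow, one_mul]
  exact abs_conv_moll_le hε hk g x fun y _ => hM y

/-- The test functions are products of a mollified cut-off with the mollified `W 0 0`. Derivatives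
of order k of the cut-off grow like ε^{-k}, but only at distances of order ε from the complement of
`Ω`, where flatness makes the derivatives of order k of the other factor O(ε^{2-k}). The products
therefore have bounded derivatives up to order two, these converge almost everywhere in the bounded
set `Ω`, and dominated convergence gives convergence in `L²`. -/
theorem memH0_of_flat (hΩ : IsOpen Ω) (hb : Bornology.IsBounded Ω) {W : ℕ → ℕ → Plane → ℝ} {M : ℝ}
    (hW : ∀ i j, i + j ≤ 2 → LocallyIntegrable (W i j))
    (hD : ∀ i j, i + j ≤ 1 → HWD univ 1 0 (W i j) (W (i + 1) j) ∧ HWD univ 0 1 (W i j) (W i (j + 1)))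
    (hM : ∀ i j, i + j ≤ 2 → ∀ x, |W i j x| ≤ M)
    (hflat : ∀ i j, i + j ≤ 2 → ∀ x, ∀ y ∉ Ω, |W i j x| ≤ M * ‖x - y‖ ^ (2 - (i + j)))
    (hc : ∀ᵐ x, ∀ i j, i + j ≤ 2 → ContinuousAt (W i j) x) :
    MemH0 2 Ω (W 0 0) ∧ ∀ i j, i + j ≤ 2 → wL Ω i j (W 0 0) =ᵐ[volume.restrict Ω] W i j := by
  have hM0 : 0 ≤ M := (abs_nonneg _).trans (hM 0 0 (by norm_num) 0)
  have hfin : IsFiniteMeasure (volume.restrict Ω) :=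
    ⟨by rw [Measure.restrict_apply_univ]; exact hb.measure_lt_top⟩
  have hne : (Ωᶜ).Nonempty := by
    rw [Set.nonempty_compl]
    rintro rfl
    exact NormedSpace.unbounded_univ ℝ Plane hb
  have hcl : IsClosed Ωᶜ := hΩ.isClosed_compl
  set d : Plane → ℝ := fun x => Metric.infDist x Ωᶜ with hd
  have hdc : Continuous d := Metric.continuous_infDist_pt _
  have hd1 : ∀ x y, d x ≤ d y + ‖x - y‖ := fun x y => by
    rw [← dist_eq_norm]; exact Metric.infDist_le_infDist_add_dist
  have hdpos : ∀ x ∈ Ω, 0 < d x := fun x hx =>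
    (hcl.notMem_iff_infDist_pos hne).1 (by simpa using hx)
  -- mollified functions
  have hker : ∀ {ε : ℝ}, 0 < ε → IsKernel ε (sc ε moll) := fun hε => moll_kernel.sc hε
  set U : ℝ → Plane → ℝ := fun ε => conv (sc ε moll) (W 0 0) with hU
  have hUs : ∀ {ε : ℝ}, 0 < ε → ContDiff ℝ ∞ (U ε) := fun hε =>
    conv_smooth (hker hε) (hW 0 0 (by norm_num))
  have hUD : ∀ {ε : ℝ}, 0 < ε → ∀ i j, i + j ≤ 2 → D i j (U ε) = conv (sc ε moll) (W i j) := by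
    intro ε hε
    have step : ∀ i j i' j', i + j ≤ 1 → i' + j' = 1 →
        D i' j' (conv (sc ε moll) (W i j)) = conv (sc ε moll) (W (i + i') (j + j')) := by
      intro i j i' j' hij h1
      have hw : HWD univ i' j' (W i j) (W (i + i') (j + j')) := by
        obtain ⟨rfl, rfl⟩ | ⟨rfl, rfl⟩ : (i' = 1 ∧ j' = 0) ∨ (i' = 0 ∧ j' = 1) := by omega
        exacts [(hD i j hij).1, (hD i j hij).2]
      funext x
      have := D_conv_weak isOpen_univ (hker hε) hw
        (by rw [indicator_univ]; exact hW i j (by omega)) (x := x) (subset_univ _)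
      rwa [indicator_univ, indicator_univ] at this
    have h1 : ∀ i j, i + j = 1 → D i j (U ε) = conv (sc ε moll) (W i j) := fun i j hij => by
      have := step 0 0 i j (by norm_num) hij
      rwa [zero_add, zero_add] at this
    refine forall_two.2 ⟨rfl, h1 1 0 rfl, h1 0 1 rfl, ?_, ?_, ?_⟩
    · rw [← step 1 0 1 0 (by norm_num) rfl, ← h1 1 0 rfl, D_D (hUs hε)]
    · rw [← step 1 0 0 1 (by norm_num) rfl, ← h1 1 0 rfl, D_D (hUs hε)]
    · rw [← step 0 1 0 1 (by norm_num) rfl, ← h1 0 1 rfl, D_D (hUs hε)]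
  -- cut-off functions
  set I : ℝ → Plane → ℝ := fun ε => {x | 3 * ε ≤ d x}.indicator 1 with hI
  have hI1 : ∀ ε x, |I ε x| ≤ 1 := fun ε x => by
    by_cases h : x ∈ {x | 3 * ε ≤ d x} <;> simp [hI, h]
  have hIl : ∀ ε, LocallyIntegrable (I ε) := fun ε =>
    (locallyIntegrable_const (1 : ℝ)).indicator
      (isClosed_le continuous_const hdc).measurableSet
  set η : ℝ → Plane → ℝ := fun ε => conv (sc ε moll) (I ε) with hη
  have hηs : ∀ {ε : ℝ}, 0 < ε → ContDiff ℝ ∞ (η ε) := fun {ε} hε => conv_smooth (hker hε) (hIl ε)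
  have hη0 : ∀ {ε : ℝ}, 0 < ε → ∀ x, d x < 2 * ε → η ε x = 0 := by
    intro ε hε x hx
    have := abs_conv_moll_le hε moll_kernel (I ε) x (M := 0) fun y hy => by
      have : ¬ 3 * ε ≤ d y := by have := hd1 y x; linarith
      simp [hI, this]
    rw [mul_zero] at this
    exact abs_nonpos_iff.1 this
  have hη1 : ∀ {ε : ℝ}, 0 < ε → ∀ x, 4 * ε < d x → η ε x = 1 := by
    intro ε hε x hx
    have := abs_conv_moll_sub_le hε (hIl ε) x 1 (M := 0) fun y hy => by
      have : 3 * ε ≤ d y := by have := hd1 x y; rw [norm_sub_rev] at this; linarith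
      simp [hI, this]
    exact sub_eq_zero.1 (abs_nonpos_iff.1 this)
  set A : ℝ := ∑ i ∈ Finset.range 3, ∑ j ∈ Finset.range 3, ∫ z, |D i j moll z| with hA
  have hAle : ∀ i j, i + j ≤ 2 → ∫ z, |D i j moll z| ≤ A := by
    intro i j hij
    have h0 : ∀ i j, 0 ≤ ∫ z, |D i j moll z| := fun i j => integral_nonneg fun z => abs_nonneg _
    exact (Finset.single_le_sum (f := fun j => ∫ z, |D i j moll z|) (fun j _ => h0 i j)
      (Finset.mem_range.2 (by omega : j < 3))).trans
      (Finset.single_le_sum (f := fun i => ∑ j ∈ Finset.range 3, ∫ z, |D i j moll z|)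
        (fun i _ => Finset.sum_nonneg fun j _ => h0 i j) (Finset.mem_range.2 (by omega : i < 3)))
  have hA0 : 0 ≤ A := (integral_nonneg fun z => abs_nonneg _).trans (hAle 0 0 (by norm_num))
  have hηJ : ∀ {ε : ℝ}, 0 < ε → ∀ x, JB ε A (η ε) x := fun {ε} hε x i j hij =>
    (abs_D_conv_moll_le (hIl ε) (hI1 ε) hε i j x).trans (by rw [mul_one]; exact hAle i j hij)
  -- the approximating test functions
  set φ : ℝ → Plane → ℝ := fun ε x => η ε x * U ε x with hφ
  have hφt : ∀ {ε : ℝ}, 0 < ε → IsTestFunction Ω (φ ε) := by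
    intro ε hε
    have hcl2 : IsClosed {x | 2 * ε ≤ d x} := isClosed_le continuous_const hdc
    have hsub : tsupport (φ ε) ⊆ {x | 2 * ε ≤ d x} := by
      refine closure_minimal (fun x hx => ?_) hcl2
      by_contra h
      exact hx (by simp [hφ, hη0 hε x (not_le.1 h)])
    have hsub2 : {x | 2 * ε ≤ d x} ⊆ Ω := by
      intro x hx
      by_contra h
      have : d x = 0 := Metric.infDist_zero_of_mem h
      change 2 * ε ≤ d x at hx
      rw [this] at hx
      linarith
    exact ⟨(hηs hε).mul (hUs hε), Metric.isCompact_of_isClosed_isBounded (isClosed_tsupport _)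
      (hb.subset (hsub.trans hsub2)), hsub.trans hsub2⟩
  have hφD : ∀ {ε : ℝ}, 0 < ε → ∀ x, 4 * ε < d x → ∀ i j, i + j ≤ 2 →
      D i j (φ ε) x = conv (sc ε moll) (W i j) x := by
    intro ε hε x hx i j hij
    rw [← hUD hε i j hij]
    refine (D_congr_germ ?_ i j).eq_of_nhds
    filter_upwards [(isOpen_lt continuous_const hdc).mem_nhds hx] with z hz
    rw [hφ]
    simp only
    rw [hη1 hε z hz, one_mul]
  have hφM : ∀ {ε : ℝ}, 0 < ε → ε ≤ 1 → ∀ x i j, i + j ≤ 2 → |D i j (φ ε) x| ≤ M + 196 * A * M := by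
    intro ε hε hε1 x i j hij
    by_cases hx : 4 * ε < d x
    · rw [hφD hε x hx i j hij]
      refine (abs_conv_moll_le hε moll_kernel _ x fun y _ => hM i j hij y).trans ?_
      rw [integral_abs_moll, one_mul]
      have : 0 ≤ 196 * A * M := by positivity
      linarith
    -- Near the complement a nearest point `y` is within `6 ε` of `x`, hence within `7 ε` of all
    -- points seen by the mollifier, and flatness gives the bound `49 M ε²` for the scaled
    -- derivatives. The product rule with its factor 4 leads to `196 A M`.
    · obtain ⟨y, hy, hxy⟩ := hcl.exists_infDist_eq_dist hne x
      have hxy' : ‖x - y‖ ≤ 6 * ε := by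
        rw [← dist_eq_norm, ← hxy]; change d x ≤ _; linarith [not_lt.1 hx]
      have hUJ : JB ε (49 * M * ε ^ 2) (U ε) x := by
        intro k l hkl
        rw [hUD hε k l hkl]
        have h1 : |conv (sc ε moll) (W k l) x| ≤ M * (7 * ε) ^ (2 - (k + l)) := by
          refine (abs_conv_moll_le hε moll_kernel _ x (M := M * (7 * ε) ^ (2 - (k + l)))
            fun z hz => (hflat k l hkl z y hy).trans ?_).trans ?_
          · have : ‖z - y‖ ≤ 7 * ε := by
              have := norm_sub_le_norm_sub_add_norm_sub z x y
              linarith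
            gcongr
          · rw [integral_abs_moll, one_mul]
        refine (mul_le_mul_of_nonneg_right h1 (by positivity)).trans ?_
        have h2 : ε ^ (2 - (k + l)) * ε ^ (k + l) = ε ^ 2 := by rw [← pow_add]; congr 1; omega
        have h3 : (7 : ℝ) ^ (2 - (k + l)) ≤ 7 ^ 2 := pow_le_pow_right₀ (by norm_num) (by omega)
        calc M * (7 * ε) ^ (2 - (k + l)) * ε ^ (k + l)
            = M * 7 ^ (2 - (k + l)) * (ε ^ (2 - (k + l)) * ε ^ (k + l)) := by rw [mul_pow]; ring
          _ ≤ M * 7 ^ 2 * ε ^ 2 := by rw [h2]; gcongr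
          _ = _ := by ring
      have h4 := ((hηJ hε x).mul hε.le (hηs hε) (hUs hε) hUJ) i j hij
      have h5 : ε ^ 2 ≤ ε ^ (i + j) := pow_le_pow_of_le_one hε.le hε1 hij
      have h6 : |D i j (φ ε) x| * ε ^ (i + j) ≤ (196 * A * M) * ε ^ (i + j) := by
        calc _ ≤ 4 * (A * (49 * M * ε ^ 2)) := h4
          _ = 196 * A * M * ε ^ 2 := by ring
          _ ≤ _ := by gcongr
      have := le_of_mul_le_mul_right h6 (by positivity)
      linarith
  -- convergence
  set e : ℕ → ℝ := fun n => 1 / ((n : ℝ) + 1) with he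
  have he0 : ∀ n, 0 < e n := fun n => by positivity
  have he1 : ∀ n, e n ≤ 1 := fun n => by
    rw [he, div_le_one (by positivity)]; have := (Nat.cast_nonneg n : (0 : ℝ) ≤ n); linarith
  have hel : Tendsto e atTop (𝓝 0) := tendsto_one_div_add_atTop_nhds_zero_nat
  have hpt : ∀ i j, i + j ≤ 2 → ∀ᵐ x ∂volume.restrict Ω,
      Tendsto (fun n => D i j (φ (e n)) x) atTop (𝓝 (W i j x)) := by
    intro i j hij
    refine (ae_restrict_iff' hΩ.measurableSet).2 ?_
    filter_upwards [hc] with x hx hxΩ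
    have h1 : ∀ᶠ n in atTop, 4 * e n < d x := by
      have : Tendsto (fun n => 4 * e n) atTop (𝓝 0) := by simpa using hel.const_mul 4
      exact this.eventually_lt_const (hdpos x hxΩ)
    rw [Metric.tendsto_atTop']
    intro δ hδ
    obtain ⟨r, hr, hrδ⟩ := Metric.continuousAt_iff.1 (hx i j hij) (δ / 2) (half_pos hδ)
    obtain ⟨N, hN⟩ := eventually_atTop.1 (h1.and (hel.eventually_lt_const hr))
    refine ⟨N, fun n hn => ?_⟩
    obtain ⟨h2, h3⟩ := hN n hn.le
    rw [hφD (he0 n) x h2 i j hij, Real.dist_eq]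
    refine lt_of_le_of_lt (abs_conv_moll_sub_le (he0 n) (hW i j hij) x _ (M := δ / 2) fun y hy => ?_)
      (half_lt_self hδ)
    rw [← Real.dist_eq]
    exact (hrδ (by rw [dist_eq_norm]; linarith)).le
  have hmem : ∀ i j, i + j ≤ 2 → MemLp (W i j) 2 (volume.restrict Ω) := fun i j hij =>
    MemLp.of_bound ((hW i j hij).aestronglyMeasurable.restrict) M
      (Eventually.of_forall fun x => hM i j hij x)
  have hL2 : ∀ i j (hij : i + j ≤ 2), Tendsto (fun n => wL Ω i j (φ (e n))) atTop
      (𝓝 ((hmem i j hij).toLp)) := by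
    intro i j hij
    rw [tendsto_iff_norm_sub_tendsto_zero]
    have hsq : Tendsto (fun n => ‖wL Ω i j (φ (e n)) - (hmem i j hij).toLp‖ ^ 2) atTop (𝓝 0) := by
      have hdom : Tendsto (fun n => ∫ x in Ω, (D i j (φ (e n)) x - W i j x) ^ 2) atTop
          (𝓝 (∫ x in Ω, (0 : ℝ))) := by
        refine tendsto_integral_of_dominated_convergence
          (fun _ => (M + 196 * A * M + M) ^ 2) (fun n => ?_) (integrable_const _) (fun n => ?_) ?_
        · exact (((continuous_D (hφt (he0 n)).1 i j).aestronglyMeasurable).sub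
            ((hW i j hij).aestronglyMeasurable.restrict)).pow 2
        · refine Eventually.of_forall fun x => ?_
          rw [norm_pow, Real.norm_eq_abs]
          have := abs_sub (D i j (φ (e n)) x) (W i j x)
          have h1 := hφM (he0 n) (he1 n) x i j hij
          have h2 := hM i j hij x
          gcongr
          linarith
        · filter_upwards [hpt i j hij] with x hx
          simpa using (hx.sub_const (W i j x)).pow 2
      rw [integral_zero] at hdom
      refine hdom.congr fun n => ?_
      rw [norm_sq_eq_integral]
      refine integral_congr_ae ?_
      filter_upwards [Lp.coeFn_sub (wL Ω i j (φ (e n))) (hmem i j hij).toLp,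
        wL_test_ae hΩ (hφt (he0 n)) i j, (hmem i j hij).coeFn_toLp] with x h1 h2 h3
      rw [h1, Pi.sub_apply, h2, h3]
    have := hsq.sqrt
    simpa [Real.sqrt_sq] using this
  obtain ⟨hw1, hw2⟩ := exists_memH0_of_tendsto hb hΩ (fun n => hφt (he0 n))
    (w := WithLp.toLp 2 fun n => (hmem (idx n).1 (idx n).2 (idx_le n)).toLp)
    (tendsto_tup.2 fun n => hL2 _ _ (idx_le n))
  set w0 : Lp ℝ 2 (volume.restrict Ω) := (hmem 0 0 (by norm_num)).toLp with hw0
  have hw1' : MemH0 2 Ω w0 := hw1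
  have hae : (w0 : Plane → ℝ) =ᵐ[volume.restrict Ω] W 0 0 := (hmem 0 0 (by norm_num)).coeFn_toLp
  -- Completeness yields a class in `L²(Ω)`; what remains is to pass to the given function, which
  -- agrees with it almost everywhere.
  obtain ⟨hH, ψ, hψ, hψl⟩ := (memH0_two_iff hΩ).1 hw1'
  refine ⟨(memH0_two_iff hΩ).2 ⟨hH.congr hΩ hae, ψ, hψ, fun i j hij => ?_⟩, fun i j hij => ?_⟩
  · rw [wL_congr hΩ hH hae hij]
    exact hψl i j hij
  · rw [wL_congr hΩ hH hae hij]
    obtain ⟨n, hn⟩ := exists_idx hij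
    have h1 : wL Ω (idx n).1 (idx n).2 w0 = (hmem (idx n).1 (idx n).2 (idx_le n)).toLp :=
      congrArg (fun t : Tup Ω => t n) hw2
    have h2 := (hmem (idx n).1 (idx n).2 (idx_le n)).coeFn_toLp
    rw [← h1, hn] at h2
    exact h2

end

section

open Filter Topology

variable {Ω : Set Plane} {K : Geometry.SimplicialComplex ℝ Plane}

/-! ### Gluing of smooth functions along the triangles -/

theorem abs_sub_le_of_D_le {C : Set Plane} (hC : Convex ℝ C) {f : Plane → ℝ}
    (hf : ContDiff ℝ ∞ f) {M : ℝ} (hM : ∀ x ∈ C, |D 1 0 f x| ≤ M ∧ |D 0 1 f x| ≤ M) {x y : Plane}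
    (hx : x ∈ C) (hy : y ∈ C) : |f x - f y| ≤ 2 * M * ‖x - y‖ := by
  have hb : ∀ z ∈ C, ‖fderiv ℝ f z‖ ≤ 2 * M := by
    intro z hz
    obtain ⟨h10, h01⟩ := hM z hz
    refine ContinuousLinearMap.opNorm_le_bound _ (by linarith [(abs_nonneg _).trans h10]) fun v => ?_
    rw [fderiv_apply_eq, Real.norm_eq_abs]
    refine (abs_add_le _ _).trans ?_
    rw [abs_mul, abs_mul]
    nlinarith [mul_le_mul (abs_coord_le_norm v 0) h10 (abs_nonneg _) (norm_nonneg _),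
      mul_le_mul (abs_coord_le_norm v 1) h01 (abs_nonneg _) (norm_nonneg _)]
  simpa [Real.norm_eq_abs] using hC.norm_image_sub_le_of_norm_fderiv_le
    (fun z _ => differentiable_of_smooth hf z) hb hy hx

/-- A function that is Lipschitz continuous on the members of a finite closed cover is Lipschitz
continuous on convex sets. -/
theorem lipschitz_of_cover {ι : Type*} [Finite ι] {C : ι → Set Plane} (hC : ∀ i, IsClosed (C i))
    (hcov : ⋃ i, C i = univ) {f : Plane → ℝ} (hf : Continuous f) {A : Set Plane}
    (hA : Convex ℝ A) {L : ℝ} (hL : ∀ i, ∀ x ∈ C i ∩ A, ∀ y ∈ C i ∩ A, |f x - f y| ≤ L * ‖x - y‖)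
    {x y : Plane} (hx : x ∈ A) (hy : y ∈ A) : |f x - f y| ≤ L * ‖x - y‖ := by
  set γ : ℝ → Plane := fun t => x + t • (y - x) with hγ
  have hγc : Continuous γ := by fun_prop
  have hγA : ∀ t ∈ Icc (0 : ℝ) 1, γ t ∈ A := fun t ht => hA.add_smul_sub_mem hx hy ht
  -- A continuation argument along the segment. The set `S` is closed, and it extends to the right
  -- of each of its points: by finiteness some member of the cover contains points of the segment
  -- arbitrarily close to the right of `γ t`, and `γ t` itself because it is closed.
  set S : Set ℝ := {t | |f (γ t) - f x| ≤ L * ‖y - x‖ * t} with hS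
  have hScl : IsClosed S := isClosed_le (by fun_prop) (by fun_prop)
  have key : Icc (0 : ℝ) 1 ⊆ S := by
    refine IsClosed.Icc_subset_of_forall_exists_gt (hScl.inter isClosed_Icc) ?_ ?_
    · simp [hS, hγ]
    · rintro t ⟨htS, ht⟩ b hb
      obtain ⟨i, hi⟩ : ∃ i, ∃ᶠ r in 𝓝[>] t, γ r ∈ C i := by
        by_contra! hcon
        have h1 : ∀ᶠ r in 𝓝[>] t, ∀ i, γ r ∉ C i := eventually_all.2 fun i => by
          simpa using hcon i
        obtain ⟨r, hr⟩ := h1.exists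
        have : γ r ∈ ⋃ i, C i := hcov ▸ mem_univ _
        obtain ⟨i, hi⟩ := mem_iUnion.1 this
        exact hr i hi
      have hti : γ t ∈ C i :=
        (hC i).mem_of_frequently_of_tendsto hi ((hγc.tendsto t).mono_left nhdsWithin_le_nhds)
      have hlt : t < min b 1 := lt_min hb ht.2
      obtain ⟨r, hri, hr1, hr2⟩ := (hi.and_eventually (Ioo_mem_nhdsGT hlt)).exists
      have hr2' := lt_min_iff.1 hr2
      refine ⟨r, ?_, hr1, hr2'.1.le⟩
      have h2 := hL i (γ r) ⟨hri, hγA r ⟨ht.1.trans hr1.le, hr2'.2.le⟩⟩ (γ t)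
        ⟨hti, hγA t ⟨ht.1, ht.2.le⟩⟩
      have h3 : ‖γ r - γ t‖ = (r - t) * ‖y - x‖ := by
        rw [hγ]
        simp only
        rw [add_sub_add_left_eq_sub, ← sub_smul, norm_smul, Real.norm_eq_abs,
          abs_of_pos (sub_pos.2 hr1)]
      rw [h3] at h2
      have h4 : |f (γ t) - f x| ≤ L * ‖y - x‖ * t := htS
      have h5 := abs_sub_le (f (γ r)) (f (γ t)) (f x)
      change |f (γ r) - f x| ≤ L * ‖y - x‖ * r
      linarith
  have h1 := key ⟨zero_le_one, le_refl (1 : ℝ)⟩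
  have h2 : |f y - f x| ≤ L * ‖y - x‖ := by simpa [hS, hγ] using h1
  rwa [abs_sub_comm, norm_sub_rev]

theorem ae_mem_interior (hP : IsPolygonalDomain Ω) (hK : IsTriangulation K Ω) :
    ∀ᵐ x, (∃ s ∈ triangles K, x ∈ interior (tri s)) ∨ x ∉ closure Ω := by
  have h1 : ∀ᵐ x, ∀ s ∈ triangles K, x ∉ tri s \ interior (tri s) :=
    (ae_ball_iff (finite_triangles hK).countable).2 fun s _ =>
      measure_eq_zero_iff_ae_notMem.1 (volume_tri_diff_interior s)
  filter_upwards [h1] with x hx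
  by_cases hxc : x ∈ closure Ω
  · obtain ⟨s, hs, hxs⟩ := exists_tri_of_mem hP hK hxc
    by_contra! hcon
    exact hx s hs ⟨hxs, hcon.1 s hs⟩
  · exact Or.inr hxc

/-- Smooth functions on the triangles with matching values and gradients, which vanish on the
boundary together with their gradients, define a function of `H²_0(Ω)`. -/
theorem exists_glue (hP : IsPolygonalDomain Ω) (hK : IsTriangulation K Ω)
    {f : Finset Plane → Plane → ℝ} (hf : ∀ s, ContDiff ℝ ∞ (f s))
    (hcompat : ∀ s ∈ triangles K, ∀ t ∈ triangles K, ∀ x ∈ tri s, x ∈ tri t → ∀ i j, i + j ≤ 1 →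
      D i j (f s) x = D i j (f t) x)
    (h0 : ∀ s ∈ triangles K, ∀ x ∈ tri s, x ∉ Ω → ∀ i j, i + j ≤ 1 → D i j (f s) x = 0) :
    ∃ V, MemH0 2 Ω V ∧ (∀ s ∈ triangles K, ∀ x ∈ tri s, V x = f s x) ∧
      ∀ s ∈ triangles K, ∀ i j, i + j ≤ 2 →
        wL Ω i j V =ᵐ[volume.restrict (interior (tri s))] D i j (f s) := by
  classical
  have hΩ := hP.isOpen
  have hfin := finite_triangles hK
  have hsel : ∀ y ∈ Ω, ∃ q ∈ triangles K, y ∈ tri q := fun y hy =>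
    exists_tri_of_mem hP hK (subset_closure hy)
  choose! q hq hyq using hsel
  -- On an edge `q` selects one of several triangles. Up to order one the choice is immaterial by
  -- compatibility; second derivatives may jump, but only on a null set.
  set W : ℕ → ℕ → Plane → ℝ := fun i j x => if x ∈ Ω then D i j (f (q x)) x else 0 with hW
  have hWout : ∀ i j x, x ∉ Ω → W i j x = 0 := fun i j x hx => by simp [hW, hx]
  have hWtri : ∀ s ∈ triangles K, ∀ x ∈ tri s, ∀ i j, i + j ≤ 1 → W i j x = D i j (f s) x := by
    intro s hs x hx i j hij
    by_cases hxΩ : x ∈ Ω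
    · simp only [hW, hxΩ, if_true]
      exact hcompat _ (hq x hxΩ) s hs x (hyq x hxΩ) hx i j hij
    · rw [hWout i j x hxΩ, h0 s hs x hx hxΩ i j hij]
  have hWint : ∀ s ∈ triangles K, ∀ x ∈ interior (tri s), ∀ i j, W i j x = D i j (f s) x := by
    intro s hs x hx i j
    have hxΩ := interior_tri_subset hP hK hs hx
    have : q x = s := by
      by_contra hne
      exact (disjoint_left.1 (disjoint_interior hs (hq x hxΩ) (Ne.symm hne)) hx) (hyq x hxΩ)
    simp only [hW, hxΩ, if_true, this]
  have hgerm : ∀ s ∈ triangles K, ∀ x ∈ interior (tri s), ∀ i j, W i j =ᶠ[𝓝 x] D i j (f s) :=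
    fun s hs x hx i j => by
      filter_upwards [isOpen_interior.mem_nhds hx] with z hz using hWint s hs z hz i j
  have hgerm0 : ∀ x ∉ closure Ω, ∀ i j, W i j =ᶠ[𝓝 x] fun _ => 0 := fun x hx i j => by
    filter_upwards [isClosed_closure.isOpen_compl.mem_nhds hx] with z hz
    exact hWout i j z fun h => hz (subset_closure h)
  have hgood := ae_mem_interior hP hK
  -- bounds
  obtain ⟨M, hM0, hM⟩ : ∃ M, 0 ≤ M ∧ ∀ s ∈ triangles K, ∀ x ∈ tri s, ∀ i j, i + j ≤ 2 →
      |D i j (f s) x| ≤ M := by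
    have h1 : ∀ s : Finset Plane, ∀ i j, ∃ M, ∀ x ∈ tri s, |D i j (f s) x| ≤ M := fun s i j =>
      (isCompact_tri s).exists_bound_of_continuousOn (continuous_D (hf s) i j).continuousOn
    choose B hB using h1
    obtain ⟨M, hM⟩ := ((hfin.prod ((Set.finite_Iic 2).prod (Set.finite_Iic 2))).image
      (fun p : Finset Plane × ℕ × ℕ => B p.1 p.2.1 p.2.2)).bddAbove
    refine ⟨max M 0, le_max_right _ _, fun s hs x hx i j hij => ?_⟩
    refine (hB s i j x hx).trans ((hM ?_).trans (le_max_left _ _))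
    exact ⟨(s, i, j), ⟨hs, by simp; omega, by simp; omega⟩, rfl⟩
  have hWM : ∀ i j, i + j ≤ 2 → ∀ x, |W i j x| ≤ M := by
    intro i j hij x
    by_cases hx : x ∈ Ω
    · simp only [hW, hx, if_true]
      exact hM _ (hq x hx) x (hyq x hx) i j hij
    · rw [hWout i j x hx, abs_zero]; exact hM0
  -- continuity
  have : Finite {s // s ∈ triangles K} := hfin
  -- A finite closed cover of the plane: the triangles, and as an additional member the complement
  -- of `Ω`, where everything is zero.
  set C : Option {s // s ∈ triangles K} → Set Plane := fun o => o.elim Ωᶜ fun s => tri s.1 with hC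
  have hCcl : ∀ o, IsClosed (C o) := by
    rintro (_ | s)
    exacts [hΩ.isClosed_compl, (isCompact_tri s.1).isClosed]
  have hCcov : ⋃ o, C o = univ := by
    refine eq_univ_of_forall fun x => mem_iUnion.2 ?_
    by_cases hx : x ∈ Ω
    exacts [⟨some ⟨q x, hq x hx⟩, hyq x hx⟩, ⟨none, hx⟩]
  have hWc : ∀ i j, i + j ≤ 1 → Continuous (W i j) := by
    intro i j hij
    refine (locallyFinite_of_finite C).continuous hCcov hCcl ?_
    rintro (_ | s)
    · exact continuousOn_const.congr fun x hx => hWout i j x hx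
    · exact (continuous_D (hf s.1) i j).continuousOn.congr fun x hx => hWtri s.1 s.2 x hx i j hij
  have hWlip : ∀ i j, i + j ≤ 1 → ∀ x y, |W i j x - W i j y| ≤ 2 * M * ‖x - y‖ := by
    intro i j hij x y
    refine lipschitz_of_cover hCcl hCcov (hWc i j hij) convex_univ ?_ (mem_univ x) (mem_univ y)
    rintro (_ | s) x ⟨hx, -⟩ y ⟨hy, -⟩
    · rw [hWout i j x hx, hWout i j y hy, sub_zero, abs_zero]; positivity
    · rw [hWtri s.1 s.2 x hx i j hij, hWtri s.1 s.2 y hy i j hij]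
      refine abs_sub_le_of_D_le (convex_tri s.1) (smooth_D (hf s.1) i j) (fun z hz => ?_) hx hy
      rw [D_D (hf _), D_D (hf _)]
      exact ⟨hM _ s.2 z hz _ _ (by omega), hM _ s.2 z hz _ _ (by omega)⟩
  have hWflat : ∀ i j, i + j ≤ 1 → ∀ x, ∀ y ∉ Ω, |W i j x| ≤ 2 * M * ‖x - y‖ := by
    intro i j hij x y hy
    simpa [hWout i j y hy] using hWlip i j hij x y
  -- In the disc of radius `R` about `y` the first derivatives are at most `2 M R`, since they
  -- vanish at `y`. The Lipschitz bound in this convex disc then makes the value quadratically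
  -- small.
  have hVflat : ∀ x, ∀ y ∉ Ω, |W 0 0 x| ≤ 4 * M * ‖x - y‖ ^ 2 := by
    intro x y hy
    set R := ‖x - y‖ with hR
    have h1 : |W 0 0 x - W 0 0 y| ≤ 2 * (2 * M * R) * ‖x - y‖ := by
      refine lipschitz_of_cover hCcl hCcov (hWc 0 0 (by norm_num)) (convex_closedBall y R) ?_
        (by rw [Metric.mem_closedBall, dist_eq_norm]) (Metric.mem_closedBall_self (norm_nonneg _))
      rintro (_ | s) x ⟨hx, hxR⟩ z ⟨hz, hzR⟩
      · rw [hWout 0 0 x hx, hWout 0 0 z hz, sub_zero, abs_zero]; positivity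
      · rw [hWtri s.1 s.2 x hx 0 0 (by norm_num), hWtri s.1 s.2 z hz 0 0 (by norm_num)]
        refine abs_sub_le_of_D_le (C := tri s.1 ∩ Metric.closedBall y R)
          ((convex_tri s.1).inter (convex_closedBall y R)) (hf s.1) (fun w hw => ?_) ⟨hx, hxR⟩ ⟨hz, hzR⟩
        rw [← hWtri s.1 s.2 w hw.1 1 0 (by norm_num), ← hWtri s.1 s.2 w hw.1 0 1 (by norm_num)]
        have : ‖w - y‖ ≤ R := by rw [← dist_eq_norm]; exact hw.2
        have h3 : 2 * M * ‖w - y‖ ≤ 2 * M * R := by gcongr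
        exact ⟨(hWflat 1 0 (by norm_num) w y hy).trans h3, (hWflat 0 1 (by norm_num) w y hy).trans h3⟩
    rw [hWout 0 0 y hy, sub_zero] at h1
    linarith
  -- measurability
  have hWloc : ∀ i j, i + j ≤ 2 → LocallyIntegrable (W i j) := by
    intro i j hij
    have hmeas : AEStronglyMeasurable (W i j) volume := by
      refine (Finset.aestronglyMeasurable_sum hfin.toFinset
        (f := fun s => (interior (tri s)).indicator (D i j (f s))) fun s _ =>
        ((continuous_D (hf s) i j).aestronglyMeasurable.indicator
          isOpen_interior.measurableSet)).congr ?_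
      filter_upwards [hgood] with x hx
      rw [Finset.sum_apply]
      rcases hx with ⟨s, hs, hxs⟩ | hx
      · rw [Finset.sum_eq_single s, indicator_of_mem hxs, hWint s hs x hxs]
        · intro t ht hts
          refine indicator_of_notMem (fun h => ?_) _
          exact disjoint_left.1 (disjoint_interior hs (hfin.mem_toFinset.1 ht) (Ne.symm hts)) hxs
            (interior_subset h)
        · intro h; exact absurd (hfin.mem_toFinset.2 hs) h
      · rw [hWout i j x fun h => hx (subset_closure h)]
        refine Finset.sum_eq_zero fun s hs => indicator_of_notMem (fun h => hx ?_) _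
        exact tri_subset_closure hK (hfin.mem_toFinset.1 hs) (interior_subset h)
    exact (locallyIntegrable_const M).mono hmeas (Eventually.of_forall fun x => by
      rw [Real.norm_eq_abs, Real.norm_eq_abs, abs_of_nonneg hM0]; exact hWM i j hij x)
  -- weak derivatives
  have hweak : ∀ i j, i + j ≤ 1 → ∀ (v : Fin 2) (i' j' : ℕ), (∀ s, pd v (D i j (f s)) = D i' j' (f s)) →
      ∀ θ, IsTestFunction univ θ → ∫ x in univ, W i j x * pd v θ x =
        - ∫ x in univ, W i' j' x * θ x := by
    intro i j hij v i' j' hD θ hθ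
    set ev : Plane := EuclideanSpace.single v (1 : ℝ) with hev
    -- Lipschitz functions may be integrated by parts with their almost everywhere derivatives,
    -- which are the classical ones inside the triangles and zero outside; jumps of second
    -- derivatives across edges do no harm.
    have hl1 : LipschitzWith ⟨2 * M, by positivity⟩ (W i j) :=
      LipschitzWith.of_dist_le_mul fun x y => by
        rw [Real.dist_eq, dist_eq_norm]; exact hWlip i j hij x y
    obtain ⟨B, hl2⟩ := hθ.1.lipschitzWith_of_hasCompactSupport hθ.2.1 (by simp)
    have := hl1.integral_lineDeriv_mul_eq (μ := volume) hl2 hθ.2.1 ev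
    rw [setIntegral_univ, setIntegral_univ]
    have e1 : ∫ x, lineDeriv ℝ (W i j) x ev * θ x = ∫ x, W i' j' x * θ x := by
      refine integral_congr_ae ?_
      filter_upwards [hgood] with x hx
      congr 1
      rcases hx with ⟨s, hs, hxs⟩ | hx
      · rw [(hgerm s hs x hxs i j).lineDeriv_eq, hWint s hs x hxs, ← hD,
          (differentiable_of_smooth (smooth_D (hf s) i j) x).lineDeriv_eq_fderiv, pd]
      · rw [(hgerm0 x hx i j).lineDeriv_eq, hWout i' j' x fun h => hx (subset_closure h)]
        simp [lineDeriv]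
    have e2 : ∫ x, lineDeriv ℝ θ x (-ev) * W i j x = - ∫ x, W i j x * pd v θ x := by
      rw [← integral_neg]
      congr 1; funext x
      rw [(differentiable_of_smooth hθ.1 x).lineDeriv_eq_fderiv, map_neg, pd]
      ring
    rw [e1, e2] at this
    rw [this, neg_neg]
  have hloc : ∀ i j, i + j ≤ 2 → LocallyIntegrableOn (W i j) univ := fun i j hij =>
    (hWloc i j hij).locallyIntegrableOn _
  have hHWD : ∀ i j, i + j ≤ 1 →
      HWD univ 1 0 (W i j) (W (i + 1) j) ∧ HWD univ 0 1 (W i j) (W i (j + 1)) := by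
    intro i j hij
    refine ⟨⟨hloc _ _ (by omega), hloc _ _ (by omega), fun θ hθ => ?_⟩,
      ⟨hloc _ _ (by omega), hloc _ _ (by omega), fun θ hθ => ?_⟩⟩
    · have := hweak i j hij 0 (i + 1) j (fun s => pd_zero_D _ _ _) θ hθ
      simpa [D] using this
    · have := hweak i j hij 1 i (j + 1) (fun s => pd_one_D (hf s) _ _) θ hθ
      simpa [D] using this
  have hflat1 : ∀ i j, i + j = 1 → ∀ x, ∀ y ∉ Ω, |W i j x| ≤ 4 * M * ‖x - y‖ ^ (2 - (i + j)) := by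
    intro i j hij x y hy
    rw [hij]
    have h1 := hWflat i j hij.le x y hy
    have h2 := mul_nonneg hM0 (norm_nonneg (x - y))
    norm_num
    linarith
  obtain ⟨hV, hVw⟩ := memH0_of_flat hΩ (isBounded_domain hK) (M := 4 * M) hWloc hHWD
    (fun i j hij x => (hWM i j hij x).trans (by linarith))
    (forall_two.2 ⟨hVflat, hflat1 1 0 rfl, hflat1 0 1 rfl,
      fun x y _ => by simpa using (hWM 2 0 (by norm_num) x).trans (by linarith),
      fun x y _ => by simpa using (hWM 1 1 (by norm_num) x).trans (by linarith),
      fun x y _ => by simpa using (hWM 0 2 (by norm_num) x).trans (by linarith)⟩) (by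
        filter_upwards [hgood] with x hx i j _
        rcases hx with ⟨s, hs, hxs⟩ | hx
        · exact (continuous_D (hf s) i j).continuousAt.congr (hgerm s hs x hxs i j).symm
        · exact continuousAt_const.congr (hgerm0 x hx i j).symm)
  refine ⟨W 0 0, hV, fun s hs x hx => hWtri s hs x hx 0 0 (by norm_num), fun s hs i j hij => ?_⟩
  have h1 := ae_restrict_of_ae_restrict_of_subset (interior_tri_subset hP hK hs) (hVw i j hij)
  filter_upwards [h1, ae_restrict_mem isOpen_interior.measurableSet] with x hx hxs
  rw [hx, hWint s hs x hxs]

end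

section

open Filter Topology

variable {Ω : Set Plane} {K : Geometry.SimplicialComplex ℝ Plane} {s t : Finset Plane}
  {v : Fin 3 → Plane} {a b : Fin 3 → ℝ}

/-! ### The Argyris interpolant -/

/-- The barycentric coordinate takes the same value at both ends of the opposite edge, so its
gradient is normal to the edge; it is not constant, so the gradient is nonzero. -/
theorem IsTri.normal (h : IsTri s v a b) (i : Fin 3) :
    a i * (v (i + 2) - v (i + 1)) 0 + b i * (v (i + 2) - v (i + 1)) 1 = 0 ∧ (a i ≠ 0 ∨ b i ≠ 0) := by
  have h0 : bc v a b i (v i) = 1 := by rw [h.bc_vertex, if_pos rfl]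
  have h1 : bc v a b i (v (i + 1)) = 0 := by
    rw [h.bc_vertex, if_neg (by clear * -; revert i; decide)]
  have h2 : bc v a b i (v (i + 2)) = 0 := by
    rw [h.bc_vertex, if_neg (by clear * -; revert i; decide)]
  rw [bc_eq] at h1 h2
  refine ⟨?_, ?_⟩
  · simp only [PiLp.sub_apply]
    linarith
  · by_contra! hcon
    rw [hcon.1, hcon.2] at h1
    linarith

theorem IsTri.exists_opposite (h : IsTri s v a b) {P Q : Plane} (hP : P ∈ s) (hQ : Q ∈ s)
    (hPQ : P ≠ Q) : ∃ i, (P = v (i + 1) ∧ Q = v (i + 2)) ∨ (P = v (i + 2) ∧ Q = v (i + 1)) := by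
  obtain ⟨j, rfl⟩ := (h.mem_iff P).1 hP
  obtain ⟨k, rfl⟩ := (h.mem_iff Q).1 hQ
  have hjk : j ≠ k := fun e => hPQ (by rw [e])
  obtain ⟨i, ⟨h1, h2⟩ | ⟨h1, h2⟩⟩ : ∃ i : Fin 3, (j = i + 1 ∧ k = i + 2) ∨ (j = i + 2 ∧ k = i + 1) := by
    clear * - hjk; revert j k; decide
  · exact ⟨i, Or.inl ⟨by rw [h1], by rw [h2]⟩⟩
  · exact ⟨i, Or.inr ⟨by rw [h1], by rw [h2]⟩⟩

/-- `p` interpolates the jets `J` in the degrees of freedom of the Argyris triangle `s`. -/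
structure IsInterpolant (s : Finset Plane) (J : ℕ → ℕ → Plane → ℝ)
    (p : MvPolynomial (Fin 2) ℝ) : Prop where
  deg : p.totalDegree ≤ 5
  vertex : ∀ P ∈ s, ∀ i j, i + j ≤ 2 → D i j (polyFun p) P = J i j P
  mid : ∀ P ∈ s, ∀ Q ∈ s, P ≠ Q → ∀ m n : ℝ, m * (Q - P) 0 + n * (Q - P) 1 = 0 →
    m * D 1 0 (polyFun p) (midpoint ℝ P Q) + n * D 0 1 (polyFun p) (midpoint ℝ P Q) =
      m * J 1 0 (midpoint ℝ P Q) + n * J 0 1 (midpoint ℝ P Q)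

/-- The local construction fixes the midpoint derivative in the direction of the gradient of a
barycentric coordinate. All normals of the edge are multiples of it, and the condition for all
normals no longer refers to the triangle, so it can be compared between neighbours. -/
theorem IsTri.isInterpolant (h : IsTri s v a b) {J : ℕ → ℕ → Plane → ℝ}
    {p : MvPolynomial (Fin 2) ℝ} (hp : p.totalDegree ≤ 5)
    (h1 : ∀ i m l, m + l ≤ 2 → D m l (polyFun p) (v i) = J m l (v i))
    (h2 : ∀ i, a i * D 1 0 (polyFun p) (QGE.mid v i) + b i * D 0 1 (polyFun p) (QGE.mid v i) =
      a i * J 1 0 (QGE.mid v i) + b i * J 0 1 (QGE.mid v i)) : IsInterpolant s J p where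
  deg := hp
  vertex P hP i j hij := by
    obtain ⟨k, rfl⟩ := (h.mem_iff P).1 hP
    exact h1 k i j hij
  mid P hP Q hQ hPQ m n hmn := by
    obtain ⟨i, hi⟩ := h.exists_opposite hP hQ hPQ
    obtain ⟨hn, hn0⟩ := h.normal i
    set e := v (i + 2) - v (i + 1) with he
    have hmid : midpoint ℝ P Q = QGE.mid v i := by
      rcases hi with ⟨rfl, rfl⟩ | ⟨rfl, rfl⟩
      exacts [rfl, midpoint_comm _ _]
    have hmn' : m * e 0 + n * e 1 = 0 := by
      rcases hi with ⟨rfl, rfl⟩ | ⟨rfl, rfl⟩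
      · exact hmn
      · simp only [he, PiLp.sub_apply] at hmn ⊢
        linarith
    have he0 : e 0 ≠ 0 ∨ e 1 ≠ 0 := by
      by_contra! hcon
      have : e = 0 := by
        ext k; fin_cases k
        exacts [hcon.1, hcon.2]
      rw [he, sub_eq_zero] at this
      rcases hi with ⟨rfl, rfl⟩ | ⟨rfl, rfl⟩
      exacts [hPQ this.symm, hPQ this]
    have hpar : m * b i = n * a i := by
      rcases he0 with h0 | h0
      · apply mul_right_cancel₀ h0; linear_combination b i * hmn' - n * hn
      · apply mul_right_cancel₀ h0; linear_combination m * hn - a i * hmn'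
    rw [hmid, ← sub_eq_zero]
    have h3 := h2 i
    rcases hn0 with h0 | h0
    · refine (mul_eq_zero.1 ?_).resolve_left h0
      linear_combination m * h3 - (D 0 1 (polyFun p) (QGE.mid v i) - J 0 1 (QGE.mid v i)) * hpar
    · refine (mul_eq_zero.1 ?_).resolve_left h0
      linear_combination n * h3 + (D 1 0 (polyFun p) (QGE.mid v i) - J 1 0 (QGE.mid v i)) * hpar

theorem edge_zero {w : MvPolynomial (Fin 2) ℝ} (hw : w.totalDegree ≤ 5) {P Q : Plane} (hPQ : P ≠ Q)
    (h1 : ∀ R, R = P ∨ R = Q → ∀ i j, i + j ≤ 1 → D i j (polyFun w) R = 0)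
    (h2 : ∀ R, R = P ∨ R = Q → ∀ i j, i + j = 1 →
      (Q - P) 0 * D (i + 1) j (polyFun w) R + (Q - P) 1 * D i (j + 1) (polyFun w) R = 0)
    (hm : ∀ m n : ℝ, m * (Q - P) 0 + n * (Q - P) 1 = 0 →
      m * D 1 0 (polyFun w) (midpoint ℝ P Q) + n * D 0 1 (polyFun w) (midpoint ℝ P Q) = 0)
    (θ : ℝ) {i j : ℕ} (hij : i + j ≤ 1) : D i j (polyFun w) (P + θ • (Q - P)) = 0 := by
  have hend : ∀ θ : ℝ, θ = 0 ∨ θ = 1 → P + θ • (Q - P) = P ∨ P + θ • (Q - P) = Q := by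
    rintro θ (rfl | rfl)
    · left; simp
    · right; simp
  have hmp : P + (1 / 2 : ℝ) • (Q - P) = midpoint ℝ P Q := by
    ext k
    rw [midpoint_coord]
    simp only [PiLp.add_apply, PiLp.smul_apply, PiLp.sub_apply, smul_eq_mul]
    ring
  refine edge_unisolvent hw (sub_ne_zero.2 hPQ.symm) (m := (Q - P) 1) (n := -(Q - P) 0) (by ring) ?_
    (fun θ hθ i j hij => h1 _ (hend θ hθ) i j hij) (fun θ hθ i j hij => h2 _ (hend θ hθ) i j hij)
    (by rw [hmp]; exact hm _ _ (by ring)) θ hij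
  by_contra! hcon
  apply sub_ne_zero.2 hPQ.symm
  ext k; fin_cases k
  exacts [neg_eq_zero.1 hcon.2, hcon.1]

/-- A common point lies on the edge opposite to an unshared vertex. If an end point of this edge is
not shared either, the point is the other end point, a shared vertex. Otherwise the difference of
the polynomials has zero Argyris data on the edge, and unisolvence applies. -/
theorem IsInterpolant.compat (hs : s ∈ triangles K) (ht : t ∈ triangles K)
    {J J' : ℕ → ℕ → Plane → ℝ} {p p' : MvPolynomial (Fin 2) ℝ} (hp : IsInterpolant s J p)
    (hp' : IsInterpolant t J' p') (hst : s ≠ t)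
    (hJ : ∀ x ∈ tri s, x ∈ tri t → ∀ i j, i + j ≤ 2 → J i j x = J' i j x) {x : Plane}
    (hxs : x ∈ tri s) (hxt : x ∈ tri t) {i j : ℕ} (hij : i + j ≤ 1) :
    D i j (polyFun p) x = D i j (polyFun p') x := by
  obtain ⟨v, a, b, h⟩ := exists_isTri_of_mem hs
  have hsub : ∀ u : Finset Plane, ∀ P ∈ u, P ∈ tri u := fun u P hP => subset_convexHull ℝ _ hP
  obtain ⟨k, hk⟩ := exists_not_mem hs ht hst h
  have h0 := bc_eq_zero_of_not_mem hs ht h hxs hxt hk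
  have hvert : x ∈ s → x ∈ t → D i j (polyFun p) x = D i j (polyFun p') x := fun h1 h2 => by
    rw [hp.vertex x h1 i j (by omega), hp'.vertex x h2 i j (by omega),
      hJ x hxs hxt i j (by omega)]
  obtain ⟨hsum, hx⟩ := h.edge h0
  by_cases m1 : v (k + 1) ∈ t
  swap
  · have h1 := bc_eq_zero_of_not_mem hs ht h hxs hxt m1
    have hx2 : x = v (k + 2) := by
      have : bc v a b (k + 2) x = 1 := by linarith
      rw [this] at hx; rw [hx]; simp
    have m2 : v (k + 2) ∈ t := by
      by_contra m2
      have := bc_eq_zero_of_not_mem hs ht h hxs hxt m2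
      linarith
    exact hvert (hx2 ▸ (h.mem_iff _).2 ⟨_, rfl⟩) (hx2 ▸ m2)
  by_cases m2 : v (k + 2) ∈ t
  swap
  · have h2 := bc_eq_zero_of_not_mem hs ht h hxs hxt m2
    have hx1 : x = v (k + 1) := by rw [hx, h2]; simp
    exact hvert (hx1 ▸ (h.mem_iff _).2 ⟨_, rfl⟩) (hx1 ▸ m1)
  set P := v (k + 1) with hP
  set Q := v (k + 2) with hQ
  have hPs : P ∈ s := (h.mem_iff _).2 ⟨_, rfl⟩
  have hQs : Q ∈ s := (h.mem_iff _).2 ⟨_, rfl⟩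
  have hPQ : P ≠ Q := fun e => by
    have := h.inj e
    clear * - this; revert k; decide
  have hD : ∀ i j x, D i j (polyFun (p - p')) x = D i j (polyFun p) x - D i j (polyFun p') x := by
    intro i j x
    rw [polyFun_sub, D_sub (polyFun_smooth _) (polyFun_smooth _)]
  have hR : ∀ R, R = P ∨ R = Q → ∀ i j, i + j ≤ 2 → D i j (polyFun (p - p')) R = 0 := by
    rintro R hR i j hij
    have hRs : R ∈ s := by rcases hR with rfl | rfl <;> assumption
    have hRt : R ∈ t := by rcases hR with rfl | rfl <;> assumption
    rw [hD, hp.vertex R hRs i j hij, hp'.vertex R hRt i j hij,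
      hJ R (hsub s R hRs) (hsub t R hRt) i j hij, sub_self]
  have hmem : ∀ u : Finset Plane, P ∈ u → Q ∈ u → midpoint ℝ P Q ∈ tri u := fun u h1 h2 =>
    (convex_tri u).midpoint_mem (hsub u P h1) (hsub u Q h2)
  have key := edge_zero (w := p - p')
    ((MvPolynomial.totalDegree_sub _ _).trans (max_le hp.deg hp'.deg)) hPQ
    (fun R h i j hij => hR R h i j (by omega))
    (fun R h i j hij => by rw [hR R h _ _ (by omega), hR R h _ _ (by omega)]; ring)
    (fun m n hmn => by
      have e1 := hp.mid P hPs Q hQs hPQ m n hmn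
      have e2 := hp'.mid P m1 Q m2 hPQ m n hmn
      rw [← hJ _ (hmem s hPs hQs) (hmem t m1 m2) 1 0 (by norm_num),
        ← hJ _ (hmem s hPs hQs) (hmem t m1 m2) 0 1 (by norm_num)] at e2
      rw [hD, hD]
      linear_combination e1 - e2) (bc v a b (k + 2) x) hij
  rw [← hx, hD] at key
  exact sub_eq_zero.1 key

/-- A point of the triangle outside `Ω` is a vertex or lies on an open edge that avoids `Ω`
altogether, where the jets of order at most one vanish. The edge lemma needs second derivatives only
with at least one tangential direction. These vanish as tangential derivatives of the first
derivatives, whereas the second normal derivative may be nonzero. -/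
theorem IsInterpolant.eq_zero (hP : IsPolygonalDomain Ω) (hK : IsTriangulation K Ω)
    (hs : s ∈ triangles K) {J : ℕ → ℕ → Plane → ℝ} {p : MvPolynomial (Fin 2) ℝ}
    (hp : IsInterpolant s J p) (hJ0 : ∀ x ∈ tri s, x ∉ Ω → ∀ i j, i + j ≤ 1 → J i j x = 0)
    {w : ℕ → Plane → ℝ} (hw : ∀ n, ContDiff ℝ ∞ (w n)) (hJ : ∀ i j, i + j ≤ 2 →
      TendstoUniformlyOn (fun n => D i j (w n)) (J i j) atTop (tri s) ∧
      ContinuousOn (J i j) (tri s)) {x : Plane} (hxs : x ∈ tri s) (hx : x ∉ Ω) {i j : ℕ}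
    (hij : i + j ≤ 1) : D i j (polyFun p) x = 0 := by
  obtain ⟨v, a, b, h⟩ := exists_isTri_of_mem hs
  have hvert : x ∈ s → D i j (polyFun p) x = 0 := fun h1 => by
    rw [hp.vertex x h1 i j (by omega), hJ0 x hxs hx i j hij]
  obtain ⟨k, hk⟩ : ∃ k, bc v a b k x = 0 := by
    by_contra! hcon
    exact hx (interior_tri_subset hP hK hs ((h.mem_interior x).2 fun k =>
      lt_of_le_of_ne ((h.mem_tri x).1 hxs k) (hcon k).symm))
  obtain ⟨hsum, hxe⟩ := h.edge hk
  by_cases z1 : bc v a b (k + 1) x = 0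
  · have : x = v (k + 2) := by
      have : bc v a b (k + 2) x = 1 := by linarith
      rw [this] at hxe; rw [hxe]; simp
    exact hvert (this ▸ (h.mem_iff _).2 ⟨_, rfl⟩)
  by_cases z2 : bc v a b (k + 2) x = 0
  · have : x = v (k + 1) := by rw [hxe, z2]; simp
    exact hvert (this ▸ (h.mem_iff _).2 ⟨_, rfl⟩)
  have p1 := lt_of_le_of_ne ((h.mem_tri x).1 hxs (k + 1)) (Ne.symm z1)
  have p2 := lt_of_le_of_ne ((h.mem_tri x).1 hxs (k + 2)) (Ne.symm z2)
  set P := v (k + 1) with hPd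
  set Q := v (k + 2) with hQd
  have hPs : P ∈ s := (h.mem_iff _).2 ⟨_, rfl⟩
  have hQs : Q ∈ s := (h.mem_iff _).2 ⟨_, rfl⟩
  have hPt : P ∈ tri s := h.vertex_mem _
  have hQt : Q ∈ tri s := h.vertex_mem _
  have hPQ : P ≠ Q := fun e => by
    have := h.inj e
    clear * - this; revert k; decide
  have hb : ∀ l, ∀ θ : ℝ, bc v a b l (P + θ • (Q - P)) =
      (1 - θ) * bc v a b l P + θ * bc v a b l Q := fun l θ => bc_line v a b l P Q θ
  have hopen : ∀ θ ∈ Ioo (0 : ℝ) 1, P + θ • (Q - P) ∉ Ω := by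
    intro θ hθ
    refine edge_not_mem hP hK hs h hx hk p1 p2 ?_ ?_ ?_
    · rw [hb, hPd, hQd, h.bc_vertex, h.bc_vertex, if_neg (by clear * -; revert k; decide),
        if_neg (by clear * -; revert k; decide)]; ring
    · rw [hb, hPd, hQd, h.bc_vertex, h.bc_vertex, if_pos rfl,
        if_neg (by clear * -; revert k; decide)]; linarith [hθ.2]
    · rw [hb, hPd, hQd, h.bc_vertex, h.bc_vertex, if_pos rfl,
        if_neg (by clear * -; revert k; decide)]; linarith [hθ.1]
  have hclosed : ∀ θ ∈ Icc (0 : ℝ) 1, P + θ • (Q - P) ∉ Ω := by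
    have hc : IsClosed {θ : ℝ | P + θ • (Q - P) ∈ Ωᶜ} :=
      hP.isOpen.isClosed_compl.preimage (by fun_prop)
    intro θ hθ
    rw [← closure_Ioo (zero_ne_one' ℝ)] at hθ
    exact closure_minimal (fun θ hθ => hopen θ hθ) hc hθ
  have hseg : ∀ θ ∈ Icc (0 : ℝ) 1, P + θ • (Q - P) ∈ tri s := fun θ hθ =>
    (convex_tri s).add_smul_sub_mem hPt hQt hθ
  have hJz : ∀ θ ∈ Icc (0 : ℝ) 1, ∀ i j, i + j ≤ 1 → J i j (P + θ • (Q - P)) = 0 :=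
    fun θ hθ i j hij => hJ0 _ (hseg θ hθ) (hclosed θ hθ) i j hij
  have hend : ∀ R, R = P ∨ R = Q → ∃ θ ∈ Icc (0 : ℝ) 1, R = P + θ • (Q - P) := by
    rintro R (rfl | rfl)
    · exact ⟨0, by simp, by simp⟩
    · exact ⟨1, by simp, by simp⟩
  have hRs : ∀ R, R = P ∨ R = Q → R ∈ s := by rintro R (rfl | rfl) <;> assumption
  have key := edge_zero hp.deg hPQ
    (fun R hR i j hij => by
      obtain ⟨θ, hθ, e⟩ := hend R hR
      rw [hp.vertex R (hRs R hR) i j (by omega), e, hJz θ hθ i j hij])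
    (fun R hR i j hij => by
      obtain ⟨θ, hθ, e⟩ := hend R hR
      rw [hp.vertex R (hRs R hR) _ _ (by omega), hp.vertex R (hRs R hR) _ _ (by omega), e]
      exact tangential_eq_zero hw hJ hij.le hseg
        (fun θ hθ => hJz θ (Ioo_subset_Icc_self hθ) i j hij.le) hθ)
    (fun m n hmn => by
      have hmp : midpoint ℝ P Q = P + (1 / 2 : ℝ) • (Q - P) := by
        ext l
        rw [midpoint_coord]
        simp only [PiLp.add_apply, PiLp.smul_apply, PiLp.sub_apply, smul_eq_mul]
        ring
      rw [hp.mid P hPs Q hQs hPQ m n hmn, hmp, hJz _ (by norm_num) 1 0 (by norm_num),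
        hJz _ (by norm_num) 0 1 (by norm_num)]
      ring) (bc v a b (k + 2) x) hij
  rwa [← hxe] at key

/-! ### Membership in the Argyris space -/

theorem iteratedFDeriv_two_eq {f : Plane → ℝ} (hf : ContDiff ℝ ∞ f) (x : Plane)
    (m : Fin 2 → Plane) : iteratedFDeriv ℝ 2 f x m =
      m 1 0 * (m 0 0 * D 2 0 f x + m 0 1 * D 1 1 f x) +
      m 1 1 * (m 0 0 * D 1 1 f x + m 0 1 * D 0 2 f x) := by
  have h1 : fderiv ℝ (fun y => fderiv ℝ f y (m 1)) x (m 0) = fderiv ℝ (fderiv ℝ f) x (m 0) (m 1) := by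
    have hd : DifferentiableAt ℝ (fderiv ℝ f) x :=
      ((hf.fderiv_right (m := ∞) (by simp)).differentiable (by simp)) x
    rw [fderiv_clm_apply hd (differentiableAt_const _)]
    simp
  rw [iteratedFDeriv_two_apply, ← h1]
  have h2 : (fun y => fderiv ℝ f y (m 1)) = fun y => m 1 0 * D 1 0 f y + m 1 1 * D 0 1 f y :=
    funext fun y => fderiv_apply_eq f y (m 1)
  have s1 := smooth_D hf 1 0
  have s2 := smooth_D hf 0 1
  have s3 : ContDiff ℝ ∞ fun y => m 1 0 * D 1 0 f y := contDiff_const.mul s1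
  have s4 : ContDiff ℝ ∞ fun y => m 1 1 * D 0 1 f y := contDiff_const.mul s2
  rw [h2, fderiv_apply_eq, D_add s3 s4, D_add s3 s4, D_smul _ s1, D_smul _ s2, D_smul _ s1,
    D_smul _ s2, D_D hf, D_D hf, D_D hf, D_D hf]
  ring

theorem isArgyris_of_interpolants {J : Finset Plane → ℕ → ℕ → Plane → ℝ}
    {p : Finset Plane → MvPolynomial (Fin 2) ℝ}
    (hp : ∀ s ∈ triangles K, IsInterpolant s (J s) (p s))
    (hJ : ∀ s ∈ triangles K, ∀ t ∈ triangles K, ∀ x ∈ tri s, x ∈ tri t → ∀ i j, i + j ≤ 2 →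
      J s i j x = J t i j x) {V : Plane → ℝ}
    (hV : ∀ s ∈ triangles K, ∀ x ∈ tri s, V x = polyFun (p s) x) : IsArgyris K V := by
  have hsub : ∀ u : Finset Plane, ∀ P ∈ u, P ∈ tri u := fun u P hP => subset_convexHull ℝ _ hP
  refine ⟨p, fun s hs => ⟨(hp s hs).deg, hV s hs⟩, fun s hs t ht => ⟨fun P hPs hPt => ?_, ?_⟩⟩
  · have h1 : ∀ i j, i + j ≤ 2 → D i j (polyFun (p s)) P = D i j (polyFun (p t)) P :=
      fun i j hij => by
        rw [(hp s hs).vertex P hPs i j hij, (hp t ht).vertex P hPt i j hij,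
          hJ s hs t ht P (hsub s P hPs) (hsub t P hPt) i j hij]
    refine ⟨h1 0 0 (by norm_num), ?_, ?_⟩
    · ext w
      rw [fderiv_apply_eq, fderiv_apply_eq, h1 1 0 (by norm_num), h1 0 1 (by norm_num)]
    · ext m
      rw [iteratedFDeriv_two_eq (polyFun_smooth _), iteratedFDeriv_two_eq (polyFun_smooth _),
        h1 2 0 (by norm_num), h1 1 1 (by norm_num), h1 0 2 (by norm_num)]
  · intro P hPs hPt Q hQs hQt hPQ n hn
    have hn' : n 0 * (Q - P) 0 + n 1 * (Q - P) 1 = 0 := by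
      rw [PiLp.inner_apply, Fin.sum_univ_two] at hn
      simp only [RCLike.inner_apply, conj_trivial] at hn
      linarith
    have hm1 := (convex_tri s).midpoint_mem (hsub s P hPs) (hsub s Q hQs)
    have hm2 := (convex_tri t).midpoint_mem (hsub t P hPt) (hsub t Q hQt)
    rw [fderiv_apply_eq, fderiv_apply_eq, (hp s hs).mid P hPs Q hQs hPQ _ _ hn',
      (hp t ht).mid P hPt Q hQt hPQ _ _ hn', hJ s hs t ht _ hm1 hm2 1 0 (by norm_num),
      hJ s hs t ht _ hm1 hm2 0 1 (by norm_num)]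

/-- Needed because quasi-optimality tests with the difference of the discrete solution and a
competitor. -/
theorem argyrisSpace_sub (hΩ : IsOpen Ω) {f g : Plane → ℝ} (hf : f ∈ argyrisSpace K Ω)
    (hg : g ∈ argyrisSpace K Ω) : (fun x => f x - g x) ∈ argyrisSpace K Ω := by
  obtain ⟨⟨p, hp, hpc⟩, hf0⟩ := hf
  obtain ⟨⟨q, hq, hqc⟩, hg0⟩ := hg
  have hd : ∀ (r : MvPolynomial (Fin 2) ℝ) x, DifferentiableAt ℝ (polyFun r) x := fun r x =>
    differentiable_of_smooth (polyFun_smooth r) x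
  have h1 : ∀ s x, fderiv ℝ (polyFun (p s - q s)) x =
      fderiv ℝ (polyFun (p s)) x - fderiv ℝ (polyFun (q s)) x := fun s x => by
    rw [polyFun_sub]; exact fderiv_sub (hd _ x) (hd _ x)
  have h2 : ∀ s x, iteratedFDeriv ℝ 2 (polyFun (p s - q s)) x =
      iteratedFDeriv ℝ 2 (polyFun (p s)) x - iteratedFDeriv ℝ 2 (polyFun (q s)) x := fun s x => by
    ext m
    rw [_root_.sub_apply, iteratedFDeriv_two_eq (polyFun_smooth _),
      iteratedFDeriv_two_eq (polyFun_smooth _), iteratedFDeriv_two_eq (polyFun_smooth _),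
      polyFun_sub, D_sub (polyFun_smooth _) (polyFun_smooth _),
      D_sub (polyFun_smooth _) (polyFun_smooth _), D_sub (polyFun_smooth _) (polyFun_smooth _)]
    ring
  refine ⟨⟨fun s => p s - q s, fun s hs => ⟨(MvPolynomial.totalDegree_sub _ _).trans
    (max_le (hp s hs).1 (hq s hs).1), fun x hx => ?_⟩, fun s hs t ht => ⟨fun P hPs hPt => ?_, ?_⟩⟩,
    hf0.sub hΩ hg0⟩
  · simp only [polyFun_sub, (hp s hs).2 x hx, (hq s hs).2 x hx]
  · obtain ⟨a1, a2, a3⟩ := (hpc s hs t ht).1 P hPs hPt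
    obtain ⟨b1, b2, b3⟩ := (hqc s hs t ht).1 P hPs hPt
    refine ⟨?_, ?_, ?_⟩
    · simp only [polyFun_sub, a1, b1]
    · rw [h1, h1, a2, b2]
    · rw [h2, h2, a3, b3]
  · intro P hPs hPt Q hQs hQt hPQ n hn
    have a := (hpc s hs t ht).2 P hPs hPt Q hQs hQt hPQ n hn
    have b := (hqc s hs t ht).2 P hPs hPt Q hQs hQt hPQ n hn
    rw [h1, h1, _root_.sub_apply, _root_.sub_apply, a, b]

end

section

open Filter Topology

variable {Ω : Set Plane} {K : Geometry.SimplicialComplex ℝ Plane}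

/-! ### Global interpolation estimates -/

theorem meshSize_nonneg (K : Geometry.SimplicialComplex ℝ Plane) : 0 ≤ meshSize K :=
  Real.sSup_nonneg (by rintro _ ⟨s, -, rfl⟩; exact Metric.diam_nonneg)

theorem diam_tri_le_meshSize (hK : IsTriangulation K Ω) {s : Finset Plane} (hs : s ∈ triangles K) :
    Metric.diam (tri s) ≤ meshSize K :=
  le_csSup ((finite_triangles hK).image _).bddAbove ⟨s, hs, rfl⟩

/-- A bound in terms of `Ω` alone, so that surplus powers of the meshsize can be absorbed in
constants. -/
theorem meshSize_le (hK : IsTriangulation K Ω) : meshSize K ≤ Metric.diam (closure Ω) :=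
  Real.sSup_le (by
    rintro _ ⟨s, hs, rfl⟩
    exact Metric.diam_mono (tri_subset_closure hK hs) (isCompact_closure hK).isBounded)
    Metric.diam_nonneg

theorem setIntegral_eq_sum (hP : IsPolygonalDomain Ω) (hK : IsTriangulation K Ω) {f : Plane → ℝ}
    (hf : IntegrableOn f Ω) :
    ∫ x in Ω, f x = ∑ s ∈ (finite_triangles hK).toFinset, ∫ x in interior (tri s), f x := by
  have hfin := finite_triangles hK
  rw [← integral_biUnion_finset hfin.toFinset (fun s _ => isOpen_interior.measurableSet)]
  · refine setIntegral_congr_set ?_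
    filter_upwards [ae_mem_interior hP hK] with x hx
    refine propext ⟨fun h => ?_, fun h => ?_⟩
    · rcases hx with ⟨s, hs, hxs⟩ | hx
      · exact mem_biUnion (hfin.mem_toFinset.2 hs) hxs
      · exact absurd (subset_closure h) hx
    · obtain ⟨s, hs, hxs⟩ := mem_iUnion₂.1 h
      exact interior_tri_subset hP hK (hfin.mem_toFinset.1 hs) hxs
  · intro s hs t ht hst
    exact (disjoint_interior (hfin.mem_toFinset.1 hs) (hfin.mem_toFinset.1 ht) hst).mono_right
      interior_subset
  · exact fun s hs => hf.mono_set (interior_tri_subset hP hK (hfin.mem_toFinset.1 hs))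

/-- Interpolation in the Argyris space. -/
theorem argyris_interpolation (hP : IsPolygonalDomain Ω) (σ : ℝ) (k : ℕ) (hk3 : 3 ≤ k)
    (hk5 : k ≤ 5) : ∃ A, 0 ≤ A ∧ ∀ K, IsTriangulation K Ω → IsShapeRegular σ K → ∀ u,
      MemH0 2 Ω u → MemH (k + 1) Ω u → ∃ V ∈ argyrisSpace K Ω,
        seminormH 2 Ω (fun x => u x - V x) ≤ A * meshSize K ^ (k - 1) * normH (k + 1) Ω u := by
  obtain ⟨A, hA, hloc⟩ := local_interpolation σ k hk3 hk5
  -- There are four sequences of two directions, and `k + 2` multi-indices of order `k + 1` in the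
  -- local error bounds.
  refine ⟨Real.sqrt (4 * (A * (k + 2))), Real.sqrt_nonneg _, fun K hK hreg u hu hk => ?_⟩
  have hΩ := hP.isOpen
  have hfin := finite_triangles hK
  have hex : ∀ s ∈ triangles K, ∃ (w : ℕ → Plane → ℝ) (J : ℕ → ℕ → Plane → ℝ)
      (p : MvPolynomial (Fin 2) ℝ), (∀ n, ContDiff ℝ ∞ (w n)) ∧
      (∀ i j, i + j ≤ 2 → TendstoUniformlyOn (fun n => D i j (w n)) (J i j) atTop (tri s)) ∧
      IsJet (tri s) (fun i j => wE Ω i j u) J ∧ IsInterpolant s J p ∧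
      ∀ m l, m + l = 2 → ∫ x in tri s, (wE Ω m l u x - D m l (polyFun p) x) ^ 2 ≤
        A * Metric.diam (tri s) ^ (2 * (k - 1)) *
          ∑ q ∈ Finset.HasAntidiagonal.antidiagonal (k + 1), ∫ x in tri s, wE Ω q.1 q.2 u x ^ 2 := by
    intro s hs
    obtain ⟨v, a, b, h⟩ := exists_isTri_of_mem hs
    obtain ⟨c, r, hr, hc, hσ⟩ := hreg s hs
    obtain ⟨w, J, hw, hlim, hJ⟩ := exists_jet_tri hP hK (by omega : 4 ≤ k + 1) hk hs
    obtain ⟨p, hp, h1, h2, h3⟩ := hloc s v a b c r w (fun i j => wE Ω i j u) J h hr hc hσ hw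
      (fun i j hij x hx => (hlim i j hij).tendsto_at hx)
    exact ⟨w, J, p, hw.smooth, hlim, hJ, h.isInterpolant hp h1 h2, h3⟩
  choose! w J p hw hlim hJ hp hest using hex
  have hJJ : ∀ s ∈ triangles K, ∀ t ∈ triangles K, ∀ x ∈ tri s, x ∈ tri t → ∀ i j, i + j ≤ 2 →
      J s i j x = J t i j x := fun s hs t ht x hxs hxt i j hij =>
    jet_eq hP hK (by omega : 4 ≤ k + 1) hk hJ hs ht hxs hxt hij
  -- The Argyris data come from the jets of `u`, which agree between triangles and vanish to first
  -- order on the boundary. Unisolvence on the edges turns this into the matching conditions for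
  -- gluing.
  obtain ⟨V, hV0, hVp, hVw⟩ := exists_glue hP hK (f := fun s => polyFun (p s))
    (fun s => polyFun_smooth _) (fun s hs t ht x hxs hxt i j hij => by
      by_cases hst : s = t
      · rw [hst]
      · exact (hp s hs).compat hs ht (hp t ht) hst (hJJ s hs t ht) hxs hxt hij)
    (fun s hs x hxs hx i j hij => (hp s hs).eq_zero hP hK hs
      (fun x hxs hx i j hij => jet_eq_zero hP hK hu hJ hs hxs hx hij) (hw s hs)
      (fun i j hij => ⟨hlim s hs i j hij, (hJ s hs i j hij).1⟩) hxs hx hij)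
  refine ⟨V, ⟨isArgyris_of_interpolants hp hJJ hVp, hV0⟩, ?_⟩
  have hN : 0 ≤ normH (k + 1) Ω u := Real.sqrt_nonneg _
  have hh := meshSize_nonneg K
  set h := meshSize K with hhdef
  have hsq : ∀ i j, IntegrableOn (fun x => wL Ω i j u x ^ 2) Ω := fun i j =>
    (Lp.memLp (wL Ω i j u)).integrable_sq
  have hB : ∀ m l, m + l = 2 → ‖wL Ω m l (fun x => u x - V x)‖ ^ 2 ≤
      A * (k + 2) * (h ^ (k - 1) * normH (k + 1) Ω u) ^ 2 := by
    intro m l hml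
    rw [norm_sq_eq_integral, setIntegral_eq_sum hP hK (Lp.memLp _).integrable_sq]
    have hstep : ∀ s ∈ hfin.toFinset, ∫ x in interior (tri s), (wL Ω m l (fun x => u x - V x) x) ^ 2 ≤
        A * h ^ (2 * (k - 1)) * ∑ q ∈ Finset.HasAntidiagonal.antidiagonal (k + 1),
          ∫ x in interior (tri s), wL Ω q.1 q.2 u x ^ 2 := by
      intro s hs
      have hs' := hfin.mem_toFinset.1 hs
      have hae : (interior (tri s) : Set Plane) =ᵐ[volume] tri s :=
        (interior_subset.eventuallyLE).antisymm (ae_le_set.2 (volume_tri_diff_interior s))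
      have hsub := interior_tri_subset hP hK hs'
      have e1 : ∫ x in interior (tri s), (wL Ω m l (fun x => u x - V x) x) ^ 2 =
          ∫ x in tri s, (wE Ω m l u x - D m l (polyFun (p s)) x) ^ 2 := by
        rw [← setIntegral_congr_set hae]
        refine integral_congr_ae ?_
        have h1 : wL Ω m l (fun x => u x - V x) =ᵐ[volume.restrict Ω]
            fun x => wL Ω m l u x - wL Ω m l V x := by
          rw [wL_sub hΩ hu.1 hV0.1 hml.le]
          exact Lp.coeFn_sub _ _
        filter_upwards [ae_restrict_of_ae_restrict_of_subset hsub h1, hVw s hs' m l hml.le,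
          ae_restrict_mem isOpen_interior.measurableSet] with x h1 h2 h3
        rw [h1, h2, wE, indicator_of_mem (hsub h3)]
      have e2 : ∀ q : ℕ × ℕ, ∫ x in tri s, wE Ω q.1 q.2 u x ^ 2 =
          ∫ x in interior (tri s), wL Ω q.1 q.2 u x ^ 2 := by
        intro q
        rw [← setIntegral_congr_set hae]
        refine setIntegral_congr_fun isOpen_interior.measurableSet fun x hx => ?_
        simp only [wE, indicator_of_mem (hsub hx)]
      rw [e1]
      refine (hest s hs' m l hml).trans ?_
      simp only [e2]
      have hd := diam_tri_le_meshSize hK hs'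
      have hd0 : 0 ≤ Metric.diam (tri s) := Metric.diam_nonneg
      have : 0 ≤ ∑ q ∈ Finset.HasAntidiagonal.antidiagonal (k + 1),
          ∫ x in interior (tri s), wL Ω q.1 q.2 u x ^ 2 :=
        Finset.sum_nonneg fun q _ => integral_nonneg fun x => sq_nonneg _
      gcongr
    refine (Finset.sum_le_sum hstep).trans ?_
    rw [← Finset.mul_sum, Finset.sum_comm]
    have hsum : ∀ q ∈ Finset.HasAntidiagonal.antidiagonal (k + 1), ∑ s ∈ hfin.toFinset,
        ∫ x in interior (tri s), wL Ω q.1 q.2 u x ^ 2 ≤ normH (k + 1) Ω u ^ 2 := by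
      intro q hq
      rw [← setIntegral_eq_sum hP hK (hsq q.1 q.2), ← norm_sq_eq_integral]
      exact pow_le_pow_left₀ (norm_nonneg _)
        (norm_wL_le_normH hΩ hk (Finset.HasAntidiagonal.mem_antidiagonal.1 hq).le) 2
    have hs2 := Finset.sum_le_sum hsum
    rw [Finset.sum_const, Finset.Nat.card_antidiagonal, nsmul_eq_mul] at hs2
    calc _ ≤ A * h ^ (2 * (k - 1)) * (((k + 1 + 1 : ℕ) : ℝ) * normH (k + 1) Ω u ^ 2) := by
          gcongr
      _ = _ := by
          rw [mul_pow, ← pow_mul, mul_comm (k - 1) 2]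
          push_cast
          ring
  have hfinal := seminormH_sq_le hΩ (hu.sub hΩ hV0).1 le_rfl hB
  have h0 : 0 ≤ Real.sqrt (4 * (A * (k + 2))) * h ^ (k - 1) * normH (k + 1) Ω u := by positivity
  refine abs_le_of_sq_le_sq' ?_ h0 |>.2
  refine hfinal.trans_eq ?_
  simp only [mul_pow]
  rw [Real.sq_sqrt (by positivity)]
  ring

end

end QGE

end

/-! ### The convergence theorem -/

theorem theorem4p2 (Ω : Set QGE.Plane) (hΩ : QGE.IsPolygonalDomain Ω)
    (Re Ro Γ₁ Γ₂ σ : ℝ) (hRe : 0 < Re) (hRo : 0 < Ro) (hΓ₁ : 0 < Γ₁) (hΓ₂ : 0 < Γ₂)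
    (ha₁ : QGE.IsContConstA₁ Ω Γ₁) (ha₂ : QGE.IsContConstA₂ Ω Ro Γ₂)
    (F : QGE.Plane → ℝ) (hF : MemLp F 2 (volume.restrict Ω))
    (hsmall : Γ₁ * QGE.dualNorm 2 Ω F < Re⁻¹ ^ 2 * Ro) :
    ∃ C₀ C₁ C₂ : ℝ, 0 < C₀ ∧ 0 < C₁ ∧ 0 < C₂ ∧
      ∀ ψ : QGE.Plane → ℝ,
        QGE.IsSolutionIn {f | QGE.MemH0 2 Ω f} Ω Re Ro F ψ →
        QGE.MemH 6 Ω ψ →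
        QGE.DualRegularity Ω Re Ro ψ →
        ∀ K : Geometry.SimplicialComplex ℝ QGE.Plane,
          QGE.IsTriangulation K Ω → QGE.IsShapeRegular σ K →
          ∀ ψh : QGE.Plane → ℝ,
            QGE.IsSolutionIn (QGE.argyrisSpace K Ω) Ω Re Ro F ψh →
            QGE.seminormH 2 Ω (fun x => ψ x - ψh x) ≤ C₂ * QGE.meshSize K ^ 4 ∧
            QGE.seminormH 1 Ω (fun x => ψ x - ψh x) ≤ C₁ * QGE.meshSize K ^ 5 ∧
            QGE.seminormH 0 Ω (fun x => ψ x - ψh x) ≤ C₀ * QGE.meshSize K ^ 6 := by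
  obtain ⟨K₀, hK₀⟩ := hΩ.triangulable
  -- The solution in `H⁶` is approximated with order four (`k = 5`), the dual solution, which is
  -- only in `H⁴`, with order two (`k = 3`).
  obtain ⟨A, hA, hA6⟩ := QGE.argyris_interpolation hΩ σ 5 (by norm_num) le_rfl
  obtain ⟨B, hB, hB4⟩ := QGE.argyris_interpolation hΩ σ 3 le_rfl (by norm_num)
  have S : QGE.Setting Ω Re Ro Γ₁ Γ₂ F :=
    ⟨hΩ.isOpen, QGE.isBounded_domain hK₀, hRe, hRo, hΓ₁, hΓ₂, ha₁, ha₂, hF, hsmall⟩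
  have hn : ∀ k u, 0 ≤ QGE.normH k Ω u := fun k u => Real.sqrt_nonneg _
  -- The family consists of all shape-regular triangulations at once, which makes the constants
  -- uniform over them.
  obtain ⟨C₀, C₁, C₂, h0, h1, h2, h⟩ := QGE.galerkin_rates S
    (ι := {K : Geometry.SimplicialComplex ℝ QGE.Plane //
      QGE.IsTriangulation K Ω ∧ QGE.IsShapeRegular σ K})
    (fun K => QGE.argyrisSpace K.1 Ω) (fun K => QGE.meshSize K.1)
    (fun K => QGE.meshSize_nonneg K.1) (fun K => QGE.meshSize_le K.2.1)
    (fun _ _ hv => hv.2) (fun _ _ hv _ hw => QGE.argyrisSpace_sub hΩ.isOpen hv hw)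
    (A := A + B) (add_nonneg hA hB)
    (fun K u hu hu6 => by
      obtain ⟨V, hV, hle⟩ := hA6 K.1 K.2.1 K.2.2 u hu hu6
      refine ⟨V, hV, hle.trans ?_⟩
      have := QGE.meshSize_nonneg K.1
      have := hn 6 u
      gcongr
      linarith)
    (fun K u hu hu4 => by
      obtain ⟨V, hV, hle⟩ := hB4 K.1 K.2.1 K.2.2 u hu hu4
      refine ⟨V, hV, hle.trans ?_⟩
      have := QGE.meshSize_nonneg K.1
      have := hn 4 u
      gcongr
      linarith)
  exact ⟨C₀, C₁, C₂, h0, h1, h2, fun ψ hψ hψ6 hreg K hK hσ ψh hψh =>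
    h ψ hψ hψ6 hreg ⟨K, hK, hσ⟩ ψh hψh⟩
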